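/- **Notation.** For $x,y\in\mathbb C^d$ let $\langle x,y\rangle=\sum_r x_r\overline{y_r}$. For $n\times n$ matrices $X,Y$ with entries in $\mathbb C^d$ and a tensor $M=(M_{ijkl})_{i,j,k,l=1}^n$ of complex numbers put $M(X,Y)=\sum_{i,j,k,l}M_{ijkl}\langle X_{ij},Y_{kl}\rangle$, $(XX^*)_{ij}=\sum_k\langle X_{ik},X_{jk}\rangle$, $(X^*X)_{ij}=\sum_k\langle X_{ki},X_{kj}\rangle$; let $\mathcal U_n(\mathbb C^d)=\{X: XX^*=X^*X=I\}$ and $\mathrm{SDP}_{\mathbb C}(M)=\sup_{d\in\mathbb N}\sup_{X,Y\in\mathcal U_n(\mathbb C^d)}|M(X,Y)|$. For complex matrices, $M(A,B)=\sum M_{ijkl}A_{ij}\overline{B_{kl}}$. $M$ is Hermitian if $M_{ijkl}=\overline{M_{jilk}}$ for all $i,j,k,l$. **Krivine's functions.** Let $g(x)=\mathrm{sign}(\cos x)$, and let $f:\mathbb R\to\mathbb R$ be the even function with $f(x+\pi)=-f(x)$, $f=1$ on $[0,\frac\pi4]$ and $f(t)=\frac6\pi(\frac\pi2-t)-\frac12(\frac4\pi)^3(\frac\pi2-t)^3$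 on $[\frac\pi4,\frac\pi2)$. Let $a_{2\ell}=0$, $a_{2\ell+1}=(-1)^\ell\cos\!\big(\frac{(2\ell+1)\pi}4\big)\frac{16}{\pi^2(2\ell+1)^4}\big(\frac1{2\ell+1}-(-1)^\ell\frac\pi4\big)$, $b_1=\sqrt2(\pi/4)^3/(3a_1)$ and $b_{2\ell+1}=-\frac1{a_1}\sum_{m\mid 2\ell+1,\,m\ne1}a_m b_{(2\ell+1)/m}$ for $\ell>0$. There is a positive integer $C$ with $\sum_{\ell>L}|b_{2\ell+1}|\le C/L$ for all integers $L\ge1$; fix any such $C$. **The Hermitian rounding procedure.** The input is $M$, $X,Y\in M_n(\mathbb C^d)$ and $\varepsilon>0$. All random choices are independent. 1. Choose $z\in\{1,-1,i,-i\}^d$ uniformly, signs $s,s'\in\{1,-1\}$ uniformly, and $t\in\mathbb R$ with density $1/(e^{\pi t/2}+e^{-\pi t/2})$. Let $X_z=\frac1{\sqrt2}(\langle X_{jk},z\rangle)_{jk}$ and $Y_z=\frac1{\sqrt2}(\langle Y_{jk},z\rangle)_{jk}$, with polar decompositions $X_z=U_z|X_z|$, $Y_z=V_z|Y_z|$, where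 $U_z,V_z$ are unitary (a fixed rule selects a polar decomposition for each matrix). Set $A=U_z|X_z|^{it}$ and $B=V_z|Y_z|^{-it}$, where $|X_z|^{it}$ acts as the sign $s$ on $\ker|X_z|$ and $|Y_z|^{-it}$ acts as the sign $s'$ on $\ker|Y_z|$. 2. If $M(A,B)$ is not real, multiply $A$ by a complex phase that makes it real. Write $A=\sum_j e^{i\theta_j}u_ju_j^*$ and $B=\sum_k e^{i\phi_k}v_kv_k^*$ with orthonormal bases $(u_j)$, $(v_k)$ of $\mathbb C^n$ and $\theta_j,\phi_k\in\mathbb R$. 3. Let $L=\lceil C/\varepsilon\rceil$. Choose $t'\in[-\pi,\pi]$ uniformly and $\ell\in\{-1,0,\dots,L\}$ with $\Pr(\ell)=|b_{2\ell+1}|$ for $\ell\ge0$ and $\Pr(-1)=\sum_{\ell>L}|b_{2\ell+1}|$. If $\ell\ge0$ let $\lambda_j=\mathrm{sign}(b_{2\ell+1})f((2\ell+1)\theta_j-t')$ and $\mu_k=g(t'-(2\ell+1)\phi_k)$; if $\ell=-1$ let $\lambda_j=\mu_k=0$. 4. Output $A'=\sum_j\lambda_ju_ju_j^*$ and $B'=\sum_k\mu_kv_kv_k^*$.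 **Theorem.** Let $n,d\in\mathbb N$, let $M$ be Hermitian, let $\varepsilon\in(0,1)$, and let $X,Y\in\mathcal U_n(\mathbb C^d)$ satisfy $$|M(X,Y)|\ge(1-\varepsilon)\,\mathrm{SDP}_{\mathbb C}(M).$$ Then, however the polar and spectral decompositions are selected, the Hermitian rounding procedure always outputs Hermitian matrices $A',B'$ of operator norm at most $1$, and $$\mathbb E\big[|M(A',B')|\big]\ \ge\ \Big(\frac1{2\sqrt2}-\Big(1+\frac1{\sqrt2}\Big)\varepsilon\Big)\,\mathrm{SDP}_{\mathbb C}(M).$$ Moreover the procedure (for some selection of the decompositions) runs in time polynomial in $n$, $d$ and $1/\varepsilon$; thus polynomial in $n$ and $1/\varepsilon$ when $d\le 2n^2$. Here time is the number of steps of one fixed program, which does not depend on the input, on a machine with exact real and complex numbers: arithmetic operations, complex conjugation, exponential, logarithm, comparisons and drawing a uniform random number in $[0,1]$ cost one step each, and the spectral decomposition of an $m\times m$ Hermitian matrix costs $m^3$ steps. -/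

import Mathlib

noncomputable section

namespace NCG

open MeasureTheory
open scoped ComplexOrder

/-! ### Four-tensors, vector-valued matrices and the semidefinite relaxation -/

/-- Four-tensors `M = (M_{ijkl})`, i.e. elements of `M_n(M_n(ℂ))`. -/
abbrev Tensor (n : ℕ) : Type := Fin n → Fin n → Fin n → Fin n → ℂ

/-- `n × n` matrices with entries in `ℂ^d`. -/
abbrev VMat (n d : ℕ) : Type := Fin n → Fin n → Fin d → ℂ

/-- Standard scalar product of `ℂ^d`, linear in the first argument. -/
def cdot {d : ℕ} (x y : Fin d → ℂ) : ℂ := ∑ r, x r * star (y r)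

/-- `M` is Hermitian: `M_{ijkl}` is the complex conjugate of `M_{jilk}`. -/
def Tensor.IsHerm {n : ℕ} (M : Tensor n) : Prop := ∀ i j k l, M i j k l = star (M j i l k)

/-- `M(X, Y) = ∑ M_{ijkl} ⟨X_{ij}, Y_{kl}⟩` for vector-valued matrices. -/
def vform {n d : ℕ} (M : Tensor n) (X Y : VMat n d) : ℂ :=
  ∑ i, ∑ j, ∑ k, ∑ l, M i j k l * cdot (X i j) (Y k l)

/-- `M(A, B) = ∑ M_{ijkl} A_{ij} conj(B_{kl})` for complex matrices. -/
def form {n : ℕ} (M : Tensor n) (A B : Matrix (Fin n) (Fin n) ℂ) : ℂ :=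
  ∑ i, ∑ j, ∑ k, ∑ l, M i j k l * (A i j * star (B k l))

/-- `(XX^*)_{ij} = ∑_k ⟨X_{ik}, X_{jk}⟩`. -/
def rowGram {n d : ℕ} (X : VMat n d) : Matrix (Fin n) (Fin n) ℂ :=
  Matrix.of fun i j => ∑ k, cdot (X i k) (X j k)

/-- `(X^*X)_{ij} = ∑_k ⟨X_{ki}, X_{kj}⟩`. -/
def colGram {n d : ℕ} (X : VMat n d) : Matrix (Fin n) (Fin n) ℂ :=
  Matrix.of fun i j => ∑ k, cdot (X k i) (X k j)

/-- The set `U_n(ℂ^d)` of vector-valued unitary matrices. -/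
def vUnitary (n d : ℕ) : Set (VMat n d) := {X | rowGram X = 1 ∧ colGram X = 1}

/-- The value `SDP_ℂ(M)`: supremum of `|M(X, Y)|` over all `d` and all `X, Y ∈ U_n(ℂ^d)`. -/
def sdp {n : ℕ} (M : Tensor n) : ℝ :=
  sSup {v | ∃ d : ℕ, ∃ X ∈ vUnitary n d, ∃ Y ∈ vUnitary n d, v = ‖vform M X Y‖}

/-! ### Krivine's two-dimensional rounding -/

/-- The function `f` on `[0, π/2]`. -/
def krivineF₀ (s : ℝ) : ℝ :=
  if s ≤ Real.pi / 4 then 1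
  else 6 / Real.pi * (Real.pi / 2 - s) - 1 / 2 * (4 / Real.pi) ^ 3 * (Real.pi / 2 - s) ^ 3

/-- The extension of `f` to `ℝ` that is even and satisfies `f (x + π) = - f x`. Here
`arccos (cos x) ∈ [0, π]` is the representative of `x` modulo the group generated by
`x ↦ x + 2π` and `x ↦ -x`. -/
def krivineF (x : ℝ) : ℝ :=
  if Real.arccos (Real.cos x) ≤ Real.pi / 2 then krivineF₀ (Real.arccos (Real.cos x))
  else - krivineF₀ (Real.pi - Real.arccos (Real.cos x))

/-- `g = sign ∘ cos`. -/
def krivineG (x : ℝ) : ℝ := Real.sign (Real.cos x)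

/-- The numbers `a_m`: zero for even `m`, and given by the explicit formula for `m = 2ℓ + 1`
(so that `ℓ = m / 2` in integer division). -/
def krivineA (m : ℕ) : ℝ :=
  if Even m then 0
  else (-1) ^ (m / 2) * Real.cos (m * Real.pi / 4) * (16 / (Real.pi ^ 2 * (m : ℝ) ^ 4))
    * (1 / (m : ℝ) - (-1) ^ (m / 2) * (Real.pi / 4))

/-- The numbers `b_m`, of which only the odd-indexed ones are used:
`b_1 = √2 (π/4)³ / (3 a_1)` and `b_m = - a_1⁻¹ ∑_{d ∣ m, d ≠ 1} a_d b_{m/d}` for `m > 1`. -/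
def krivineB (m : ℕ) : ℝ :=
  if m = 1 then √2 * (Real.pi / 4) ^ 3 / (3 * krivineA 1)
  else - (1 / krivineA 1) *
    ∑ d ∈ (m.divisors.erase 1).attach, krivineA d.1 * krivineB (m / d.1)
termination_by m
decreasing_by
  have h := d.2
  rw [Finset.mem_erase, Nat.mem_divisors] at h
  have h0 : 0 < d.1 := Nat.pos_of_dvd_of_pos h.2.1 (Nat.pos_of_ne_zero h.2.2)
  exact Nat.div_lt_self (Nat.pos_of_ne_zero h.2.2) (by have := h.1; omega)

/-- `C` is a constant for which `∑_{ℓ > L} |b_{2ℓ+1}| ≤ C / L` for all `L ≥ 1`. -/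
def IsTailConst (C : ℕ) : Prop :=
  0 < C ∧ Summable (fun l : ℕ => |krivineB (2 * l + 1)|) ∧
    ∀ L : ℕ, 1 ≤ L → ∑' l : ℕ, |krivineB (2 * (L + 1 + l) + 1)| ≤ (C : ℝ) / L

/-- The law of the random index `ℓ ∈ {-1, 0, …, L}`: `Pr(ℓ) = |b_{2ℓ+1}|` for `0 ≤ ℓ ≤ L` and
`Pr(-1) = 1 - p = ∑_{ℓ > L} |b_{2ℓ+1}|`. -/
def indexLaw (L : ℕ) : Measure ℤ :=
  (∑ l ∈ Finset.range (L + 1),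
      ENNReal.ofReal |krivineB (2 * l + 1)| • Measure.dirac (l : ℤ))
    + ENNReal.ofReal (∑' l : ℕ, |krivineB (2 * (L + 1 + l) + 1)|) • Measure.dirac (-1)

/-- The angle in `[0, 2π)` that the complex number `x` makes with the positive real axis. -/
def angle (x : ℂ) : ℝ := if 0 ≤ x.arg then x.arg else x.arg + 2 * Real.pi

/-- The number `λ_j` that the two-dimensional rounding with random choices `t ∈ [-π, π]` and
`ℓ ∈ {-1, 0, …, L}` assigns to the unit complex number `x = x_j`. -/
def krivineLam (t : ℝ) (l : ℤ) (x : ℂ) : ℝ :=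
  if 0 ≤ l then
    Real.sign (krivineB (2 * l.toNat + 1)) * krivineF ((2 * l + 1) * angle x - t)
  else 0

/-- The number `μ_k` that the two-dimensional rounding assigns to `y = y_k`. -/
def krivineMu (t : ℝ) (l : ℤ) (y : ℂ) : ℝ :=
  if 0 ≤ l then krivineG (t - (2 * l + 1) * angle y) else 0

/-! ### The Hermitian rounding procedure -/

/-- A rule that selects a polar decomposition `T = U P` (`U` unitary, `P = |T|` positive
semidefinite) of every complex matrix `T`, and a spectral decomposition
`A = ∑_j e^{iθ_j} u_j u_j^*` of every unitary matrix `A`. Neither is unique in general: a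
statement about the procedure has to say which selections it is about. The vectors `u_j` are the
columns of the unitary matrix `vec A`. -/
structure Selection (n : ℕ) where
  /-- the unitary factor `U` of the polar decomposition -/
  pol : Matrix (Fin n) (Fin n) ℂ → Matrix (Fin n) (Fin n) ℂ
  /-- the positive semidefinite factor `P` of the polar decomposition -/
  mod : Matrix (Fin n) (Fin n) ℂ → Matrix (Fin n) (Fin n) ℂ
  /-- the angles `θ_j` of the spectral decomposition -/
  ang : Matrix (Fin n) (Fin n) ℂ → Fin n → ℝ
  /-- the matrix with columns `u_j` of the spectral decomposition -/
  vec : Matrix (Fin n) (Fin n) ℂ → Matrix (Fin n) (Fin n) ℂ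
  pol_unitary : ∀ T, pol T ∈ Matrix.unitaryGroup (Fin n) ℂ
  mod_posSemidef : ∀ T, (mod T).PosSemidef
  polar : ∀ T, T = pol T * mod T
  vec_unitary : ∀ A ∈ Matrix.unitaryGroup (Fin n) ℂ, vec A ∈ Matrix.unitaryGroup (Fin n) ℂ
  spectral : ∀ A ∈ Matrix.unitaryGroup (Fin n) ℂ,
    A = vec A * Matrix.diagonal (fun j => Complex.exp (Complex.I * ang A j)) * (vec A).conjTranspose

/-- The function `c` of a Hermitian matrix `P`: `∑_j c(σ_j) w_j w_j^*` where `σ_j` are the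
eigenvalues and `w_j` an orthonormal basis of eigenvectors of `P` (zero if `P` is not
Hermitian). -/
def hermFun {n : ℕ} (c : ℝ → ℂ) (P : Matrix (Fin n) (Fin n) ℂ) : Matrix (Fin n) (Fin n) ℂ :=
  open Classical in
  if h : P.IsHermitian then
    (h.eigenvectorUnitary : Matrix (Fin n) (Fin n) ℂ)
      * Matrix.diagonal (fun j => c (h.eigenvalues j))
      * (h.eigenvectorUnitary : Matrix (Fin n) (Fin n) ℂ).conjTranspose
  else 0

/-- `σ ↦ σ^{it}` for `σ > 0`; at `σ = 0` the value is the sign `-1` if `s` is true and `1`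
otherwise. -/
def imPow (s : Bool) (t σ : ℝ) : ℂ :=
  if σ = 0 then (if s then -1 else 1) else Complex.exp (Complex.I * (t * Real.log σ))

/-- `X_z = ⟨X, z⟩ / √2` with `z_r = i ^ (z r)`, so that `z` ranges over `{1, -1, i, -i}^d`. -/
def proj {n d : ℕ} (X : VMat n d) (z : Fin d → Fin 4) : Matrix (Fin n) (Fin n) ℂ :=
  Matrix.of fun j k => ((1 / √2 : ℝ) : ℂ) * cdot (X j k) (fun r => Complex.I ^ (z r : ℕ))

/-- The unitary matrix `U_z |X_z|^{it}` of the complex rounding procedure. On the kernel of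
`|X_z|` the factor `|X_z|^{it}` acts as the sign given by `s`. -/
def complexRound {n d : ℕ} (R : Selection n) (X : VMat n d) (z : Fin d → Fin 4) (s : Bool)
    (t : ℝ) : Matrix (Fin n) (Fin n) ℂ :=
  R.pol (proj X z) * hermFun (imPow s t) (R.mod (proj X z))

/-- The phase by which the first matrix is multiplied in order to make the complex number `w`
real; it is `1` if `w` is real already. -/
def phase (w : ℂ) : ℂ := if w.im = 0 then 1 else star w / (‖w‖ : ℂ)

/-- The random choices of the Hermitian rounding procedure: `z`, the two signs that are used on
the kernels of `|X_z|` and of `|Y_z|`, the number `t` of the complex rounding, and the numbers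
`t' ∈ [-π, π]` and `ℓ` of the two-dimensional rounding. -/
abbrev Seed (d : ℕ) : Type := (Fin d → Fin 4) × (Bool × Bool) × ℝ × ℝ × ℤ

/-- The hyperbolic secant distribution, with density `1 / (e^{πt/2} + e^{-πt/2})`. -/
def sechLaw : Measure ℝ :=
  volume.withDensity fun t =>
    ENNReal.ofReal (1 / (Real.exp (Real.pi * t / 2) + Real.exp (-(Real.pi * t / 2))))

/-- The law of the random choices, which are independent: `z` and the signs are uniform, `t` has
the hyperbolic secant distribution, `t'` is uniform in `[-π, π]`, and `ℓ` has law
`indexLaw L`. -/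
def seedLaw (d L : ℕ) : Measure (Seed d) :=
  (PMF.uniformOfFintype (Fin d → Fin 4)).toMeasure.prod <|
    (PMF.uniformOfFintype (Bool × Bool)).toMeasure.prod <|
      sechLaw.prod <|
        (ProbabilityTheory.cond volume (Set.Icc (-Real.pi) Real.pi)).prod (indexLaw L)

/-- The matrices `(A, B)` of the Hermitian rounding procedure: the output of the complex
rounding, with the first matrix multiplied by a phase that makes `M(A, B)` real. -/
def unitaryPair {n d : ℕ} (R : Selection n) (M : Tensor n) (X Y : VMat n d) (ω : Seed d) :
    Matrix (Fin n) (Fin n) ℂ × Matrix (Fin n) (Fin n) ℂ :=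
  let A := complexRound R X ω.1 ω.2.1.1 ω.2.2.1
  let B := complexRound R Y ω.1 ω.2.1.2 (-ω.2.2.1)
  (phase (form M A B) • A, B)

/-- `∑_j c(e^{iθ_j}) u_j u_j^*` where `A = ∑_j e^{iθ_j} u_j u_j^*` is the selected spectral
decomposition. -/
def roundEig {n : ℕ} (R : Selection n) (c : ℂ → ℝ) (A : Matrix (Fin n) (Fin n) ℂ) :
    Matrix (Fin n) (Fin n) ℂ :=
  R.vec A * Matrix.diagonal (fun j => ((c (Complex.exp (Complex.I * R.ang A j)) : ℝ) : ℂ))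
    * (R.vec A).conjTranspose

/-- The output `(A', B')` of the Hermitian rounding procedure. -/
def hermRound {n d : ℕ} (R : Selection n) (M : Tensor n) (X Y : VMat n d) (ω : Seed d) :
    Matrix (Fin n) (Fin n) ℂ × Matrix (Fin n) (Fin n) ℂ :=
  let P := unitaryPair R M X Y ω
  (roundEig R (krivineLam ω.2.2.2.1 ω.2.2.2.2) P.1,
    roundEig R (krivineMu ω.2.2.2.1 ω.2.2.2.2) P.2)

/-- Operator norm of a complex matrix with respect to the Euclidean norm. -/
def opNorm {n : ℕ} (A : Matrix (Fin n) (Fin n) ℂ) : ℝ := ‖Matrix.toEuclideanCLM (𝕜 := ℂ) A‖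

/-! ### A real-number machine with a step count

Programs of a small imperative language that works on exact numbers. A state has registers for
natural numbers and arrays of complex numbers. The atomic operations are integer addition and
multiplication (for counters and indices), complex arithmetic, conjugation, exponential and
logarithm, comparison, and a random number uniform in `[0, 1]`, each at unit cost, as well as the
spectral decomposition of an `m × m` Hermitian matrix, at cost `m ^ 3`. There is no rounding of
reals to integers, and the only constants in a program are natural numbers and `i`. -/

/-- Integer expressions. -/
inductive NExp : Type
  | const (k : ℕ)
  | reg (r : ℕ)
  | add (e f : NExp)
  | mul (e f : NExp)

/-- Complex expressions; `get a idx` reads the entry of the array `a` with the multi-index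
`idx`. -/
inductive CExp : Type
  | nat (e : NExp)
  | I
  | get (a : ℕ) (idx : List NExp)
  | add (e f : CExp)
  | sub (e f : CExp)
  | mul (e f : CExp)
  | div (e f : CExp)
  | conj (e : CExp)
  | exp (e : CExp)
  | log (e : CExp)

/-- Tests: comparison of integers, and of the real parts of complex numbers. -/
inductive Test : Type
  | natLt (e f : NExp)
  | reLt (e f : CExp)

/-- Programs. -/
inductive Prog : Type
  | skip
  | setNat (r : ℕ) (e : NExp)
  | setArr (a : ℕ) (idx : List NExp) (e : CExp)
  | rand (a : ℕ) (idx : List NExp)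
  | eigh (src vals vecs : ℕ) (m : NExp)
  | seq (p q : Prog)
  | ite (b : Test) (p q : Prog)
  | while (b : Test) (p : Prog)

/-- Memory of the machine; `pos` is the number of random numbers drawn so far. -/
structure State where
  nat : ℕ → ℕ
  arr : ℕ → List ℕ → ℂ
  pos : ℕ

/-- A sequence of random numbers in `[0, 1]`. -/
abbrev Tape : Type := ℕ → unitInterval

/-- The law of a sequence of independent uniform random numbers. -/
def tapeLaw : Measure Tape := Measure.infinitePi fun _ : ℕ => (volume : Measure unitInterval)

def NExp.eval (s : State) : NExp → ℕ
  | const k => k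
  | reg r => s.nat r
  | add e f => e.eval s + f.eval s
  | mul e f => e.eval s * f.eval s

/-- Number of nodes, which is the cost of evaluating the expression. -/
def NExp.size : NExp → ℕ
  | const _ => 1
  | reg _ => 1
  | add e f => e.size + f.size + 1
  | mul e f => e.size + f.size + 1

/-- Cost of evaluating a multi-index. -/
def idxSize (idx : List NExp) : ℕ := (idx.map NExp.size).sum

def CExp.eval (s : State) : CExp → ℂ
  | nat e => (e.eval s : ℂ)
  | I => Complex.I
  | get a idx => s.arr a (idx.map (NExp.eval s))
  | add e f => e.eval s + f.eval s
  | sub e f => e.eval s - f.eval s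
  | mul e f => e.eval s * f.eval s
  | div e f => e.eval s / f.eval s
  | conj e => star (e.eval s)
  | exp e => Complex.exp (e.eval s)
  | log e => Complex.log (e.eval s)

/-- Number of nodes, which is the cost of evaluating the expression. -/
def CExp.size : CExp → ℕ
  | nat e => e.size + 1
  | I => 1
  | get _ idx => idxSize idx + 1
  | add e f => e.size + f.size + 1
  | sub e f => e.size + f.size + 1
  | mul e f => e.size + f.size + 1
  | div e f => e.size + f.size + 1
  | conj e => e.size + 1
  | exp e => e.size + 1
  | log e => e.size + 1

def Test.holds (s : State) : Test → Prop
  | natLt e f => e.eval s < f.eval s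
  | reLt e f => (e.eval s).re < (f.eval s).re

def Test.size : Test → ℕ
  | natLt e f => e.size + f.size + 1
  | reLt e f => e.size + f.size + 1

def State.setNat (s : State) (r v : ℕ) : State :=
  { s with nat := Function.update s.nat r v }

def State.setArr (s : State) (a : ℕ) (idx : List ℕ) (v : ℂ) : State :=
  { s with arr := Function.update s.arr a (Function.update (s.arr a) idx v) }

/-- The leading `m × m` block of the two-dimensional array `a`. -/
def State.block (s : State) (a m : ℕ) : Matrix (Fin m) (Fin m) ℂ :=
  Matrix.of fun i j => s.arr a [(i : ℕ), (j : ℕ)]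

/-- Effect of the spectral decomposition: if the `m × m` block `H` of the array `src` is
Hermitian, its eigenvalues `σ_i` are written to the entries `[i]` of the array `vals`, and the
entries of a unitary matrix whose columns are the corresponding eigenvectors are written to the
array `vecs`. Otherwise nothing happens. -/
def State.eigh (s : State) (src vals vecs m : ℕ) : State :=
  open Classical in
  if hH : (s.block src m).IsHermitian then
    { s with arr := fun a idx =>
        match idx with
        | [i] => if h : a = vals ∧ i < m then ((hH.eigenvalues ⟨i, h.2⟩ : ℝ) : ℂ) else s.arr a idx
        | [i, j] =>
          if h : a = vecs ∧ i < m ∧ j < m then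
            (hH.eigenvectorUnitary : Matrix (Fin m) (Fin m) ℂ) ⟨i, h.2.1⟩ ⟨j, h.2.2⟩
          else s.arr a idx
        | _ => s.arr a idx }
  else s

/-- `Exec τ p s s' c`: started in the state `s`, with random numbers taken from `τ`, the program
`p` halts in the state `s'` after `c` steps. -/
inductive Exec (τ : Tape) : Prog → State → State → ℕ → Prop
  | skip (s : State) : Exec τ .skip s s 1
  | setNat (s : State) (r : ℕ) (e : NExp) :
      Exec τ (.setNat r e) s (s.setNat r (e.eval s)) (e.size + 1)
  | setArr (s : State) (a : ℕ) (idx : List NExp) (e : CExp) :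
      Exec τ (.setArr a idx e) s (s.setArr a (idx.map (NExp.eval s)) (e.eval s))
        (idxSize idx + e.size + 1)
  | rand (s : State) (a : ℕ) (idx : List NExp) :
      Exec τ (.rand a idx) s
        { s.setArr a (idx.map (NExp.eval s)) (((τ s.pos : ℝ)) : ℂ) with pos := s.pos + 1 }
        (idxSize idx + 1)
  | eigh (s : State) (src vals vecs : ℕ) (m : NExp) :
      Exec τ (.eigh src vals vecs m) s (s.eigh src vals vecs (m.eval s))
        (m.size + m.eval s ^ 3 + 1)
  | seq {p q : Prog} {s₁ s₂ s₃ : State} {c c' : ℕ} :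
      Exec τ p s₁ s₂ c → Exec τ q s₂ s₃ c' → Exec τ (.seq p q) s₁ s₃ (c + c')
  | iteTrue {b : Test} {p q : Prog} {s s' : State} {c : ℕ} :
      b.holds s → Exec τ p s s' c → Exec τ (.ite b p q) s s' (b.size + c)
  | iteFalse {b : Test} {p q : Prog} {s s' : State} {c : ℕ} :
      ¬ b.holds s → Exec τ q s s' c → Exec τ (.ite b p q) s s' (b.size + c)
  | whileTrue {b : Test} {p : Prog} {s₁ s₂ s₃ : State} {c c' : ℕ} :
      b.holds s₁ → Exec τ p s₁ s₂ c → Exec τ (.while b p) s₂ s₃ c' →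
        Exec τ (.while b p) s₁ s₃ (b.size + c + c')
  | whileFalse {b : Test} {p : Prog} {s : State} :
      ¬ b.holds s → Exec τ (.while b p) s s b.size

/-- The machine is deterministic once the random numbers are given. -/
theorem Exec.deterministic {τ : Tape} {p : Prog} {s s₁ s₂ : State} {c₁ c₂ : ℕ}
    (h₁ : Exec τ p s s₁ c₁) (h₂ : Exec τ p s s₂ c₂) : s₁ = s₂ ∧ c₁ = c₂ := by
  induction h₁ generalizing s₂ c₂ with
  | skip | setNat | setArr | rand | eigh => cases h₂; exact ⟨rfl, rfl⟩
  | seq _ _ ih ih' =>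
    cases h₂ with
    | seq k k' =>
      obtain ⟨rfl, rfl⟩ := ih k
      obtain ⟨rfl, rfl⟩ := ih' k'
      exact ⟨rfl, rfl⟩
  | iteTrue hb _ ih =>
    cases h₂ with
    | iteTrue _ k => obtain ⟨rfl, rfl⟩ := ih k; exact ⟨rfl, rfl⟩
    | iteFalse nb _ => exact absurd hb nb
  | iteFalse hb _ ih =>
    cases h₂ with
    | iteTrue nb _ => exact absurd nb hb
    | iteFalse _ k => obtain ⟨rfl, rfl⟩ := ih k; exact ⟨rfl, rfl⟩
  | whileTrue hb _ _ ih ih' =>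
    cases h₂ with
    | whileTrue _ k k' =>
      obtain ⟨rfl, rfl⟩ := ih k
      obtain ⟨rfl, rfl⟩ := ih' k'
      exact ⟨rfl, rfl⟩
    | whileFalse nb => exact absurd hb nb
  | whileFalse hb =>
    cases h₂ with
    | whileTrue nb _ _ => exact absurd nb hb
    | whileFalse _ => exact ⟨rfl, rfl⟩

/-- The initial state: registers `0` and `1` hold `n` and `d`; the arrays `0`, `1`, `2`, `3` hold
`ε` and the entries of `M`, `X` and `Y`; everything else is zero. -/
def inputState {n d : ℕ} (ε : ℝ) (M : Tensor n) (X Y : VMat n d) : State where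
  nat r := if r = 0 then n else if r = 1 then d else 0
  arr a idx :=
    match a, idx with
    | 0, [] => (ε : ℂ)
    | 1, [i, j, k, l] =>
      if h : i < n ∧ j < n ∧ k < n ∧ l < n then
        M ⟨i, h.1⟩ ⟨j, h.2.1⟩ ⟨k, h.2.2.1⟩ ⟨l, h.2.2.2⟩
      else 0
    | 2, [i, j, r] =>
      if h : i < n ∧ j < n ∧ r < d then X ⟨i, h.1⟩ ⟨j, h.2.1⟩ ⟨r, h.2.2⟩ else 0
    | 3, [i, j, r] =>
      if h : i < n ∧ j < n ∧ r < d then Y ⟨i, h.1⟩ ⟨j, h.2.1⟩ ⟨r, h.2.2⟩ else 0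
    | _, _ => 0
  pos := 0

/-- The result of a computation: the `n × n` matrices in the arrays `4` and `5`. -/
def State.output (s : State) (n : ℕ) : Matrix (Fin n) (Fin n) ℂ × Matrix (Fin n) (Fin n) ℂ :=
  (s.block 4 n, s.block 5 n)

end NCG

end

noncomputable section

namespace NCG

open MeasureTheory
open scoped ComplexOrder Matrix

/-! ### Bilinearity of the form and domination by the semidefinite value -/

section Form

variable {n : ℕ} (M : Tensor n)

/-! The procedure is two roundings in a row. A complex rounding turns `X`, `Y` into unitary matrices
and loses a factor 2; Krivine's two-dimensional rounding turns unitary matrices with a real value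
into Hermitian contractions and loses a factor √2. This explains the constant 1/(2√2).

Complex rounding. If t has the hyperbolic secant law, then E[a^{it}] = 1/cosh(log a) = 2a/(1 + a²)
for a > 0 (`integral_exp_log_sechLaw`), that is, E[a^{it}] = 2a - E[a^{2+it}]; the random signs on
the kernels make this true for a = 0 as well. Taking for a the products of a singular value of X_z
and one of Y_z, the expectation of M(A, B) over t and the signs is 2M(X_z, Y_z) minus that of
M(U|X_z|^{2+it}, V|Y_z|^{2-it}). Averaged over z the first term is M(X, Y), because the phases are
orthonormal. For the second term, the fourth moments of the phases give E(X_z X_z^*)² ≤ 1/2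
(`fourth_moment_posSemidef`). Hence the matrices U|X_z|^{2+it}, scaled by √2 and averaged, form a
family with both Gram matrices at most 1. Such a family can be completed to a vector-valued unitary
without changing the value (`norm_sum_form_le_sdp`), so the second term is at most half of `sdp M`.
Thus |E M(A, B)| ≥ (1/2 - ε) sdp (`le_norm_sum_integral_complexRound`).

Two-dimensional rounding. Since M is Hermitian, its values on pairs of spectral projections are
real, so a real M(A, B) is a real combination of the numbers cos(θ_j - φ_k). Rounding at frequency m
with a uniform shift replaces these by K(m(θ_j - φ_k)) up to a sign, where K is the convolution of f
and g; its cosine coefficients are proportional to a_m. The numbers b_m are a multiple of the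
Dirichlet inverse of (a_m), whence ∑ b_m K(mδ) = (cos δ)/√2 (`hasSum_krivineB_mul_krivineK`). The
|b_m| are probabilities: b_m has the sign of the quadratic character χ modulo 8, K(mπ/4) = χ(m)/2
for odd m, and δ = π/4 yields ∑ |b_m| = 1 (`hasSum_abs_krivineB`). Cutting the series at L = ⌈C/ε⌉
costs at most ε sdp, so the total is (1/√2)(1/2 - ε) - ε times sdp.

The program. Since f and g factor through the cosine, A' and B' are functions of the Hermitian parts
of e^{-it'} A^{2ℓ+1} and e^{-it'} B^{2ℓ+1} (`roundEig_turn`). They are therefore independent of the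
selected spectral decompositions, measurable in the random choices, and computable from spectral
decompositions of Hermitian matrices alone. A polar decomposition is assembled from the eigenvectors
of T^*T and TT^*, and the random choices are made from uniform numbers by inverse transforms. The
structure `Cmd` carries the effect of a program and a polynomial bound on its cost together, so both
come out of one construction. -/

theorem form_add_left (A A' B : Matrix (Fin n) (Fin n) ℂ) :
    form M (A + A') B = form M A B + form M A' B := by
  simp only [form, Matrix.add_apply, add_mul, mul_add, Finset.sum_add_distrib]

theorem form_add_right (A B B' : Matrix (Fin n) (Fin n) ℂ) :
    form M A (B + B') = form M A B + form M A B' := by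
  simp only [form, Matrix.add_apply, star_add, mul_add, Finset.sum_add_distrib]

theorem form_smul_left (c : ℂ) (A B : Matrix (Fin n) (Fin n) ℂ) :
    form M (c • A) B = c * form M A B := by
  simp only [form, Matrix.smul_apply, smul_eq_mul, Finset.mul_sum]
  refine Finset.sum_congr rfl fun i _ => Finset.sum_congr rfl fun j _ =>
    Finset.sum_congr rfl fun k _ => Finset.sum_congr rfl fun l _ => ?_
  ring

theorem form_smul_right (c : ℂ) (A B : Matrix (Fin n) (Fin n) ℂ) :
    form M A (c • B) = star c * form M A B := by
  simp only [form, Matrix.smul_apply, smul_eq_mul, Finset.mul_sum, star_mul']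
  refine Finset.sum_congr rfl fun i _ => Finset.sum_congr rfl fun j _ =>
    Finset.sum_congr rfl fun k _ => Finset.sum_congr rfl fun l _ => ?_
  ring

@[simp] theorem form_zero_left (B : Matrix (Fin n) (Fin n) ℂ) : form M 0 B = 0 := by
  simp [form]

@[simp] theorem form_zero_right (A : Matrix (Fin n) (Fin n) ℂ) : form M A 0 = 0 := by
  simp [form]

theorem form_sum_left {ι : Type*} (s : Finset ι) (A : ι → Matrix (Fin n) (Fin n) ℂ)
    (B : Matrix (Fin n) (Fin n) ℂ) :
    form M (∑ r ∈ s, A r) B = ∑ r ∈ s, form M (A r) B := by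
  classical
  induction s using Finset.induction_on with
  | empty => simp
  | insert a s ha ih => rw [Finset.sum_insert ha, Finset.sum_insert ha, form_add_left, ih]

theorem form_sum_right {ι : Type*} (s : Finset ι) (A : Matrix (Fin n) (Fin n) ℂ)
    (B : ι → Matrix (Fin n) (Fin n) ℂ) :
    form M A (∑ r ∈ s, B r) = ∑ r ∈ s, form M A (B r) := by
  classical
  induction s using Finset.induction_on with
  | empty => simp
  | insert a s ha ih => rw [Finset.sum_insert ha, Finset.sum_insert ha, form_add_right, ih]

/-- A Hermitian tensor takes real values on pairs of Hermitian matrices. -/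
theorem star_form_of_isHerm {M : Tensor n} (hM : M.IsHerm) {A B : Matrix (Fin n) (Fin n) ℂ}
    (hA : A.IsHermitian) (hB : B.IsHermitian) : star (form M A B) = form M A B := by
  simp only [form, star_sum, star_mul', star_star]
  -- Exchanging i with j and k with l absorbs the conjugation, in the tensor and in both matrices.
  rw [Finset.sum_comm]
  refine Finset.sum_congr rfl fun i _ => Finset.sum_congr rfl fun j _ => ?_
  rw [Finset.sum_comm]
  refine Finset.sum_congr rfl fun k _ => Finset.sum_congr rfl fun l _ => ?_
  rw [hM i j k l, hA.apply i j, ← hB.apply k l, star_star]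

end Form

/-- The `r`-th coordinate matrix of a vector-valued matrix. -/
def slice {n d : ℕ} (X : VMat n d) (r : Fin d) : Matrix (Fin n) (Fin n) ℂ :=
  Matrix.of fun i j => X i j r

/-- This replaces a vector-valued matrix by the family of its coordinate matrices; all later
estimates against `sdp` are made for such families. -/
theorem vform_eq_sum_form {n d : ℕ} (M : Tensor n) (X Y : VMat n d) :
    vform M X Y = ∑ r, form M (slice X r) (slice Y r) := by
  simp only [vform, form, cdot, slice, Matrix.of_apply, Finset.mul_sum]
  rw [Finset.sum_comm]
  simp_rw [Finset.sum_comm (s := (Finset.univ : Finset (Fin d)))]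
  rw [Finset.sum_comm]

theorem rowGram_eq_sum {n d : ℕ} (X : VMat n d) :
    rowGram X = ∑ r, slice X r * (slice X r)ᴴ := by
  ext i j
  simp only [rowGram, cdot, slice, Matrix.of_apply, Matrix.sum_apply, Matrix.mul_apply,
    Matrix.conjTranspose_apply]
  rw [Finset.sum_comm]

/-- The transpose arises because `colGram` conjugates its second factor; it is harmless in the
condition that the Gram matrix be 1. -/
theorem colGram_eq_sum {n d : ℕ} (X : VMat n d) :
    colGram X = (∑ r, (slice X r)ᴴ * slice X r)ᵀ := by
  ext i j
  simp only [colGram, cdot, slice, Matrix.of_apply, Matrix.sum_apply, Matrix.mul_apply,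
    Matrix.conjTranspose_apply, Matrix.transpose_apply]
  rw [Finset.sum_comm]
  simp_rw [mul_comm]

theorem mem_vUnitary_iff {n d : ℕ} (X : VMat n d) :
    X ∈ vUnitary n d ↔
      ∑ r, slice X r * (slice X r)ᴴ = 1 ∧ ∑ r, (slice X r)ᴴ * slice X r = 1 := by
  rw [vUnitary, Set.mem_ofPred_eq, rowGram_eq_sum, colGram_eq_sum, Matrix.transpose_eq_one]

theorem norm_le_one_of_mem_vUnitary {n d : ℕ} {X : VMat n d} (hX : X ∈ vUnitary n d)
    (i j : Fin n) : ∑ r, ‖X i j r‖ ^ 2 ≤ 1 := by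
  have h := congrArg Complex.re (congrFun (congrFun hX.1 i) i)
  have key : ∀ k, (cdot (X i k) (X i k)).re = ∑ r, ‖X i k r‖ ^ 2 := by
    intro k
    rw [cdot, Complex.re_sum]
    refine Finset.sum_congr rfl fun r _ => ?_
    rw [Complex.star_def, Complex.mul_conj, Complex.ofReal_re, Complex.normSq_eq_norm_sq]
  simp only [rowGram, Matrix.of_apply, Complex.re_sum, Matrix.one_apply_eq, Complex.one_re,
    key] at h
  rw [← h]
  exact Finset.single_le_sum (f := fun k => ∑ r, ‖X i k r‖ ^ 2)
    (fun k _ => Finset.sum_nonneg fun r _ => by positivity) (Finset.mem_univ j)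

/-- A crude bound, needed to make the set in the definition of `sdp` bounded above; an unbounded
real supremum would be the default value 0. -/
theorem norm_vform_le {n d : ℕ} (M : Tensor n) {X Y : VMat n d} (hX : X ∈ vUnitary n d)
    (hY : Y ∈ vUnitary n d) : ‖vform M X Y‖ ≤ ∑ i, ∑ j, ∑ k, ∑ l, ‖M i j k l‖ := by
  have hc : ∀ i j k l, ‖cdot (X i j) (Y k l)‖ ≤ 1 := by
    intro i j k l
    have h1 := norm_le_one_of_mem_vUnitary hX i j
    have h2 := norm_le_one_of_mem_vUnitary hY k l
    calc ‖cdot (X i j) (Y k l)‖ ≤ ∑ r, ‖X i j r‖ * ‖Y k l r‖ := by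
          refine (norm_sum_le _ _).trans (le_of_eq ?_)
          simp
      _ ≤ ∑ r, (‖X i j r‖ ^ 2 + ‖Y k l r‖ ^ 2) / 2 :=
          Finset.sum_le_sum fun r _ => by nlinarith [sq_nonneg (‖X i j r‖ - ‖Y k l r‖)]
      _ = ((∑ r, ‖X i j r‖ ^ 2) + ∑ r, ‖Y k l r‖ ^ 2) / 2 := by
          rw [← Finset.sum_div, Finset.sum_add_distrib]
      _ ≤ 1 := by linarith
  unfold vform
  refine (norm_sum_le _ _).trans (Finset.sum_le_sum fun i _ => ?_)
  refine (norm_sum_le _ _).trans (Finset.sum_le_sum fun j _ => ?_)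
  refine (norm_sum_le _ _).trans (Finset.sum_le_sum fun k _ => ?_)
  refine (norm_sum_le _ _).trans (Finset.sum_le_sum fun l _ => ?_)
  rw [norm_mul]
  exact mul_le_of_le_one_right (norm_nonneg _) (hc i j k l)

theorem norm_vform_le_sdp {n d : ℕ} (M : Tensor n) {X Y : VMat n d} (hX : X ∈ vUnitary n d)
    (hY : Y ∈ vUnitary n d) : ‖vform M X Y‖ ≤ sdp M := by
  refine le_csSup ⟨∑ i, ∑ j, ∑ k, ∑ l, ‖M i j k l‖, ?_⟩ ⟨d, X, hX, Y, hY, rfl⟩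
  rintro v ⟨d', X', hX', Y', hY', rfl⟩
  exact norm_vform_le M hX' hY'

theorem sdp_nonneg {n : ℕ} (M : Tensor n) : 0 ≤ sdp M := by
  refine Real.sSup_nonneg ?_
  rintro v ⟨d', X', hX', Y', hY', rfl⟩
  exact norm_nonneg _

/-! ### Families of matrices with Gram matrices at most 1 are dominated by `sdp` -/

section Domination

open scoped MatrixOrder Matrix.Norms.L2Operator in
theorem exists_eq_conjTranspose_mul_self {n : ℕ} {S : Matrix (Fin n) (Fin n) ℂ}
    (h : S.PosSemidef) : ∃ B : Matrix (Fin n) (Fin n) ℂ, S = Bᴴ * B :=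
  CStarAlgebra.nonneg_iff_eq_star_mul_self.1 h.nonneg

variable {n : ℕ} {ι : Type*} [Fintype ι]

/-- `sdp` ranges over all dimensions, so a family over any finite type counts once its members are
numbered. -/
theorem norm_sum_form_le_sdp_of_eq_one (M : Tensor n) (A B : ι → Matrix (Fin n) (Fin n) ℂ)
    (hA : ∑ r, A r * (A r)ᴴ = 1) (hA' : ∑ r, (A r)ᴴ * A r = 1)
    (hB : ∑ r, B r * (B r)ᴴ = 1) (hB' : ∑ r, (B r)ᴴ * B r = 1) :
    ‖∑ r, form M (A r) (B r)‖ ≤ sdp M := by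
  let e := Fintype.equivFin ι
  let X : VMat n (Fintype.card ι) := fun i j r => A (e.symm r) i j
  let Y : VMat n (Fintype.card ι) := fun i j r => B (e.symm r) i j
  have hsX : ∀ r, slice X r = A (e.symm r) := fun r => rfl
  have hsY : ∀ r, slice Y r = B (e.symm r) := fun r => rfl
  have hX : X ∈ vUnitary n _ := by
    rw [mem_vUnitary_iff]
    simp only [hsX]
    rw [e.symm.sum_comp (fun r => A r * (A r)ᴴ), e.symm.sum_comp (fun r => (A r)ᴴ * A r)]
    exact ⟨hA, hA'⟩
  have hY : Y ∈ vUnitary n _ := by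
    rw [mem_vUnitary_iff]
    simp only [hsY]
    rw [e.symm.sum_comp (fun r => B r * (B r)ᴴ), e.symm.sum_comp (fun r => (B r)ᴴ * B r)]
    exact ⟨hB, hB'⟩
  have h := norm_vform_le_sdp M hX hY
  rw [vform_eq_sum_form] at h
  simp only [hsX, hsY] at h
  rwa [e.symm.sum_comp (fun r => form M (A r) (B r))] at h

/-- Two positive semidefinite matrices of equal trace are the two Gram matrices of one family. -/
theorem exists_family_of_trace_eq {S T : Matrix (Fin n) (Fin n) ℂ} (hS : S.PosSemidef)
    (hT : T.PosSemidef) (h : S.trace = T.trace) :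
    ∃ Z : Fin n × Fin n → Matrix (Fin n) (Fin n) ℂ,
      ∑ r, Z r * (Z r)ᴴ = S ∧ ∑ r, (Z r)ᴴ * Z r = T := by
  by_cases h0 : S.trace = 0
  · have hS0 := hS.trace_eq_zero_iff.1 h0
    have hT0 := hT.trace_eq_zero_iff.1 (h ▸ h0)
    exact ⟨fun _ => 0, by simp [hS0], by simp [hT0]⟩
  · obtain ⟨P, hP⟩ := exists_eq_conjTranspose_mul_self hS
    obtain ⟨Q, hQ⟩ := exists_eq_conjTranspose_mul_self hT
    have htr : ((S.trace.re : ℝ) : ℂ) = S.trace := by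
      have := hS.trace_nonneg
      rw [Complex.le_def] at this
      exact Complex.ext rfl this.2
    have hpos : 0 ≤ S.trace.re := (Complex.le_def.1 hS.trace_nonneg).1
    have hsq : ((√S.trace.re : ℝ) : ℂ) * ((√S.trace.re : ℝ) : ℂ) = S.trace := by
      rw [← Complex.ofReal_mul, Real.mul_self_sqrt hpos, htr]
    set c : ℂ := ((√S.trace.re : ℝ) : ℂ)⁻¹ with hc
    have hcs : star c = c := by simp [hc]
    have hcc : c * c * S.trace = 1 := by
      rw [hc, ← mul_inv, hsq, inv_mul_cancel₀ h0]
    have hSe : ∀ i j, S i j = ∑ k, star (P k i) * P k j := fun i j => by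
      rw [hP]; simp [Matrix.mul_apply]
    have hTe : ∀ i j, T i j = ∑ k, star (Q k i) * Q k j := fun i j => by
      rw [hQ]; simp [Matrix.mul_apply]
    have hStr : ∑ i, ∑ k, star (P k i) * P k i = S.trace := by
      simp [Matrix.trace, hSe]
    have hTtr : ∑ i, ∑ k, star (Q k i) * Q k i = S.trace := by
      rw [h]; simp [Matrix.trace, hTe]
    -- The members have rank at most one: the conjugate of row `r.1` of `P` times row `r.2` of `Q`.
    -- In either Gram sum the other factor contributes its whole trace, which `c * c` cancels.
    refine ⟨fun r => Matrix.of fun i j => c * (star (P r.1 i) * Q r.2 j), ?_, ?_⟩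
    · ext i j
      rw [Matrix.sum_apply, Fintype.sum_prod_type]
      simp only [Matrix.mul_apply, Matrix.conjTranspose_apply, Matrix.of_apply, star_mul', hcs,
        star_star]
      calc ∑ x, ∑ y, ∑ l, c * (star (P x i) * Q y l) * (c * (P x j * star (Q y l)))
          = ∑ x, (c * c) * (star (P x i) * P x j) * ∑ l, ∑ y, star (Q y l) * Q y l := by
            refine Finset.sum_congr rfl fun x _ => ?_
            rw [Finset.sum_comm, Finset.mul_sum]
            refine Finset.sum_congr rfl fun l _ => ?_
            rw [Finset.mul_sum]
            exact Finset.sum_congr rfl fun y _ => by ring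
        _ = S i j := by
            rw [hTtr, hSe]
            refine Finset.sum_congr rfl fun x _ => ?_
            linear_combination (star (P x i) * P x j) * hcc
    · ext i j
      rw [Matrix.sum_apply, Fintype.sum_prod_type]
      simp only [Matrix.mul_apply, Matrix.conjTranspose_apply, Matrix.of_apply, star_mul', hcs,
        star_star]
      calc ∑ x, ∑ y, ∑ l, c * (P x l * star (Q y i)) * (c * (star (P x l) * Q y j))
          = ∑ y, (c * c) * (star (Q y i) * Q y j) * ∑ l, ∑ x, star (P x l) * P x l := by
            rw [Finset.sum_comm]
            refine Finset.sum_congr rfl fun y _ => ?_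
            rw [Finset.sum_comm, Finset.mul_sum]
            refine Finset.sum_congr rfl fun l _ => ?_
            rw [Finset.mul_sum]
            exact Finset.sum_congr rfl fun x _ => by ring
        _ = T i j := by
            rw [hStr, hTe]
            refine Finset.sum_congr rfl fun y _ => ?_
            linear_combination (star (Q y i) * Q y j) * hcc

/-- The two defects have equal trace because the trace is cyclic, so one family `Z` repairs both. -/
theorem exists_unitary_completion (A : ι → Matrix (Fin n) (Fin n) ℂ)
    (hA : (1 - ∑ r, A r * (A r)ᴴ).PosSemidef) (hA' : (1 - ∑ r, (A r)ᴴ * A r).PosSemidef) :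
    ∃ Z : Fin n × Fin n → Matrix (Fin n) (Fin n) ℂ,
      ∑ r, A r * (A r)ᴴ + ∑ r, Z r * (Z r)ᴴ = 1 ∧
      ∑ r, (A r)ᴴ * A r + ∑ r, (Z r)ᴴ * Z r = 1 := by
  obtain ⟨Z, h1, h2⟩ := exists_family_of_trace_eq hA hA' (by
    simp only [Matrix.trace_sub, Matrix.trace_sum]
    congr 1
    exact Finset.sum_congr rfl fun r _ => Matrix.trace_mul_comm _ _)
  exact ⟨Z, by rw [h1]; abel, by rw [h2]; abel⟩

/-- Families with both Gram matrices at most `1` are dominated by vector-valued unitaries. -/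
theorem norm_sum_form_le_sdp (M : Tensor n) (A B : ι → Matrix (Fin n) (Fin n) ℂ)
    (hA : (1 - ∑ r, A r * (A r)ᴴ).PosSemidef) (hA' : (1 - ∑ r, (A r)ᴴ * A r).PosSemidef)
    (hB : (1 - ∑ r, B r * (B r)ᴴ).PosSemidef) (hB' : (1 - ∑ r, (B r)ᴴ * B r).PosSemidef) :
    ‖∑ r, form M (A r) (B r)‖ ≤ sdp M := by
  obtain ⟨Z, hZ, hZ'⟩ := exists_unitary_completion A hA hA'
  obtain ⟨W, hW, hW'⟩ := exists_unitary_completion B hB hB'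
  -- The completions stand in different blocks, `Z` against zero and zero against `W`, so they do
  -- not change the value.
  have h := norm_sum_form_le_sdp_of_eq_one (ι := ι ⊕ ((Fin n × Fin n) ⊕ (Fin n × Fin n))) M
    (Sum.elim A (Sum.elim Z fun _ => 0)) (Sum.elim B (Sum.elim (fun _ => 0) W))
    (by simpa [Fintype.sum_sum_type] using hZ) (by simpa [Fintype.sum_sum_type] using hZ')
    (by simpa [Fintype.sum_sum_type] using hW) (by simpa [Fintype.sum_sum_type] using hW')
  simpa [Fintype.sum_sum_type] using h

/-- The special case of one pair of contractions. -/
theorem norm_form_le_sdp (M : Tensor n) (A B : Matrix (Fin n) (Fin n) ℂ)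
    (hA : (1 - A * Aᴴ).PosSemidef) (hA' : (1 - Aᴴ * A).PosSemidef)
    (hB : (1 - B * Bᴴ).PosSemidef) (hB' : (1 - Bᴴ * B).PosSemidef) :
    ‖form M A B‖ ≤ sdp M := by
  have h := norm_sum_form_le_sdp (ι := Unit) M (fun _ => A) (fun _ => B)
    (by simpa using hA) (by simpa using hA') (by simpa using hB) (by simpa using hB')
  simpa using h

end Domination

end NCG

end

noncomputable section

namespace NCG

open MeasureTheory
open scoped ComplexOrder Matrix

/-! ### Functions of diagonalised matrices -/

section ConjDiag

variable {n : ℕ}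

/-- `V diag(a) V^*`. -/
def conjDiag (V : Matrix (Fin n) (Fin n) ℂ) (a : Fin n → ℂ) : Matrix (Fin n) (Fin n) ℂ :=
  V * Matrix.diagonal a * Vᴴ

theorem conjDiag_apply (V : Matrix (Fin n) (Fin n) ℂ) (a : Fin n → ℂ) (i j : Fin n) :
    conjDiag V a i j = ∑ k, V i k * a k * star (V j k) := by
  simp [conjDiag, Matrix.mul_apply, Matrix.diagonal_apply]

theorem conjTranspose_conjDiag (V : Matrix (Fin n) (Fin n) ℂ) (a : Fin n → ℂ) :
    (conjDiag V a)ᴴ = conjDiag V (fun j => star (a j)) := by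
  ext i j
  simp only [Matrix.conjTranspose_apply, conjDiag_apply, star_sum, star_mul', star_star]
  exact Finset.sum_congr rfl fun k _ => by ring

theorem conjDiag_add (V : Matrix (Fin n) (Fin n) ℂ) (a b : Fin n → ℂ) :
    conjDiag V a + conjDiag V b = conjDiag V (fun j => a j + b j) := by
  ext i j
  simp only [Matrix.add_apply, conjDiag_apply, ← Finset.sum_add_distrib]
  exact Finset.sum_congr rfl fun k _ => by ring

theorem smul_conjDiag (c : ℂ) (V : Matrix (Fin n) (Fin n) ℂ) (a : Fin n → ℂ) :
    c • conjDiag V a = conjDiag V (fun j => c * a j) := by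
  ext i j
  simp only [Matrix.smul_apply, conjDiag_apply, smul_eq_mul, Finset.mul_sum]
  exact Finset.sum_congr rfl fun k _ => by ring

variable {V W : Matrix (Fin n) (Fin n) ℂ}

theorem conjDiag_one (hV : V ∈ Matrix.unitaryGroup (Fin n) ℂ) :
    conjDiag V (fun _ => 1) = 1 := by
  have := Matrix.mem_unitaryGroup_iff.1 hV
  rw [conjDiag, Matrix.diagonal_one, mul_one]
  exact this

theorem conjDiag_mul (hV : V ∈ Matrix.unitaryGroup (Fin n) ℂ) (a b : Fin n → ℂ) :
    conjDiag V a * conjDiag V b = conjDiag V (fun j => a j * b j) := by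
  have h : Vᴴ * V = 1 := Matrix.mem_unitaryGroup_iff'.1 hV
  calc V * Matrix.diagonal a * Vᴴ * (V * Matrix.diagonal b * Vᴴ)
      = V * Matrix.diagonal a * (Vᴴ * V) * Matrix.diagonal b * Vᴴ := by noncomm_ring
    _ = _ := by
        rw [h, mul_one, Matrix.mul_assoc V, Matrix.diagonal_mul_diagonal]
        rfl

theorem conjDiag_pow (hV : V ∈ Matrix.unitaryGroup (Fin n) ℂ) (a : Fin n → ℂ) (m : ℕ) :
    conjDiag V a ^ m = conjDiag V (fun j => a j ^ m) := by
  induction m with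
  | zero => simp [conjDiag_one hV]
  | succ m ih =>
    rw [pow_succ, ih, conjDiag_mul hV]
    simp only [pow_succ]

theorem conjDiag_injective (hV : V ∈ Matrix.unitaryGroup (Fin n) ℂ) {a b : Fin n → ℂ}
    (h : conjDiag V a = conjDiag V b) : a = b := by
  have hV' : Vᴴ * V = 1 := Matrix.mem_unitaryGroup_iff'.1 hV
  have key : ∀ c, Vᴴ * conjDiag V c * V = Matrix.diagonal c := fun c => by
    calc Vᴴ * (V * Matrix.diagonal c * Vᴴ) * V = (Vᴴ * V) * Matrix.diagonal c * (Vᴴ * V) := by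
          noncomm_ring
      _ = _ := by rw [hV', one_mul, mul_one]
  exact Matrix.diagonal_injective (by rw [← key a, ← key b, h])

/-- A function of a diagonalisable matrix does not depend on the diagonalisation. -/
theorem conjDiag_comp_eq {α : Type*} {c : ℂ → α} (g : α → ℂ)
    (hV : V ∈ Matrix.unitaryGroup (Fin n) ℂ) (hW : W ∈ Matrix.unitaryGroup (Fin n) ℂ)
    {a b : Fin n → ℂ} (h : conjDiag V a = conjDiag W b) :
    conjDiag V (fun j => g (c (a j))) = conjDiag W (fun j => g (c (b j))) := by
  have hV1 : Vᴴ * V = 1 := Matrix.mem_unitaryGroup_iff'.1 hV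
  have hW1 : Wᴴ * W = 1 := Matrix.mem_unitaryGroup_iff'.1 hW
  have hV2 : V * Vᴴ = 1 := Matrix.mem_unitaryGroup_iff.1 hV
  have hW2 : W * Wᴴ = 1 := Matrix.mem_unitaryGroup_iff.1 hW
  set U := Wᴴ * V with hU
  have h1 : U * Matrix.diagonal a = Matrix.diagonal b * U := by
    calc Wᴴ * V * Matrix.diagonal a = Wᴴ * (V * Matrix.diagonal a * Vᴴ) * V := by
          rw [Matrix.mul_assoc Wᴴ, Matrix.mul_assoc Wᴴ, Matrix.mul_assoc (V * _), hV1, mul_one]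
      _ = Wᴴ * (W * Matrix.diagonal b * Wᴴ) * V := by
          rw [show V * Matrix.diagonal a * Vᴴ = _ from h]; rfl
      _ = (Wᴴ * W) * Matrix.diagonal b * (Wᴴ * V) := by noncomm_ring
      _ = _ := by rw [hW1, one_mul]
  -- `U` intertwines the two diagonal matrices, so `U i j` can be nonzero only where `a j = b i`;
  -- hence it intertwines every function of them.
  have h2 : U * Matrix.diagonal (fun j => g (c (a j)))
      = Matrix.diagonal (fun j => g (c (b j))) * U := by
    ext i j
    have := congrFun (congrFun h1 i) j
    rw [Matrix.mul_diagonal, Matrix.diagonal_mul] at this ⊢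
    by_cases hz : U i j = 0
    · simp [hz]
    · have hab : a j = b i := mul_left_cancel₀ hz (by rw [this, mul_comm])
      rw [hab, mul_comm]
  calc V * Matrix.diagonal (fun j => g (c (a j))) * Vᴴ
      = (W * Wᴴ) * V * Matrix.diagonal (fun j => g (c (a j))) * Vᴴ := by rw [hW2, one_mul]
    _ = W * (U * Matrix.diagonal (fun j => g (c (a j)))) * Vᴴ := by rw [hU]; noncomm_ring
    _ = W * Matrix.diagonal (fun j => g (c (b j))) * Wᴴ * (V * Vᴴ) := by
        rw [h2, hU]; noncomm_ring
    _ = _ := by rw [hV2, mul_one]; rfl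

theorem conjDiag_comp (c : ℂ → ℂ)
    (hV : V ∈ Matrix.unitaryGroup (Fin n) ℂ) (hW : W ∈ Matrix.unitaryGroup (Fin n) ℂ)
    {a b : Fin n → ℂ} (h : conjDiag V a = conjDiag W b) :
    conjDiag V (fun j => c (a j)) = conjDiag W (fun j => c (b j)) :=
  conjDiag_comp_eq (c := id) c hV hW h

theorem conjDiag_real_isHermitian (V : Matrix (Fin n) (Fin n) ℂ) (a : Fin n → ℝ) :
    (conjDiag V fun j => (a j : ℂ)).IsHermitian := by
  rw [Matrix.IsHermitian, conjTranspose_conjDiag]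
  simp

theorem conjDiag_posSemidef (V : Matrix (Fin n) (Fin n) ℂ) {a : Fin n → ℝ}
    (ha : ∀ j, 0 ≤ a j) : (conjDiag V fun j => (a j : ℂ)).PosSemidef := by
  refine Matrix.PosSemidef.mul_mul_conjTranspose_same (Matrix.posSemidef_diagonal_iff.2 ?_) V
  intro j
  exact_mod_cast ha j

theorem one_sub_conjDiag (hV : V ∈ Matrix.unitaryGroup (Fin n) ℂ) (a : Fin n → ℂ) :
    1 - conjDiag V a = conjDiag V (fun j => 1 - a j) := by
  rw [← conjDiag_one hV, sub_eq_add_neg, ← neg_one_smul ℂ (conjDiag V a), smul_conjDiag,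
    conjDiag_add]
  congr 1
  ext j
  ring

theorem one_sub_conjDiag_posSemidef (hV : V ∈ Matrix.unitaryGroup (Fin n) ℂ) {a : Fin n → ℝ}
    (ha : ∀ j, |a j| ≤ 1) :
    (1 - (conjDiag V fun j => (a j : ℂ)) * (conjDiag V fun j => (a j : ℂ))ᴴ).PosSemidef ∧
    (1 - (conjDiag V fun j => (a j : ℂ))ᴴ * (conjDiag V fun j => (a j : ℂ))).PosSemidef := by
  rw [(conjDiag_real_isHermitian V a).eq, and_self, conjDiag_mul hV, one_sub_conjDiag hV]
  have : (fun j => 1 - (a j : ℂ) * a j) = fun j => ((1 - a j * a j : ℝ) : ℂ) := by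
    ext j; push_cast; ring
  rw [this]
  exact conjDiag_posSemidef V fun j => by nlinarith [abs_mul_abs_self (a j), abs_nonneg (a j), ha j]

open scoped Matrix.Norms.L2Operator in
theorem opNorm_conjDiag_le (hV : V ∈ Matrix.unitaryGroup (Fin n) ℂ) {a : Fin n → ℝ}
    (ha : ∀ j, |a j| ≤ 1) : opNorm (conjDiag V fun j => (a j : ℂ)) ≤ 1 := by
  change ‖conjDiag V fun j => (a j : ℂ)‖ ≤ 1
  have h1 : ‖V‖ ≤ 1 := by
    -- For `n = 0` the matrix ring is trivial and `V` has norm 0 instead of 1.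
    rcases subsingleton_or_nontrivial (Matrix (Fin n) (Fin n) ℂ) with h | h
    · rw [Subsingleton.elim V 0, norm_zero]; exact zero_le_one
    · exact (CStarRing.norm_of_mem_unitary hV).le
  have h2 : ‖Vᴴ‖ ≤ 1 := by rw [Matrix.l2_opNorm_conjTranspose]; exact h1
  have h3 : ‖(Matrix.diagonal fun j => (a j : ℂ) : Matrix (Fin n) (Fin n) ℂ)‖ ≤ 1 := by
    rw [Matrix.l2_opNorm_diagonal]
    exact (pi_norm_le_iff_of_nonneg zero_le_one).2 fun j => by simpa using ha j
  calc ‖conjDiag V fun j => (a j : ℂ)‖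
      ≤ ‖V‖ * ‖(Matrix.diagonal fun j => (a j : ℂ) : Matrix (Fin n) (Fin n) ℂ)‖ * ‖Vᴴ‖ :=
        (norm_mul_le _ _).trans (mul_le_mul_of_nonneg_right (norm_mul_le _ _) (norm_nonneg _))
    _ ≤ 1 * 1 * 1 := by gcongr
    _ = 1 := by norm_num

theorem spectral_conjDiag {P : Matrix (Fin n) (Fin n) ℂ} (h : P.IsHermitian) :
    P = conjDiag h.eigenvectorUnitary (fun j => (h.eigenvalues j : ℂ)) :=
  h.spectral_theorem

theorem hermFun_eq {c : ℝ → ℂ} {P : Matrix (Fin n) (Fin n) ℂ} (h : P.IsHermitian) :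
    hermFun c P = conjDiag h.eigenvectorUnitary (fun j => c (h.eigenvalues j)) := by
  rw [hermFun, dif_pos h]; rfl

/-- The eigenbasis chosen in the definition of `hermFun` is immaterial. -/
theorem hermFun_conjDiag (c : ℝ → ℂ) (hV : V ∈ Matrix.unitaryGroup (Fin n) ℂ) (a : Fin n → ℝ) :
    hermFun c (conjDiag V fun j => (a j : ℂ)) = conjDiag V (fun j => c (a j)) := by
  have h := conjDiag_real_isHermitian V a
  rw [hermFun_eq h]
  have := conjDiag_comp (fun z => c z.re) h.eigenvectorUnitary.2 hV (spectral_conjDiag h).symm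
  simpa using this

theorem roundEig_eq (R : Selection n) (c : ℂ → ℝ) (A : Matrix (Fin n) (Fin n) ℂ) :
    roundEig R c A =
      conjDiag (R.vec A) (fun j => ((c (Complex.exp (Complex.I * R.ang A j)) : ℝ) : ℂ)) := rfl

theorem norm_eq_one_of_conjDiag_mem (hV : V ∈ Matrix.unitaryGroup (Fin n) ℂ) {a : Fin n → ℂ}
    (hA : conjDiag V a ∈ Matrix.unitaryGroup (Fin n) ℂ) (j : Fin n) : ‖a j‖ = 1 := by
  have h : (conjDiag V a)ᴴ * conjDiag V a = 1 := Matrix.mem_unitaryGroup_iff'.1 hA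
  rw [conjTranspose_conjDiag, conjDiag_mul hV, ← conjDiag_one hV] at h
  have := congrFun (conjDiag_injective hV h) j
  rw [Complex.star_def, ← Complex.normSq_eq_conj_mul_self, Complex.normSq_eq_norm_sq] at this
  have h2 : ‖a j‖ ^ 2 = 1 := by exact_mod_cast this
  nlinarith [norm_nonneg (a j)]

/-- The spectral theorem for unitary matrices. -/
theorem exists_unitary_diagonalization {A : Matrix (Fin n) (Fin n) ℂ}
    (hA : A ∈ Matrix.unitaryGroup (Fin n) ℂ) :
    ∃ V ∈ Matrix.unitaryGroup (Fin n) ℂ, ∃ θ : Fin n → ℝ,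
      A = conjDiag V (fun j => Complex.exp (Complex.I * θ j)) := by
  -- Cayley transform: some z on the unit circle avoids the finite spectrum of `A`, so B = z⁻¹A does
  -- not have the eigenvalue 1. Then H = i(1 + B)(1 - B)⁻¹ is Hermitian, and an eigenbasis of H
  -- diagonalises `A`.
  have hinf : (Set.range (fun z : Circle => (z : ℂ))).Infinite := by
    have : Infinite Circle := by
      refine (Circle.argEquiv.infinite_iff).2 ?_
      exact (Set.Ioc_infinite (by linarith [Real.pi_pos])).to_subtype
    exact Set.infinite_range_of_injective Circle.coe_injective
  obtain ⟨_, ⟨⟨z, rfl⟩, hz⟩⟩ := (hinf.sdiff (A.finite_spectrum)).nonempty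
  dsimp only at hz
  have hz0 : (z : ℂ) ≠ 0 := z.coe_ne_zero
  have hzz : star (z : ℂ) * z = 1 := by
    rw [Complex.star_def, ← Complex.normSq_eq_conj_mul_self]; simp
  have hz' : star (z : ℂ) = (z : ℂ)⁻¹ := eq_inv_of_mul_eq_one_left hzz
  set B := (z : ℂ)⁻¹ • A with hB
  have hBB : Bᴴ * B = 1 := by
    have hA' : Aᴴ * A = 1 := Matrix.mem_unitaryGroup_iff'.1 hA
    rw [hB, Matrix.conjTranspose_smul, smul_mul_smul_comm, hA', star_inv₀, hz', inv_inv,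
      mul_inv_cancel₀ hz0, one_smul]
  have hunit : IsUnit (1 - B) := by
    have : IsUnit ((z : ℂ) • (1 : Matrix (Fin n) (Fin n) ℂ) - A) := by
      rw [spectrum.notMem_iff, Algebra.algebraMap_eq_smul_one] at hz
      exact hz
    have h2 : 1 - B = (z : ℂ)⁻¹ • ((z : ℂ) • (1 : Matrix (Fin n) (Fin n) ℂ) - A) := by
      rw [smul_sub, smul_smul, inv_mul_cancel₀ hz0, one_smul]
    rw [h2]
    exact this.smul (Units.mk0 _ (inv_ne_zero hz0))
  obtain ⟨C, hC⟩ := hunit.exists_right_inv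
  have hC' : C * (1 - B) = 1 := mul_eq_one_comm.1 hC
  set H := Complex.I • ((1 + B) * C) with hH
  have hBC : B * C = C - 1 := by
    have : C - B * C = 1 := by rw [← hC]; noncomm_ring
    rw [← this]; abel
  have hH2 : H = Complex.I • (2 • C - 1) := by
    rw [hH, add_mul, hBC, one_mul]; congr 1; noncomm_ring
  have hHerm : H.IsHermitian := by
    have hCt : Cᴴ * (1 - Bᴴ) = 1 := by
      have := congrArg Matrix.conjTranspose hC
      simpa using congrArg Matrix.conjTranspose hC
    -- The inverse C of 1 - B has Hermitian part 1/2, which is what makes H = i(2C - 1) Hermitian.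
    have hsum : Cᴴ + C = 1 := by
      have e1 : Cᴴ * ((1 - Bᴴ) * (1 - B)) * C = Cᴴ * ((1 - Bᴴ) + (1 - B)) * C := by
        congr 2
        calc (1 - Bᴴ) * (1 - B) = 1 - B - Bᴴ + Bᴴ * B := by noncomm_ring
          _ = _ := by rw [hBB]; abel
      have e2 : Cᴴ * ((1 - Bᴴ) * (1 - B)) * C = 1 := by
        calc _ = (Cᴴ * (1 - Bᴴ)) * ((1 - B) * C) := by noncomm_ring
          _ = 1 := by rw [hCt, hC, one_mul]
      have e3 : Cᴴ * ((1 - Bᴴ) + (1 - B)) * C = C + Cᴴ := by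
        calc _ = (Cᴴ * (1 - Bᴴ)) * C + Cᴴ * ((1 - B) * C) := by noncomm_ring
          _ = _ := by rw [hCt, hC, one_mul, mul_one]
      rw [add_comm, ← e3, ← e1, e2]
    rw [Matrix.IsHermitian, hH2, Matrix.conjTranspose_smul, Matrix.conjTranspose_sub,
      Matrix.conjTranspose_one, two_smul, Matrix.conjTranspose_add,
      eq_sub_of_add_eq hsum, Complex.star_def, Complex.conj_I, neg_smul, ← smul_neg]
    congr 1
    abel
  set V := (hHerm.eigenvectorUnitary : Matrix (Fin n) (Fin n) ℂ) with hVdef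
  have hV : V ∈ Matrix.unitaryGroup (Fin n) ℂ := hHerm.eigenvectorUnitary.2
  set σ := hHerm.eigenvalues with hσ
  have hspec : H = conjDiag V (fun j => (σ j : ℂ)) := spectral_conjDiag hHerm
  have hne : ∀ j, (σ j : ℂ) + Complex.I ≠ 0 := fun j h => by
    have := congrArg Complex.im h
    simp at this
  have hIV : Complex.I • (1 : Matrix (Fin n) (Fin n) ℂ) = conjDiag V (fun _ => Complex.I) := by
    rw [← conjDiag_one hV, smul_conjDiag]; simp
  -- The inverse Cayley transform B = (H - i)(H + i)⁻¹.
  have hBH : B * (H + Complex.I • 1) = H - Complex.I • 1 := by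
    have : H + Complex.I • 1 = Complex.I • (2 • C) := by rw [hH2, ← smul_add]; simp
    rw [this, mul_smul_comm, mul_smul_comm, hBC, hH2, ← smul_sub]
    congr 1
    rw [two_smul, two_smul]; abel
  have hBdiag : B = conjDiag V (fun j => ((σ j : ℂ) - Complex.I) * ((σ j : ℂ) + Complex.I)⁻¹) := by
    have e1 : H + Complex.I • 1 = conjDiag V (fun j => (σ j : ℂ) + Complex.I) := by
      rw [hspec, hIV, conjDiag_add]
    have e2 : H - Complex.I • 1 = conjDiag V (fun j => (σ j : ℂ) - Complex.I) := by
      rw [hspec, hIV, sub_eq_add_neg, ← neg_one_smul ℂ (conjDiag V fun _ => Complex.I),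
        smul_conjDiag, conjDiag_add]
      congr 1; ext j; ring
    rw [← conjDiag_mul hV, ← e2, ← hBH, e1, mul_assoc, conjDiag_mul hV]
    have : (fun j => ((σ j : ℂ) + Complex.I) * ((σ j : ℂ) + Complex.I)⁻¹) = fun _ => 1 := by
      ext j; exact mul_inv_cancel₀ (hne j)
    rw [this, conjDiag_one hV, mul_one]
  have hAdiag : A = conjDiag V
      (fun j => (z : ℂ) * (((σ j : ℂ) - Complex.I) * ((σ j : ℂ) + Complex.I)⁻¹)) := by
    rw [← smul_conjDiag, ← hBdiag, hB, smul_smul, mul_inv_cancel₀ hz0, one_smul]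
  refine ⟨V, hV, fun j => Complex.arg
    ((z : ℂ) * (((σ j : ℂ) - Complex.I) * ((σ j : ℂ) + Complex.I)⁻¹)), ?_⟩
  rw [hAdiag] at hA
  conv_lhs => rw [hAdiag]
  congr 1
  ext j
  have h1 := norm_eq_one_of_conjDiag_mem hV hA j
  have h2 := Complex.norm_mul_exp_arg_mul_I
    ((z : ℂ) * (((σ j : ℂ) - Complex.I) * ((σ j : ℂ) + Complex.I)⁻¹))
  rw [h1, Complex.ofReal_one, one_mul, mul_comm] at h2
  exact h2.symm

end ConjDiag

end NCG

end

noncomputable section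

namespace NCG

open MeasureTheory

/-! ### Krivine's coefficients -/

/-- The quadratic character modulo `8`, as a real number. -/
def chi (m : ℕ) : ℝ := ((ZMod.χ₈ (m : ZMod 8) : ℤ) : ℝ)

theorem chi_mul (m k : ℕ) : chi (m * k) = chi m * chi k := by
  rw [chi, chi, chi, Nat.cast_mul, map_mul, Int.cast_mul]

theorem chi_even {m : ℕ} (h : Even m) : chi m = 0 := by
  have := ZMod.χ₈_nat_eq_if_mod_eight m
  rw [if_pos (Nat.even_iff.1 h)] at this
  simp [chi, this]

theorem chi_odd {m : ℕ} (h : Odd m) : chi m = 1 ∨ chi m = -1 := by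
  have h2 := Nat.odd_iff.1 h
  have := ZMod.χ₈_nat_eq_if_mod_eight m
  rw [if_neg (by omega)] at this
  unfold chi
  rw [this]
  split_ifs <;> simp

theorem chi_sq {m : ℕ} (h : Odd m) : chi m * chi m = 1 := by
  rcases chi_odd h with h | h <;> rw [h] <;> norm_num

@[simp] theorem chi_one : chi 1 = 1 := by simp [chi]

/-- The sign of this cosine is a completely multiplicative function of m, which is what makes the
signs in a recursion over divisors tractable. -/
theorem cos_mul_pi_div_four {m : ℕ} (h : Odd m) :
    Real.cos (m * Real.pi / 4) = chi m * (√2 / 2) := by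
  obtain ⟨q, r, hr, rfl⟩ : ∃ q r : ℕ, r < 8 ∧ m = 8 * q + r :=
    ⟨m / 8, m % 8, Nat.mod_lt _ (by norm_num), (Nat.div_add_mod m 8).symm⟩
  have h1 : ((8 * q + r : ℕ) : ℝ) * Real.pi / 4 = r * Real.pi / 4 + q * (2 * Real.pi) := by
    push_cast; ring
  have h2 : chi (8 * q + r) = chi r := by
    simp only [chi]
    congr 2
    push_cast
    have : (8 : ZMod 8) = 0 := by decide
    rw [this]; simp
  rw [h1, Real.cos_add_nat_mul_two_pi, h2]
  have hodd : r % 2 = 1 := by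
    have := Nat.odd_iff.1 h; omega
  have hc : chi r = if r % 8 = 1 ∨ r % 8 = 7 then 1 else -1 := by
    have := ZMod.χ₈_nat_eq_if_mod_eight r
    rw [if_neg (by omega)] at this
    unfold chi
    rw [this]; split_ifs <;> simp
  rw [hc]
  have hp := Real.cos_pi_div_four
  interval_cases r <;> simp at hodd ⊢
  · rw [show 3 * Real.pi / 4 = Real.pi - Real.pi / 4 by ring, Real.cos_pi_sub, hp]
  · rw [show 5 * Real.pi / 4 = Real.pi / 4 + Real.pi by ring, Real.cos_add_pi, hp]
  · rw [show 7 * Real.pi / 4 = 2 * Real.pi - Real.pi / 4 by ring, Real.cos_two_pi_sub, hp]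

theorem krivineA_even {m : ℕ} (h : Even m) : krivineA m = 0 := by
  rw [krivineA, if_pos h]

theorem krivineA_odd {m : ℕ} (h : Odd m) :
    krivineA m = chi m * (8 * √2 / Real.pi ^ 2 *
      ((1 / (m : ℝ) - (-1) ^ (m / 2) * (Real.pi / 4)) * (-1) ^ (m / 2) / (m : ℝ) ^ 4)) := by
  have hm : (m : ℝ) ≠ 0 := by
    have := h.pos; positivity
  rw [krivineA, if_neg (Nat.not_even_iff_odd.2 h), cos_mul_pi_div_four h]
  have := Real.pi_ne_zero
  field_simp
  ring

theorem krivineA_one : krivineA 1 = 8 * √2 / Real.pi ^ 2 * (1 - Real.pi / 4) := by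
  rw [krivineA_odd odd_one]; simp

theorem krivineA_one_pos : 0 < krivineA 1 := by
  rw [krivineA_one]
  have := Real.pi_lt_d2
  have := Real.pi_pos
  have : 0 < 1 - Real.pi / 4 := by linarith
  positivity

/-! ### Signs and decay of the numbers `krivineB` -/

/-- The nonnegative numbers `-χ(m) a_m / a_1` for `m ≠ 1`. -/
def krivineAlpha (m : ℕ) : ℝ := -(chi m * krivineA m / krivineA 1)

theorem krivineAlpha_even {m : ℕ} (h : Even m) : krivineAlpha m = 0 := by
  simp [krivineAlpha, chi_even h]

theorem krivineAlpha_odd {m : ℕ} (h : Odd m) :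
    krivineAlpha m =
      (Real.pi / 4 - (-1) ^ (m / 2) / (m : ℝ)) / ((1 - Real.pi / 4) * (m : ℝ) ^ 4) := by
  have hm : (m : ℝ) ≠ 0 := by
    have := h.pos; positivity
  have h1 : 1 - Real.pi / 4 ≠ 0 := by
    have := Real.pi_lt_d2
    intro h; linarith
  have h2 : √2 ≠ 0 := by positivity
  have hs : ((-1 : ℝ) ^ (m / 2)) * (-1) ^ (m / 2) = 1 := by
    rw [← mul_pow]; norm_num
  have hp := Real.pi_ne_zero
  rw [krivineAlpha, krivineA_odd h, krivineA_one, ← mul_assoc, chi_sq h, one_mul]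
  rw [mul_div_mul_left _ _ (by positivity), div_div, mul_comm ((m : ℝ) ^ 4), ← neg_div]
  congr 1
  linear_combination (Real.pi / 4) * hs

/-- For odd m ≥ 3 the term ±1/m is at most 1/3 < π/4, whereas 1 > π/4 for m = 1; this is why only
the first coefficient has the opposite sign. -/
theorem krivineAlpha_nonneg {m : ℕ} (h : m ≠ 1) : 0 ≤ krivineAlpha m := by
  rcases Nat.even_or_odd m with he | ho
  · rw [krivineAlpha_even he]
  · have hm : (3 : ℝ) ≤ m := by
      have : 3 ≤ m := by
        obtain ⟨k, rfl⟩ := ho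
        omega
      exact_mod_cast this
    rw [krivineAlpha_odd ho]
    have h1 : (-1 : ℝ) ^ (m / 2) / (m : ℝ) ≤ 1 / 3 := by
      have : (-1 : ℝ) ^ (m / 2) ≤ 1 := by
        rcases neg_one_pow_eq_or ℝ (m / 2) with h | h <;> norm_num [h]
      rw [div_le_div_iff₀ (by linarith) (by norm_num)]
      linarith
    have := Real.pi_gt_three
    have := Real.pi_lt_d2
    have h2 : 0 ≤ 1 - Real.pi / 4 := by linarith
    have h3 : 0 ≤ Real.pi / 4 - (-1 : ℝ) ^ (m / 2) / (m : ℝ) := by linarith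
    positivity

/-- The right side is written as a telescoping difference. The factor (π/4 + 1/3)/(1 - π/4) is at
most 6, and 1/m³ ≤ 1/((m - 1)m(m + 1)). -/
theorem mul_krivineAlpha_le {m : ℕ} (h : 2 ≤ m) :
    m * krivineAlpha m ≤ 3 * (1 / (((m : ℝ) - 1) * m) - 1 / (m * ((m : ℝ) + 1))) := by
  have hm2 : (2 : ℝ) ≤ m := by exact_mod_cast h
  have hT : 1 / (((m : ℝ) - 1) * m) - 1 / (m * ((m : ℝ) + 1))
      = 2 / (((m : ℝ) - 1) * m * (m + 1)) := by
    have : (m : ℝ) - 1 ≠ 0 := by intro h; linarith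
    have : (m : ℝ) + 1 ≠ 0 := by intro h; linarith
    field_simp
    ring
  rw [hT]
  rcases Nat.even_or_odd m with he | ho
  · rw [krivineAlpha_even he]
    have : 0 < (m : ℝ) - 1 := by linarith
    simp only [mul_zero]
    positivity
  · have hm : (3 : ℝ) ≤ m := by
      have : 3 ≤ m := by
        obtain ⟨k, rfl⟩ := ho
        omega
      exact_mod_cast this
    rw [krivineAlpha_odd ho]
    have h1 : -(1 / 3) ≤ (-1 : ℝ) ^ (m / 2) / (m : ℝ) := by
      have : -1 ≤ (-1 : ℝ) ^ (m / 2) := by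
        rcases neg_one_pow_eq_or ℝ (m / 2) with h | h <;> norm_num [h]
      rw [le_div_iff₀ (by linarith)]
      linarith
    have hp := Real.pi_gt_three
    have hp' := Real.pi_lt_d2
    have h2 : 0 < 1 - Real.pi / 4 := by linarith
    have h3 : (Real.pi / 4 - (-1 : ℝ) ^ (m / 2) / (m : ℝ)) / (1 - Real.pi / 4) ≤ 6 := by
      rw [div_le_iff₀ h2]; linarith
    have h4 : 0 < (m : ℝ) - 1 := by linarith
    have h5 : (1 : ℝ) / (m : ℝ) ^ 3 ≤ 1 / (((m : ℝ) - 1) * m * (m + 1)) := by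
      apply one_div_le_one_div_of_le (by positivity)
      nlinarith
    calc (m : ℝ) * ((Real.pi / 4 - (-1) ^ (m / 2) / (m : ℝ)) / ((1 - Real.pi / 4) * (m : ℝ) ^ 4))
        = ((Real.pi / 4 - (-1) ^ (m / 2) / (m : ℝ)) / (1 - Real.pi / 4)) * (1 / (m : ℝ) ^ 3) := by
          field_simp
      _ ≤ 6 * (1 / (((m : ℝ) - 1) * m * (m + 1))) := by
          gcongr
      _ = _ := by ring

/-- The term m = 2 vanishes, so the telescoping starts at m = 3 with 3 · 1/6. What matters is that
the bound is smaller than 1. -/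
theorem sum_mul_krivineAlpha_le (N : ℕ) :
    ∑ m ∈ Finset.Icc 2 N, (m : ℝ) * krivineAlpha m ≤ 1 / 2 := by
  rcases Nat.lt_or_ge N 3 with h | h
  · calc ∑ m ∈ Finset.Icc 2 N, (m : ℝ) * krivineAlpha m = 0 := by
          refine Finset.sum_eq_zero fun m hm => ?_
          have : m = 2 := by rw [Finset.mem_Icc] at hm; omega
          rw [this, krivineAlpha_even even_two, mul_zero]
      _ ≤ 1 / 2 := by norm_num
  · have key : ∀ N : ℕ, 3 ≤ N → ∑ m ∈ Finset.Icc 2 N, (m : ℝ) * krivineAlpha m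
        ≤ 3 * (1 / 6 - 1 / ((N : ℝ) * (N + 1))) := by
      intro N hN
      induction N, hN using Nat.le_induction with
      | base =>
        have : Finset.Icc 2 3 = {2, 3} := by decide
        rw [this, Finset.sum_pair (by norm_num), krivineAlpha_even even_two]
        have := mul_krivineAlpha_le (m := 3) (by norm_num)
        norm_num at this ⊢
        linarith
      | succ N hN ih =>
        rw [Finset.sum_Icc_succ_top (by omega)]
        have := mul_krivineAlpha_le (m := N + 1) (by omega)
        push_cast at this ⊢
        have e : ((N : ℝ) + 1 - 1) = N := by ring
        rw [e] at this
        linarith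
    have := key N h
    have h2 : 0 ≤ 1 / ((N : ℝ) * (N + 1)) := by positivity
    linarith

theorem krivineB_one : krivineB 1 = √2 * (Real.pi / 4) ^ 3 / (3 * krivineA 1) := by
  rw [krivineB, if_pos rfl]

theorem krivineB_one_pos : 0 < krivineB 1 := by
  rw [krivineB_one]
  have := krivineA_one_pos
  have := Real.pi_pos
  positivity

theorem krivineB_of_ne {m : ℕ} (h : m ≠ 1) :
    krivineB m = - (1 / krivineA 1) *
      ∑ d ∈ m.divisors.erase 1, krivineA d * krivineB (m / d) := by
  rw [krivineB, if_neg h]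
  congr 1
  exact Finset.sum_attach (m.divisors.erase 1) (fun d => krivineA d * krivineB (m / d))

/-- Twisting with the multiplicative function `chi` gives a recursion with nonnegative coefficients.
-/
theorem chi_mul_krivineB_of_ne {m : ℕ} (h : m ≠ 1) :
    chi m * krivineB m =
      ∑ d ∈ m.divisors.erase 1, krivineAlpha d * (chi (m / d) * krivineB (m / d)) := by
  rw [krivineB_of_ne h, Finset.mul_sum, Finset.mul_sum]
  refine Finset.sum_congr rfl fun d hd => ?_
  have hdm : d * (m / d) = m := by
    rw [Finset.mem_erase, Nat.mem_divisors] at hd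
    exact Nat.mul_div_cancel' hd.2.1
  have : chi m = chi d * chi (m / d) := by rw [← chi_mul, hdm]
  rw [this, krivineAlpha]
  ring

theorem krivineB_even {m : ℕ} (h : Even m) : krivineB m = 0 := by
  induction m using Nat.strong_induction_on with
  | _ m ih =>
    have h1 : m ≠ 1 := by rintro rfl; exact absurd h (by decide)
    rw [krivineB_of_ne h1, Finset.sum_eq_zero, mul_zero]
    intro d hd
    rw [Finset.mem_erase, Nat.mem_divisors] at hd
    rcases Nat.even_or_odd d with hde | hdo
    · rw [krivineA_even hde, zero_mul]
    · have hdm : d * (m / d) = m := Nat.mul_div_cancel' hd.2.1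
      have hlt : m / d < m := by
        refine Nat.div_lt_self (Nat.pos_of_ne_zero hd.2.2) ?_
        have := hdo.pos
        have := hd.1
        omega
      rw [ih _ hlt ?_, mul_zero]
      rw [← hdm, Nat.even_mul] at h
      exact h.resolve_left (Nat.not_even_iff_odd.2 hdo)

/-- Induction along the twisted recursion, starting from b_1 > 0. It shows that |b_m| = χ(m) b_m. -/
theorem chi_mul_krivineB_nonneg (m : ℕ) : 0 ≤ chi m * krivineB m := by
  induction m using Nat.strong_induction_on with
  | _ m ih =>
    by_cases h1 : m = 1
    · rw [h1, chi_one, one_mul]; exact krivineB_one_pos.le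
    · rw [chi_mul_krivineB_of_ne h1]
      refine Finset.sum_nonneg fun d hd => ?_
      rw [Finset.mem_erase, Nat.mem_divisors] at hd
      refine mul_nonneg (krivineAlpha_nonneg hd.1) (ih _ ?_)
      refine Nat.div_lt_self (Nat.pos_of_ne_zero hd.2.2) ?_
      have := Nat.pos_of_dvd_of_pos hd.2.1 (Nat.pos_of_ne_zero hd.2.2)
      have := hd.1
      omega

theorem abs_krivineB (m : ℕ) : |krivineB m| = chi m * krivineB m := by
  rw [← abs_of_nonneg (chi_mul_krivineB_nonneg m), abs_mul]
  rcases Nat.even_or_odd m with h | h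
  · simp [krivineB_even h]
  · rcases chi_odd h with h | h <;> simp [h]

theorem abs_krivineB_of_ne {m : ℕ} (h : m ≠ 1) :
    |krivineB m| = ∑ p ∈ m.divisorsAntidiagonal with p.1 ≠ 1,
      krivineAlpha p.1 * |krivineB p.2| := by
  rw [abs_krivineB, chi_mul_krivineB_of_ne h]
  simp only [abs_krivineB]
  rw [Finset.sum_filter, Nat.sum_divisorsAntidiagonal
    (fun a b => if a ≠ 1 then krivineAlpha a * (chi b * krivineB b) else 0), ← Finset.sum_filter]
  refine Finset.sum_congr ?_ fun _ _ => rfl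
  ext d; simp [and_comm]

/-- The recursion is a Dirichlet convolution and the weight m is multiplicative. So the partial sum
S satisfies S ≤ |b_1| + (∑ m α_m) S ≤ |b_1| + S/2. The weight m is what yields a tail of order 1/L.
-/
theorem sum_mul_abs_krivineB_le (N : ℕ) :
    ∑ m ∈ Finset.Icc 1 N, (m : ℝ) * |krivineB m| ≤ 2 * |krivineB 1| := by
  rcases Nat.eq_zero_or_pos N with rfl | hN
  · simp
  set S := ∑ m ∈ Finset.Icc 1 N, (m : ℝ) * |krivineB m| with hS
  have hsplit : S = |krivineB 1| + ∑ m ∈ Finset.Icc 2 N, (m : ℝ) * |krivineB m| := by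
    rw [hS, ← Finset.insert_Icc_add_one_left_eq_Icc (show 1 ≤ N from hN), Finset.sum_insert
        (by simp)]
    simp
  have hS0 : 0 ≤ S := Finset.sum_nonneg fun _ _ => by positivity
  have h2 : ∑ m ∈ Finset.Icc 2 N, (m : ℝ) * |krivineB m| ≤ (1 / 2) * S := by
    calc ∑ m ∈ Finset.Icc 2 N, (m : ℝ) * |krivineB m|
        = ∑ m ∈ Finset.Icc 2 N, ∑ p ∈ (Finset.Icc 2 N ×ˢ Finset.Icc 1 N) with p.1 * p.2 = m,
            ((p.1 : ℝ) * krivineAlpha p.1) * ((p.2 : ℝ) * |krivineB p.2|) := by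
          refine Finset.sum_congr rfl fun m hm => ?_
          rw [Finset.mem_Icc] at hm
          rw [abs_krivineB_of_ne (by omega), Finset.mul_sum]
          have hset : (m.divisorsAntidiagonal.filter fun p => p.1 ≠ 1) =
              (Finset.Icc 2 N ×ˢ Finset.Icc 1 N).filter fun p => p.1 * p.2 = m := by
            ext ⟨d, e⟩
            simp only [Finset.mem_filter, Nat.mem_divisorsAntidiagonal, Finset.mem_product,
              Finset.mem_Icc]
            constructor
            · rintro ⟨⟨rfl, h0⟩, h1⟩
              have hd : 0 < d := Nat.pos_of_ne_zero (by rintro rfl; simp at h0)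
              have he : 0 < e := Nat.pos_of_ne_zero (by rintro rfl; simp at h0)
              refine ⟨⟨⟨by omega, ?_⟩, he, ?_⟩, rfl⟩
              · exact (Nat.le_mul_of_pos_right d he).trans hm.2
              · exact (Nat.le_mul_of_pos_left e hd).trans hm.2
            · rintro ⟨⟨⟨h1, -⟩, h2, -⟩, rfl⟩
              exact ⟨⟨rfl, by positivity⟩, by omega⟩
          rw [hset]
          refine Finset.sum_congr rfl fun p hp => ?_
          rw [Finset.mem_filter] at hp
          rw [← hp.2]; push_cast; ring
      _ = ∑ p ∈ (Finset.Icc 2 N ×ˢ Finset.Icc 1 N) with p.1 * p.2 ∈ Finset.Icc 2 N,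
            ((p.1 : ℝ) * krivineAlpha p.1) * ((p.2 : ℝ) * |krivineB p.2|) := by
          rw [← Finset.sum_fiberwise_of_maps_to
            (s := (Finset.Icc 2 N ×ˢ Finset.Icc 1 N).filter fun p => p.1 * p.2 ∈ Finset.Icc 2 N)
            (t := Finset.Icc 2 N) (g := fun p => p.1 * p.2)
            (fun p hp => (Finset.mem_filter.1 hp).2)]
          refine Finset.sum_congr rfl fun m hm => Finset.sum_congr ?_ fun _ _ => rfl
          ext p
          simp only [Finset.mem_filter]
          constructor
          · rintro ⟨h1, h2⟩; exact ⟨⟨h1, h2 ▸ hm⟩, h2⟩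
          · rintro ⟨⟨h1, -⟩, h2⟩; exact ⟨h1, h2⟩
      _ ≤ ∑ p ∈ Finset.Icc 2 N ×ˢ Finset.Icc 1 N,
            ((p.1 : ℝ) * krivineAlpha p.1) * ((p.2 : ℝ) * |krivineB p.2|) := by
          refine Finset.sum_le_sum_of_subset_of_nonneg (Finset.filter_subset _ _) fun p hp _ => ?_
          rw [Finset.mem_product, Finset.mem_Icc] at hp
          have := krivineAlpha_nonneg (m := p.1) (by omega)
          positivity
      _ = (∑ m ∈ Finset.Icc 2 N, (m : ℝ) * krivineAlpha m) * S := by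
          rw [hS, Finset.sum_mul_sum, Finset.sum_product]
      _ ≤ (1 / 2) * S := mul_le_mul_of_nonneg_right (sum_mul_krivineAlpha_le N) hS0
  linarith

theorem summable_mul_abs_krivineB : Summable fun m : ℕ => (m : ℝ) * |krivineB m| := by
  refine summable_of_sum_range_le (c := 2 * |krivineB 1|) (fun m => by positivity) fun N => ?_
  refine le_trans ?_ (sum_mul_abs_krivineB_le N)
  rcases Nat.eq_zero_or_pos N with rfl | hN
  · simp
  rw [Finset.range_eq_Ico, Finset.sum_eq_sum_Ico_succ_bot hN]
  simp only [Nat.cast_zero, zero_mul, zero_add]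
  refine Finset.sum_le_sum_of_subset_of_nonneg ?_ fun _ _ _ => by positivity
  intro m; simp only [Finset.mem_Ico, Finset.mem_Icc]; omega

theorem summable_abs_krivineB : Summable fun m : ℕ => |krivineB m| := by
  refine Summable.of_nonneg_of_le (fun m => abs_nonneg _) (fun m => ?_) summable_mul_abs_krivineB
  rcases Nat.eq_zero_or_pos m with rfl | hm
  · simp [krivineB_even]
  · have : (1 : ℝ) ≤ m := by exact_mod_cast hm
    nlinarith [abs_nonneg (krivineB m)]

theorem injective_two_mul_add_one (k : ℕ) : Function.Injective fun l : ℕ => 2 * (k + l) + 1 :=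
  fun a b h => by simpa using h

theorem summable_abs_krivineB_odd (k : ℕ) :
    Summable fun l : ℕ => |krivineB (2 * (k + l) + 1)| :=
  summable_abs_krivineB.comp_injective (injective_two_mul_add_one k)

/-- The tail of the series `∑ |b_m|` is of order `1 / L`. -/
theorem exists_isTailConst : ∃ C : ℕ, IsTailConst C := by
  set S := ∑' m : ℕ, (m : ℝ) * |krivineB m| with hS
  have hS0 : 0 ≤ S := tsum_nonneg fun m => by positivity
  refine ⟨⌈S⌉₊ + 1, Nat.succ_pos _, by simpa using summable_abs_krivineB_odd 0, fun L hL => ?_⟩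
  have hL' : (0 : ℝ) < L := by exact_mod_cast hL
  have hinj := injective_two_mul_add_one (L + 1)
  have hw := summable_mul_abs_krivineB.comp_injective hinj
  -- Every index in the tail exceeds L, so L times the tail is bounded by the weighted sum.
  have h1 : ∑' l : ℕ, (L : ℝ) * |krivineB (2 * (L + 1 + l) + 1)| ≤ S := by
    calc _ ≤ ∑' l : ℕ, ((2 * (L + 1 + l) + 1 : ℕ) : ℝ) * |krivineB (2 * (L + 1 + l) + 1)| := by
          refine Summable.tsum_le_tsum (fun l => ?_)
            ((summable_abs_krivineB_odd (L + 1)).mul_left _) hw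
          gcongr
          omega
      _ ≤ S := Summable.tsum_le_tsum_of_inj _ hinj (fun m _ => by positivity) (fun l => le_rfl) hw
          summable_mul_abs_krivineB
  rw [tsum_mul_left] at h1
  rw [le_div_iff₀ hL', mul_comm]
  push_cast
  linarith [Nat.le_ceil S]

end NCG

end

noncomputable section

namespace NCG

open MeasureTheory

/-! ### Krivine's functions and their Fourier series -/

theorem measurable_sign : Measurable Real.sign := by
  unfold Real.sign
  exact Measurable.ite measurableSet_Iio measurable_const
    (Measurable.ite measurableSet_Ioi measurable_const measurable_const)

theorem abs_sign_le (x : ℝ) : |Real.sign x| ≤ 1 := by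
  rcases Real.sign_apply_eq x with h | h | h <;> rw [h] <;> norm_num

/-- The cubic polynomial that defines `f` near `π / 2`. -/
def krivineCubic (s : ℝ) : ℝ := 6 / Real.pi * s - 1 / 2 * (4 / Real.pi) ^ 3 * s ^ 3

/-- The function with `f = krivinePhi ∘ cos`. -/
def krivinePhi (c : ℝ) : ℝ :=
  krivineCubic (max (-(Real.pi / 4)) (min (Real.arcsin c) (Real.pi / 4)))

theorem krivineCubic_neg (s : ℝ) : krivineCubic (-s) = -krivineCubic s := by
  simp only [krivineCubic]; ring

theorem krivineCubic_pi_div_four : krivineCubic (Real.pi / 4) = 1 := by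
  have := Real.pi_ne_zero
  simp only [krivineCubic]
  field_simp
  norm_num

theorem krivinePhi_of_le {c : ℝ} (h : Real.pi / 4 ≤ Real.arcsin c) : krivinePhi c = 1 := by
  have := Real.pi_pos
  rw [krivinePhi, min_eq_right h, max_eq_right (by linarith), krivineCubic_pi_div_four]

theorem krivinePhi_of_ge {c : ℝ} (h : Real.arcsin c ≤ -(Real.pi / 4)) : krivinePhi c = -1 := by
  have := Real.pi_pos
  rw [krivinePhi, min_eq_left (by linarith), max_eq_left (by linarith), krivineCubic_neg,
    krivineCubic_pi_div_four]

theorem krivinePhi_of_mem {c : ℝ} (h : -(Real.pi / 4) ≤ Real.arcsin c)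
    (h' : Real.arcsin c ≤ Real.pi / 4) : krivinePhi c = krivineCubic (Real.arcsin c) := by
  rw [krivinePhi, min_eq_left h', max_eq_right h]

theorem krivinePhi_neg (c : ℝ) : krivinePhi (-c) = -krivinePhi c := by
  rcases le_total (Real.pi / 4) (Real.arcsin c) with h | h
  · rw [krivinePhi_of_le h, krivinePhi_of_ge (by rw [Real.arcsin_neg]; linarith)]
  rcases le_total (-(Real.pi / 4)) (Real.arcsin c) with h' | h'
  · rw [krivinePhi_of_mem h' h, krivinePhi_of_mem (by rw [Real.arcsin_neg]; linarith)
      (by rw [Real.arcsin_neg]; linarith), Real.arcsin_neg, krivineCubic_neg]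
  · rw [krivinePhi_of_ge h', krivinePhi_of_le (by rw [Real.arcsin_neg]; linarith), neg_neg]

theorem continuous_krivinePhi : Continuous krivinePhi := by
  unfold krivinePhi krivineCubic
  have := Real.continuous_arcsin
  fun_prop

/-- With s = (π/4)v the cubic is (3v - v³)/2. One minus it is (v - 1)²(2 + v)/2 and one plus it is
(v + 1)²(2 - v)/2. -/
theorem abs_krivinePhi_le (c : ℝ) : |krivinePhi c| ≤ 1 := by
  unfold krivinePhi
  set s := max (-(Real.pi / 4)) (min (Real.arcsin c) (Real.pi / 4)) with hs
  have hp := Real.pi_pos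
  have h1 : -(Real.pi / 4) ≤ s := le_max_left _ _
  have h2 : s ≤ Real.pi / 4 := max_le (by linarith) (min_le_right _ _)
  obtain ⟨v, hv⟩ : ∃ v, s = Real.pi / 4 * v := ⟨s / (Real.pi / 4), by field_simp⟩
  have hv1 : -1 ≤ v := by rw [hv] at h1; nlinarith
  have hv2 : v ≤ 1 := by rw [hv] at h2; nlinarith
  have : krivineCubic s = 3 / 2 * v - 1 / 2 * v ^ 3 := by
    rw [krivineCubic, hv]; field_simp; ring
  rw [this, abs_le]
  constructor <;> nlinarith [mul_nonneg (sq_nonneg (v - 1)) (by linarith : 0 ≤ 2 + v),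
    mul_nonneg (sq_nonneg (v + 1)) (by linarith : 0 ≤ 2 - v)]

/-- Writing f through the cosine makes its continuity and symmetries immediate. It is also the
reason why the rounded matrices are functions of a Hermitian matrix. -/
theorem krivineF_eq (x : ℝ) : krivineF x = krivinePhi (Real.cos x) := by
  unfold krivineF krivineF₀
  have hs : Real.arccos (Real.cos x) = Real.pi / 2 - Real.arcsin (Real.cos x) := rfl
  rw [hs]
  set s := Real.arcsin (Real.cos x)
  have hp := Real.pi_pos
  split_ifs with h1 h2 h3
  · exact (krivinePhi_of_le (by linarith)).symm
  · rw [krivinePhi_of_mem (by linarith) (by linarith), krivineCubic]; ring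
  · exact (krivinePhi_of_ge (by linarith)).symm
  · rw [krivinePhi_of_mem (by linarith) (by linarith), krivineCubic]; ring

theorem krivineF_eq_of_mem {x : ℝ} (h0 : 0 ≤ x) (h1 : x ≤ Real.pi / 2) :
    krivineF x = krivineF₀ x := by
  unfold krivineF
  rw [Real.arccos_cos h0 (by linarith [Real.pi_pos]), if_pos h1]

theorem continuous_krivineF : Continuous krivineF := by
  rw [show krivineF = fun x => krivinePhi (Real.cos x) from funext krivineF_eq]
  exact continuous_krivinePhi.comp Real.continuous_cos

theorem abs_krivineF_le (x : ℝ) : |krivineF x| ≤ 1 := by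
  rw [krivineF_eq]; exact abs_krivinePhi_le _

theorem krivineF_pi_sub (x : ℝ) : krivineF (Real.pi - x) = -krivineF x := by
  rw [krivineF_eq, krivineF_eq, Real.cos_pi_sub, krivinePhi_neg]

theorem krivineF_neg (x : ℝ) : krivineF (-x) = krivineF x := by
  rw [krivineF_eq, krivineF_eq, Real.cos_neg]

-- The Fourier series of the Bernoulli polynomial of degree 4, rescaled to the period 2π.
open scoped Nat in
theorem hasSum_cos_pow_four {y : ℝ} (h0 : 0 ≤ y) (h1 : y ≤ 2 * Real.pi) :
    HasSum (fun n : ℕ => 1 / (n : ℝ) ^ 4 * Real.cos (n * y))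
      (-(Real.pi ^ 4 / 3) * ((y / (2 * Real.pi)) ^ 4 - 2 * (y / (2 * Real.pi)) ^ 3
        + (y / (2 * Real.pi)) ^ 2 - 1 / 30)) := by
  have hp := Real.pi_pos
  have h := hasSum_one_div_nat_pow_mul_cos (k := 2) (by norm_num) (x := y / (2 * Real.pi))
    ⟨by positivity, by rw [div_le_one (by positivity)]; exact h1⟩
  convert! h using 1
  · ext n
    congr 2
    field_simp
  · have hb : bernoulli 3 = 0 := bernoulli_eq_zero_of_odd (by decide) (by norm_num)
    have hb4 : bernoulli 4 = -1 / 30 := by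
      rw [bernoulli_eq_bernoulli'_of_ne_one (by norm_num), bernoulli'_four]
    simp [Polynomial.bernoulli_def, Finset.sum_range_succ, hb, hb4, Nat.choose,
      Nat.factorial, Polynomial.map_monomial]
    ring

open scoped Nat in
theorem hasSum_sin_pow_three {y : ℝ} (h0 : 0 ≤ y) (h1 : y ≤ 2 * Real.pi) :
    HasSum (fun n : ℕ => 1 / (n : ℝ) ^ 3 * Real.sin (n * y))
      (2 * Real.pi ^ 3 / 3 * ((y / (2 * Real.pi)) ^ 3 - 3 / 2 * (y / (2 * Real.pi)) ^ 2
        + 1 / 2 * (y / (2 * Real.pi)))) := by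
  have hp := Real.pi_pos
  have h := hasSum_one_div_nat_pow_mul_sin (k := 1) (by norm_num) (x := y / (2 * Real.pi))
    ⟨by positivity, by rw [div_le_one (by positivity)]; exact h1⟩
  convert! h using 1
  · ext n
    congr 2
    field_simp
  · have hb : bernoulli 3 = 0 := bernoulli_eq_zero_of_odd (by decide) (by norm_num)
    simp [Polynomial.bernoulli_def, Finset.sum_range_succ, hb, Nat.choose,
      Nat.factorial, Polynomial.map_monomial]
    ring

theorem cos_nat_mul_add_pi (n : ℕ) (y : ℝ) :
    Real.cos (n * (y + Real.pi)) = (-1) ^ n * Real.cos (n * y) := by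
  rw [mul_add, Real.cos_add_nat_mul_pi]

theorem sin_nat_mul_add_pi (n : ℕ) (y : ℝ) :
    Real.sin (n * (y + Real.pi)) = (-1) ^ n * Real.sin (n * y) := by
  rw [mul_add, Real.sin_add_nat_mul_pi]

/-- Half the difference of the series at |y| and at |y| + π keeps exactly the odd frequencies. -/
theorem hasSum_odd_cos {y : ℝ} (h : |y| ≤ Real.pi) :
    HasSum (fun n : ℕ => if Odd n then 1 / (n : ℝ) ^ 4 * Real.cos (n * y) else 0)
      (Real.pi ^ 4 / 96 - Real.pi / 8 * (Real.pi * y ^ 2 / 2 - |y| ^ 3 / 3)) := by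
  have hp := Real.pi_pos
  have e := ((hasSum_cos_pow_four (abs_nonneg y) (by linarith)).sub
    (hasSum_cos_pow_four (y := |y| + Real.pi) (by positivity) (by linarith))).mul_left (1 / 2)
  convert! e using 1
  · ext n
    rw [cos_nat_mul_add_pi]
    have : Real.cos (n * |y|) = Real.cos (n * y) := by
      rw [← Real.cos_abs (n * y), abs_mul, Nat.abs_cast]
    rw [this]
    split_ifs with hn
    · rw [hn.neg_one_pow]; ring
    · rw [(Nat.not_odd_iff_even.1 hn).neg_one_pow]; ring
  · rw [← sq_abs y]; field_simp; ring

theorem hasSum_odd_sin {y : ℝ} (h : |y| ≤ Real.pi) :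
    HasSum (fun n : ℕ => if Odd n then 1 / (n : ℝ) ^ 3 * Real.sin (n * y) else 0)
      (Real.pi / 8 * y * (Real.pi - |y|)) := by
  have hp := Real.pi_pos
  have key : ∀ y : ℝ, 0 ≤ y → y ≤ Real.pi →
      HasSum (fun n : ℕ => if Odd n then 1 / (n : ℝ) ^ 3 * Real.sin (n * y) else 0)
      (Real.pi / 8 * y * (Real.pi - y)) := by
    intro y h0 h1
    have e := ((hasSum_sin_pow_three h0 (by linarith)).sub
      (hasSum_sin_pow_three (y := y + Real.pi) (by positivity) (by linarith))).mul_left (1 / 2)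
    convert! e using 1
    · ext n
      rw [sin_nat_mul_add_pi]
      split_ifs with hn
      · rw [hn.neg_one_pow]; ring
      · rw [(Nat.not_odd_iff_even.1 hn).neg_one_pow]; ring
    · field_simp; ring
  rcases le_total 0 y with h0 | h0
  · rw [abs_of_nonneg h0] at h ⊢
    exact key y h0 h
  · rw [abs_of_nonpos h0] at h ⊢
    convert! (key (-y) (by linarith) h).neg using 1
    · ext n
      rw [mul_neg, Real.sin_neg]
      split_ifs <;> simp
    · ring

/-- Fourier coefficients of `f`. -/
def krivineFCoeff (m : ℕ) : ℝ :=
  48 / Real.pi ^ 2 * (m * (-1) ^ (m / 2) * krivineA m)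

theorem sin_mul_pi_div_two {m : ℕ} (h : Odd m) :
    Real.sin (m * (Real.pi / 2)) = (-1) ^ (m / 2) := by
  obtain ⟨l, rfl⟩ := h
  have : (2 * l + 1) / 2 = l := by omega
  rw [this]
  have h2 : ((2 * l + 1 : ℕ) : ℝ) * (Real.pi / 2) = Real.pi / 2 + l * Real.pi := by
    push_cast; ring
  rw [h2, Real.sin_add_nat_mul_pi, Real.sin_pi_div_two, mul_one]

theorem cos_mul_pi_div_two {m : ℕ} (h : Odd m) : Real.cos (m * (Real.pi / 2)) = 0 := by
  obtain ⟨l, rfl⟩ := h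
  have h2 : ((2 * l + 1 : ℕ) : ℝ) * (Real.pi / 2) = Real.pi / 2 + l * Real.pi := by
    push_cast; ring
  rw [h2, Real.cos_add_nat_mul_pi, Real.cos_pi_div_two, mul_zero]

/-- The factor cos(mπ/4) in a_m is absorbed by the addition theorems into shifts by ±π/4. The
Fourier series of f thereby becomes a combination of four series of known sum. -/
theorem krivineFCoeff_mul_cos {m : ℕ} (h : Odd m) (s : ℝ) :
    krivineFCoeff m * Real.cos (m * (Real.pi / 2 - s)) =
      768 / Real.pi ^ 4 *
        (1 / 2 * (1 / (m : ℝ) ^ 4 * Real.cos (m * (s - Real.pi / 4))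
          - 1 / (m : ℝ) ^ 4 * Real.cos (m * (s + Real.pi / 4)))
        - Real.pi / 8 * (1 / (m : ℝ) ^ 3 * Real.sin (m * (s + Real.pi / 4))
          + 1 / (m : ℝ) ^ 3 * Real.sin (m * (s - Real.pi / 4)))) := by
  have hm : (m : ℝ) ≠ 0 := by
    have := h.pos; positivity
  have hp := Real.pi_ne_zero
  obtain ⟨σ, hσ⟩ : ∃ σ : ℝ, σ = (-1) ^ (m / 2) := ⟨_, rfl⟩
  have h1 : Real.cos (m * (Real.pi / 2 - s)) = σ * Real.sin (m * s) := by
    rw [mul_sub, Real.cos_sub, sin_mul_pi_div_two h, cos_mul_pi_div_two h, hσ]; ring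
  obtain ⟨c, hc⟩ : ∃ c, c = Real.cos (m * (Real.pi / 4)) := ⟨_, rfl⟩
  -- For odd m, cos(mπ/2) = 0 means 2c² = 1, and sin(mπ/2) = σ means 2c sin(mπ/4) = σ.
  have h2 : Real.sin (m * (Real.pi / 4)) = σ * c := by
    have e1 := Real.sin_two_mul (m * (Real.pi / 4))
    have e2 := Real.cos_two_mul (m * (Real.pi / 4))
    have e3 : 2 * (m * (Real.pi / 4)) = m * (Real.pi / 2) := by ring
    rw [e3, sin_mul_pi_div_two h] at e1
    rw [e3, cos_mul_pi_div_two h] at e2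
    rw [← hc] at e1 e2
    rw [hσ, e1]
    linear_combination Real.sin (m * (Real.pi / 4)) * e2
  rw [h1, krivineFCoeff, krivineA, if_neg (Nat.not_even_iff_odd.2 h), ← hσ,
    show (m : ℝ) * Real.pi / 4 = m * (Real.pi / 4) by ring, ← hc]
  simp only [mul_sub, mul_add, Real.sin_add, Real.sin_sub, Real.cos_add, Real.cos_sub]
  rw [← hc, h2]
  have hσ1 : σ = 1 ∨ σ = -1 := hσ ▸ neg_one_pow_eq_or ℝ _
  rcases hσ1 with rfl | rfl
  · field_simp; ring
  · field_simp; ring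

theorem hasSum_krivineFCoeff_of_mem {x : ℝ} (h0 : 0 ≤ x) (h1 : x ≤ Real.pi / 2) :
    HasSum (fun m : ℕ => krivineFCoeff m * Real.cos (m * x)) (krivineF x) := by
  have hp := Real.pi_pos
  obtain ⟨s, rfl⟩ : ∃ s, x = Real.pi / 2 - s := ⟨Real.pi / 2 - x, by ring⟩
  have hu : |s - Real.pi / 4| ≤ Real.pi := by rw [abs_le]; constructor <;> linarith
  have hv : |s + Real.pi / 4| ≤ Real.pi := by rw [abs_le]; constructor <;> linarith
  have e := ((((hasSum_odd_cos hu).sub (hasSum_odd_cos hv)).mul_left (1 / 2)).sub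
    (((hasSum_odd_sin hv).add (hasSum_odd_sin hu)).mul_left (Real.pi / 8))).mul_left
      (768 / Real.pi ^ 4)
  convert! e using 1
  · ext m
    split_ifs with hm
    · exact krivineFCoeff_mul_cos hm s
    · simp [krivineFCoeff, krivineA_even (Nat.not_odd_iff_even.1 hm)]
  · rw [krivineF_eq_of_mem h0 h1, krivineF₀, abs_of_nonneg (show 0 ≤ s + Real.pi / 4 by linarith)]
    split_ifs with hs
    · rw [abs_of_nonneg (show 0 ≤ s - Real.pi / 4 by linarith)]
      field_simp; ring
    · rw [abs_of_nonpos (show s - Real.pi / 4 ≤ 0 by linarith)]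
      field_simp; ring

/-- Both sides are the value at cos x of the m-th Chebyshev polynomial. -/
theorem cos_nat_mul_arccos_cos (m : ℕ) (x : ℝ) :
    Real.cos (m * Real.arccos (Real.cos x)) = Real.cos (m * x) := by
  have h1 := Polynomial.Chebyshev.T_real_cos x m
  have h2 := Polynomial.Chebyshev.T_real_cos (Real.arccos (Real.cos x)) m
  rw [Real.cos_arccos (Real.neg_one_le_cos x) (Real.cos_le_one x)] at h2
  rw [h1] at h2
  push_cast at h2
  exact h2.symm

/-- The Fourier series of `f`. -/
theorem hasSum_krivineFCoeff (x : ℝ) :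
    HasSum (fun m : ℕ => krivineFCoeff m * Real.cos (m * x)) (krivineF x) := by
  have hy : krivineF x = krivineF (Real.arccos (Real.cos x)) := by
    rw [krivineF_eq, krivineF_eq, Real.cos_arccos (Real.neg_one_le_cos x) (Real.cos_le_one x)]
  simp_rw [← cos_nat_mul_arccos_cos _ x]
  rw [hy]
  set y := Real.arccos (Real.cos x)
  rcases le_total y (Real.pi / 2) with h | h
  · exact hasSum_krivineFCoeff_of_mem (Real.arccos_nonneg _) h
  · have h2 := hasSum_krivineFCoeff_of_mem (x := Real.pi - y)
      (by linarith [Real.arccos_le_pi (Real.cos x)]) (by linarith)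
    rw [krivineF_pi_sub] at h2
    convert! h2.neg using 1
    · ext m
      rcases Nat.even_or_odd m with hm | hm
      · simp [krivineFCoeff, krivineA_even hm]
      · have : Real.cos (m * (Real.pi - y)) = -Real.cos (m * y) := by
          rw [mul_sub, Real.cos_nat_mul_pi_sub, hm.neg_one_pow]; ring
        rw [this]; ring
    · ring

theorem abs_krivineA_le (m : ℕ) : |krivineA m| ≤ 32 * (1 / (m : ℝ) ^ 4) := by
  rcases Nat.even_or_odd m with h | h
  · rw [krivineA_even h, abs_zero]; positivity
  · have hm : (1 : ℝ) ≤ m := by exact_mod_cast h.pos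
    have hp := Real.pi_gt_three
    have hp4 := Real.pi_le_four
    have e1 : |(-1 : ℝ) ^ (m / 2)| = 1 := by simp
    rw [krivineA, if_neg (Nat.not_even_iff_odd.2 h), abs_mul, abs_mul, abs_mul, e1, one_mul]
    have e2 : |Real.cos (m * Real.pi / 4)| ≤ 1 := Real.abs_cos_le_one _
    have e3 : |16 / (Real.pi ^ 2 * (m : ℝ) ^ 4)| ≤ 16 * (1 / (m : ℝ) ^ 4) := by
      rw [abs_of_pos (by positivity), mul_one_div]
      gcongr
      exact le_mul_of_one_le_left (by positivity) (by nlinarith)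
    have e4 : |1 / (m : ℝ) - (-1) ^ (m / 2) * (Real.pi / 4)| ≤ 2 := by
      refine (abs_sub _ _).trans ?_
      rw [abs_mul, e1, one_mul, abs_of_pos (by positivity), abs_of_pos (by positivity)]
      have : 1 / (m : ℝ) ≤ 1 := by rw [div_le_one (by linarith)]; exact hm
      linarith
    calc _ ≤ 1 * (16 * (1 / (m : ℝ) ^ 4)) * 2 := by gcongr
      _ = _ := by ring

theorem summable_abs_krivineA : Summable fun m : ℕ => |krivineA m| :=
  Summable.of_nonneg_of_le (fun _ => abs_nonneg _) abs_krivineA_le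
    ((Real.summable_one_div_nat_pow.2 (by norm_num)).mul_left _)

theorem summable_abs_krivineFCoeff : Summable fun m : ℕ => |krivineFCoeff m| := by
  refine Summable.of_nonneg_of_le (fun _ => abs_nonneg _) (fun m => ?_)
    ((Real.summable_one_div_nat_pow.2 (by norm_num : 1 < 3)).mul_left (48 / Real.pi ^ 2 * 32))
  rcases Nat.eq_zero_or_pos m with rfl | hm
  · simp [krivineFCoeff]
  have hm' : (0 : ℝ) < m := by exact_mod_cast hm
  have e1 : |(-1 : ℝ) ^ (m / 2)| = 1 := by simp
  rw [krivineFCoeff, abs_mul, abs_mul, abs_mul, e1, abs_of_pos hm', mul_one,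
    abs_of_pos (by have := Real.pi_pos; positivity), mul_assoc]
  have := abs_krivineA_le m
  calc 48 / Real.pi ^ 2 * (m * |krivineA m|) ≤ 48 / Real.pi ^ 2 * (m * (32 * (1 /
      (m : ℝ) ^ 4))) := by
        gcongr
    _ = _ := by field_simp

/-! ### The convolution of f and g, and Dirichlet inversion of its coefficients -/

/-- The convolution of `f` and `g`, normalised by `1 / (2π)`. -/
def krivineK (δ : ℝ) : ℝ :=
  (1 / Real.pi) * ∫ u in (-(Real.pi / 2))..(Real.pi / 2), krivineF (δ - u)

/-- Termwise integration of the Fourier series of f over a half period multiplies the m-th term by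
2(-1)^{(m-1)/2}/m. This cancels the factor m(-1)^{(m-1)/2} in `krivineFCoeff` and leaves a_m. -/
theorem hasSum_krivineK (δ : ℝ) :
    HasSum (fun m : ℕ => 96 / Real.pi ^ 3 * krivineA m * Real.cos (m * δ)) (krivineK δ) := by
  have hp := Real.pi_ne_zero
  have h := intervalIntegral.hasSum_intervalIntegral_of_summable_norm
    (a := -(Real.pi / 2)) (b := Real.pi / 2)
    (f := fun m : ℕ => (⟨fun u => krivineFCoeff m * Real.cos (m * (δ - u)), by fun_prop⟩ : C(ℝ, ℝ)))
    (by
      refine Summable.of_nonneg_of_le (fun _ => norm_nonneg _) (fun m => ?_)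
        summable_abs_krivineFCoeff
      rw [ContinuousMap.norm_le _ (abs_nonneg _)]
      rintro ⟨u, hu⟩
      simp only [ContinuousMap.restrict_apply, ContinuousMap.coe_mk, norm_mul, Real.norm_eq_abs]
      exact mul_le_of_le_one_right (abs_nonneg _) (Real.abs_cos_le_one _))
  simp only [ContinuousMap.coe_mk] at h
  simp_rw [(hasSum_krivineFCoeff _).tsum_eq] at h
  have h2 := h.mul_left (1 / Real.pi)
  convert! h2 using 1
  ext m
  rcases Nat.even_or_odd m with hm | hm
  · simp [krivineFCoeff, krivineA_even hm]
  have hm0 : (m : ℝ) ≠ 0 := by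
    have := hm.pos; positivity
  rw [intervalIntegral.integral_const_mul]
  have hint : ∫ u in (-(Real.pi / 2))..(Real.pi / 2), Real.cos (m * (δ - u))
      = 2 * (-1) ^ (m / 2) * Real.cos (m * δ) / m := by
    have hd : ∀ u ∈ Set.uIcc (-(Real.pi / 2)) (Real.pi / 2),
        HasDerivAt (fun u => -(Real.sin (m * (δ - u)) / m)) (Real.cos (m * (δ - u))) u := by
      intro u _
      have h1 : HasDerivAt (fun u : ℝ => (m : ℝ) * (δ - u)) (-(m : ℝ)) u := by
        simpa using ((hasDerivAt_id u).const_sub δ).const_mul (m : ℝ)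
      have h2 := (h1.sin.div_const (m : ℝ)).neg
      have e : -(Real.cos (m * (δ - u)) * -(m : ℝ) / m) = Real.cos (m * (δ - u)) := by
        field_simp
      rw [e] at h2
      exact h2
    rw [intervalIntegral.integral_eq_sub_of_hasDerivAt hd
      (Continuous.intervalIntegrable (by fun_prop) _ _)]
    have e1 : (m : ℝ) * (δ - Real.pi / 2) = m * δ - m * (Real.pi / 2) := by ring
    have e2 : (m : ℝ) * (δ - -(Real.pi / 2)) = m * δ + m * (Real.pi / 2) := by ring
    rw [e1, e2, Real.sin_sub, Real.sin_add, sin_mul_pi_div_two hm, cos_mul_pi_div_two hm]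
    ring
  rw [hint, krivineFCoeff]
  have hσ : ((-1 : ℝ) ^ (m / 2)) * (-1) ^ (m / 2) = 1 := by rw [← mul_pow]; norm_num
  field_simp
  linear_combination (-96 * krivineA m * Real.cos (m * δ)) * hσ

/-- The window is [-π/4, 3π/4]: f is 1 on the first half of it, and on the second half it is odd
about π/2 and integrates to 0. -/
theorem krivineK_pi_div_four : krivineK (Real.pi / 4) = 1 / 2 := by
  have hp := Real.pi_pos
  have hi : ∀ a b, IntervalIntegrable krivineF volume a b := fun a b =>
    continuous_krivineF.intervalIntegrable a b
  rw [krivineK, intervalIntegral.integral_comp_sub_left krivineF]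
  have e1 : Real.pi / 4 - Real.pi / 2 = -(Real.pi / 4) := by ring
  have e2 : Real.pi / 4 - -(Real.pi / 2) = 3 * Real.pi / 4 := by ring
  rw [e1, e2, ← intervalIntegral.integral_add_adjacent_intervals (hi _ (Real.pi / 4)) (hi _ _)]
  have h1 : ∫ x in (-(Real.pi / 4))..(Real.pi / 4), krivineF x = Real.pi / 2 := by
    have : ∫ x in (-(Real.pi / 4))..(Real.pi / 4), krivineF x
        = ∫ x in (-(Real.pi / 4))..(Real.pi / 4), (1 : ℝ) := by
      refine intervalIntegral.integral_congr fun x hx => ?_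
      rw [Set.uIcc_of_le (by linarith)] at hx
      have hx' : |x| ≤ Real.pi / 4 := abs_le.2 hx
      have : krivineF x = krivineF |x| := by
        rcases abs_choice x with h | h <;> rw [h]
        rw [krivineF_neg]
      rw [this, krivineF_eq_of_mem (abs_nonneg _) (by linarith), krivineF₀, if_pos hx']
    rw [this]; simp; ring
  have h2 : ∫ x in (Real.pi / 4)..(3 * Real.pi / 4), krivineF x = 0 := by
    have h := intervalIntegral.integral_comp_sub_left (a := Real.pi / 4) (b := 3 * Real.pi / 4)
      krivineF Real.pi
    simp_rw [krivineF_pi_sub] at h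
    rw [intervalIntegral.integral_neg] at h
    have e3 : Real.pi - 3 * Real.pi / 4 = Real.pi / 4 := by ring
    have e4 : Real.pi - Real.pi / 4 = 3 * Real.pi / 4 := by ring
    rw [e3, e4] at h
    linarith
  rw [h1, h2]
  field_simp
  ring

/-- Rounding one pair of angles with a common uniform shift. -/
theorem integral_krivineF_mul_krivineG (α β : ℝ) :
    ∫ t in (-Real.pi)..Real.pi, krivineF (α - t) * krivineG (t - β)
      = 2 * Real.pi * krivineK (α - β) := by
  have hp := Real.pi_pos
  have hmF : Continuous fun t => krivineF (α - t) := continuous_krivineF.comp (by fun_prop)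
  have hgm : Measurable krivineG := by
    unfold krivineG
    exact measurable_sign.comp Real.measurable_cos
  have hi : ∀ a b, IntervalIntegrable (fun t => krivineF (α - t) * krivineG
      (t - β)) volume a b := by
    intro a b
    refine (intervalIntegrable_const (c := (1 : ℝ))).mono_fun
      (hmF.measurable.mul (hgm.comp (by fun_prop))).aestronglyMeasurable
      (Filter.Eventually.of_forall fun t => ?_)
    dsimp only
    rw [norm_mul, norm_one]
    have h1 : ‖krivineF (α - t)‖ ≤ 1 := abs_krivineF_le _
    have h2 : ‖krivineG (t - β)‖ ≤ 1 := abs_sign_le _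
    nlinarith [norm_nonneg (krivineF (α - t)), norm_nonneg (krivineG (t - β))]
  have hper : Function.Periodic (fun t => krivineF (α - t) * krivineG (t - β)) (2 * Real.pi) := by
    intro t
    simp only [krivineF_eq, krivineG]
    rw [show α - (t + 2 * Real.pi) = α - t - 2 * Real.pi by ring, Real.cos_sub_two_pi,
      show t + 2 * Real.pi - β = t - β + 2 * Real.pi by ring, Real.cos_add_two_pi]
  -- By periodicity the window may start at β - π/2. On its first half g(t - β) = 1, and passing to
  -- the second half changes the signs of both f and g, so the two halves agree.
  have h := hper.intervalIntegral_add_eq (-Real.pi) (β - Real.pi / 2)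
  rw [show -Real.pi + 2 * Real.pi = Real.pi by ring] at h
  rw [h, ← intervalIntegral.integral_add_adjacent_intervals (hi _ (β + Real.pi / 2)) (hi _ _)]
  have h1 : ∫ t in (β - Real.pi / 2)..(β + Real.pi / 2), krivineF (α - t) * krivineG (t - β)
      = ∫ t in (β - Real.pi / 2)..(β + Real.pi / 2), krivineF (α - t) := by
    refine intervalIntegral.integral_congr_Ioo_of_le (by linarith) fun t ht => ?_
    have : 0 < Real.cos (t - β) :=
      Real.cos_pos_of_mem_Ioo ⟨by linarith [ht.1], by linarith [ht.2]⟩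
    rw [krivineG, Real.sign_of_pos this, mul_one]
  have h2 : ∫ t in (β + Real.pi / 2)..(β - Real.pi / 2 + 2 * Real.pi),
      krivineF (α - t) * krivineG (t - β)
      = ∫ t in (β - Real.pi / 2)..(β + Real.pi / 2), krivineF (α - t) := by
    have e := intervalIntegral.integral_comp_add_right (a := β - Real.pi / 2)
      (b := β + Real.pi / 2) (fun t => krivineF (α - t) * krivineG (t - β)) Real.pi
    rw [show β - Real.pi / 2 + Real.pi = β + Real.pi / 2 by ring,
      show β + Real.pi / 2 + Real.pi = β - Real.pi / 2 + 2 * Real.pi by ring] at e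
    rw [← e, ← h1]
    refine intervalIntegral.integral_congr fun t _ => ?_
    simp only [krivineF_eq, krivineG]
    rw [show α - (t + Real.pi) = α - t - Real.pi by ring, Real.cos_sub_pi,
      show t + Real.pi - β = t - β + Real.pi by ring, Real.cos_add_pi, krivinePhi_neg,
      Real.sign_neg, neg_mul_neg]
  have h3 : ∫ t in (β - Real.pi / 2)..(β + Real.pi / 2), krivineF (α - t)
      = ∫ u in (-(Real.pi / 2))..(Real.pi / 2), krivineF (α - β - u) := by
    have e := intervalIntegral.integral_comp_add_right (a := -(Real.pi / 2))
      (b := Real.pi / 2) (fun t => krivineF (α - t)) β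
    rw [show -(Real.pi / 2) + β = β - Real.pi / 2 by ring, add_comm (Real.pi / 2) β] at e
    rw [← e]
    congr 1; ext u; congr 1; ring
  rw [h1, h2, h3, krivineK]
  field_simp
  ring

/-- The sequence b is a multiple of the Dirichlet inverse of a. The constant is chosen so that its
product with 96/π³, the factor in `hasSum_krivineK`, is √2/2. -/
theorem sum_krivineB_mul_krivineA {m : ℕ} (hm : m ≠ 0) :
    ∑ p ∈ m.divisorsAntidiagonal, krivineB p.1 * krivineA p.2 =
      if m = 1 then √2 * (Real.pi / 4) ^ 3 / 3 else 0 := by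
  have ha := krivineA_one_pos.ne'
  split_ifs with h
  · subst h
    rw [Nat.divisorsAntidiagonal_one, Finset.sum_singleton, krivineB_one]
    field_simp
  · have h1 : 1 ∈ m.divisors := Nat.one_mem_divisors.2 hm
    have hb := krivineB_of_ne h
    rw [← Nat.map_swap_divisorsAntidiagonal, Finset.sum_map]
    change ∑ p ∈ m.divisorsAntidiagonal, krivineB p.2 * krivineA p.1 = 0
    rw [Nat.sum_divisorsAntidiagonal (fun x y => krivineB y * krivineA x),
      ← Finset.add_sum_erase _ _ h1, Nat.div_one, hb]
    simp_rw [mul_comm (krivineB _)]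
    field_simp
    ring

/-- The defining property of the numbers `b_m`. -/
theorem hasSum_krivineB_mul_krivineK (δ : ℝ) :
    HasSum (fun m : ℕ => krivineB m * krivineK (m * δ)) (√2 / 2 * Real.cos δ) := by
  set c : ℝ := 96 / Real.pi ^ 3 with hc
  set T : ℕ × ℕ → ℝ := fun p => krivineB p.1 * (c * krivineA p.2 * Real.cos (p.2 * (p.1 * δ)))
    with hT
  have hsum : Summable T := by
    refine Summable.of_norm_bounded
      ((summable_abs_krivineB.mul_of_nonneg (summable_abs_krivineA.mul_left |c|)
        (fun _ => abs_nonneg _) fun _ => by positivity)) fun p => ?_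
    rw [hT, Real.norm_eq_abs, abs_mul, abs_mul, abs_mul]
    refine mul_le_mul_of_nonneg_left ?_ (abs_nonneg _)
    exact mul_le_of_le_one_right (by positivity) (Real.abs_cos_le_one _)
  have h1 : HasSum (fun m : ℕ => krivineB m * krivineK (m * δ)) (∑' p, T p) :=
    hsum.hasSum.prod_fiberwise fun m => (hasSum_krivineK (m * δ)).mul_left (krivineB m)
  have h2 : HasSum (fun m : ℕ => if m = 1 then √2 / 2 * Real.cos δ else 0) (∑' p, T p) := by
    have e := (Equiv.sigmaFiberEquiv fun p : ℕ × ℕ => p.1 * p.2).hasSum_iff.2 hsum.hasSum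
    refine e.sigma fun m => ?_
    -- For `m = 0` the divisor pairs form the empty set while the fibre is infinite; its terms
    -- vanish because `krivineA` and `krivineB` are zero at 0.
    have hset : ∀ p ∉ m.divisorsAntidiagonal,
        Set.indicator {p : ℕ × ℕ | p.1 * p.2 = m} T p = 0 := by
      intro p hp
      by_cases hpm : p.1 * p.2 = m
      · rw [Set.indicator_of_mem (by exact hpm)]
        rw [Nat.mem_divisorsAntidiagonal] at hp
        have : p.1 * p.2 = 0 := by
          by_contra h0
          exact hp ⟨hpm, hpm ▸ h0⟩
        rcases Nat.mul_eq_zero.1 this with h | h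
        · simp [hT, h, krivineB_even]
        · simp [hT, h, krivineA_even]
      · exact Set.indicator_of_notMem (by exact hpm) _
    have e2 := hasSum_sum_of_ne_finset_zero (L := SummationFilter.unconditional _) hset
    have e3 := (hasSum_subtype_iff_indicator (f := T)
      (s := {p : ℕ × ℕ | p.1 * p.2 = m})).2 e2
    have hval : ∑ p ∈ m.divisorsAntidiagonal, Set.indicator {p : ℕ × ℕ | p.1 * p.2 = m} T p
        = if m = 1 then √2 / 2 * Real.cos δ else 0 := by
      rcases Nat.eq_zero_or_pos m with rfl | hm
      · simp
      have : ∑ p ∈ m.divisorsAntidiagonal, Set.indicator {p : ℕ × ℕ | p.1 * p.2 = m} T p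
          = (c * Real.cos (m * δ)) *
            ∑ p ∈ m.divisorsAntidiagonal, krivineB p.1 * krivineA p.2 := by
        rw [Finset.mul_sum]
        refine Finset.sum_congr rfl fun p hp => ?_
        have hpm := (Nat.mem_divisorsAntidiagonal.1 hp).1
        rw [Set.indicator_of_mem (by exact hpm), hT]
        dsimp only
        rw [← hpm]; push_cast
        rw [show (p.2 : ℝ) * (p.1 * δ) = p.1 * p.2 * δ by ring]
        ring
      rw [this, sum_krivineB_mul_krivineA hm.ne']
      split_ifs with h
      · subst h
        have := Real.pi_ne_zero
        rw [hc, Nat.cast_one, one_mul]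
        field_simp
        ring
      · ring
    rw [hval] at e3
    exact e3
  have h3 := hasSum_ite_eq 1 (√2 / 2 * Real.cos δ)
  rwa [h2.unique h3] at h1

/-- Termwise cos(qmπ/4) = χ(m) cos(qπ/4) for odd q, so multiplying the angle by m multiplies the
whole series by χ(m). -/
theorem krivineK_mul_pi_div_four {m : ℕ} (h : Odd m) :
    krivineK (m * (Real.pi / 4)) = chi m / 2 := by
  have h1 := hasSum_krivineK (m * (Real.pi / 4))
  have h2 := (hasSum_krivineK (Real.pi / 4)).mul_left (chi m)
  rw [krivineK_pi_div_four, mul_one_div] at h2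
  refine h1.unique ?_
  convert! h2 using 1
  ext q
  rcases Nat.even_or_odd q with hq | hq
  · simp [krivineA_even hq]
  · have e1 := cos_mul_pi_div_four (hq.mul h)
    have e2 := cos_mul_pi_div_four hq
    rw [show (q : ℝ) * (m * (Real.pi / 4)) = (q * m : ℕ) * Real.pi / 4 by push_cast; ring,
      show (q : ℝ) * (Real.pi / 4) = q * Real.pi / 4 by ring, e1, e2, chi_mul]
    ring

/-- The probabilities `|b_m|` add up to one. -/
theorem hasSum_abs_krivineB : HasSum (fun m : ℕ => |krivineB m|) 1 := by
  -- At δ = π/4 the values K(mδ) = χ(m)/2 have exactly the signs of the b_m.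
  have h := (hasSum_krivineB_mul_krivineK (Real.pi / 4)).mul_left 2
  have e : (2 : ℝ) * (√2 / 2 * Real.cos (Real.pi / 4)) = 1 := by
    rw [Real.cos_pi_div_four]
    have := Real.mul_self_sqrt (show (0 : ℝ) ≤ 2 by norm_num)
    linear_combination this / 2
  rw [e] at h
  convert! h using 1
  ext m
  rcases Nat.even_or_odd m with hm | hm
  · simp [krivineB_even hm]
  · rw [krivineK_mul_pi_div_four hm, abs_krivineB]; ring

end NCG

end

noncomputable section

namespace NCG

open MeasureTheory

/-! ### The hyperbolic secant distribution -/

/-- Density of the hyperbolic secant distribution. -/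
def sechDens (t : ℝ) : ℝ :=
  1 / (Real.exp (Real.pi * t / 2) + Real.exp (-(Real.pi * t / 2)))

theorem sechDens_pos (t : ℝ) : 0 < sechDens t := by
  unfold sechDens; positivity

theorem measurable_sechDens : Measurable sechDens := by
  unfold sechDens; fun_prop

/-- The distribution function of the hyperbolic secant distribution. -/
def sechCdf (t : ℝ) : ℝ := 2 / Real.pi * Real.arctan (Real.exp (Real.pi * t / 2))

/-- The quantile function of the hyperbolic secant distribution. -/
def sechQuantile (u : ℝ) : ℝ := 2 / Real.pi * Real.log (Real.tan (Real.pi * u / 2))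

theorem hasDerivAt_sechCdf (t : ℝ) : HasDerivAt sechCdf (sechDens t) t := by
  have hp := Real.pi_ne_zero
  have h1 : HasDerivAt (fun t : ℝ => Real.pi * t / 2) (Real.pi / 2) t := by
    simpa using ((hasDerivAt_id t).const_mul Real.pi).div_const 2
  have h2 := (h1.exp.arctan).const_mul (2 / Real.pi)
  refine h2.congr_deriv ?_
  rw [sechDens, Real.exp_neg]
  have he : Real.exp (Real.pi * t / 2) ≠ 0 := (Real.exp_pos _).ne'
  field_simp
  ring

theorem sechQuantile_sechCdf (t : ℝ) : sechQuantile (sechCdf t) = t := by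
  have hp := Real.pi_ne_zero
  rw [sechQuantile, sechCdf]
  rw [show Real.pi * (2 / Real.pi * Real.arctan (Real.exp (Real.pi * t / 2))) / 2
    = Real.arctan (Real.exp (Real.pi * t / 2)) by field_simp, Real.tan_arctan, Real.log_exp]
  field_simp

theorem range_sechCdf : Set.range sechCdf = Set.Ioo 0 1 := by
  have hp := Real.pi_pos
  ext x
  constructor
  · rintro ⟨t, rfl⟩
    have h1 := Real.arctan_lt_pi_div_two (Real.exp (Real.pi * t / 2))
    have h2 : 0 < Real.arctan (Real.exp (Real.pi * t / 2)) := by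
      rw [← Real.arctan_zero]; exact Real.arctan_strictMono (Real.exp_pos _)
    refine ⟨by unfold sechCdf; positivity, ?_⟩
    calc sechCdf t < 2 / Real.pi * (Real.pi / 2) := by unfold sechCdf; gcongr
      _ = 1 := by field_simp
  · rintro ⟨h0, h1⟩
    refine ⟨sechQuantile x, ?_⟩
    have ht : 0 < Real.tan (Real.pi * x / 2) :=
      Real.tan_pos_of_pos_of_lt_pi_div_two (by positivity) (by nlinarith)
    rw [sechCdf, sechQuantile,
      show Real.pi * (2 / Real.pi * Real.log (Real.tan (Real.pi * x / 2))) / 2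
        = Real.log (Real.tan (Real.pi * x / 2)) by field_simp, Real.exp_log ht,
      Real.arctan_tan (by nlinarith) (by nlinarith)]
    field_simp

theorem sechLaw_eq : sechLaw = volume.withDensity fun t => ENNReal.ofReal (sechDens t) := rfl

theorem measurable_sechCdf : Measurable sechCdf :=
  (continuous_iff_continuousAt.2 fun t => (hasDerivAt_sechCdf t).continuousAt).measurable

theorem measurable_tan : Measurable Real.tan := by
  rw [show Real.tan = fun x => Real.sin x / Real.cos x from funext Real.tan_eq_sin_div_cos]
  fun_prop

theorem measurable_sechQuantile : Measurable sechQuantile := by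
  unfold sechQuantile
  exact (Real.measurable_log.comp (measurable_tan.comp (by fun_prop))).const_mul _

/-- Change of variables: the derivative of `sechCdf` is the density. -/
theorem measurePreserving_sechCdf :
    MeasurePreserving sechCdf sechLaw (volume.restrict (Set.Ioo 0 1)) := by
  refine ⟨measurable_sechCdf, ?_⟩
  ext E hE
  have hinj : Set.InjOn sechCdf Set.univ :=
    (Function.LeftInverse.injective sechQuantile_sechCdf).injOn
  have h := lintegral_image_eq_lintegral_abs_deriv_mul MeasurableSet.univ
    (fun t _ => (hasDerivAt_sechCdf t).hasDerivWithinAt) hinj (E.indicator 1)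
  rw [Set.image_univ, range_sechCdf, lintegral_indicator_one hE, setLIntegral_univ] at h
  rw [h, Measure.map_apply measurable_sechCdf hE, sechLaw_eq,
    withDensity_apply _ (measurable_sechCdf hE),
    ← lintegral_indicator (measurable_sechCdf hE)]
  refine lintegral_congr fun t => ?_
  rw [abs_of_pos (sechDens_pos t)]
  by_cases ht : sechCdf t ∈ E
  · rw [Set.indicator_of_mem ht, Set.indicator_of_mem (by exact ht)]; simp
  · rw [Set.indicator_of_notMem ht, Set.indicator_of_notMem (by exact ht)]; simp

/-- Inverse transform sampling: the number t is obtained in this way from a uniform number. The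
total mass of `sechLaw` also follows from it. -/
theorem measurePreserving_sechQuantile :
    MeasurePreserving sechQuantile (volume.restrict (Set.Ioo 0 1)) sechLaw := by
  refine ⟨measurable_sechQuantile, ?_⟩
  rw [← measurePreserving_sechCdf.map_eq,
    Measure.map_map measurable_sechQuantile measurable_sechCdf]
  have : sechQuantile ∘ sechCdf = id := funext sechQuantile_sechCdf
  rw [this, Measure.map_id]

instance : IsProbabilityMeasure sechLaw := by
  have : IsProbabilityMeasure (volume.restrict (Set.Ioo (0 : ℝ) 1)) := ⟨by simp⟩
  rw [← measurePreserving_sechQuantile.map_eq]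
  exact Measure.isProbabilityMeasure_map measurable_sechQuantile.aemeasurable

/-! ### The characteristic function as a Beta integral -/

/-- The logistic function, which transforms the integral into a Beta integral. -/
def logistic (t : ℝ) : ℝ := 1 / (1 + Real.exp (-(Real.pi * t)))

theorem hasDerivAt_logistic (t : ℝ) : HasDerivAt logistic
    (Real.pi * Real.exp (-(Real.pi * t)) / (1 + Real.exp (-(Real.pi * t))) ^ 2) t := by
  have h1 : HasDerivAt (fun t : ℝ => -(Real.pi * t)) (-Real.pi) t := by
    exact (((hasDerivAt_id t).const_mul Real.pi).neg).congr_deriv (by simp)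
  have hne : 1 + Real.exp (-(Real.pi * t)) ≠ 0 := by positivity
  have h2 := (h1.exp.const_add 1).inv hne
  have h3 : logistic = (fun t => 1 + Real.exp (-(Real.pi * t)))⁻¹ := by
    ext x; simp [logistic]
  rw [h3]
  refine h2.congr_deriv ?_
  ring

theorem injective_logistic : Function.Injective logistic := by
  intro a b h
  have hp := Real.pi_ne_zero
  simp only [logistic, one_div, inv_inj, add_right_inj, Real.exp_eq_exp, neg_inj] at h
  exact mul_left_cancel₀ hp h

theorem range_logistic : Set.range logistic = Set.Ioo 0 1 := by
  ext x
  constructor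
  · rintro ⟨t, rfl⟩
    have := Real.exp_pos (-(Real.pi * t))
    refine ⟨by unfold logistic; positivity, ?_⟩
    rw [logistic, div_lt_one (by positivity)]
    linarith
  · rintro ⟨h0, h1⟩
    have hp := Real.pi_ne_zero
    refine ⟨-(Real.log (1 / x - 1) / Real.pi), ?_⟩
    have : 0 < 1 / x - 1 := by
      rw [sub_pos, lt_div_iff₀ h0]; linarith
    rw [logistic, show -(Real.pi * -(Real.log (1 / x - 1) / Real.pi)) = Real.log (1 / x - 1) by
      field_simp, Real.exp_log this]
    field_simp
    ring

/-- The characteristic function of the hyperbolic secant distribution. -/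
theorem integral_exp_sechLaw (x : ℝ) :
    ∫ t, Complex.exp (Complex.I * (t * x)) ∂sechLaw = 1 / Complex.cosh x := by
  have hp : (Real.pi : ℂ) ≠ 0 := by exact_mod_cast Real.pi_ne_zero
  -- With u = 1/2 + ix/π and v = 1 - u the logistic substitution turns the integral into B(u, v)/π.
  -- By the reflection formula B(u, v) = Γ(u)Γ(1 - u) = π/sin(πu) = π/cosh x.
  set u : ℂ := 1 / 2 + Complex.I * x / Real.pi with hu
  set v : ℂ := 1 / 2 - Complex.I * x / Real.pi with hv
  have huv : u + v = 1 := by rw [hu, hv]; ring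
  have hre : u.re = 1 / 2 ∧ v.re = 1 / 2 := by
    have : (Complex.I * x / Real.pi).re = 0 := by
      rw [mul_div_assoc, ← Complex.ofReal_div, Complex.I_mul_re, Complex.ofReal_im, neg_zero]
    rw [hu, hv, Complex.add_re, Complex.sub_re, this]
    norm_num
  have hbeta : Complex.betaIntegral u v = Real.pi / Complex.cosh x := by
    have h := Complex.Gamma_mul_Gamma_eq_betaIntegral (s := u) (t := v)
      (by rw [hre.1]; norm_num) (by rw [hre.2]; norm_num)
    rw [huv, Complex.Gamma_one, one_mul] at h
    rw [← h, show v = 1 - u by rw [← huv]; ring, Complex.Gamma_mul_Gamma_one_sub]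
    congr 1
    rw [hu, show (Real.pi : ℂ) * (1 / 2 + Complex.I * x / Real.pi)
      = x * Complex.I + Real.pi / 2 by field_simp; ring, Complex.sin_add_pi_div_two,
      Complex.cos_mul_I]
  have hint : Complex.betaIntegral u v
      = ∫ t : ℝ, (Real.pi : ℂ) * (Complex.exp (Complex.I * (t * x)) * (sechDens t : ℂ)) := by
    rw [Complex.betaIntegral, intervalIntegral.integral_of_le zero_le_one,
      integral_Ioc_eq_integral_Ioo, ← range_logistic, ← Set.image_univ,
      integral_image_eq_integral_abs_deriv_smul MeasurableSet.univ
        (fun t _ => (hasDerivAt_logistic t).hasDerivWithinAt) injective_logistic.injOn,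
      setIntegral_univ]
    refine integral_congr_ae (Filter.Eventually.of_forall fun t => ?_)
    have hE := Real.exp_pos (-(Real.pi * t))
    have hE1 : 0 < 1 + Real.exp (-(Real.pi * t)) := by positivity
    -- In terms of Λ every factor of the integrand is an exponential, so only the exponents have to
    -- be compared.
    set Λ := Real.log (1 + Real.exp (-(Real.pi * t))) with hΛ
    have hL : Real.exp Λ = 1 + Real.exp (-(Real.pi * t)) := Real.exp_log hE1
    have e1 : (logistic t : ℂ) = Complex.exp (-(Λ : ℂ)) := by
      rw [← Complex.ofReal_neg, ← Complex.ofReal_exp, Real.exp_neg, hL, logistic, one_div]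
    have e2 : (1 - (logistic t : ℂ)) = Complex.exp ((-(Real.pi * t) - Λ : ℝ) : ℂ) := by
      rw [← Complex.ofReal_exp, Real.exp_sub, hL, logistic]
      push_cast
      have : (1 : ℂ) + Complex.exp (-(Real.pi * t)) ≠ 0 := by
        exact_mod_cast hE1.ne'
      field_simp
      ring
    have e3 : (logistic t : ℂ) ^ (u - 1) = Complex.exp (-(Λ : ℂ) * (u - 1)) := by
      rw [e1, ← Complex.ofReal_neg, ← Complex.ofReal_exp,
        Complex.cpow_def_of_ne_zero (by exact_mod_cast (Real.exp_pos _).ne'),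
        ← Complex.ofReal_log (Real.exp_pos _).le, Real.log_exp]
    have e4 : (1 - (logistic t : ℂ)) ^ (v - 1)
        = Complex.exp ((-(Real.pi * t) - Λ) * (v - 1)) := by
      rw [e2, ← Complex.ofReal_exp,
        Complex.cpow_def_of_ne_zero (by exact_mod_cast (Real.exp_pos _).ne'),
        ← Complex.ofReal_log (Real.exp_pos _).le, Real.log_exp]
      push_cast; rfl
    have e5 : |Real.pi * Real.exp (-(Real.pi * t)) / (1 + Real.exp (-(Real.pi * t))) ^ 2|
        = Real.pi * Real.exp (-(Real.pi * t) - Λ - Λ) := by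
      rw [abs_of_pos (by have := Real.pi_pos; positivity), Real.exp_sub, Real.exp_sub, hL]
      field_simp
    have e6 : sechDens t = Real.exp (-(Real.pi * t) / 2 - Λ) := by
      rw [Real.exp_sub, hL, sechDens, div_eq_div_iff (by positivity) (by positivity), one_mul,
        mul_add, ← Real.exp_add, ← Real.exp_add,
        show -(Real.pi * t) / 2 + Real.pi * t / 2 = 0 by ring,
        show -(Real.pi * t) / 2 + -(Real.pi * t / 2) = -(Real.pi * t) by ring, Real.exp_zero]
    dsimp only
    rw [e3, e4, e5, e6, Complex.real_smul, ← Complex.exp_add]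
    push_cast
    rw [mul_assoc, ← Complex.exp_add, ← Complex.exp_add]
    congr 2
    have hux : (Real.pi : ℂ) * v = Real.pi / 2 - Complex.I * x := by
      rw [hv]; field_simp
    rw [show u = 1 - v by rw [← huv]; ring]
    linear_combination (-(t : ℂ)) * hux
  have hdens : ∫ t, Complex.exp (Complex.I * (t * x)) ∂sechLaw
      = ∫ t : ℝ, Complex.exp (Complex.I * (t * x)) * (sechDens t : ℂ) := by
    rw [sechLaw_eq, integral_withDensity_eq_integral_toReal_smul
      (measurable_sechDens.ennreal_ofReal) (by simp)]
    refine integral_congr_ae (Filter.Eventually.of_forall fun t => ?_)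
    dsimp only
    rw [ENNReal.toReal_ofReal (sechDens_pos t).le, Complex.real_smul, mul_comm]
  rw [hdens]
  rw [hbeta, integral_const_mul] at hint
  have := mul_left_cancel₀ hp (hint.symm.trans (mul_one_div _ _).symm)
  exact this

/-- The identity behind the rounding: it says that (1 + a²) E[a^{it}] = 2a. -/
theorem integral_exp_log_sechLaw {a : ℝ} (ha : 0 < a) :
    ∫ t, Complex.exp (Complex.I * (t * Real.log a)) ∂sechLaw
      = ((2 * a / (1 + a ^ 2) : ℝ) : ℂ) := by
  rw [integral_exp_sechLaw, ← Complex.ofReal_cosh, Real.cosh_log ha]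
  norm_cast
  field_simp
  ring

end NCG

end

noncomputable section

namespace NCG

open MeasureTheory
open scoped ComplexOrder Matrix

/-! ### Moments of the random phases -/

section Moments

variable {d : ℕ}

/-- The phases `ζ_r = i ^ (z r)`. -/
def zeta (z : Fin d → Fin 4) (r : Fin d) : ℂ := Complex.I ^ (z r : ℕ)

theorem zeta_mul_star (z : Fin d → Fin 4) (r : Fin d) : zeta z r * star (zeta z r) = 1 := by
  rw [zeta, star_pow, ← mul_pow, Complex.star_def, Complex.conj_I]
  simp

/-- Rotation of the phase number `a` by a quarter turn. -/
def shiftEquiv (a : Fin d) : (Fin d → Fin 4) ≃ (Fin d → Fin 4) :=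
  Equiv.addRight (Pi.single a 1)

theorem zeta_shift (a r : Fin d) (z : Fin d → Fin 4) :
    zeta (shiftEquiv a z) r = (if r = a then Complex.I else 1) * zeta z r := by
  have key : ∀ k : Fin 4, Complex.I ^ ((k + 1 : Fin 4) : ℕ) = Complex.I * Complex.I ^ (k : ℕ) := by
    intro k
    fin_cases k <;> simp [pow_succ]
  simp only [zeta, shiftEquiv, Equiv.coe_addRight, Pi.add_apply]
  split_ifs with h
  · subst h; rw [Pi.single_eq_same, key]
  · rw [Pi.single_eq_of_ne h, add_zero, one_mul]

/-- The shift is a bijection, so the sum equals c times itself. -/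
theorem sum_eq_zero_of_shift {T : (Fin d → Fin 4) → ℂ} (a : Fin d) {c : ℂ} (hc : c ≠ 1)
    (h : ∀ z, T (shiftEquiv a z) = c * T z) : ∑ z, T z = 0 := by
  have h1 : ∑ z, T z = c * ∑ z, T z := by
    rw [Finset.mul_sum, ← (shiftEquiv a).sum_comp T]
    exact Finset.sum_congr rfl fun z _ => h z
  have h2 : (1 - c) * ∑ z, T z = 0 := by rw [sub_mul, one_mul, ← h1, sub_self]
  exact (mul_eq_zero.1 h2).resolve_left (sub_ne_zero.2 hc.symm)

theorem sum_zeta_two (r s : Fin d) :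
    ∑ z : Fin d → Fin 4, star (zeta z r) * zeta z s = if r = s then (4 : ℂ) ^ d else 0 := by
  split_ifs with h
  · subst h
    simp_rw [mul_comm (star _), zeta_mul_star]
    simp
  · refine sum_eq_zero_of_shift r (c := -Complex.I) ?_ fun z => ?_
    · intro h; have := congrArg Complex.re h; simp at this
    · rw [zeta_shift, zeta_shift, if_pos rfl, if_neg (Ne.symm h)]
      simp; ring

/-- The product is 1 if the conjugated indices r, t are s, u up to order; otherwise rotating one
unbalanced phase multiplies it by a number other than 1. -/
theorem sum_zeta_four (r s t u : Fin d) :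
    ∑ z : Fin d → Fin 4, star (zeta z r) * zeta z s * (star (zeta z t) * zeta z u)
      = if (r = s ∧ t = u) ∨ (r = u ∧ s = t) then (4 : ℂ) ^ d else 0 := by
  have hI : -Complex.I ≠ 1 := by
    intro h; have := congrArg Complex.re h; simp at this
  split_ifs with h
  · have : ∀ z : Fin d → Fin 4, star (zeta z r) * zeta z s * (star (zeta z t) * zeta z u) = 1 := by
      intro z
      have hz : ∀ r, star (zeta z r) * zeta z r = 1 := fun r => by rw [mul_comm, zeta_mul_star]
      rcases h with ⟨rfl, rfl⟩ | ⟨rfl, rfl⟩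
      · rw [hz, hz, one_mul]
      · linear_combination (star (zeta z s) * zeta z s) * hz r + hz s
    rw [Finset.sum_congr rfl fun z _ => this z]
    simp
  · push Not at h
    by_cases hrs : r = s
    · subst hrs
      have htu := h.1 rfl
      refine sum_eq_zero_of_shift t hI fun z => ?_
      simp only [zeta_shift, if_neg (Ne.symm htu), if_true]
      split_ifs <;> simp <;> ring_nf
      simp
    · by_cases hru : r = u
      · subst hru
        have hst := h.2 rfl
        refine sum_eq_zero_of_shift t hI fun z => ?_
        simp only [zeta_shift, if_neg hst, if_true]
        split_ifs <;> simp <;> ring_nf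
        simp
      -- Here the conjugated phase occurs squared and rotates by -1. This is where fourth roots of
      -- unity are needed: for random signs the square would be 1.
      · by_cases htr : t = r
        · subst htr
          refine sum_eq_zero_of_shift t (c := -1) (by norm_num) fun z => ?_
          simp only [zeta_shift, if_neg (Ne.symm hrs), if_neg (Ne.symm hru), if_true]
          simp; ring_nf; simp
        · refine sum_eq_zero_of_shift r hI fun z => ?_
          simp only [zeta_shift, if_neg (Ne.symm hrs), if_neg (Ne.symm hru), if_neg htr, if_true]
          simp; ring

end Moments

/-! ### Fourth moments of matrices with random phases -/

section FourthMoment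

variable {n d : ℕ}

/-- The fourth moment of `∑_r η_r C_r` for a family with both Gram matrices equal to `1`. -/
theorem fourth_moment_posSemidef (C : Fin d → Matrix (Fin n) (Fin n) ℂ)
    (h1 : ∑ r, C r * (C r)ᴴ = 1) (h2 : ∑ r, (C r)ᴴ * C r = 1)
    (η : (Fin d → Fin 4) → Fin d → ℂ)
    (hη : ∀ r s t u, ∑ z, η z r * star (η z s) * (η z t * star (η z u))
      = if (r = s ∧ t = u) ∨ (r = u ∧ s = t) then (4 : ℂ) ^ d else 0) :
    (1 - ((2 / 4 ^ d : ℝ) : ℂ) • ∑ z : Fin d → Fin 4,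
      ((((1 / √2 : ℝ) : ℂ) • ∑ r, η z r • C r) * (((1 / √2 : ℝ) : ℂ) • ∑ r, η z r • C r)ᴴ) *
      ((((1 / √2 : ℝ) : ℂ) • ∑ r, η z r • C r) * (((1 / √2 : ℝ) : ℂ) • ∑ r,
          η z r • C r)ᴴ)).PosSemidef := by
  set Q := ∑ r, (C r * (C r)ᴴ) * (C r * (C r)ᴴ) with hQ
  have hQp : Q.PosSemidef := by
    refine Matrix.posSemidef_sum _ fun r _ => ?_
    have := Matrix.posSemidef_self_mul_conjTranspose (C r * (C r)ᴴ)
    rwa [Matrix.conjTranspose_mul, Matrix.conjTranspose_conjTranspose] at this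
  have hhalf : ((1 / √2 : ℝ) : ℂ) * ((1 / √2 : ℝ) : ℂ) = 1 / 2 := by
    rw [← Complex.ofReal_mul, ← pow_two, div_pow, Real.sq_sqrt (by norm_num)]
    norm_num
  have hexp : ∀ z : Fin d → Fin 4,
      ((((1 / √2 : ℝ) : ℂ) • ∑ r, η z r • C r) * (((1 / √2 : ℝ) : ℂ) • ∑ r, η z r • C r)ᴴ) *
      ((((1 / √2 : ℝ) : ℂ) • ∑ r, η z r • C r) * (((1 / √2 : ℝ) : ℂ) • ∑ r, η z r • C r)ᴴ)
      = (1 / 4 : ℂ) • ∑ r, ∑ s, ∑ t, ∑ u,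
        (η z r * star (η z s) * (η z t * star (η z u))) • ((C r * (C s)ᴴ) * (C t * (C u)ᴴ)) := by
    intro z
    have e : (((1 / √2 : ℝ) : ℂ) • ∑ r, η z r • C r) * (((1 / √2 : ℝ) : ℂ) • ∑ r, η z r • C r)ᴴ
        = (1 / 2 : ℂ) • ∑ r, ∑ s, (η z r * star (η z s)) • (C r * (C s)ᴴ) := by
      have hst : star ((1 / √2 : ℝ) : ℂ) = ((1 / √2 : ℝ) : ℂ) := by
        rw [Complex.star_def, Complex.conj_ofReal]
      rw [Matrix.conjTranspose_smul, smul_mul_smul_comm, hst, hhalf, Matrix.conjTranspose_sum,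
          Finset.sum_mul_sum]
      simp_rw [Matrix.conjTranspose_smul, smul_mul_smul_comm]
    rw [e, smul_mul_smul_comm, Finset.sum_mul_sum]
    have : (1 / 2 : ℂ) * (1 / 2) = 1 / 4 := by norm_num
    rw [this]
    congr 1
    simp_rw [Finset.sum_mul_sum, smul_mul_smul_comm]
    refine Finset.sum_congr rfl fun r _ => ?_
    rw [Finset.sum_comm]
  have hsum : ∑ z : Fin d → Fin 4, ∑ r, ∑ s, ∑ t, ∑ u,
        (η z r * star (η z s) * (η z t * star (η z u))) • ((C r * (C s)ᴴ) * (C t * (C u)ᴴ))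
      = (4 : ℂ) ^ d • (2 • 1 - Q) := by
    have e1 : ∑ z : Fin d → Fin 4, ∑ r, ∑ s, ∑ t, ∑ u,
        (η z r * star (η z s) * (η z t * star (η z u))) • ((C r * (C s)ᴴ) * (C t * (C u)ᴴ))
        = ∑ r, ∑ s, ∑ t, ∑ u, (if (r = s ∧ t = u) ∨ (r = u ∧ s = t) then (4 : ℂ) ^ d else 0) •
          ((C r * (C s)ᴴ) * (C t * (C u)ᴴ)) := by
      rw [Finset.sum_comm]
      refine Finset.sum_congr rfl fun r _ => ?_
      rw [Finset.sum_comm]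
      refine Finset.sum_congr rfl fun s _ => ?_
      rw [Finset.sum_comm]
      refine Finset.sum_congr rfl fun t _ => ?_
      rw [Finset.sum_comm]
      refine Finset.sum_congr rfl fun u _ => ?_
      rw [← Finset.sum_smul, hη]
    -- Inclusion and exclusion: the two pairings coincide exactly when all four indices agree.
    have e2 : ∀ r s t u : Fin d, (if (r = s ∧ t = u) ∨ (r = u ∧ s = t) then (4 : ℂ) ^ d else 0)
        = (4 : ℂ) ^ d * ((if r = s then (if t = u then 1 else 0) else 0)
          + (if r = u then (if s = t then 1 else 0) else 0)
          - (if r = s then (if r = t then (if r = u then 1 else 0) else 0) else 0)) := by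
      intro r s t u
      by_cases hrs : r = s
      · subst hrs
        by_cases hrt : r = t
        · subst hrt
          by_cases hru : r = u <;> simp [hru]
        · by_cases htu : t = u
          · subst htu; simp [hrt]
          · simp [hrt, htu]
      · by_cases hru : r = u
        · subst hru
          by_cases hst : s = t
          · subst hst; simp [hrs]
          · simp [hrs, hst]
        · simp [hrs, hru]
    rw [e1]
    simp_rw [e2, mul_smul, sub_smul, add_smul]
    simp_rw [← Finset.smul_sum, Finset.sum_sub_distrib, Finset.sum_add_distrib]
    congr 1
    simp only [ite_smul, one_smul, zero_smul, Finset.sum_ite_eq, Finset.sum_ite_irrel,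
      Finset.mem_univ, if_true, Finset.sum_const_zero]
    rw [hQ, two_smul]
    congr 1
    congr 1
    -- The first pairing uses only the row condition; the second, crossing one needs the column
    -- condition inside the row condition.
    · simp_rw [← Finset.mul_sum, h1, mul_one, h1]
    · calc ∑ r, ∑ s, (C r * (C s)ᴴ) * (C s * (C r)ᴴ)
          = ∑ r, C r * (∑ s, (C s)ᴴ * C s) * (C r)ᴴ := by
            refine Finset.sum_congr rfl fun r _ => ?_
            rw [Finset.mul_sum, Finset.sum_mul]
            exact Finset.sum_congr rfl fun s _ => by noncomm_ring
        _ = 1 := by rw [h2]; simp_rw [mul_one, h1]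
  simp_rw [hexp]
  rw [← Finset.smul_sum, hsum]
  -- The two pairings contribute 1 each and their overlap is `Q`, so twice the mean is 1 - Q/2 and
  -- the defect Q/2 is positive semidefinite.
  have hfin : (1 : Matrix (Fin n) (Fin n) ℂ)
      - ((2 / 4 ^ d : ℝ) : ℂ) • (1 / 4 : ℂ) • (4 : ℂ) ^ d • (2 • 1 - Q) = (1 / 2 : ℂ) • Q := by
    rw [smul_smul, smul_smul, mul_assoc]
    have : ((2 / 4 ^ d : ℝ) : ℂ) * (1 / 4 * 4 ^ d) = 1 / 2 := by
      push_cast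
      have : (4 : ℂ) ^ d ≠ 0 := by positivity
      field_simp
      norm_num
    rw [this, smul_sub, two_nsmul, smul_add, ← add_smul]
    norm_num
  rw [hfin]
  exact hQp.smul (by rw [Complex.le_def]; norm_num)

variable (X Y : VMat n d)

theorem proj_eq (z : Fin d → Fin 4) :
    proj X z = ((1 / √2 : ℝ) : ℂ) • ∑ r, star (zeta z r) • slice X r := by
  ext i j
  simp only [proj, cdot, Matrix.of_apply, Matrix.smul_apply, Matrix.sum_apply, slice, smul_eq_mul,
    zeta]
  congr 1
  exact Finset.sum_congr rfl fun r _ => mul_comm _ _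

/-- By orthogonality of the phases only equal coordinates survive; the 1/2 is the square of the
normalisation 1/√2. -/
theorem sum_form_proj (M : Tensor n) :
    ∑ z : Fin d → Fin 4, form M (proj X z) (proj Y z) = 4 ^ d / 2 * vform M X Y := by
  have hhalf : ((1 / √2 : ℝ) : ℂ) * ((1 / √2 : ℝ) : ℂ) = 1 / 2 := by
    rw [← Complex.ofReal_mul, ← pow_two, div_pow, Real.sq_sqrt (by norm_num)]
    norm_num
  simp_rw [proj_eq, form_smul_left, form_smul_right, form_sum_left, form_sum_right,
    form_smul_left, form_smul_right, star_star]
  simp_rw [← mul_assoc, Complex.star_def, Complex.conj_ofReal]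
  simp_rw [hhalf]
  simp_rw [mul_assoc, ← Finset.mul_sum]
  rw [vform_eq_sum_form, Finset.sum_comm, show (4 : ℂ) ^ d / 2 = 1 / 2 * 4 ^ d by ring,
    mul_assoc]
  congr 1
  rw [Finset.mul_sum]
  refine Finset.sum_congr rfl fun r _ => ?_
  simp_rw [Finset.mul_sum]
  rw [Finset.sum_comm]
  simp_rw [← mul_assoc, ← Finset.sum_mul, ← Complex.star_def, sum_zeta_two]
  simp

end FourthMoment

end NCG

end

noncomputable section

namespace NCG

open MeasureTheory
open scoped ComplexOrder Matrix

/-! ### The expectation of the complex rounding -/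

theorem norm_imPow (s : Bool) (t σ : ℝ) : ‖imPow s t σ‖ = 1 := by
  unfold imPow
  split_ifs <;> simp [Complex.norm_exp]

theorem star_imPow_mul (s : Bool) (t σ : ℝ) : star (imPow s t σ) * imPow s t σ = 1 := by
  rw [Complex.star_def, ← Complex.normSq_eq_conj_mul_self, Complex.normSq_eq_norm_sq, norm_imPow]
  simp

theorem continuous_imPow (s : Bool) (σ : ℝ) : Continuous fun t => imPow s t σ := by
  unfold imPow
  split_ifs <;> fun_prop

theorem integrable_imPow_mul (s s' : Bool) (σ τ : ℝ) (c : ℂ) :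
    Integrable (fun t => imPow s t σ * star (imPow s' (-t) τ) * c) sechLaw := by
  refine Integrable.of_bound (C := ‖c‖) ?_ (Filter.Eventually.of_forall fun t => ?_)
  · have h1 := continuous_imPow s σ
    have h2 := (continuous_imPow s' τ).comp continuous_neg
    exact ((h1.mul (continuous_star.comp h2)).mul continuous_const).aestronglyMeasurable
  · rw [norm_mul, norm_mul, norm_star, norm_imPow, norm_imPow, one_mul, one_mul]

/-- The identity `E[a^{it}] = 2a - E[a^{2+it}]`, including the signs on the kernels. -/
theorem sum_integral_imPow {σ τ : ℝ} (hσ : 0 ≤ σ) (hτ : 0 ≤ τ) :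
    ∑ s : Bool × Bool, ∫ t, imPow s.1 t σ * star (imPow s.2 (-t) τ)
      * (1 + ((σ * τ) ^ 2 : ℝ)) ∂sechLaw = 8 * ((σ * τ : ℝ) : ℂ) := by
  rw [Fintype.sum_prod_type]
  simp only [Fintype.sum_bool]
  -- If a singular value is 0, the two signs on its kernel cancel and both sides vanish. Otherwise
  -- the signs play no role, and 8 is the number 4 of sign pairs times the 2 in 2a/(1 + a²).
  rcases hσ.eq_or_lt with rfl | hσ'
  · have e : ∀ s' : Bool, ∀ t, imPow true t 0 * star (imPow s' (-t) τ)
        * (1 + ((0 * τ) ^ 2 : ℝ)) = -(imPow false t 0 * star (imPow s' (-t) τ)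
        * (1 + ((0 * τ) ^ 2 : ℝ))) := by
      intro s' t; simp [imPow]
    simp_rw [e, integral_neg]
    simp
    ring
  rcases hτ.eq_or_lt with rfl | hτ'
  · have e : ∀ s : Bool, ∀ t, imPow s t σ * star (imPow true (-t) 0)
        * (1 + ((σ * 0) ^ 2 : ℝ)) = -(imPow s t σ * star (imPow false (-t) 0)
        * (1 + ((σ * 0) ^ 2 : ℝ))) := by
      intro s' t; simp [imPow]
    simp_rw [e, integral_neg]
    simp
  · have e : ∀ s s' : Bool, ∀ t, imPow s t σ * star (imPow s' (-t) τ)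
        = Complex.exp (Complex.I * (t * Real.log (σ * τ))) := by
      intro s s' t
      rw [imPow, imPow, if_neg hσ'.ne', if_neg hτ'.ne', Complex.star_def, ← Complex.exp_conj,
        ← Complex.exp_add, Real.log_mul hσ'.ne' hτ'.ne']
      congr 1
      simp only [map_mul, Complex.conj_I, Complex.conj_ofReal]
      push_cast
      ring
    simp_rw [e, integral_mul_const, integral_exp_log_sechLaw (mul_pos hσ' hτ')]
    have h : (1 : ℂ) + ((σ * τ) ^ 2 : ℝ) ≠ 0 := by
      have : (1 : ℝ) + (σ * τ) ^ 2 ≠ 0 := by positivity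
      exact_mod_cast this
    push_cast at h ⊢
    field_simp
    ring

section

variable {n d : ℕ}

theorem mul_conjDiag_eq_sum (U V : Matrix (Fin n) (Fin n) ℂ) (a : Fin n → ℂ) :
    U * conjDiag V a = ∑ j, a j • (U * conjDiag V (Pi.single j 1)) := by
  have : conjDiag V a = ∑ j, a j • conjDiag V (Pi.single j 1) := by
    ext i k
    simp only [Matrix.sum_apply, Matrix.smul_apply, conjDiag_apply, Pi.single_apply, smul_eq_mul]
    refine Finset.sum_congr rfl fun j _ => ?_
    simp
    ring
  conv_lhs => rw [this]
  rw [Finset.mul_sum]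
  simp_rw [mul_smul_comm]

/-- This separates the singular values from the vectors, so that the expectation over t can be taken
for each pair of singular values. -/
theorem form_mul_conjDiag (M : Tensor n) (U V U' V' : Matrix (Fin n) (Fin n) ℂ)
    (a b : Fin n → ℂ) :
    form M (U * conjDiag V a) (U' * conjDiag V' b) = ∑ j, ∑ k, a j * star (b k) *
      form M (U * conjDiag V (Pi.single j 1)) (U' * conjDiag V' (Pi.single k 1)) := by
  rw [mul_conjDiag_eq_sum, mul_conjDiag_eq_sum U', form_sum_left]
  simp_rw [form_sum_right, form_smul_left, form_smul_right, mul_assoc]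

/-- `σ ↦ σ^{2+it}`. -/
def imPowSq (s : Bool) (t σ : ℝ) : ℂ := (σ : ℂ) ^ 2 * imPow s t σ

theorem integrable_form_imPow (M : Tensor n) (U V U' V' : Matrix (Fin n) (Fin n) ℂ)
    (σ τ : Fin n → ℝ) (s : Bool × Bool) :
    Integrable (fun t => form M (U * conjDiag V fun j => imPow s.1 t (σ j))
      (U' * conjDiag V' fun j => imPow s.2 (-t) (τ j))) sechLaw := by
  refine (integrable_congr (Filter.Eventually.of_forall fun t =>
    form_mul_conjDiag M U V U' V' _ _)).2 ?_
  exact integrable_finsetSum _ fun j _ => integrable_finsetSum _ fun k _ =>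
    integrable_imPow_mul _ _ _ _ _

theorem integrable_form_imPowSq (M : Tensor n) (U V U' V' : Matrix (Fin n) (Fin n) ℂ)
    (σ τ : Fin n → ℝ) (s : Bool × Bool) :
    Integrable (fun t => form M (U * conjDiag V fun j => imPowSq s.1 t (σ j))
      (U' * conjDiag V' fun j => imPowSq s.2 (-t) (τ j))) sechLaw := by
  refine (integrable_congr (Filter.Eventually.of_forall fun t =>
    form_mul_conjDiag M U V U' V' _ _)).2 ?_
  refine integrable_finsetSum _ fun j _ => integrable_finsetSum _ fun k _ => ?_
  refine (integrable_imPow_mul s.1 s.2 (σ j) (τ k) ((σ j : ℂ) ^ 2 * (τ k : ℂ) ^ 2 *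
    form M (U * conjDiag V (Pi.single j 1)) (U' * conjDiag V' (Pi.single k 1)))).congr
      (Filter.Eventually.of_forall fun t => ?_)
  simp only [imPowSq, star_mul', star_pow, Complex.star_def, Complex.conj_ofReal]
  ring

/-- The second matrix enters conjugated and with exponent -it, so each pair of singular values
contributes (σ_j τ_k)^{it}, to which `sum_integral_imPow` applies. -/
theorem sum_integral_form_imPow (M : Tensor n) (U V U' V' : Matrix (Fin n) (Fin n) ℂ)
    {σ τ : Fin n → ℝ} (hσ : ∀ j, 0 ≤ σ j) (hτ : ∀ j, 0 ≤ τ j) :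
    ∑ s : Bool × Bool, ∫ t, (form M (U * conjDiag V fun j => imPow s.1 t (σ j))
        (U' * conjDiag V' fun j => imPow s.2 (-t) (τ j))
      + form M (U * conjDiag V fun j => imPowSq s.1 t (σ j))
        (U' * conjDiag V' fun j => imPowSq s.2 (-t) (τ j))) ∂sechLaw
      = 8 * form M (U * conjDiag V fun j => (σ j : ℂ)) (U' * conjDiag V' fun j => (τ j : ℂ)) := by
  set E : Fin n → Fin n → ℂ := fun j k =>
    form M (U * conjDiag V (Pi.single j 1)) (U' * conjDiag V' (Pi.single k 1)) with hE
  have h1 : ∀ s : Bool × Bool, ∀ t, (form M (U * conjDiag V fun j => imPow s.1 t (σ j))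
        (U' * conjDiag V' fun j => imPow s.2 (-t) (τ j))
      + form M (U * conjDiag V fun j => imPowSq s.1 t (σ j))
        (U' * conjDiag V' fun j => imPowSq s.2 (-t) (τ j)))
      = ∑ j, ∑ k, imPow s.1 t (σ j) * star (imPow s.2 (-t) (τ k))
          * (1 + ((σ j * τ k) ^ 2 : ℝ)) * E j k := by
    intro s t
    rw [form_mul_conjDiag, form_mul_conjDiag, ← Finset.sum_add_distrib]
    refine Finset.sum_congr rfl fun j _ => ?_
    rw [← Finset.sum_add_distrib]
    refine Finset.sum_congr rfl fun k _ => ?_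
    simp only [imPowSq, star_mul', star_pow, Complex.star_def, Complex.conj_ofReal, hE]
    push_cast
    ring
  simp_rw [h1]
  have hint : ∀ (s : Bool × Bool) j k, Integrable (fun t => imPow s.1 t (σ j)
      * star (imPow s.2 (-t) (τ k)) * (1 + ((σ j * τ k) ^ 2 : ℝ)) * E j k) sechLaw := by
    intro s j k
    simp_rw [mul_assoc _ (1 + _) (E j k)]
    exact integrable_imPow_mul _ _ _ _ _
  have h2 : ∀ s : Bool × Bool, ∫ t, (∑ j, ∑ k, imPow s.1 t (σ j) * star (imPow s.2 (-t) (τ k))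
          * (1 + ((σ j * τ k) ^ 2 : ℝ)) * E j k) ∂sechLaw
      = ∑ j, ∑ k, (∫ t, imPow s.1 t (σ j) * star (imPow s.2 (-t) (τ k))
          * (1 + ((σ j * τ k) ^ 2 : ℝ)) ∂sechLaw) * E j k := by
    intro s
    rw [integral_finsetSum _ fun j _ => integrable_finsetSum _ fun k _ => hint s j k]
    refine Finset.sum_congr rfl fun j _ => ?_
    rw [integral_finsetSum _ fun k _ => hint s j k]
    simp_rw [integral_mul_const]
  simp_rw [h2]
  rw [Finset.sum_comm, form_mul_conjDiag, Finset.mul_sum]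
  refine Finset.sum_congr rfl fun j _ => ?_
  rw [Finset.sum_comm, Finset.mul_sum]
  refine Finset.sum_congr rfl fun k _ => ?_
  rw [← Finset.sum_mul, sum_integral_imPow (hσ j) (hτ k)]
  simp only [Complex.star_def, Complex.conj_ofReal, hE]
  push_cast
  ring

variable (R : Selection n) (M : Tensor n)

/-- The eigenvector matrix of the positive factor. -/
def modVec (T : Matrix (Fin n) (Fin n) ℂ) : Matrix (Fin n) (Fin n) ℂ :=
  (R.mod_posSemidef T).1.eigenvectorUnitary

/-- The singular values of `T`. -/
def modVal (T : Matrix (Fin n) (Fin n) ℂ) : Fin n → ℝ := (R.mod_posSemidef T).1.eigenvalues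

theorem modVec_mem (T : Matrix (Fin n) (Fin n) ℂ) :
    modVec R T ∈ Matrix.unitaryGroup (Fin n) ℂ := (R.mod_posSemidef T).1.eigenvectorUnitary.2

theorem modVal_nonneg (T : Matrix (Fin n) (Fin n) ℂ) (j : Fin n) : 0 ≤ modVal R T j :=
  (R.mod_posSemidef T).eigenvalues_nonneg j

theorem mod_eq (T : Matrix (Fin n) (Fin n) ℂ) :
    R.mod T = conjDiag (modVec R T) fun j => (modVal R T j : ℂ) :=
  spectral_conjDiag (R.mod_posSemidef T).1

theorem complexRound_eq (X : VMat n d) (z : Fin d → Fin 4) (s : Bool) (t : ℝ) :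
    complexRound R X z s t = R.pol (proj X z) *
      conjDiag (modVec R (proj X z)) fun j => imPow s t (modVal R (proj X z) j) := by
  rw [complexRound, hermFun_eq (R.mod_posSemidef _).1]; rfl

theorem complexRound_mem (X : VMat n d) (z : Fin d → Fin 4) (s : Bool) (t : ℝ) :
    complexRound R X z s t ∈ Matrix.unitaryGroup (Fin n) ℂ := by
  rw [complexRound_eq]
  refine mul_mem (R.pol_unitary _) ?_
  rw [Matrix.mem_unitaryGroup_iff', Matrix.star_eq_conjTranspose, conjTranspose_conjDiag,
    conjDiag_mul (modVec_mem R _)]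
  simp_rw [star_imPow_mul]
  exact conjDiag_one (modVec_mem R _)

/-- The matrix `U |T|^{2+it}`. -/
def squareRound (T : Matrix (Fin n) (Fin n) ℂ) (s : Bool) (t : ℝ) : Matrix (Fin n) (Fin n) ℂ :=
  R.pol T * conjDiag (modVec R T) fun j => imPowSq s t (modVal R T j)

theorem imPowSq_mul_star (s : Bool) (t σ : ℝ) :
    imPowSq s t σ * star (imPowSq s t σ) = (σ : ℂ) * σ * (σ * σ) := by
  have := star_imPow_mul s t σ
  simp only [imPowSq, star_mul', star_pow, Complex.star_def, Complex.conj_ofReal] at this ⊢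
  linear_combination (σ : ℂ) ^ 4 * this

/-- The imaginary power and the polar factor drop out, which leaves fourth powers of |T| that do not
depend on t. -/
theorem squareRound_gram (T : Matrix (Fin n) (Fin n) ℂ) (s : Bool) (t : ℝ) :
    squareRound R T s t * (squareRound R T s t)ᴴ = (T * Tᴴ) * (T * Tᴴ) ∧
    (squareRound R T s t)ᴴ * squareRound R T s t = (Tᴴ * T) * (Tᴴ * T) := by
  have hU : (R.pol T)ᴴ * R.pol T = 1 := Matrix.mem_unitaryGroup_iff'.1 (R.pol_unitary T)
  have hV := modVec_mem R T
  have hP : (R.mod T)ᴴ = R.mod T := (R.mod_posSemidef T).1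
  have hPP : R.mod T * R.mod T * (R.mod T * R.mod T)
      = conjDiag (modVec R T) fun j => (modVal R T j : ℂ) * modVal R T j *
        (modVal R T j * modVal R T j) := by
    rw [mod_eq, conjDiag_mul hV, conjDiag_mul hV]
  have hT := R.polar T
  have hTt : Tᴴ = R.mod T * (R.pol T)ᴴ := by
    conv_lhs => rw [hT]
    rw [Matrix.conjTranspose_mul, hP]
  have hTT : Tᴴ * T = R.mod T * R.mod T := by
    calc Tᴴ * T = R.mod T * (R.pol T)ᴴ * (R.pol T * R.mod T) := by rw [← hTt, ← hT]
      _ = R.mod T * ((R.pol T)ᴴ * R.pol T) * R.mod T := by noncomm_ring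
      _ = _ := by rw [hU, mul_one]
  constructor
  · calc squareRound R T s t * (squareRound R T s t)ᴴ
        = R.pol T * (R.mod T * R.mod T * (R.mod T * R.mod T)) * (R.pol T)ᴴ := by
          rw [hPP, squareRound, Matrix.conjTranspose_mul, conjTranspose_conjDiag, ← mul_assoc,
            mul_assoc (R.pol T), conjDiag_mul hV]
          simp_rw [imPowSq_mul_star]
      _ = T * (Tᴴ * T) * Tᴴ := by
          rw [hTT]
          calc _ = (R.pol T * R.mod T) * (R.mod T * R.mod T) * (R.mod T * (R.pol T)ᴴ) := by
                noncomm_ring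
            _ = _ := by rw [← hT, ← hTt]
      _ = _ := by noncomm_ring
  · rw [hTT, hPP, squareRound, Matrix.conjTranspose_mul, conjTranspose_conjDiag]
    calc _ = conjDiag (modVec R T) (fun j => star (imPowSq s t (modVal R T j))) *
          ((R.pol T)ᴴ * R.pol T) * conjDiag (modVec R T) (fun j => imPowSq s t (modVal R T j)) := by
            noncomm_ring
      _ = _ := by
        rw [hU, mul_one, conjDiag_mul hV]
        simp_rw [mul_comm (star _), imPowSq_mul_star]

/-- The squared weight 2/4^d is twice the uniform weight on z. The fourth moment bound is applied to
the coordinate matrices for one Gram matrix and to their adjoints for the other. -/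
theorem squareRound_posSemidef {X : VMat n d} (hX : X ∈ vUnitary n d) (s : Bool) (t : ℝ) :
    (1 - ∑ z : Fin d → Fin 4, (((√(2 / 4 ^ d) : ℝ) : ℂ) • squareRound R (proj X z) s t) *
      (((√(2 / 4 ^ d) : ℝ) : ℂ) • squareRound R (proj X z) s t)ᴴ).PosSemidef ∧
    (1 - ∑ z : Fin d → Fin 4, (((√(2 / 4 ^ d) : ℝ) : ℂ) • squareRound R (proj X z) s t)ᴴ *
      (((√(2 / 4 ^ d) : ℝ) : ℂ) • squareRound R (proj X z) s t)).PosSemidef := by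
  rw [mem_vUnitary_iff] at hX
  have hst : star ((√(2 / 4 ^ d) : ℝ) : ℂ) = ((√(2 / 4 ^ d) : ℝ) : ℂ) := by
    rw [Complex.star_def, Complex.conj_ofReal]
  have hst' : star ((1 / √2 : ℝ) : ℂ) = ((1 / √2 : ℝ) : ℂ) := by
    rw [Complex.star_def, Complex.conj_ofReal]
  have hsq : ((√(2 / 4 ^ d) : ℝ) : ℂ) * ((√(2 / 4 ^ d) : ℝ) : ℂ) = ((2 / 4 ^ d : ℝ) : ℂ) := by
    rw [← Complex.ofReal_mul, Real.mul_self_sqrt (by positivity)]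
  simp_rw [Matrix.conjTranspose_smul, hst, smul_mul_smul_comm, hsq, (squareRound_gram R _ s t).1,
    (squareRound_gram R _ s t).2, ← Finset.smul_sum]
  constructor
  · have h := fourth_moment_posSemidef (slice X) hX.1 hX.2 (fun z r => star (zeta z r))
      (fun r s t u => by simpa only [star_star] using sum_zeta_four r s t u)
    simp_rw [← proj_eq] at h
    exact h
  · have h := fourth_moment_posSemidef (fun r => (slice X r)ᴴ)
      (by simpa only [Matrix.conjTranspose_conjTranspose] using hX.2)
      (by simpa only [Matrix.conjTranspose_conjTranspose] using hX.1) (fun z r => zeta z r)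
      (fun r s t u => by
        have := congrArg star (sum_zeta_four r s t u)
        simp only [star_sum, star_mul', star_star] at this
        rw [this]
        split_ifs <;> simp)
    have hproj : ∀ z, ((1 / √2 : ℝ) : ℂ) • ∑ r, zeta z r • (slice X r)ᴴ = (proj X z)ᴴ := by
      intro z
      rw [proj_eq, Matrix.conjTranspose_smul, hst', Matrix.conjTranspose_sum]
      simp_rw [Matrix.conjTranspose_smul, star_star]
    simp_rw [hproj, Matrix.conjTranspose_conjTranspose] at h
    exact h

/-- The weights of both families scale the sum by 2/4^d; on average over z the correction term is
thus at most half of `sdp M`. -/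
theorem norm_sum_form_squareRound_le {X Y : VMat n d} (hX : X ∈ vUnitary n d)
    (hY : Y ∈ vUnitary n d) (s s' : Bool) (t t' : ℝ) :
    ‖∑ z : Fin d → Fin 4, form M (squareRound R (proj X z) s t) (squareRound R (proj Y z) s' t')‖
      ≤ 4 ^ d / 2 * sdp M := by
  have h := norm_sum_form_le_sdp M _ _ (squareRound_posSemidef R hX s t).1
    (squareRound_posSemidef R hX s t).2 (squareRound_posSemidef R hY s' t').1
    (squareRound_posSemidef R hY s' t').2
  have hsq : ((√(2 / 4 ^ d) : ℝ) : ℂ) * ((√(2 / 4 ^ d) : ℝ) : ℂ) = ((2 / 4 ^ d : ℝ) : ℂ) := by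
    rw [← Complex.ofReal_mul, Real.mul_self_sqrt (by positivity)]
  simp_rw [form_smul_left, form_smul_right, Complex.star_def, Complex.conj_ofReal, ← mul_assoc, hsq,
    ← Finset.mul_sum] at h
  rw [norm_mul, Complex.norm_real, Real.norm_of_nonneg (by positivity), div_mul_eq_mul_div,
    div_le_iff₀ (by positivity)] at h
  linarith

theorem integrable_form_complexRound (X Y : VMat n d) (z : Fin d → Fin 4) (s : Bool × Bool) :
    Integrable (fun t => form M (complexRound R X z s.1 t) (complexRound R Y z s.2 (-t)))
      sechLaw := by
  simp_rw [complexRound_eq]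
  exact integrable_form_imPow _ _ _ _ _ _ _ _

/-- The complex rounding loses at most a factor of two, up to lower order terms. -/
theorem le_norm_sum_integral_complexRound {X Y : VMat n d} (hX : X ∈ vUnitary n d)
    (hY : Y ∈ vUnitary n d) :
    4 * 4 ^ d * (‖vform M X Y‖ - 1 / 2 * sdp M) ≤
      ‖∑ z : Fin d → Fin 4, ∑ s : Bool × Bool,
        ∫ t, form M (complexRound R X z s.1 t) (complexRound R Y z s.2 (-t)) ∂sechLaw‖ := by
  set S1 := ∑ z : Fin d → Fin 4, ∑ s : Bool × Bool,
        ∫ t, form M (complexRound R X z s.1 t) (complexRound R Y z s.2 (-t)) ∂sechLaw with hS1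
  set S2 := ∑ z : Fin d → Fin 4, ∑ s : Bool × Bool,
        ∫ t, form M (squareRound R (proj X z) s.1 t) (squareRound R (proj Y z) s.2 (-t)) ∂sechLaw
    with hS2
  have hint : ∀ z (s : Bool × Bool), Integrable (fun t => form M (squareRound R (proj X z) s.1 t)
      (squareRound R (proj Y z) s.2 (-t))) sechLaw := fun z s =>
    integrable_form_imPowSq _ _ _ _ _ _ _ _
  -- There are 4 · 4^d pairs of phases and signs, so after averaging the value and the correction
  -- add up to M(X, Y) exactly.
  have h12 : S1 + S2 = 4 * 4 ^ d * vform M X Y := by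
    rw [hS1, hS2, ← Finset.sum_add_distrib]
    have : ∀ z : Fin d → Fin 4,
        (∑ s : Bool × Bool, ∫ t, form M (complexRound R X z s.1 t) (complexRound R Y z s.2 (-t))
          ∂sechLaw) + (∑ s : Bool × Bool, ∫ t, form M (squareRound R (proj X z) s.1 t)
          (squareRound R (proj Y z) s.2 (-t)) ∂sechLaw) = 8 * form M (proj X z) (proj Y z) := by
      intro z
      rw [← Finset.sum_add_distrib]
      have h := sum_integral_form_imPow M (R.pol (proj X z)) (modVec R (proj X z))
        (R.pol (proj Y z)) (modVec R (proj Y z)) (modVal_nonneg R (proj X z))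
        (modVal_nonneg R (proj Y z))
      rw [← mod_eq, ← mod_eq, ← R.polar, ← R.polar] at h
      rw [← h]
      refine Finset.sum_congr rfl fun s _ => ?_
      rw [← integral_add (integrable_form_complexRound R M X Y z s) (hint z s)]
      simp_rw [complexRound_eq]
      rfl
    simp_rw [this]
    rw [← Finset.mul_sum, sum_form_proj]
    ring
  have hS2le : ‖S2‖ ≤ 4 * (4 ^ d / 2 * sdp M) := by
    rw [hS2, Finset.sum_comm]
    refine (norm_sum_le _ _).trans ?_
    have : ∀ s : Bool × Bool, ‖∑ z : Fin d → Fin 4, ∫ t, form M (squareRound R (proj X z) s.1 t)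
        (squareRound R (proj Y z) s.2 (-t)) ∂sechLaw‖ ≤ 4 ^ d / 2 * sdp M := by
      intro s
      rw [← integral_finsetSum _ fun z _ => hint z s]
      refine (norm_integral_le_of_norm_le_const (Filter.Eventually.of_forall fun t =>
        norm_sum_form_squareRound_le R M hX hY s.1 s.2 t (-t))).trans ?_
      simp
    refine (Finset.sum_le_sum fun s _ => this s).trans ?_
    simp
  have hfin : ‖(4 * 4 ^ d : ℂ) * vform M X Y‖ ≤ ‖S1‖ + ‖S2‖ := h12 ▸ norm_add_le S1 S2
  rw [norm_mul] at hfin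
  have : ‖(4 * 4 ^ d : ℂ)‖ = 4 * 4 ^ d := by simp
  rw [this] at hfin
  linarith

end

end NCG

end

noncomputable section

namespace NCG

open MeasureTheory
open scoped ComplexOrder Matrix

/-! ### The two-dimensional rounding of a pair of unitary matrices -/

theorem exp_angle {x : ℂ} (h : ‖x‖ = 1) : Complex.exp (Complex.I * angle x) = x := by
  have h2 := Complex.norm_mul_exp_arg_mul_I x
  rw [h, Complex.ofReal_one, one_mul, mul_comm] at h2
  unfold angle
  split_ifs
  · exact h2
  · push_cast
    rw [mul_add, Complex.exp_add, h2, show Complex.I * (2 * (Real.pi : ℂ)) = 2 * Real.pi * Complex.I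
      by ring, Complex.exp_two_pi_mul_I, mul_one]

/-- `Re (x^m e^{-it})`, which is `cos (mθ - t)` for `x = e^{iθ}`. -/
def turn (m : ℕ) (t : ℝ) (x : ℂ) : ℝ := (x ^ m * Complex.exp (-(Complex.I * t))).re

theorem turn_eq_cos (m : ℕ) (t : ℝ) {x : ℂ} (h : ‖x‖ = 1) :
    turn m t x = Real.cos (m * angle x - t) := by
  unfold turn
  conv_lhs => rw [← exp_angle h]
  rw [← Complex.exp_nat_mul, ← Complex.exp_add, ← Complex.exp_ofReal_mul_I_re]
  congr 2
  push_cast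
  ring

theorem turn_exp (m : ℕ) (t θ : ℝ) :
    turn m t (Complex.exp (Complex.I * θ)) = Real.cos (m * θ - t) := by
  unfold turn
  rw [← Complex.exp_nat_mul, ← Complex.exp_add, ← Complex.exp_ofReal_mul_I_re]
  congr 2
  push_cast
  ring

/-- Only the cosine of the rotated angle enters, so the branch chosen for `angle` is irrelevant. -/
theorem krivineLam_natCast (t : ℝ) (l : ℕ) {x : ℂ} (h : ‖x‖ = 1) :
    krivineLam t l x = Real.sign (krivineB (2 * l + 1)) * krivinePhi (turn (2 * l + 1) t x) := by
  rw [krivineLam, if_pos (by positivity), turn_eq_cos _ _ h, krivineF_eq]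
  simp

theorem krivineMu_natCast (t : ℝ) (l : ℕ) {x : ℂ} (h : ‖x‖ = 1) :
    krivineMu t l x = Real.sign (turn (2 * l + 1) t x) := by
  rw [krivineMu, if_pos (by positivity), turn_eq_cos _ _ h, krivineG, ← Real.cos_neg]
  congr 2
  push_cast
  ring

theorem krivineLam_of_neg (t : ℝ) {l : ℤ} (h : l < 0) (x : ℂ) : krivineLam t l x = 0 := by
  rw [krivineLam, if_neg (by omega)]

theorem krivineMu_of_neg (t : ℝ) {l : ℤ} (h : l < 0) (x : ℂ) : krivineMu t l x = 0 := by
  rw [krivineMu, if_neg (by omega)]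

theorem abs_krivineLam_le (t : ℝ) (l : ℤ) (x : ℂ) : |krivineLam t l x| ≤ 1 := by
  unfold krivineLam
  split_ifs
  · rw [abs_mul]
    exact mul_le_one₀ (abs_sign_le _) (abs_nonneg _) (abs_krivineF_le _)
  · simp

theorem abs_krivineMu_le (t : ℝ) (l : ℤ) (x : ℂ) : |krivineMu t l x| ≤ 1 := by
  unfold krivineMu
  split_ifs
  · exact abs_sign_le _
  · simp

section

variable {n : ℕ} (R : Selection n) {c c' : ℂ → ℝ} {A B : Matrix (Fin n) (Fin n) ℂ}

theorem roundEig_isHermitian (c : ℂ → ℝ) (A : Matrix (Fin n) (Fin n) ℂ) :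
    (roundEig R c A).IsHermitian := by
  rw [roundEig_eq]; exact conjDiag_real_isHermitian _ _

theorem opNorm_roundEig_le (hc : ∀ x, |c x| ≤ 1) (hA : A ∈ Matrix.unitaryGroup (Fin n) ℂ) :
    opNorm (roundEig R c A) ≤ 1 := by
  rw [roundEig_eq]; exact opNorm_conjDiag_le (R.vec_unitary A hA) fun j => hc _

theorem norm_form_roundEig_le (M : Tensor n) (hc : ∀ x, |c x| ≤ 1) (hc' : ∀ x, |c' x| ≤ 1)
    (hA : A ∈ Matrix.unitaryGroup (Fin n) ℂ) (hB : B ∈ Matrix.unitaryGroup (Fin n) ℂ) :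
    ‖form M (roundEig R c A) (roundEig R c' B)‖ ≤ sdp M := by
  rw [roundEig_eq, roundEig_eq]
  have h1 := one_sub_conjDiag_posSemidef (R.vec_unitary A hA) (fun j =>
    hc (Complex.exp (Complex.I * R.ang A j)))
  have h2 := one_sub_conjDiag_posSemidef (R.vec_unitary B hB) (fun j =>
    hc' (Complex.exp (Complex.I * R.ang B j)))
  exact norm_form_le_sdp M _ _ h1.1 h1.2 h2.1 h2.2

theorem form_conjDiag (M : Tensor n) (V V' : Matrix (Fin n) (Fin n) ℂ) (a b : Fin n → ℂ) :
    form M (conjDiag V a) (conjDiag V' b) = ∑ j, ∑ k, a j * star (b k) *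
      form M (conjDiag V (Pi.single j 1)) (conjDiag V' (Pi.single k 1)) := by
  have := form_mul_conjDiag M 1 V 1 V' a b
  simpa only [one_mul] using this

end

/-! ### The law of the index -/

/-- The probability of the failure index `-1`. -/
def krivineTail (L : ℕ) : ℝ := ∑' l : ℕ, |krivineB (2 * (L + 1 + l) + 1)|

theorem hasSum_odd_of_even_zero {E : Type*} [AddCommMonoid E] [TopologicalSpace E] {f : ℕ → E}
    {a : E} (h : HasSum f a) (h0 : ∀ m, Even m → f m = 0) :
    HasSum (fun l : ℕ => f (2 * l + 1)) a := by
  have hinj : Function.Injective fun l : ℕ => 2 * l + 1 := fun a b h => by simpa using h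
  refine (hinj.hasSum_iff ?_).2 h
  intro m hm
  refine h0 m (Nat.not_odd_iff_even.1 ?_)
  rintro ⟨k, rfl⟩
  exact hm ⟨k, rfl⟩

theorem hasSum_abs_krivineB_odd : HasSum (fun l : ℕ => |krivineB (2 * l + 1)|) 1 :=
  hasSum_odd_of_even_zero hasSum_abs_krivineB fun m hm => by rw [krivineB_even hm, abs_zero]

theorem sum_add_krivineTail (L : ℕ) :
    ∑ l ∈ Finset.range (L + 1), |krivineB (2 * l + 1)| + krivineTail L = 1 := by
  have h := hasSum_abs_krivineB_odd.summable.sum_add_tsum_nat_add (L + 1)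
  rw [hasSum_abs_krivineB_odd.tsum_eq] at h
  rw [← h, krivineTail]
  congr 2
  ext l
  ring_nf

theorem krivineTail_nonneg (L : ℕ) : 0 ≤ krivineTail L := tsum_nonneg fun _ => abs_nonneg _

instance (L : ℕ) : IsProbabilityMeasure (indexLaw L) := by
  constructor
  rw [indexLaw, ← krivineTail]
  simp only [Measure.coe_add, Pi.add_apply, Measure.coe_finsetSum, Finset.sum_apply,
    Measure.smul_apply, measure_univ, smul_eq_mul, mul_one]
  rw [← ENNReal.ofReal_sum_of_nonneg fun _ _ => abs_nonneg _,
    ← ENNReal.ofReal_add (Finset.sum_nonneg fun _ _ => abs_nonneg _) (krivineTail_nonneg L),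
    sum_add_krivineTail, ENNReal.ofReal_one]

theorem integral_indexLaw (L : ℕ) (g : ℤ → ℂ) :
    ∫ l, g l ∂(indexLaw L) = ∑ l ∈ Finset.range (L + 1), ((|krivineB (2 * l + 1)| : ℝ) : ℂ) * g l
      + (krivineTail L : ℂ) * g (-1) := by
  have hi : ∀ (r : ℝ) (k : ℤ), Integrable g (ENNReal.ofReal r • Measure.dirac k) := fun r k =>
    (integrable_dirac (by simp)).smul_measure ENNReal.ofReal_ne_top
  rw [indexLaw, integral_add_measure (integrable_finsetSum_measure.2 fun l _ => hi _ _) (hi _ _),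
    integral_finsetSum_measure fun l _ => hi _ _]
  simp only [integral_smul_measure, integral_dirac, ENNReal.toReal_ofReal (abs_nonneg _)]
  rw [← krivineTail, ENNReal.toReal_ofReal (krivineTail_nonneg L)]
  simp

/-! ### The uniform shift -/

/-- The uniform law on `[-π, π]`. -/
def shiftLaw : Measure ℝ := ProbabilityTheory.cond volume (Set.Icc (-Real.pi) Real.pi)

instance : IsProbabilityMeasure shiftLaw := by
  refine ProbabilityTheory.cond_isProbabilityMeasure_of_finite ?_ ?_
  · simp [Real.pi_pos]
  · simp

theorem integral_shiftLaw (g : ℝ → ℝ) :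
    ∫ t, g t ∂shiftLaw = 1 / (2 * Real.pi) * ∫ t in (-Real.pi)..Real.pi, g t := by
  have hp := Real.pi_pos
  rw [shiftLaw, ProbabilityTheory.cond, integral_smul_measure, Real.volume_Icc,
    ← ENNReal.ofReal_inv_of_pos (by linarith), ENNReal.toReal_ofReal
    (by rw [inv_nonneg]; linarith), intervalIntegral.integral_of_le (by linarith),
    integral_Icc_eq_integral_Ioc, smul_eq_mul]
  congr 1
  rw [one_div]; congr 1; ring

section

variable {n : ℕ} (R : Selection n) (M : Tensor n) {A B : Matrix (Fin n) (Fin n) ℂ}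

/-- The coefficient of `λ_j μ_k` in `M(A', B')`. -/
def eigForm (A B : Matrix (Fin n) (Fin n) ℂ) (j k : Fin n) : ℂ :=
  form M (conjDiag (R.vec A) (Pi.single j 1)) (conjDiag (R.vec B) (Pi.single k 1))

/-- The spectral projections are Hermitian matrices, and a Hermitian tensor is real on such pairs.
-/
theorem eigForm_real (hM : M.IsHerm) (A B : Matrix (Fin n) (Fin n) ℂ) (j k : Fin n) :
    star (eigForm R M A B j k) = eigForm R M A B j k := by
  have h : ∀ (V : Matrix (Fin n) (Fin n) ℂ) (j : Fin n),
      (conjDiag V (Pi.single j 1)).IsHermitian := fun V j => by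
    rw [Matrix.IsHermitian, conjTranspose_conjDiag]
    congr 1
    ext i
    by_cases hi : i = j
    · subst hi; simp
    · simp [Pi.single_eq_of_ne hi]
  exact star_form_of_isHerm hM (h _ _) (h _ _)

theorem form_roundEig (c c' : ℂ → ℝ) :
    form M (roundEig R c A) (roundEig R c' B) = ∑ j, ∑ k,
      ((c (Complex.exp (Complex.I * R.ang A j)) * c' (Complex.exp (Complex.I * R.ang B k)) : ℝ) : ℂ)
        * eigForm R M A B j k := by
  rw [roundEig_eq, roundEig_eq, form_conjDiag]
  simp only [Complex.star_def, Complex.conj_ofReal, Complex.ofReal_mul]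
  rfl

theorem form_eq_sum_eigForm (hA : A ∈ Matrix.unitaryGroup (Fin n) ℂ)
    (hB : B ∈ Matrix.unitaryGroup (Fin n) ℂ) :
    form M A B = ∑ j, ∑ k, Complex.exp (Complex.I * ((R.ang A j - R.ang B k : ℝ) : ℂ))
      * eigForm R M A B j k := by
  have h1 : A = conjDiag (R.vec A) fun j => Complex.exp (Complex.I * R.ang A j) :=
    R.spectral A hA
  have h2 : B = conjDiag (R.vec B) fun j => Complex.exp (Complex.I * R.ang B j) :=
    R.spectral B hB
  conv_lhs => rw [h1, h2]
  rw [form_conjDiag]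
  refine Finset.sum_congr rfl fun j _ => Finset.sum_congr rfl fun k _ => ?_
  rw [eigForm, Complex.star_def, ← Complex.exp_conj, ← Complex.exp_add]
  congr 2
  simp only [map_mul, Complex.conj_I, Complex.conj_ofReal]
  push_cast; ring

/-- The contribution of the frequency `m`. -/
def freqForm (A B : Matrix (Fin n) (Fin n) ℂ) (m : ℕ) : ℂ :=
  ∑ j, ∑ k, ((krivineK (m * (R.ang A j - R.ang B k)) : ℝ) : ℂ) * eigForm R M A B j k

/-- With real coefficients, taking real parts turns exponentials into cosines. This is the purpose
of the phase that makes M(A, B) real. -/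
theorem sum_cos_mul_eigForm (hM : M.IsHerm) (hA : A ∈ Matrix.unitaryGroup (Fin n) ℂ)
    (hB : B ∈ Matrix.unitaryGroup (Fin n) ℂ) (him : (form M A B).im = 0) :
    ∑ j, ∑ k, (Real.cos (R.ang A j - R.ang B k) : ℂ) * eigForm R M A B j k = form M A B := by
  have hre : form M A B = ((form M A B).re : ℂ) :=
    Complex.ext (Complex.ofReal_re _).symm (him.trans (Complex.ofReal_im _).symm)
  conv_rhs => rw [hre, form_eq_sum_eigForm R M hA hB, Complex.re_sum, Complex.ofReal_sum]
  refine Finset.sum_congr rfl fun j _ => ?_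
  rw [Complex.re_sum, Complex.ofReal_sum]
  refine Finset.sum_congr rfl fun k _ => ?_
  have hreal : eigForm R M A B j k = ((eigForm R M A B j k).re : ℂ) := by
    have := eigForm_real R M hM A B j k
    rw [Complex.star_def, Complex.conj_eq_iff_re] at this
    exact this.symm
  rw [hreal, Complex.re_mul_ofReal, mul_comm Complex.I, Complex.exp_ofReal_mul_I_re,
    Complex.ofReal_mul]

theorem krivineB_mul_freqForm (m : ℕ) : (krivineB m : ℂ) * freqForm R M A B m = ∑ j, ∑ k,
    ((krivineB m * krivineK (m * (R.ang A j - R.ang B k)) : ℝ) : ℂ) * eigForm R M A B j k := by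
  rw [freqForm, Finset.mul_sum]
  refine Finset.sum_congr rfl fun j _ => ?_
  rw [Finset.mul_sum]
  refine Finset.sum_congr rfl fun k _ => ?_
  rw [← mul_assoc, ← Complex.ofReal_mul]

/-- Krivine's identity for each difference δ = θ_j - φ_k, combined with the coefficients `eigForm`.
-/
theorem hasSum_freqForm (hM : M.IsHerm) (hA : A ∈ Matrix.unitaryGroup (Fin n) ℂ)
    (hB : B ∈ Matrix.unitaryGroup (Fin n) ℂ) (him : (form M A B).im = 0) :
    HasSum (fun l : ℕ => (krivineB (2 * l + 1) : ℂ) * freqForm R M A B (2 * l + 1))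
      (((√2 / 2 : ℝ) : ℂ) * form M A B) := by
  have h1 : HasSum (fun m : ℕ => (krivineB m : ℂ) * freqForm R M A B m)
      (((√2 / 2 : ℝ) : ℂ) * form M A B) := by
    rw [← sum_cos_mul_eigForm R M hM hA hB him, Finset.mul_sum]
    simp only [krivineB_mul_freqForm, Finset.mul_sum]
    refine hasSum_sum fun j _ => hasSum_sum fun k _ => ?_
    rw [← mul_assoc, ← Complex.ofReal_mul]
    exact HasSum.mul_right (eigForm R M A B j k)
      (Complex.hasSum_ofReal.2 (hasSum_krivineB_mul_krivineK (R.ang A j - R.ang B k)))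
  refine hasSum_odd_of_even_zero
    (f := fun m : ℕ => (krivineB m : ℂ) * freqForm R M A B m) h1 fun m hm => ?_
  rw [krivineB_even hm, Complex.ofReal_zero, zero_mul]

theorem integrable_bounded {α : Type*} [MeasurableSpace α] {μ : Measure α} [IsFiniteMeasure μ]
    {f : α → ℂ} (hf : Measurable f) {C : ℝ} (h : ∀ x, ‖f x‖ ≤ C) : Integrable f μ :=
  Integrable.of_bound hf.aestronglyMeasurable C (Filter.Eventually.of_forall h)

/-- The value of the rounded pair. -/
def pairForm (A B : Matrix (Fin n) (Fin n) ℂ) (p : ℝ × ℤ) : ℂ :=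
  form M (roundEig R (krivineLam p.1 p.2) A) (roundEig R (krivineMu p.1 p.2) B)

theorem pairForm_of_neg {t : ℝ} {l : ℤ} (h : l < 0) : pairForm R M A B (t, l) = 0 := by
  have : krivineLam t l = fun _ => 0 := funext fun x => krivineLam_of_neg t h x
  rw [pairForm, form_roundEig]
  simp [this]

theorem pairForm_natCast (t : ℝ) (l : ℕ) : pairForm R M A B (t, l) =
    ∑ j, ∑ k, ((Real.sign (krivineB (2 * l + 1)) *
      (krivineF ((2 * l + 1 : ℕ) * R.ang A j - t) * krivineG (t - (2 * l + 1 : ℕ) *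
          R.ang B k)) : ℝ) : ℂ)
        * eigForm R M A B j k := by
  rw [pairForm, form_roundEig]
  refine Finset.sum_congr rfl fun j _ => Finset.sum_congr rfl fun k _ => ?_
  have hn : ∀ θ : ℝ, ‖Complex.exp (Complex.I * θ)‖ = 1 := fun θ => by simp [Complex.norm_exp]
  dsimp only
  rw [krivineLam_natCast _ _ (hn _), krivineMu_natCast _ _ (hn _), turn_exp, turn_exp, krivineF_eq,
    krivineG, ← Real.cos_neg (t - _), neg_sub, mul_assoc]

theorem measurable_krivineG : Measurable krivineG := by
  unfold krivineG
  exact measurable_sign.comp Real.measurable_cos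

theorem measurable_pairForm : Measurable (pairForm R M A B) := by
  refine measurable_from_prod_countable_left fun l => ?_
  rcases lt_or_ge l 0 with h | h
  · simp_rw [pairForm_of_neg R M h]
    exact measurable_const
  · obtain ⟨l, rfl⟩ := Int.eq_ofNat_of_zero_le h
    simp_rw [pairForm_natCast]
    refine Finset.measurable_sum _ fun j _ => Finset.measurable_sum _ fun k _ => ?_
    refine Measurable.mul_const ?_ _
    refine Complex.measurable_ofReal.comp (Measurable.const_mul ?_ _)
    exact (continuous_krivineF.measurable.comp (by fun_prop)).mul
      (measurable_krivineG.comp (by fun_prop))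

theorem norm_pairForm_le (hA : A ∈ Matrix.unitaryGroup (Fin n) ℂ)
    (hB : B ∈ Matrix.unitaryGroup (Fin n) ℂ) (p : ℝ × ℤ) : ‖pairForm R M A B p‖ ≤ sdp M :=
  norm_form_roundEig_le R M (abs_krivineLam_le _ _) (abs_krivineMu_le _ _) hA hB

theorem integral_pairForm_natCast (l : ℕ) :
    ∫ t, pairForm R M A B (t, l) ∂shiftLaw
      = (Real.sign (krivineB (2 * l + 1)) : ℂ) * freqForm R M A B (2 * l + 1) := by
  simp_rw [pairForm_natCast]
  have hm : ∀ j k, Measurable fun t : ℝ => Real.sign (krivineB (2 * l + 1)) *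
      (krivineF ((2 * l + 1 : ℕ) * R.ang A j - t) * krivineG (t - (2 * l + 1 : ℕ) * R.ang B k)) :=
    fun j k => Measurable.const_mul ((continuous_krivineF.measurable.comp (by fun_prop)).mul
      (measurable_krivineG.comp (by fun_prop))) _
  have hb : ∀ j k t, |Real.sign (krivineB (2 * l + 1)) *
      (krivineF ((2 * l + 1 : ℕ) * R.ang A j - t) * krivineG (t - (2 * l + 1 : ℕ) *
          R.ang B k))| ≤ 1 :=
    fun j k t => by
      rw [abs_mul, abs_mul]
      exact mul_le_one₀ (abs_sign_le _) (by positivity)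
        (mul_le_one₀ (abs_krivineF_le _) (abs_nonneg _) (abs_sign_le _))
  have hi : ∀ j k, Integrable (fun t : ℝ => ((Real.sign (krivineB (2 * l + 1)) *
      (krivineF ((2 * l + 1 : ℕ) * R.ang A j - t) * krivineG (t - (2 * l + 1 : ℕ) *
          R.ang B k)) : ℝ) : ℂ)
        * eigForm R M A B j k) shiftLaw := fun j k =>
    (integrable_bounded (Complex.measurable_ofReal.comp (hm j k)) (C := 1) fun t => by
      rw [Function.comp_apply, Complex.norm_real]; exact hb j k t).mul_const _
  rw [integral_finsetSum _ fun j _ => integrable_finsetSum _ fun k _ => hi j k, freqForm,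
    Finset.mul_sum]
  refine Finset.sum_congr rfl fun j _ => ?_
  rw [integral_finsetSum _ fun k _ => hi j k, Finset.mul_sum]
  refine Finset.sum_congr rfl fun k _ => ?_
  rw [integral_mul_const, integral_complex_ofReal, ← mul_assoc, ← Complex.ofReal_mul,
      integral_const_mul,
    integral_shiftLaw, integral_krivineF_mul_krivineG, ← mul_sub]
  congr 3
  have := Real.pi_ne_zero
  field_simp

theorem sign_mul_abs (x : ℝ) : |x| * Real.sign x = x := by
  rcases lt_trichotomy x 0 with h | rfl | h
  · rw [Real.sign_of_neg h, abs_of_neg h]; ring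
  · simp
  · rw [Real.sign_of_pos h, abs_of_pos h]; ring

/-- Up to the sign of b_m, the contribution of a frequency is an expectation of values on pairs of
contractions, and each of these is at most `sdp M`. -/
theorem norm_krivineB_mul_freqForm_le (hA : A ∈ Matrix.unitaryGroup (Fin n) ℂ)
    (hB : B ∈ Matrix.unitaryGroup (Fin n) ℂ) (l : ℕ) :
    ‖(krivineB (2 * l + 1) : ℂ) * freqForm R M A B (2 * l + 1)‖
      ≤ |krivineB (2 * l + 1)| * sdp M := by
  rw [← sign_mul_abs (krivineB (2 * l + 1)), Complex.ofReal_mul, mul_assoc,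
    ← integral_pairForm_natCast, norm_mul, Complex.norm_real, sign_mul_abs, Real.norm_eq_abs,
    abs_abs]
  refine mul_le_mul_of_nonneg_left ?_ (abs_nonneg _)
  refine (norm_integral_le_of_norm_le_const (Filter.Eventually.of_forall fun t =>
        norm_pairForm_le R M hA hB (t, l))).trans ?_
  simp

theorem integral_pairForm (hA : A ∈ Matrix.unitaryGroup (Fin n) ℂ)
    (hB : B ∈ Matrix.unitaryGroup (Fin n) ℂ) (L : ℕ) :
    ∫ p, pairForm R M A B p ∂(shiftLaw.prod (indexLaw L)) =
      ∑ l ∈ Finset.range (L + 1), (krivineB (2 * l + 1) : ℂ) * freqForm R M A B (2 * l + 1) := by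
  have hm := measurable_pairForm R M (A := A) (B := B)
  rw [integral_prod _ (integrable_bounded hm (norm_pairForm_le R M hA hB))]
  simp_rw [integral_indexLaw, pairForm_of_neg R M (show (-1 : ℤ) < 0 by norm_num), mul_zero,
    add_zero]
  have hi : ∀ l : ℤ, Integrable (fun t => pairForm R M A B (t, l)) shiftLaw := fun l =>
    integrable_bounded (hm.comp (measurable_id.prodMk measurable_const))
      fun t => norm_pairForm_le R M hA hB (t, l)
  rw [integral_finsetSum _ fun (l : ℕ) _ => (hi l).const_mul _]
  refine Finset.sum_congr rfl fun l _ => ?_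
  rw [integral_const_mul, integral_pairForm_natCast, ← mul_assoc, ← Complex.ofReal_mul,
    sign_mul_abs]

/-- The two-dimensional rounding of a pair of unitary matrices with a real value. -/
theorem le_norm_integral_pairForm (hM : M.IsHerm) (hA : A ∈ Matrix.unitaryGroup (Fin n) ℂ)
    (hB : B ∈ Matrix.unitaryGroup (Fin n) ℂ) (him : (form M A B).im = 0) (L : ℕ) :
    √2 / 2 * ‖form M A B‖ - krivineTail L * sdp M ≤
      ‖∫ p, pairForm R M A B p ∂(shiftLaw.prod (indexLaw L))‖ := by
  rw [integral_pairForm R M hA hB]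
  have h := hasSum_freqForm R M hM hA hB him
  set g : ℕ → ℂ := fun l => (krivineB (2 * l + 1) : ℂ) * freqForm R M A B (2 * l + 1) with hg
  have hle : ∀ l, ‖g l‖ ≤ |krivineB (2 * l + 1)| * sdp M := norm_krivineB_mul_freqForm_le R M hA hB
  have hs := h.summable.sum_add_tsum_nat_add (L + 1)
  rw [h.tsum_eq] at hs
  -- The index -1 outputs zero, so truncation drops exactly this tail of the series.
  have htail : ‖∑' l, g (l + (L + 1))‖ ≤ krivineTail L * sdp M := by
    refine tsum_of_norm_bounded (g := fun l => |krivineB (2 * (L + 1 + l) + 1)| * sdp M) ?_ ?_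
    · exact ((summable_abs_krivineB_odd (L + 1)).hasSum).mul_right _
    · intro l; rw [add_comm l]; exact hle _
  have h2 : ‖((√2 / 2 : ℝ) : ℂ) * form M A B‖ = √2 / 2 * ‖form M A B‖ := by
    rw [norm_mul, Complex.norm_real, Real.norm_of_nonneg (by positivity)]
  rw [← h2, ← hs]
  have := norm_add_le (∑ l ∈ Finset.range (L + 1), g l) (∑' l, g (l + (L + 1)))
  linarith

end

end NCG

end

noncomputable section

namespace NCG

open MeasureTheory
open scoped ComplexOrder Matrix

/-! ### The rounded matrices as functions of a Hermitian matrix -/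

section

variable {n : ℕ}

/-- The Hermitian part of `e^{-it} A^m`. -/
def turnMat (m : ℕ) (t : ℝ) (A : Matrix (Fin n) (Fin n) ℂ) : Matrix (Fin n) (Fin n) ℂ :=
  (1 / 2 : ℂ) • (Complex.exp (-(Complex.I * t)) • A ^ m + (Complex.exp (-(Complex.I * t)) • A ^ m)ᴴ)

theorem turnMat_conjDiag (m : ℕ) (t : ℝ) {V : Matrix (Fin n) (Fin n) ℂ}
    (hV : V ∈ Matrix.unitaryGroup (Fin n) ℂ) (a : Fin n → ℂ) :
    turnMat m t (conjDiag V a) = conjDiag V fun j => (turn m t (a j) : ℂ) := by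
  rw [turnMat, conjDiag_pow hV, smul_conjDiag, conjTranspose_conjDiag, conjDiag_add, smul_conjDiag]
  congr 1
  ext j
  rw [turn, Complex.re_eq_add_conj, mul_comm (a j ^ m), Complex.star_def]
  ring

/-- A function of the cosines of the rotated eigenangles is a function of the Hermitian matrix
`turnMat`. The right side no longer mentions `R`, which gives both measurability for arbitrary
selections and a way to compute the output. -/
theorem roundEig_turn (R : Selection n) (φ : ℝ → ℝ) (m : ℕ) (t : ℝ)
    {A : Matrix (Fin n) (Fin n) ℂ} (hA : A ∈ Matrix.unitaryGroup (Fin n) ℂ) :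
    roundEig R (fun x => φ (turn m t x)) A = hermFun (fun σ => (φ σ : ℂ)) (turnMat m t A) := by
  conv_rhs => rw [show A = conjDiag (R.vec A) _ from R.spectral A hA,
    turnMat_conjDiag m t (R.vec_unitary A hA), hermFun_conjDiag _ (R.vec_unitary A hA)]
  rfl

theorem roundEig_congr (R : Selection n) {c c' : ℂ → ℝ} (h : ∀ x, ‖x‖ = 1 → c x = c' x)
    (A : Matrix (Fin n) (Fin n) ℂ) : roundEig R c A = roundEig R c' A := by
  rw [roundEig_eq, roundEig_eq]
  congr 1
  ext j
  rw [h _ (by simp [Complex.norm_exp])]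

theorem roundEig_krivineLam (R : Selection n) (t : ℝ) (l : ℕ) {A : Matrix (Fin n) (Fin n) ℂ}
    (hA : A ∈ Matrix.unitaryGroup (Fin n) ℂ) :
    roundEig R (krivineLam t l) A =
      hermFun (fun σ => ((Real.sign (krivineB (2 * l + 1)) * krivinePhi σ : ℝ) : ℂ))
        (turnMat (2 * l + 1) t A) := by
  rw [← roundEig_turn R _ _ _ hA]
  exact roundEig_congr R (fun x hx => krivineLam_natCast t l hx) A

theorem roundEig_krivineMu (R : Selection n) (t : ℝ) (l : ℕ) {A : Matrix (Fin n) (Fin n) ℂ}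
    (hA : A ∈ Matrix.unitaryGroup (Fin n) ℂ) :
    roundEig R (krivineMu t l) A =
      hermFun (fun σ => (Real.sign σ : ℂ)) (turnMat (2 * l + 1) t A) := by
  rw [← roundEig_turn R _ _ _ hA]
  exact roundEig_congr R (fun x hx => krivineMu_natCast t l hx) A

theorem roundEig_krivineLam_neg (R : Selection n) (t : ℝ) {l : ℤ} (h : l < 0)
    (A : Matrix (Fin n) (Fin n) ℂ) : roundEig R (krivineLam t l) A = 0 := by
  ext i j
  rw [roundEig_eq, conjDiag_apply]
  simp [krivineLam_of_neg t h]

theorem roundEig_krivineMu_neg (R : Selection n) (t : ℝ) {l : ℤ} (h : l < 0)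
    (A : Matrix (Fin n) (Fin n) ℂ) : roundEig R (krivineMu t l) A = 0 := by
  ext i j
  rw [roundEig_eq, conjDiag_apply]
  simp [krivineMu_of_neg t h]

theorem turnMat_eq_conjDiag (m : ℕ) (t : ℝ) {A : Matrix (Fin n) (Fin n) ℂ}
    (hA : A ∈ Matrix.unitaryGroup (Fin n) ℂ) :
    ∃ V ∈ Matrix.unitaryGroup (Fin n) ℂ, ∃ a : Fin n → ℝ, (∀ j, a j ∈ Set.Icc (-1) 1) ∧
      turnMat m t A = conjDiag V fun j => (a j : ℂ) := by
  obtain ⟨V, hV, θ, h⟩ := exists_unitary_diagonalization hA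
  refine ⟨V, hV, _, fun j => ?_, by rw [h, turnMat_conjDiag m t hV]⟩
  rw [turn_exp]
  exact ⟨Real.neg_one_le_cos _, Real.cos_le_one _⟩

end

/-! ### Measurability -/

/-- `φ` is a pointwise limit of polynomials on `[-1, 1]`. -/
def IsPolyLimit (φ : ℝ → ℝ) : Prop :=
  ∃ p : ℕ → Polynomial ℝ, ∀ x ∈ Set.Icc (-1 : ℝ) 1,
    Filter.Tendsto (fun N => (p N).eval x) Filter.atTop (nhds (φ x))

/-- Weierstrass approximation of `ψ N` on [-1, 1] with error 1/(N + 1). -/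
theorem isPolyLimit_of_tendsto {φ : ℝ → ℝ} (ψ : ℕ → ℝ → ℝ) (hc : ∀ N, Continuous (ψ N))
    (h : ∀ x, Filter.Tendsto (fun N => ψ N x) Filter.atTop (nhds (φ x))) : IsPolyLimit φ := by
  choose p hp using fun N : ℕ => exists_polynomial_near_of_continuousOn (-1) 1 (ψ N)
    (hc N).continuousOn (1 / ((N : ℝ) + 1)) (by positivity)
  refine ⟨p, fun x hx => ?_⟩
  have h1 : Filter.Tendsto (fun N => (p N).eval x - ψ N x) Filter.atTop (nhds 0) :=
    squeeze_zero_norm (fun N => (hp N x hx).le) tendsto_one_div_add_atTop_nhds_zero_nat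
  simpa using h1.add (h x)

theorem isPolyLimit_krivinePhi (c : ℝ) : IsPolyLimit fun σ => c * krivinePhi σ :=
  isPolyLimit_of_tendsto (fun _ σ => c * krivinePhi σ)
    (fun _ => continuous_const.mul continuous_krivinePhi) fun _ => tendsto_const_nhds

/-- The sign is discontinuous but a pointwise limit of truncated linear functions; this is why
pointwise convergence is all that is asked for. -/
theorem isPolyLimit_sign : IsPolyLimit Real.sign := by
  refine isPolyLimit_of_tendsto (fun N x => max (-1) (min (N * x) 1)) (fun N => by fun_prop)
    fun x => ?_
  rcases lt_trichotomy x 0 with h | rfl | h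
  · rw [Real.sign_of_neg h]
    refine tendsto_const_nhds.congr' ?_
    obtain ⟨N₀, hN₀⟩ := exists_nat_gt (1 / (-x))
    filter_upwards [Filter.eventually_ge_atTop N₀] with N hN
    have : 1 < (N₀ : ℝ) * (-x) := (div_lt_iff₀ (by linarith)).1 hN₀
    have h2 : (N₀ : ℝ) ≤ N := by exact_mod_cast hN
    have h3 : (N : ℝ) * x ≤ -1 := by nlinarith
    exact (max_eq_left ((min_le_left _ _).trans h3)).symm
  · simp
  · rw [Real.sign_of_pos h]
    refine tendsto_const_nhds.congr' ?_
    obtain ⟨N₀, hN₀⟩ := exists_nat_gt (1 / x)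
    filter_upwards [Filter.eventually_ge_atTop N₀] with N hN
    have : 1 < (N₀ : ℝ) * x := (div_lt_iff₀ h).1 hN₀
    have h2 : (N₀ : ℝ) ≤ N := by exact_mod_cast hN
    have h3 : 1 ≤ (N : ℝ) * x := by nlinarith
    rw [min_eq_right h3, max_eq_right (by norm_num)]

section

variable {n : ℕ} {α : Type*} [MeasurableSpace α]

/-- All entries of a matrix-valued function are measurable. -/
def EntryMeasurable (A : α → Matrix (Fin n) (Fin n) ℂ) : Prop :=
  ∀ i j, Measurable fun x => A x i j

namespace EntryMeasurable

variable {A B : α → Matrix (Fin n) (Fin n) ℂ}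

theorem const (A : Matrix (Fin n) (Fin n) ℂ) : EntryMeasurable fun _ : α => A :=
  fun _ _ => measurable_const

theorem add (hA : EntryMeasurable A) (hB : EntryMeasurable B) :
    EntryMeasurable fun x => A x + B x := fun i j => (hA i j).add (hB i j)

theorem mul (hA : EntryMeasurable A) (hB : EntryMeasurable B) :
    EntryMeasurable fun x => A x * B x := fun i j => by
  simp only [Matrix.mul_apply]
  exact Finset.measurable_sum _ fun k _ => (hA i k).mul (hB k j)

theorem smul {c : α → ℂ} (hc : Measurable c) (hA : EntryMeasurable A) :
    EntryMeasurable fun x => c x • A x := fun i j => hc.mul (hA i j)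

theorem conjTranspose (hA : EntryMeasurable A) : EntryMeasurable fun x => (A x)ᴴ := fun i j =>
  continuous_star.measurable.comp (hA j i)

theorem pow (hA : EntryMeasurable A) (m : ℕ) : EntryMeasurable fun x => A x ^ m := by
  induction m with
  | zero => simpa only [pow_zero] using const 1
  | succ m ih => simpa only [pow_succ] using ih.mul hA

theorem comp (hA : EntryMeasurable A) {β : Type*} [MeasurableSpace β] {f : β → α}
    (hf : Measurable f) : EntryMeasurable fun x => A (f x) := fun i j => (hA i j).comp hf

theorem form (M : Tensor n) (hA : EntryMeasurable A) (hB : EntryMeasurable B) :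
    Measurable fun x => NCG.form M (A x) (B x) := by
  unfold NCG.form
  exact Finset.measurable_sum _ fun i _ => Finset.measurable_sum _ fun j _ =>
    Finset.measurable_sum _ fun k _ => Finset.measurable_sum _ fun l _ =>
      ((hA i j).mul (continuous_star.measurable.comp (hB k l))).const_mul _

theorem turnMat (hA : EntryMeasurable A) {t : α → ℝ} (ht : Measurable t) (m : ℕ) :
    EntryMeasurable fun x => NCG.turnMat m (t x) (A x) := by
  have hc : Measurable fun x => Complex.exp (-(Complex.I * t x)) := by fun_prop
  have h := smul hc (hA.pow m)
  exact smul measurable_const (h.add h.conjTranspose)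

end EntryMeasurable

/-- A polynomial with real coefficients applied to a matrix. -/
def polyMat (p : Polynomial ℝ) (A : Matrix (Fin n) (Fin n) ℂ) : Matrix (Fin n) (Fin n) ℂ :=
  p.sum fun k c => (c : ℂ) • A ^ k

theorem EntryMeasurable.polyMat {A : α → Matrix (Fin n) (Fin n) ℂ} (hA : EntryMeasurable A)
    (p : Polynomial ℝ) : EntryMeasurable fun x => NCG.polyMat p (A x) := fun i j => by
  simp only [NCG.polyMat, Polynomial.sum, Matrix.sum_apply]
  exact Finset.measurable_sum _ fun k _ => smul measurable_const (hA.pow k) i j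

theorem polyMat_conjDiag_apply (p : Polynomial ℝ) {V : Matrix (Fin n) (Fin n) ℂ}
    (hV : V ∈ Matrix.unitaryGroup (Fin n) ℂ) (a : Fin n → ℝ) :
    polyMat p (conjDiag V fun j => (a j : ℂ)) = conjDiag V fun j => ((p.eval (a j) : ℝ) : ℂ) := by
  ext i j
  simp only [polyMat, Polynomial.sum, Matrix.sum_apply, conjDiag_pow hV, smul_conjDiag,
    conjDiag_apply, Polynomial.eval_eq_sum]
  rw [Finset.sum_comm]
  refine Finset.sum_congr rfl fun k _ => ?_
  push_cast
  rw [Finset.mul_sum, Finset.sum_mul]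

/-- The eigenvectors used by `hermFun` need not depend measurably on the matrix. Polynomials of a
matrix do, and diagonalising shows that they converge entrywise to the function. -/
theorem EntryMeasurable.hermFun {H : α → Matrix (Fin n) (Fin n) ℂ} (hH : EntryMeasurable H)
    (hd : ∀ x, ∃ V ∈ Matrix.unitaryGroup (Fin n) ℂ, ∃ a : Fin n → ℝ,
      (∀ j, a j ∈ Set.Icc (-1) 1) ∧ H x = conjDiag V fun j => (a j : ℂ))
    {φ : ℝ → ℝ} (hφ : IsPolyLimit φ) :
    EntryMeasurable fun x => NCG.hermFun (fun σ => (φ σ : ℂ)) (H x) := fun i j => by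
  obtain ⟨p, hp⟩ := hφ
  refine measurable_of_tendsto_metrizable (fun N => hH.polyMat (p N) i j)
    (tendsto_pi_nhds.2 fun x => ?_)
  obtain ⟨V, hV, a, ha, h⟩ := hd x
  simp_rw [h, polyMat_conjDiag_apply _ hV, hermFun_conjDiag _ hV, conjDiag_apply]
  refine tendsto_finsetSum _ fun k _ => ((Filter.Tendsto.const_mul _ ?_).mul_const _)
  exact (Complex.continuous_ofReal.tendsto _).comp (hp _ (ha k))

theorem EntryMeasurable.roundEig_krivineLam (R : Selection n) {A : α → Matrix (Fin n) (Fin n) ℂ}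
    (hA : EntryMeasurable A) (hu : ∀ x, A x ∈ Matrix.unitaryGroup (Fin n) ℂ) {t : α → ℝ}
    (ht : Measurable t) (l : ℤ) :
    EntryMeasurable fun x => roundEig R (krivineLam (t x) l) (A x) := by
  rcases lt_or_ge l 0 with h | h
  · simp_rw [roundEig_krivineLam_neg R _ h]
    exact const 0
  · obtain ⟨l, rfl⟩ := Int.eq_ofNat_of_zero_le h
    simp_rw [NCG.roundEig_krivineLam R _ l (hu _)]
    exact (hA.turnMat ht _).hermFun (fun x => turnMat_eq_conjDiag _ _ (hu x))
      (isPolyLimit_krivinePhi _)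

theorem EntryMeasurable.roundEig_krivineMu (R : Selection n) {A : α → Matrix (Fin n) (Fin n) ℂ}
    (hA : EntryMeasurable A) (hu : ∀ x, A x ∈ Matrix.unitaryGroup (Fin n) ℂ) {t : α → ℝ}
    (ht : Measurable t) (l : ℤ) :
    EntryMeasurable fun x => roundEig R (krivineMu (t x) l) (A x) := by
  rcases lt_or_ge l 0 with h | h
  · simp_rw [roundEig_krivineMu_neg R _ h]
    exact const 0
  · obtain ⟨l, rfl⟩ := Int.eq_ofNat_of_zero_le h
    simp_rw [NCG.roundEig_krivineMu R _ l (hu _)]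
    exact (hA.turnMat ht _).hermFun (fun x => turnMat_eq_conjDiag _ _ (hu x)) isPolyLimit_sign

end

/-! ### The procedure -/

theorem measurable_phase : Measurable phase := by
  unfold phase
  refine Measurable.ite (measurableSet_eq_fun (by fun_prop) measurable_const) measurable_const ?_
  exact continuous_star.measurable.div (by fun_prop)

theorem norm_phase (w : ℂ) : ‖phase w‖ = 1 := by
  unfold phase
  split_ifs with h
  · simp
  · have : w ≠ 0 := fun h0 => h (by simp [h0])
    simp [this]

theorem phase_mul_im (w : ℂ) : (phase w * w).im = 0 := by
  unfold phase
  split_ifs with h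
  · simpa using h
  · rw [div_mul_eq_mul_div, Complex.star_def, ← Complex.normSq_eq_conj_mul_self,
      ← Complex.ofReal_div, Complex.ofReal_im]

section

variable {n d : ℕ} (R : Selection n) (M : Tensor n) (X Y : VMat n d)

theorem entryMeasurable_complexRound (z : Fin d → Fin 4) (s : Bool) :
    EntryMeasurable fun t => complexRound R X z s t := fun i j => by
  simp_rw [complexRound_eq, Matrix.mul_apply, conjDiag_apply]
  refine (continuous_finsetSum _ fun k _ => continuous_const.mul ?_).measurable
  exact continuous_finsetSum _ fun l _ =>
    (continuous_const.mul (continuous_imPow s _)).mul continuous_const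

theorem unitaryPair_fst_mem (ω : Seed d) :
    (unitaryPair R M X Y ω).1 ∈ Matrix.unitaryGroup (Fin n) ℂ := by
  have h := complexRound_mem R X ω.1 ω.2.1.1 ω.2.2.1
  have hp := norm_phase (form M (complexRound R X ω.1 ω.2.1.1 ω.2.2.1)
    (complexRound R Y ω.1 ω.2.1.2 (-ω.2.2.1)))
  change phase _ • complexRound R X ω.1 ω.2.1.1 ω.2.2.1 ∈ _
  rw [Matrix.mem_unitaryGroup_iff] at h ⊢
  rw [star_smul, Matrix.smul_mul, Matrix.mul_smul, h, smul_smul, Complex.star_def, Complex.mul_conj,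
    Complex.normSq_eq_norm_sq, hp]
  simp

theorem unitaryPair_snd_mem (ω : Seed d) :
    (unitaryPair R M X Y ω).2 ∈ Matrix.unitaryGroup (Fin n) ℂ :=
  complexRound_mem R Y ω.1 ω.2.1.2 (-ω.2.2.1)

theorem hermRound_properties (ω : Seed d) :
    (hermRound R M X Y ω).1.IsHermitian ∧ (hermRound R M X Y ω).2.IsHermitian ∧
      opNorm (hermRound R M X Y ω).1 ≤ 1 ∧ opNorm (hermRound R M X Y ω).2 ≤ 1 :=
  ⟨roundEig_isHermitian R _ _, roundEig_isHermitian R _ _,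
    opNorm_roundEig_le R (abs_krivineLam_le _ _) (unitaryPair_fst_mem R M X Y ω),
    opNorm_roundEig_le R (abs_krivineMu_le _ _) (unitaryPair_snd_mem R M X Y ω)⟩

theorem norm_form_hermRound_le (ω : Seed d) :
    ‖form M (hermRound R M X Y ω).1 (hermRound R M X Y ω).2‖ ≤ sdp M :=
  norm_form_roundEig_le R M (abs_krivineLam_le _ _) (abs_krivineMu_le _ _)
    (unitaryPair_fst_mem R M X Y ω) (unitaryPair_snd_mem R M X Y ω)

/-- The phases, the signs and the index take countably many values, so only the two real variables
matter. -/
theorem measurable_seed {f : Seed d → ℂ}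
    (h : ∀ z s l, Measurable fun q : ℝ × ℝ => f (z, s, q.1, q.2, l)) : Measurable f := by
  refine measurable_from_prod_countable_right fun z =>
    measurable_from_prod_countable_right fun s => ?_
  have h1 : Measurable fun q : (ℝ × ℝ) × ℤ => f (z, s, q.1.1, q.1.2, q.2) :=
    measurable_from_prod_countable_left fun l => h z s l
  exact h1.comp (MeasurableEquiv.prodAssoc.symm.measurable (α := ℝ × ℝ × ℤ))

theorem measurable_form_hermRound :
    Measurable fun ω => form M (hermRound R M X Y ω).1 (hermRound R M X Y ω).2 := by
  refine measurable_seed fun z s l => ?_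
  have hA := entryMeasurable_complexRound R X z s.1
  have hB := (entryMeasurable_complexRound R Y z s.2).comp measurable_neg
  have hP : EntryMeasurable fun q : ℝ × ℝ => (unitaryPair R M X Y (z, s, q.1, q.2, l)).1 :=
    (EntryMeasurable.smul (measurable_phase.comp (hA.form M hB)) hA).comp measurable_fst
  have hQ : EntryMeasurable fun q : ℝ × ℝ => (unitaryPair R M X Y (z, s, q.1, q.2, l)).2 :=
    hB.comp measurable_fst
  exact EntryMeasurable.form M
    (hP.roundEig_krivineLam R (fun _ => unitaryPair_fst_mem R M X Y _) measurable_snd l)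
    (hQ.roundEig_krivineMu R (fun _ => unitaryPair_snd_mem R M X Y _) measurable_snd l)

instance (L : ℕ) : IsProbabilityMeasure (seedLaw d L) := by
  have : IsProbabilityMeasure
      (ProbabilityTheory.cond volume (Set.Icc (-Real.pi) Real.pi) : Measure ℝ) :=
    inferInstanceAs (IsProbabilityMeasure shiftLaw)
  unfold seedLaw
  infer_instance

theorem integrable_form_hermRound (L : ℕ) :
    Integrable (fun ω => ‖form M (hermRound R M X Y ω).1 (hermRound R M X Y ω).2‖)
      (seedLaw d L) :=
  (integrable_bounded (measurable_form_hermRound R M X Y) (norm_form_hermRound_le R M X Y)).norm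

theorem integral_seedLaw {L : ℕ} {g : Seed d → ℝ} (hg : Integrable g (seedLaw d L)) :
    ∫ ω, g ω ∂seedLaw d L = 1 / (4 * 4 ^ d) * ∑ z, ∑ s : Bool × Bool, ∫ q : ℝ × ℝ × ℤ, g (z, s, q)
      ∂(sechLaw.prod (shiftLaw.prod (indexLaw L))) := by
  have hs : IsProbabilityMeasure (sechLaw.prod (shiftLaw.prod (indexLaw L))) := inferInstance
  unfold seedLaw at hg ⊢
  rw [← shiftLaw] at hg ⊢
  rw [integral_prod _ hg, PMF.integral_eq_sum, Finset.mul_sum]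
  refine Finset.sum_congr rfl fun z _ => ?_
  have hz : Integrable (fun y => g (z, y)) ((PMF.uniformOfFintype (Bool × Bool)).toMeasure.prod
      (sechLaw.prod (shiftLaw.prod (indexLaw L)))) := by
    -- Fubini gives integrability for almost every z only; as every z has positive mass, it holds
    -- for all of them.
    have := (integrable_prod_iff hg.1).1 hg |>.1
    rw [ae_iff] at this
    by_contra hcon
    have h0 := measure_mono_null (Set.singleton_subset_iff.2 hcon) this
    rw [PMF.toMeasure_apply_singleton _ _ (measurableSet_singleton z)] at h0
    simp at h0
  rw [integral_prod _ hz, PMF.integral_eq_sum]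
  simp only [PMF.uniformOfFintype_apply, smul_eq_mul, Fintype.card_fun, Fintype.card_fin,
    Fintype.card_prod, Fintype.card_bool, ← Finset.mul_sum]
  rw [← mul_assoc]
  congr 1
  simp

/-- For fixed phases, signs and t, the two-dimensional bound applies to the unitary pair, and
multiplying by a phase does not change |M(A, B)|. The triangle inequality for the average over t, z
and the signs then leads back to the complex rounding. -/
theorem le_integral_norm_form_hermRound {M : Tensor n} {X Y : VMat n d} (hM : M.IsHerm)
    (hX : X ∈ vUnitary n d) (hY : Y ∈ vUnitary n d) (L : ℕ) :
    √2 / 2 * (‖vform M X Y‖ - 1 / 2 * sdp M) - krivineTail L * sdp M ≤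
      ∫ ω, ‖form M (hermRound R M X Y ω).1 (hermRound R M X Y ω).2‖ ∂seedLaw d L := by
  rw [integral_seedLaw (integrable_form_hermRound R M X Y L)]
  set F : (Fin d → Fin 4) → Bool × Bool → ℝ → ℂ := fun z s t =>
    form M (complexRound R X z s.1 t) (complexRound R Y z s.2 (-t)) with hF
  have key : ∀ z s, √2 / 2 * ‖∫ t, F z s t ∂sechLaw‖ - krivineTail L * sdp M ≤
      ∫ q : ℝ × ℝ × ℤ, ‖form M (hermRound R M X Y (z, s, q)).1 (hermRound R M X Y (z, s, q)).2‖
        ∂(sechLaw.prod (shiftLaw.prod (indexLaw L))) := by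
    intro z s
    have hm : Measurable fun q : ℝ × ℝ × ℤ =>
        form M (hermRound R M X Y (z, s, q)).1 (hermRound R M X Y (z, s, q)).2 :=
      (measurable_form_hermRound R M X Y).comp (by fun_prop)
    have hi := (integrable_bounded (μ := sechLaw.prod (shiftLaw.prod (indexLaw L))) hm
      fun q => norm_form_hermRound_le R M X Y (z, s, q)).norm
    rw [integral_prod _ hi]
    have hFi : Integrable (F z s) sechLaw := integrable_form_complexRound R M X Y z s
    calc √2 / 2 * ‖∫ t, F z s t ∂sechLaw‖ - krivineTail L * sdp M
        ≤ √2 / 2 * (∫ t, ‖F z s t‖ ∂sechLaw) - krivineTail L * sdp M := by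
          gcongr
          exact norm_integral_le_integral_norm _
      _ = ∫ t, (√2 / 2 * ‖F z s t‖ - krivineTail L * sdp M) ∂sechLaw := by
          rw [integral_sub (hFi.norm.const_mul _) (integrable_const _), integral_const_mul]
          simp
      _ ≤ _ := by
          refine integral_mono ((hFi.norm.const_mul _).sub (integrable_const _))
            hi.integral_prod_left fun t => ?_
          -- The unitary pair does not depend on the last two random choices, which are set to 0.
          set P := unitaryPair R M X Y (z, s, t, 0, 0) with hP
          have h0 : form M P.1 P.2 = phase (F z s t) * F z s t := form_smul_left M _ _ _
          have h1 : ‖form M P.1 P.2‖ = ‖F z s t‖ := by rw [h0, norm_mul, norm_phase, one_mul]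
          have h2 := le_norm_integral_pairForm R M hM (unitaryPair_fst_mem R M X Y (z, s, t, 0, 0))
            (unitaryPair_snd_mem R M X Y (z, s, t, 0, 0)) (by rw [← hP, h0]; exact phase_mul_im _) L
          rw [← hP, h1] at h2
          exact h2.trans (norm_integral_le_integral_norm _)
  have hsum : ∑ z, ∑ s : Bool × Bool, (√2 / 2 * ‖∫ t, F z s t ∂sechLaw‖ - krivineTail L * sdp M) ≤
      ∑ z, ∑ s : Bool × Bool, ∫ q : ℝ × ℝ × ℤ,
        ‖form M (hermRound R M X Y (z, s, q)).1 (hermRound R M X Y (z, s, q)).2‖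
        ∂(sechLaw.prod (shiftLaw.prod (indexLaw L))) :=
    Finset.sum_le_sum fun z _ => Finset.sum_le_sum fun s _ => key z s
  have htri := le_norm_sum_integral_complexRound R M hX hY
  have htri2 : ‖∑ z, ∑ s : Bool × Bool, ∫ t, F z s t ∂sechLaw‖ ≤
      ∑ z, ∑ s : Bool × Bool, ‖∫ t, F z s t ∂sechLaw‖ :=
    (norm_sum_le _ _).trans (Finset.sum_le_sum fun z _ => norm_sum_le _ _)
  have h4 := htri.trans htri2
  simp only [Finset.sum_sub_distrib, ← Finset.mul_sum, Finset.sum_const, Finset.card_univ,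
    Fintype.card_fun, Fintype.card_fin, Fintype.card_prod, Fintype.card_bool, nsmul_eq_mul] at hsum
  have hc : (0 : ℝ) < 4 * 4 ^ d := by positivity
  rw [one_div (4 * 4 ^ d : ℝ), ← div_eq_inv_mul, le_div_iff₀ hc]
  refine le_trans ?_ hsum
  have h5 := mul_le_mul_of_nonneg_left h4 (show 0 ≤ √2 / 2 by positivity)
  push_cast
  linarith

/-- The choice of L makes the tail at most ε, and (√2/2)(1 - ε - 1/2) - ε is the stated factor. -/
theorem hermRound_guarantee {M : Tensor n} {X Y : VMat n d} {C : ℕ} (hC : IsTailConst C) {ε : ℝ}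
    (hM : M.IsHerm) (h0 : 0 < ε) (hX : X ∈ vUnitary n d) (hY : Y ∈ vUnitary n d)
    (h : (1 - ε) * sdp M ≤ ‖vform M X Y‖) :
    (1 / (2 * √2) - (1 + 1 / √2) * ε) * sdp M ≤
      ∫ ω, ‖form M (hermRound R M X Y ω).1 (hermRound R M X Y ω).2‖
        ∂seedLaw d ⌈(C : ℝ) / ε⌉₊ := by
  refine le_trans ?_ (le_integral_norm_form_hermRound R hM hX hY _)
  set L := ⌈(C : ℝ) / ε⌉₊ with hL
  have hCp : (0 : ℝ) < C := by exact_mod_cast hC.1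
  have hLC : (C : ℝ) / ε ≤ L := Nat.le_ceil _
  have hL0 : (0 : ℝ) < L := (div_pos hCp h0).trans_le hLC
  have htail : krivineTail L ≤ ε := by
    refine (hC.2.2 L (by exact_mod_cast hL0)).trans ?_
    rw [div_le_iff₀ hL0]
    rwa [div_le_iff₀' h0] at hLC
  have hs := sdp_nonneg M
  have h1 := mul_le_mul_of_nonneg_right htail hs
  have h2 := mul_le_mul_of_nonneg_left h (show 0 ≤ √2 / 2 by positivity)
  have e1 : 1 / √2 = √2 / 2 := by
    rw [div_eq_div_iff (by positivity) (by norm_num)]; norm_num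
  have e2 : 1 / (2 * √2) = √2 / 4 := by
    rw [div_eq_div_iff (by positivity) (by norm_num)]
    nlinarith [Real.mul_self_sqrt (show (0 : ℝ) ≤ 2 by norm_num)]
  rw [e1, e2]
  linarith

end

end NCG

end

noncomputable section

namespace NCG

open MeasureTheory

/-! ### Sampling the random choices from uniform random numbers -/

/-- Lebesgue measure on `[0, 1]`. -/
def unitLaw : Measure ℝ := volume.restrict (Set.Icc 0 1)

instance : IsProbabilityMeasure tapeLaw := by unfold tapeLaw; infer_instance

/-- The `i`-th random number. -/
def draw (i : ℕ) (τ : Tape) : ℝ := (τ i : ℝ)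

theorem measurable_draw (i : ℕ) : Measurable (draw i) :=
  measurable_subtype_coe.comp (measurable_pi_apply i)

theorem measurePreserving_draw (i : ℕ) : MeasurePreserving (draw i) tapeLaw unitLaw := by
  refine MeasurePreserving.comp (μb := (volume : Measure unitInterval)) ⟨measurable_subtype_coe, ?_⟩
    (measurePreserving_eval_infinitePi _ i)
  rw [volume_set_coe_def, (MeasurableEmbedding.subtype_coe measurableSet_Icc).map_comap,
    Subtype.range_coe, unitLaw]

theorem dependsOn_draw (i : ℕ) : DependsOn (draw i) ({i} : Finset ℕ) := fun τ τ' h => by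
  rw [draw, draw, h i (by simp)]

theorem exists_eq_comp_restrict {D : Type*} [MeasurableSpace D] {S : Finset ℕ} {f : Tape → D}
    (hm : Measurable f) (hd : DependsOn f (S : Set ℕ)) :
    ∃ F : (S → unitInterval) → D, Measurable F ∧ f = fun τ => F (fun i : S => τ i) := by
  refine ⟨fun y => f fun i => if hi : i ∈ S then y ⟨i, hi⟩ else 0, hm.comp ?_, ?_⟩
  · refine measurable_pi_lambda _ fun i => ?_
    by_cases hi : i ∈ S
    · simpa [hi] using measurable_pi_apply _
    · simp [hi]
  · funext τ
    exact hd fun i hi => by simp [Finset.mem_coe.1 hi]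

theorem iIndepFun_tapeLaw :
    ProbabilityTheory.iIndepFun (fun (i : ℕ) (τ : Tape) => τ i) tapeLaw := by
  rw [ProbabilityTheory.iIndepFun_iff_map_fun_eq_infinitePi_map (by fun_prop), Measure.map_id',
    tapeLaw]
  congr 1
  funext i
  exact (measurePreserving_eval_infinitePi (fun _ : ℕ => (volume : Measure unitInterval))
    i).map_eq.symm

/-- Functions of disjoint finite sets of draws are independent; the product law of the seed is
assembled from such blocks. -/
theorem measurePreserving_prodMk {A B : Type*} [MeasurableSpace A] [MeasurableSpace B]
    {μ : Measure A} {ν : Measure B} {f : Tape → A} {g : Tape → B}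
    (hf : MeasurePreserving f tapeLaw μ) (hg : MeasurePreserving g tapeLaw ν) {S T : Finset ℕ}
    (hS : DependsOn f (S : Set ℕ)) (hT : DependsOn g (T : Set ℕ)) (h : Disjoint S T) :
    MeasurePreserving (fun τ => (f τ, g τ)) tapeLaw (μ.prod ν) := by
  obtain ⟨F, hF, rfl⟩ := exists_eq_comp_restrict hf.measurable hS
  obtain ⟨G, hG, rfl⟩ := exists_eq_comp_restrict hg.measurable hT
  have hfg := (iIndepFun_tapeLaw.indepFun_finset S T h (fun i => measurable_pi_apply i)).comp hF hG
  refine ⟨hf.measurable.prodMk hg.measurable, ?_⟩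
  rw [← hf.map_eq, ← hg.map_eq]
  exact (ProbabilityTheory.indepFun_iff_map_prod_eq_prod_map_map hf.measurable.aemeasurable
    hg.measurable.aemeasurable).1 hfg

/-! ### Discrete uniform choices -/

theorem tapeLaw_pi (S : Finset ℕ) (t : ℕ → Set ℝ) (ht : ∀ i, MeasurableSet (t i)) :
    tapeLaw {τ | ∀ i ∈ S, draw i τ ∈ t i} = ∏ i ∈ S, unitLaw (t i) := by
  have h1 : {τ : Tape | ∀ i ∈ S, draw i τ ∈ t i}
      = Set.pi (S : Set ℕ) fun i => (fun u : unitInterval => (u : ℝ)) ⁻¹' t i := by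
    ext τ; simp [draw, Set.mem_pi]
  rw [h1, tapeLaw, Measure.infinitePi_pi _ fun i _ => measurable_subtype_coe (ht i)]
  refine Finset.prod_congr rfl fun i _ => ?_
  rw [← (measurePreserving_draw i).measure_preimage (ht i).nullMeasurableSet]
  exact ((measurePreserving_eval_infinitePi (fun _ : ℕ => (volume : Measure unitInterval))
    i).measure_preimage (measurable_subtype_coe (ht i)).nullMeasurableSet).symm

/-- The choice of a fourth root of unity. -/
def quarter (u : ℝ) : Fin 4 := if u < 1 / 4 then 0 else if u < 1 / 2 then 1
    else if u < 3 / 4 then 2 else 3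

theorem measurable_quarter : Measurable quarter := by
  unfold quarter
  refine Measurable.ite measurableSet_Iio measurable_const (Measurable.ite measurableSet_Iio
    measurable_const (Measurable.ite measurableSet_Iio measurable_const measurable_const))

theorem quarter_eq_zero {u : ℝ} : quarter u = 0 ↔ u < 1 / 4 := by
  unfold quarter
  split_ifs <;> simp <;> linarith

theorem quarter_eq_one {u : ℝ} : quarter u = 1 ↔ 1 / 4 ≤ u ∧ u < 1 / 2 := by
  unfold quarter
  split_ifs <;> simp <;> first | linarith | (intros; linarith) | (constructor <;> linarith)

theorem quarter_eq_two {u : ℝ} : quarter u = 2 ↔ 1 / 2 ≤ u ∧ u < 3 / 4 := by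
  unfold quarter
  split_ifs <;> simp <;> first | linarith | (intros; linarith) | (constructor <;> linarith)

theorem quarter_eq_three {u : ℝ} : quarter u = 3 ↔ 3 / 4 ≤ u := by
  unfold quarter
  split_ifs <;> simp <;> linarith

theorem unitLaw_quarter (k : Fin 4) : unitLaw (quarter ⁻¹' {k}) = 4⁻¹ := by
  have h4 : ENNReal.ofReal (1 / 4) = 4⁻¹ := by
    rw [one_div, ENNReal.ofReal_inv_of_pos (by norm_num)]; norm_num
  rw [unitLaw, Measure.restrict_apply (measurable_quarter (measurableSet_singleton k)), ← h4]
  -- The fibre lies between a half-open and a closed interval of the same length, so endpoints need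
  -- no attention.
  have key : ∀ a b : ℝ, 0 ≤ a → b ≤ 1 → b - a = 1 / 4 →
      (∀ u, u ∈ Set.Icc (0 : ℝ) 1 → u ∈ Set.Ico a b → quarter u = k) →
      (∀ u, u ∈ Set.Icc (0 : ℝ) 1 → quarter u = k → u ∈ Set.Icc a b) →
      volume (quarter ⁻¹' {k} ∩ Set.Icc 0 1) = ENNReal.ofReal (1 / 4) := by
    intro a b ha hb hab h1 h2
    refine le_antisymm ?_ ?_
    · rw [← hab, ← Real.volume_Icc]
      exact measure_mono fun u hu => h2 u hu.2 hu.1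
    · rw [← hab, ← Real.volume_Ico]
      refine measure_mono fun u hu => ?_
      have hu' : u ∈ Set.Icc (0 : ℝ) 1 := ⟨ha.trans hu.1, hu.2.le.trans hb⟩
      exact ⟨h1 u hu' hu, hu'⟩
  have hk : k = 0 ∨ k = 1 ∨ k = 2 ∨ k = 3 := by clear key; revert k; decide
  rcases hk with rfl | rfl | rfl | rfl
  · exact key 0 (1 / 4) (by norm_num) (by norm_num) (by norm_num)
      (fun u _ h => quarter_eq_zero.2 h.2) fun u hu h => ⟨hu.1, (quarter_eq_zero.1 h).le⟩
  · exact key (1 / 4) (1 / 2) (by norm_num) (by norm_num) (by norm_num)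
      (fun u _ h => quarter_eq_one.2 h)
      fun u _ h => ⟨(quarter_eq_one.1 h).1, (quarter_eq_one.1 h).2.le⟩
  · exact key (1 / 2) (3 / 4) (by norm_num) (by norm_num) (by norm_num)
      (fun u _ h => quarter_eq_two.2 h)
      fun u _ h => ⟨(quarter_eq_two.1 h).1, (quarter_eq_two.1 h).2.le⟩
  · exact key (3 / 4) 1 (by norm_num) (by norm_num) (by norm_num)
      (fun u _ h => quarter_eq_three.2 h.1) fun u hu h => ⟨quarter_eq_three.1 h, hu.2⟩

/-- The choice of a sign. -/
def coin (u : ℝ) : Bool := decide (u < 1 / 2)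

theorem measurable_coin : Measurable coin := by
  have : coin = fun u => if u < 1 / 2 then true else false := by
    funext u; by_cases h : u < 1 / 2 <;> simp [coin]
  rw [this]
  exact Measurable.ite measurableSet_Iio measurable_const measurable_const

theorem unitLaw_coin (b : Bool) : unitLaw (coin ⁻¹' {b}) = 2⁻¹ := by
  have h2 : ENNReal.ofReal (1 / 2) = 2⁻¹ := by
    rw [one_div, ENNReal.ofReal_inv_of_pos (by norm_num)]; norm_num
  rw [unitLaw, Measure.restrict_apply (measurable_coin (measurableSet_singleton b)), ← h2]
  cases b
  · have : coin ⁻¹' {false} ∩ Set.Icc 0 1 = Set.Icc (1 / 2) 1 := by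
      ext u; simp [coin]; intros; linarith
    rw [this, Real.volume_Icc]; norm_num
  · have : coin ⁻¹' {true} ∩ Set.Icc 0 1 = Set.Ico 0 (1 / 2) := by
      ext u; simp [coin]; constructor <;> intros <;> constructor <;> (try constructor) <;> linarith
    rw [this, Real.volume_Ico]; norm_num

/-- The draws 0 to 4 are reserved for t, t', the index and the two signs; the phases start at draw
5. -/
theorem measurePreserving_quarters (d : ℕ) :
    MeasurePreserving (fun τ (r : Fin d) => quarter (draw (5 + r) τ)) tapeLaw
      (PMF.uniformOfFintype (Fin d → Fin 4)).toMeasure := by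
  have hm : Measurable (fun τ (r : Fin d) => quarter (draw (5 + r) τ)) :=
    measurable_pi_lambda _ fun r => measurable_quarter.comp (measurable_draw _)
  refine ⟨hm, Measure.ext_of_singleton fun z => ?_⟩
  rw [Measure.map_apply hm (measurableSet_singleton z),
    PMF.toMeasure_apply_singleton _ _ (measurableSet_singleton z), PMF.uniformOfFintype_apply]
  have h1 : (fun τ (r : Fin d) => quarter (draw (5 + r) τ)) ⁻¹' {z} =
      {τ | ∀ i ∈ Finset.Ico 5 (5 + d), draw i τ ∈
        if h : i - 5 < d then quarter ⁻¹' {z ⟨i - 5, h⟩} else Set.univ} := by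
    ext τ
    simp only [Set.mem_preimage, Set.mem_singleton_iff, Set.mem_ofPred_eq, Finset.mem_Ico]
    constructor
    · rintro rfl i ⟨h5, hi⟩
      rw [dif_pos (by omega)]
      simp [show 5 + (i - 5) = i by omega]
    · intro h
      funext r
      have := h (5 + r) ⟨by omega, by omega⟩
      rw [dif_pos (by omega)] at this
      simpa using this
  rw [h1, tapeLaw_pi]
  · rw [Finset.prod_congr rfl (g := fun _ => (4 : ENNReal)⁻¹)]
    · simp [ENNReal.inv_pow]
    · intro i hi
      rw [Finset.mem_Ico] at hi
      rw [dif_pos (by omega), unitLaw_quarter]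
  · intro i
    split_ifs
    · exact measurable_quarter (measurableSet_singleton _)
    · exact MeasurableSet.univ

theorem measurePreserving_coins :
    MeasurePreserving (fun τ => (coin (draw 3 τ), coin (draw 4 τ))) tapeLaw
      (PMF.uniformOfFintype (Bool × Bool)).toMeasure := by
  have hm : Measurable (fun τ => (coin (draw 3 τ), coin (draw 4 τ))) :=
    (measurable_coin.comp (measurable_draw _)).prodMk (measurable_coin.comp (measurable_draw _))
  refine ⟨hm, Measure.ext_of_singleton fun z => ?_⟩
  rw [Measure.map_apply hm (measurableSet_singleton z),
    PMF.toMeasure_apply_singleton _ _ (measurableSet_singleton z), PMF.uniformOfFintype_apply]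
  have h1 : (fun τ => (coin (draw 3 τ), coin (draw 4 τ))) ⁻¹' {z} =
      {τ | ∀ i ∈ ({3, 4} : Finset ℕ), draw i τ ∈ if i = 3 then coin ⁻¹' {z.1}
          else coin ⁻¹' {z.2}} := by
    ext τ
    simp [Prod.ext_iff]
  rw [h1, tapeLaw_pi, Finset.prod_congr rfl (g := fun _ => (2 : ENNReal)⁻¹)]
  · rw [Finset.prod_const, ← ENNReal.inv_pow]
    simp
    norm_num
  · intro i _
    split_ifs <;> exact unitLaw_coin _
  · intro i
    split_ifs <;> exact measurable_coin (measurableSet_singleton _)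

/-! ### The shift and the index -/

theorem measurePreserving_shift :
    MeasurePreserving (fun u => Real.pi * (2 * u - 1)) unitLaw shiftLaw := by
  have hp := Real.pi_pos
  refine ⟨by fun_prop, ?_⟩
  have h1 : Set.Icc (0 : ℝ) 1 = (fun u => Real.pi * (2 * u - 1)) ⁻¹' Set.Icc
      (-Real.pi) Real.pi := by
    ext u
    simp only [Set.mem_Icc, Set.mem_preimage]
    constructor
    · rintro ⟨h1, h2⟩; constructor <;> nlinarith
    · rintro ⟨h1, h2⟩; constructor <;> nlinarith
  have h2 : Measure.map (fun u => Real.pi * (2 * u - 1)) volume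
      = ENNReal.ofReal (2 * Real.pi)⁻¹ • volume := by
    have h3 : (fun u => Real.pi * (2 * u - 1)) = (fun x => x + -Real.pi) ∘ (fun u => (2 *
        Real.pi) * u) := by
      funext u; simp; ring
    rw [h3, ← Measure.map_map (by fun_prop) (by fun_prop), Real.map_volume_mul_left (by positivity),
      Measure.map_smul, (measurePreserving_add_right volume (-Real.pi)).map_eq,
      abs_of_pos (by positivity)]
  rw [unitLaw, h1, ← Measure.restrict_map (by fun_prop) measurableSet_Icc, h2, shiftLaw,
    ProbabilityTheory.cond, Measure.restrict_smul, Real.volume_Icc,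
    ← ENNReal.ofReal_inv_of_pos (by linarith)]
  congr 3; ring

/-- Partial sums of the probabilities of the indices. -/
def indexSum (l : ℕ) : ℝ := ∑ i ∈ Finset.range l, |krivineB (2 * i + 1)|

theorem indexSum_mono : Monotone indexSum := fun _ _ h =>
  Finset.sum_le_sum_of_subset_of_nonneg (Finset.range_mono h) fun _ _ _ => abs_nonneg _

theorem indexSum_zero : indexSum 0 = 0 := by simp [indexSum]

theorem indexSum_succ (l : ℕ) : indexSum (l + 1) = indexSum l + |krivineB (2 * l + 1)| := by
  rw [indexSum, Finset.sum_range_succ, indexSum]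

theorem indexSum_add_krivineTail (L : ℕ) : indexSum (L + 1) + krivineTail L = 1 :=
  sum_add_krivineTail L

/-- The number of `l ≤ L` for which the `l`-th partial sum is at most `u`. -/
def indexCount (L : ℕ) (u : ℝ) : ℕ :=
  ((Finset.range (L + 1)).filter fun l => indexSum (l + 1) ≤ u).card

/-- The index in `{-1, 0, …, L}` chosen by the number `u`. -/
def indexOf (L : ℕ) (u : ℝ) : ℤ := if indexCount L u ≤ L then indexCount L u else -1

theorem indexCount_of_mem {L l : ℕ} {u : ℝ} (hl : l ≤ L) (h : u ∈ Set.Ico (indexSum l) (indexSum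
    (l + 1))) :
    indexCount L u = l := by
  have : ((Finset.range (L + 1)).filter fun l => indexSum (l + 1) ≤ u) = Finset.range l := by
    ext i
    simp only [Finset.mem_filter, Finset.mem_range]
    constructor
    · rintro ⟨_, hi⟩
      by_contra hcon
      exact absurd (h.2.trans_le (indexSum_mono (by omega : l + 1 ≤ i + 1))) (not_lt.2 hi)
    · intro hi
      exact ⟨by omega, (indexSum_mono (by omega : i + 1 ≤ l)).trans h.1⟩
  rw [indexCount, this, Finset.card_range]

theorem indexCount_of_ge {L : ℕ} {u : ℝ} (h : indexSum (L + 1) ≤ u) : indexCount L u = L + 1 := by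
  rw [indexCount, Finset.filter_true_of_mem, Finset.card_range]
  intro i hi
  rw [Finset.mem_range] at hi
  exact (indexSum_mono (by omega)).trans h

theorem indexOf_of_mem {L l : ℕ} {u : ℝ} (hl : l ≤ L)
    (h : u ∈ Set.Ico (indexSum l) (indexSum (l + 1))) : indexOf L u = l := by
  rw [indexOf, indexCount_of_mem hl h, if_pos hl]

theorem indexOf_of_ge {L : ℕ} {u : ℝ} (h : indexSum (L + 1) ≤ u) : indexOf L u = -1 := by
  rw [indexOf, indexCount_of_ge h, if_neg (by omega)]

theorem measurable_indexOf (L : ℕ) : Measurable (indexOf L) := by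
  have h1 : Measurable (indexCount L) := by
    have : indexCount L = fun u => ∑ l ∈ Finset.range (L + 1), if indexSum (l + 1) ≤
        u then 1 else 0 := by
      funext u; rw [indexCount, Finset.card_filter]
    rw [this]
    exact Finset.measurable_sum _ fun l _ =>
      Measurable.ite measurableSet_Ici measurable_const measurable_const
  exact (measurable_from_top (f := fun k : ℕ => if k ≤ L then (k : ℤ) else -1)).comp h1

theorem restrict_Ico_indexSum (l : ℕ) : volume.restrict (Set.Ico 0 (indexSum l)) =
    ∑ i ∈ Finset.range l, (volume.restrict (Set.Ico (indexSum i) (indexSum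
        (i + 1))) : Measure ℝ) := by
  induction l with
  | zero => simp [indexSum_zero]
  | succ l ih =>
    rw [Finset.sum_range_succ, ← ih, ← Measure.restrict_union _ measurableSet_Ico,
      Set.Ico_union_Ico_eq_Ico]
    · rw [← indexSum_zero]; exact indexSum_mono (Nat.zero_le l)
    · exact indexSum_mono (Nat.le_succ l)
    · exact Set.disjoint_left.2 fun u h1 h2 => absurd h1.2 (not_lt.2 h2.1)

/-- The unit interval is cut at the partial sums: piece number i has length |b_{2i+1}|, and the last
piece has the length of the tail. -/
theorem unitLaw_eq (L : ℕ) : unitLaw = ∑ i ∈ Finset.range (L + 1),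
    (volume.restrict (Set.Ico (indexSum i) (indexSum (i + 1))) : Measure ℝ)
      + volume.restrict (Set.Icc (indexSum (L + 1)) 1) := by
  rw [← restrict_Ico_indexSum, ← Measure.restrict_union _ measurableSet_Icc,
    Set.Ico_union_Icc_eq_Icc, unitLaw]
  · rw [← indexSum_zero]; exact indexSum_mono (Nat.zero_le _)
  · have := indexSum_add_krivineTail L
    linarith [krivineTail_nonneg L]
  · exact Set.disjoint_left.2 fun u h1 h2 => absurd h1.2 (not_lt.2 h2.1)

theorem map_restrict_const {f : ℝ → ℤ} {s : Set ℝ} (hs : MeasurableSet s) {k : ℤ}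
    (h : ∀ u ∈ s, f u = k) : (volume.restrict s).map f = volume s • Measure.dirac k := by
  rw [Measure.map_congr (g := fun _ => k) ((ae_restrict_iff' hs).2 (Filter.Eventually.of_forall h)),
    Measure.map_const, Measure.restrict_apply_univ]

theorem measurePreserving_indexOf (L : ℕ) :
    MeasurePreserving (indexOf L) unitLaw (indexLaw L) := by
  refine ⟨measurable_indexOf L, ?_⟩
  have hm := measurable_indexOf L
  rw [unitLaw_eq L, Measure.map_add _ _ hm, indexLaw, ← krivineTail]
  congr 1
  · rw [← Measure.mapₗ_apply_of_measurable hm, map_sum]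
    refine Finset.sum_congr rfl fun l hl => ?_
    rw [Finset.mem_range] at hl
    rw [Measure.mapₗ_apply_of_measurable hm, map_restrict_const measurableSet_Ico
      fun u hu => indexOf_of_mem (by omega) hu, Real.volume_Ico, indexSum_succ, add_sub_cancel_left]
  · rw [map_restrict_const measurableSet_Icc fun u hu => indexOf_of_ge hu.1, Real.volume_Icc,
      ← indexSum_add_krivineTail L, add_sub_cancel_left]

/-! ### The seed -/

/-- The random choices made with the help of a sequence of uniform random numbers. -/
def tapeSeed (d L : ℕ) (τ : Tape) : Seed d :=
  (fun r => quarter (draw (5 + r) τ), (coin (draw 3 τ), coin (draw 4 τ)),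
    sechQuantile (draw 0 τ), Real.pi * (2 * draw 1 τ - 1), indexOf L (draw 2 τ))

theorem measurePreserving_tapeSeed (d L : ℕ) :
    MeasurePreserving (tapeSeed d L) tapeLaw (seedLaw d L) := by
  have hsech : MeasurePreserving sechQuantile unitLaw sechLaw := by
    have := measurePreserving_sechQuantile
    rwa [restrict_Ioo_eq_restrict_Icc] at this
  have h0 := hsech.comp (measurePreserving_draw 0)
  have h1 := measurePreserving_shift.comp (measurePreserving_draw 1)
  have h2 := (measurePreserving_indexOf L).comp (measurePreserving_draw 2)
  have d0 : DependsOn (sechQuantile ∘ draw 0) (({0} : Finset ℕ) : Set ℕ) := fun x y h => by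
    rw [Function.comp_apply, Function.comp_apply, dependsOn_draw 0 h]
  have d12 : DependsOn (fun τ => (Real.pi * (2 * draw 1 τ - 1), indexOf L (draw 2 τ)))
      (({1, 2} : Finset ℕ) : Set ℕ) := fun x y h => by
    simp only [draw, h 1 (by simp), h 2 (by simp)]
  have h12 := measurePreserving_prodMk (S := {1}) (T := {2}) h1 h2
    (fun x y h => by rw [Function.comp_apply, Function.comp_apply, dependsOn_draw 1 h])
    (fun x y h => by rw [Function.comp_apply, Function.comp_apply, dependsOn_draw 2 h]) (by simp)
  have h012 := measurePreserving_prodMk h0 h12 d0 d12 (by decide)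
  have hc := measurePreserving_prodMk (S := {3, 4}) (T := {0, 1, 2}) measurePreserving_coins h012
    (fun x y h => by simp only [draw, h 3 (by simp), h 4 (by simp)])
    (fun x y h => by
      simp only [draw, Function.comp_apply, h 0 (by simp), h 1 (by simp), h 2 (by simp)])
    (by decide)
  exact measurePreserving_prodMk (S := Finset.Ico 5 (5 + d)) (T := {0, 1, 2, 3, 4})
    (measurePreserving_quarters d) hc
    (fun x y h => by
      funext r
      simp only [draw, h (5 + r) (by simp)])
    (fun x y h => by
      simp only [draw, h 0 (by simp), h 1 (by simp), h 2 (by simp),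
        h 3 (by simp), h 4 (by simp)])
    (by rw [Finset.disjoint_left]; intro i hi; simp at hi ⊢; omega)

end NCG

end

noncomputable section

namespace NCG

/-! ### Structured programs

Programs that are built from assignments, spectral decompositions and nested loops over the ranges
`n`, `d` and `L + 1`, where `n`, `d`, `L` are the contents of the registers `0`, `1`, `2`. A loop
of nesting depth `k` uses the register `k + 3` as its counter. -/

theorem State.ext {s s' : State} (h1 : s.nat = s'.nat) (h2 : s.arr = s'.arr) (h3 : s.pos = s'.pos) :
    s = s' := by
  cases s; cases s'; simp_all

/-- The quantity in which the running time is polynomial. -/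
def State.size (s : State) : ℕ := s.nat 0 + s.nat 1 + s.nat 2 + 1

theorem State.one_le_size (s : State) : 1 ≤ s.size := Nat.le_add_left _ _

theorem State.size_congr {s s' : State} (h : s.nat = s'.nat) : s.size = s'.size := by
  rw [State.size, State.size, h]

theorem State.size_setNat (s : State) (k v : ℕ) : (s.setNat (k + 3) v).size = s.size := by
  simp [State.size, State.setNat]

theorem State.setNat_self (s : State) (r : ℕ) : s.setNat r (s.nat r) = s :=
  State.ext (Function.update_eq_self _ _) rfl rfl

theorem State.setNat_setNat (s : State) (r v w : ℕ) : (s.setNat r v).setNat r w = s.setNat r w :=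
  State.ext (Function.update_idem _ _ _) rfl rfl

theorem State.setArr_setArr (s : State) (a : ℕ) (idx : List ℕ) (v w : ℂ) :
    (s.setArr a idx v).setArr a idx w = s.setArr a idx w := by
  refine State.ext rfl ?_ rfl
  simp [State.setArr]

/-- The counters of the loops of depth at least `k` are zero. -/
def State.Clean (k : ℕ) (s : State) : Prop := ∀ r, k + 3 ≤ r → s.nat r = 0

theorem State.Clean.setNat {k : ℕ} {s : State} (h : s.Clean k) (v : ℕ) :
    (s.setNat (k + 3) v).Clean (k + 1) := fun r hr => by
  have hne : r ≠ k + 3 := by omega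
  simpa [State.setNat, hne] using h r (by omega)

theorem State.Clean.congr {k : ℕ} {s s' : State} (h : s.Clean k) (h' : s'.nat = s.nat) :
    s'.Clean k := fun r hr => by rw [h', h r hr]

/-- A program fragment of depth `k` together with its effect. -/
structure Cmd (k : ℕ) where
  /-- the program -/
  prog : Prog
  /-- the effect on the state -/
  sem : Tape → State → State
  /-- the arrays that may be changed -/
  writes : List ℕ
  nat_eq : ∀ τ s, (sem τ s).nat = s.nat
  frame : ∀ τ s, ∀ b ∉ writes, (sem τ s).arr b = s.arr b
  exec : ∃ K, ∀ τ s, s.Clean k → ∃ c, Exec τ prog s (sem τ s) c ∧ c ≤ K * s.size ^ K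

namespace Cmd

variable {k : ℕ}

/-- All costs are brought to the form K · N^K, a shape that is closed under composition and loops.
-/
theorem const_le {N : ℕ} (hN : 1 ≤ N) (c : ℕ) : c ≤ c * N ^ c :=
  Nat.le_mul_of_pos_right _ (Nat.pow_pos hN)

/-- Assignment to an array entry. -/
def set (a : ℕ) (idx : List NExp) (e : CExp) : Cmd k where
  prog := .setArr a idx e
  sem _ s := s.setArr a (idx.map (NExp.eval s)) (e.eval s)
  writes := [a]
  nat_eq _ _ := rfl
  frame _ s b hb := by
    have : b ≠ a := by simpa using hb
    simp [State.setArr, this]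
  exec := ⟨idxSize idx + e.size + 1, fun τ s _ =>
    ⟨_, Exec.setArr s a idx e, const_le s.one_le_size _⟩⟩

/-- Assignment of a random number to an array entry. -/
def rand (a : ℕ) (idx : List NExp) : Cmd k where
  prog := .rand a idx
  sem τ s := { s.setArr a (idx.map (NExp.eval s)) (((τ s.pos : ℝ)) : ℂ) with pos := s.pos + 1 }
  writes := [a]
  nat_eq _ _ := rfl
  frame _ s b hb := by
    have : b ≠ a := by simpa using hb
    simp [State.setArr, this]
  exec := ⟨idxSize idx + 1, fun τ s _ => ⟨_, Exec.rand s a idx, const_le s.one_le_size _⟩⟩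

theorem eigh_nat (s : State) (src vals vecs m : ℕ) : (s.eigh src vals vecs m).nat = s.nat := by
  unfold State.eigh
  split_ifs <;> rfl

/-- Spectral decomposition of an `n × n` matrix. -/
def eigh (src vals vecs : ℕ) : Cmd k where
  prog := .eigh src vals vecs (.reg 0)
  sem _ s := s.eigh src vals vecs (s.nat 0)
  writes := [vals, vecs]
  nat_eq _ s := eigh_nat s src vals vecs _
  frame _ s b hb := by
    have hb' : b ≠ vals ∧ b ≠ vecs := by simpa using hb
    unfold State.eigh
    split_ifs
    · funext idx
      match idx with
      | [] => rfl
      | [i] => simp [hb'.1]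
      | [i, j] => simp [hb'.2]
      | _ :: _ :: _ :: _ => rfl
    · rfl
  exec := ⟨3, fun τ s _ => ⟨_, Exec.eigh s src vals vecs (.reg 0), by
    have h1 : s.nat 0 ^ 3 ≤ s.size ^ 3 := Nat.pow_le_pow_left (by unfold State.size; omega) 3
    have h2 : 1 ≤ s.size ^ 3 := Nat.pow_pos s.one_le_size
    simp only [NExp.size, NExp.eval]
    omega⟩⟩

/-- Sequential composition. -/
def seq (p q : Cmd k) : Cmd k where
  prog := .seq p.prog q.prog
  sem τ s := q.sem τ (p.sem τ s)
  writes := p.writes ++ q.writes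
  nat_eq τ s := (q.nat_eq _ _).trans (p.nat_eq _ _)
  frame τ s b hb := by
    rw [List.mem_append, not_or] at hb
    rw [q.frame _ _ b hb.2, p.frame _ _ b hb.1]
  exec := by
    obtain ⟨K, hK⟩ := p.exec
    obtain ⟨K', hK'⟩ := q.exec
    refine ⟨K + K', fun τ s hs => ?_⟩
    obtain ⟨c, hc, hcK⟩ := hK τ s hs
    obtain ⟨c', hc', hcK'⟩ := hK' τ (p.sem τ s) (hs.congr (p.nat_eq τ s))
    refine ⟨_, Exec.seq hc hc', ?_⟩
    rw [State.size_congr (p.nat_eq τ s)] at hcK'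
    have h1 : s.size ^ K ≤ s.size ^ (K + K') := Nat.pow_le_pow_right s.one_le_size (by omega)
    have h2 : s.size ^ K' ≤ s.size ^ (K + K') := Nat.pow_le_pow_right s.one_le_size (by omega)
    rw [add_mul]
    exact add_le_add (hcK.trans (Nat.mul_le_mul_left _ h1)) (hcK'.trans (Nat.mul_le_mul_left _ h2))

open Classical in
/-- Conditional. -/
def ite (b : Test) (p q : Cmd k) : Cmd k where
  prog := .ite b p.prog q.prog
  sem τ s := if b.holds s then p.sem τ s else q.sem τ s
  writes := p.writes ++ q.writes
  nat_eq τ s := by split_ifs; exacts [p.nat_eq _ _, q.nat_eq _ _]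
  frame τ s b hb := by
    rw [List.mem_append, not_or] at hb
    split_ifs
    exacts [p.frame _ _ b hb.1, q.frame _ _ b hb.2]
  exec := by
    obtain ⟨K, hK⟩ := p.exec
    obtain ⟨K', hK'⟩ := q.exec
    refine ⟨b.size + (K + K'), fun τ s hs => ?_⟩
    have h0 : b.size ≤ b.size * s.size ^ (b.size + (K + K')) :=
      Nat.le_mul_of_pos_right _ (Nat.pow_pos s.one_le_size)
    have h1 : s.size ^ K ≤ s.size ^ (b.size + (K + K')) :=
      Nat.pow_le_pow_right s.one_le_size (by omega)
    have h2 : s.size ^ K' ≤ s.size ^ (b.size + (K + K')) :=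
      Nat.pow_le_pow_right s.one_le_size (by omega)
    have h3 := Nat.mul_le_mul_left K h1
    have h4 := Nat.mul_le_mul_left K' h2
    by_cases hb : b.holds s
    · obtain ⟨c, hc, hcK⟩ := hK τ s hs
      refine ⟨_, by rw [if_pos hb]; exact Exec.iteTrue hb hc, ?_⟩
      rw [add_mul, add_mul]; omega
    · obtain ⟨c, hc, hcK⟩ := hK' τ s hs
      refine ⟨_, by rw [if_neg hb]; exact Exec.iteFalse hb hc, ?_⟩
      rw [add_mul, add_mul]; omega

end Cmd

/-- The ranges of loops. -/
inductive Dim : Type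
  | n
  | d
  | L

/-- The expression for the length of a range. -/
def Dim.exp : Dim → NExp
  | n => .reg 0
  | d => .reg 1
  | L => .add (.reg 2) (.const 1)

/-- The length of a range. -/
def Dim.val (s : State) : Dim → ℕ
  | n => s.nat 0
  | d => s.nat 1
  | L => s.nat 2 + 1

theorem Dim.eval_exp (s : State) (D : Dim) : D.exp.eval s = D.val s := by cases D <;> rfl

theorem Dim.size_exp_le (D : Dim) : D.exp.size ≤ 3 := by cases D <;> simp [Dim.exp, NExp.size]

theorem Dim.val_le (s : State) (D : Dim) : D.val s ≤ s.size := by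
  cases D <;> simp only [Dim.val, State.size] <;> omega

theorem Dim.val_congr {s s' : State} (h : s.nat = s'.nat) (D : Dim) : D.val s = D.val s' := by
  cases D <;> simp [Dim.val, h]

theorem Dim.val_setNat (s : State) (k v : ℕ) (D : Dim) : D.val (s.setNat (k + 3) v) = D.val s := by
  cases D <;> simp [Dim.val, State.setNat]

/-- The state after `t` rounds of a loop with counter `r` and with body `f`. -/
def iter (f : State → State) (r : ℕ) (s : State) : ℕ → State
  | 0 => s
  -- Restoring the counter makes the effect of a loop leave all registers unchanged. The program
  -- resets it to 0 instead, which is the same in a clean state.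
  | t + 1 => (f ((iter f r s t).setNat r t)).setNat r (s.nat r)

theorem iter_nat {f : State → State} (hf : ∀ s, (f s).nat = s.nat) (r : ℕ) (s : State) (t : ℕ) :
    (iter f r s t).nat = s.nat := by
  induction t with
  | zero => rfl
  | succ t ih =>
    simp only [iter, State.setNat, hf, ih]
    rw [Function.update_idem, Function.update_eq_self]

namespace Cmd

variable {k : ℕ}

theorem iter_frame (p : Cmd k) (τ : Tape) (r : ℕ) (s : State) (t b : ℕ) (hb : b ∉ p.writes) :
    (iter (p.sem τ) r s t).arr b = s.arr b := by
  induction t with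
  | zero => rfl
  | succ t ih => exact (p.frame τ _ b hb).trans ih

/-- A loop over the range `D`. -/
def loop (D : Dim) (p : Cmd (k + 1)) : Cmd k where
  prog := .seq (.while (.natLt (.reg (k + 3)) D.exp)
    (.seq p.prog (.setNat (k + 3) (.add (.reg (k + 3)) (.const 1))))) (.setNat (k + 3) (.const 0))
  sem τ s := iter (p.sem τ) (k + 3) s (D.val s)
  writes := p.writes
  nat_eq τ s := iter_nat (p.nat_eq τ) _ _ _
  frame τ s b hb := p.iter_frame τ _ s _ b hb
  exec := by
    obtain ⟨K, hK⟩ := p.exec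
    refine ⟨2 * K + 20, fun τ s hs => ?_⟩
    set N := s.size with hN
    have hN1 : 1 ≤ N := s.one_le_size
    set f := p.sem τ with hf
    have hnat : ∀ t, (iter f (k + 3) s t).nat = s.nat := iter_nat (p.nat_eq τ) _ _
    have hval : ∀ t v, D.exp.eval ((iter f (k + 3) s t).setNat (k + 3) v) = D.val s := fun t v => by
      rw [Dim.eval_exp, Dim.val_setNat, Dim.val_congr (hnat t)]
    -- Induction on the number j of remaining rounds. A round costs at most 5 for the test and 4 for
    -- the increment besides the body; the final 5 is the failing test.
    have key : ∀ j t, t + j = D.val s → ∃ c,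
        Exec τ (.while (.natLt (.reg (k + 3)) D.exp)
          (.seq p.prog (.setNat (k + 3) (.add (.reg (k + 3)) (.const 1)))))
          ((iter f (k + 3) s t).setNat (k + 3) t)
          ((iter f (k + 3) s (D.val s)).setNat (k + 3) (D.val s)) c ∧
        c ≤ j * (K * N ^ K + 9) + 5 := by
      intro j
      induction j with
      | zero =>
        intro t ht
        obtain rfl : t = D.val s := by omega
        refine ⟨_, Exec.whileFalse ?_, ?_⟩
        · simp only [Test.holds, hval, NExp.eval]
          simp [State.setNat]
        · have := D.size_exp_le
          simp only [Test.size, NExp.size]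
          omega
      | succ j ih =>
        intro t ht
        obtain ⟨c', hc', hcK'⟩ := ih (t + 1) (by omega)
        have hcl : ((iter f (k + 3) s t).setNat (k + 3) t).Clean (k + 1) :=
          (hs.congr (hnat t)).setNat t
        obtain ⟨c, hc, hcK⟩ := hK τ _ hcl
        rw [State.size_setNat, State.size_congr (hnat t), ← hN] at hcK
        have hstep : (f ((iter f (k + 3) s t).setNat (k + 3) t)).setNat (k + 3)
            ((NExp.add (.reg (k + 3)) (.const 1)).eval (f ((iter f (k + 3) s t).setNat (k + 3) t)))
            = (iter f (k + 3) s (t + 1)).setNat (k + 3) (t + 1) := by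
          rw [iter, State.setNat_setNat]
          simp only [NExp.eval]
          rw [hf, p.nat_eq]
          simp [State.setNat]
        have hset := Exec.setNat (τ := τ) (f ((iter f (k + 3) s t).setNat (k + 3) t)) (k + 3)
          (.add (.reg (k + 3)) (.const 1))
        rw [hstep] at hset
        refine ⟨_, Exec.whileTrue ?_ (Exec.seq hc hset) hc', ?_⟩
        · simp only [Test.holds, hval, NExp.eval]
          simp [State.setNat]; omega
        · have := D.size_exp_le
          simp only [Test.size, NExp.size]
          rw [add_mul j 1]
          omega
    obtain ⟨c, hc, hcK⟩ := key (D.val s) 0 (by omega)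
    have h0 : (iter f (k + 3) s 0).setNat (k + 3) 0 = s := by
      have := s.setNat_self (k + 3)
      rw [hs (k + 3) le_rfl] at this
      exact this
    have hend : ((iter f (k + 3) s (D.val s)).setNat (k + 3) (D.val s)).setNat (k + 3) 0
        = iter f (k + 3) s (D.val s) := by
      rw [State.setNat_setNat]
      have := (iter f (k + 3) s (D.val s)).setNat_self (k + 3)
      rwa [hnat, hs (k + 3) le_rfl] at this
    rw [h0] at hc
    have hfin := Exec.setNat (τ := τ) ((iter f (k + 3) s (D.val s)).setNat (k + 3) (D.val s))
        (k + 3)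
      (.const 0)
    rw [NExp.eval, hend] at hfin
    refine ⟨_, Exec.seq hc hfin, ?_⟩
    have h1 : D.val s * (K * N ^ K + 9) ≤ N * (K * N ^ K + 9) :=
      Nat.mul_le_mul_right _ (D.val_le s)
    have h2 : N * (K * N ^ K) ≤ K * N ^ (2 * K + 20) := by
      calc N * (K * N ^ K) = K * N ^ (K + 1) := by ring
        _ ≤ _ := Nat.mul_le_mul_left _ (Nat.pow_le_pow_right hN1 (by omega))
    have h3 : N ≤ N ^ (2 * K + 20) := Nat.le_self_pow (by omega) N
    have h4 : 1 ≤ N ^ (2 * K + 20) := Nat.pow_pos hN1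
    have h5 : K * N ^ (2 * K + 20) ≤ 2 * K * N ^ (2 * K + 20) := Nat.mul_le_mul_right _ (by omega)
    simp only [NExp.size]
    simp only [mul_add] at h1 hcK
    rw [add_mul]
    omega

theorem loop_sem (D : Dim) (p : Cmd (k + 1)) (τ : Tape) (s : State) :
    (loop D p).sem τ s = iter (p.sem τ) (k + 3) s (D.val s) := rfl

end Cmd

end NCG

end

noncomputable section

namespace NCG

/-! ### Tabulation of expressions with sums and case distinctions -/

/-- Expressions with case distinctions and sums. A sum that is nested `k` deep, counting the
surrounding loops, uses the register `k + 3` as its summation variable. -/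
inductive XExp : Type
  | ret (e : CExp)
  | cond (b : Test) (X Y : XExp)
  | sum (D : Dim) (X : XExp)

open Classical in
/-- The value of an expression that stands inside `k` loops. -/
def XExp.val : XExp → ℕ → State → ℂ
  | ret e, _, s => e.eval s
  | cond b X Y, k, s => if b.holds s then X.val k s else Y.val k s
  | sum D X, k, s => ∑ i ∈ Finset.range (D.val s), X.val (k + 1) (s.setNat (k + 3) i)

/-- The array `a` is not read. -/
def CExp.avoids (a : ℕ) : CExp → Bool
  | nat _ => true
  | I => true
  | get b _ => a != b
  | add e f => e.avoids a && f.avoids a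
  | sub e f => e.avoids a && f.avoids a
  | mul e f => e.avoids a && f.avoids a
  | div e f => e.avoids a && f.avoids a
  | conj e => e.avoids a
  | exp e => e.avoids a
  | log e => e.avoids a

/-- The array `a` is not read. -/
def Test.avoids (a : ℕ) : Test → Bool
  | natLt _ _ => true
  | reLt e f => e.avoids a && f.avoids a

/-- The array `a` is not read. -/
def XExp.avoids (a : ℕ) : XExp → Bool
  | ret e => e.avoids a
  | cond b X Y => b.avoids a && X.avoids a && Y.avoids a
  | sum _ X => X.avoids a

/-- The states differ at most in the array `a`. -/
structure AgreeOff (a : ℕ) (s s' : State) : Prop where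
  nat : s.nat = s'.nat
  arr : ∀ b ≠ a, s.arr b = s'.arr b

theorem AgreeOff.setNat {a : ℕ} {s s' : State} (h : AgreeOff a s s') (r v : ℕ) :
    AgreeOff a (s.setNat r v) (s'.setNat r v) :=
  ⟨by simp [State.setNat, h.nat], h.arr⟩

theorem AgreeOff.setArr (a : ℕ) (s : State) (idx : List ℕ) (v : ℂ) :
    AgreeOff a (s.setArr a idx v) s :=
  ⟨rfl, fun b hb => by simp [State.setArr, hb]⟩

theorem NExp.eval_congr {s s' : State} (h : s.nat = s'.nat) (e : NExp) : e.eval s = e.eval s' := by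
  induction e with
  | const k => rfl
  | reg r => simp [NExp.eval, h]
  | add e f he hf => simp [NExp.eval, he, hf]
  | mul e f he hf => simp [NExp.eval, he, hf]

theorem map_eval_congr {s s' : State} (h : s.nat = s'.nat) (idx : List NExp) :
    idx.map (NExp.eval s) = idx.map (NExp.eval s') :=
  List.map_congr_left fun e _ => NExp.eval_congr h e

theorem CExp.eval_congr {a : ℕ} {s s' : State} (h : AgreeOff a s s') (e : CExp)
    (he : e.avoids a = true) : e.eval s = e.eval s' := by
  induction e with
  | nat e => simp [CExp.eval, NExp.eval_congr h.nat]
  | I => rfl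
  | get b idx =>
    have hb : b ≠ a := (bne_iff_ne.1 he).symm
    rw [CExp.eval, CExp.eval, h.arr b hb, map_eval_congr h.nat]
  | add e f h1 h2 | sub e f h1 h2 | mul e f h1 h2 | div e f h1 h2 =>
    rw [CExp.avoids, Bool.and_eq_true] at he
    rw [CExp.eval, CExp.eval, h1 he.1, h2 he.2]
  | conj e h1 | exp e h1 | log e h1 => rw [CExp.eval, CExp.eval, h1 he]

theorem Test.holds_congr {a : ℕ} {s s' : State} (h : AgreeOff a s s') (b : Test)
    (hb : b.avoids a = true) : b.holds s ↔ b.holds s' := by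
  cases b with
  | natLt e f => simp only [Test.holds, NExp.eval_congr h.nat]
  | reLt e f =>
    rw [Test.avoids, Bool.and_eq_true] at hb
    rw [Test.holds, Test.holds, CExp.eval_congr h e hb.1, CExp.eval_congr h f hb.2]

open Classical in
theorem XExp.val_congr {a : ℕ} {s s' : State} (h : AgreeOff a s s') (X : XExp)
    (hX : X.avoids a = true) (k : ℕ) : X.val k s = X.val k s' := by
  induction X generalizing k s s' with
  | ret e => exact CExp.eval_congr h e hX
  | cond b X Y h1 h2 =>
    rw [XExp.avoids, Bool.and_eq_true, Bool.and_eq_true] at hX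
    rw [XExp.val, XExp.val, h1 h hX.1.2, h2 h hX.2]
    exact if_congr (Test.holds_congr h b hX.1.1) rfl rfl
  | sum D X ih =>
    rw [XExp.val, XExp.val, Dim.val_congr h.nat]
    exact Finset.sum_congr rfl fun i _ => ih (h.setNat _ _) hX _

/-- The indices do not change in loops of depth at least `k`. -/
def Stable (k : ℕ) (idx : List NExp) : Prop :=
  ∀ (s : State) (r v : ℕ), k + 3 ≤ r → idx.map (NExp.eval (s.setNat r v)) = idx.map (NExp.eval s)

theorem stable_nil (k : ℕ) : Stable k [] := fun _ _ _ _ => rfl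

theorem stable_reg {k r : ℕ} (h : r < k + 3) : Stable k [.reg r] := fun s r' v h' => by
  have : r ≠ r' := by omega
  simp [NExp.eval, State.setNat, this]

theorem Stable.succ {k : ℕ} {idx : List NExp} (h : Stable k idx) : Stable (k + 1) idx :=
  fun s r v hr => h s r v (by omega)

theorem Stable.append {k : ℕ} {i j : List NExp} (hi : Stable k i) (hj : Stable k j) :
    Stable k (i ++ j) := fun s r v hr => by
  rw [List.map_append, List.map_append, hi s r v hr, hj s r v hr]

namespace Cmd

variable (a : ℕ) (idx : List NExp)

/-- Adds the value of an expression to an array entry. -/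
def acc : XExp → (k : ℕ) → Cmd k
  | .ret e, _ => set a idx (.add (.get a idx) e)
  | .cond b X Y, k => ite b (acc X k) (acc Y k)
  | .sum D X, k => loop D (acc X (k + 1))

/-- Writes the value of an expression to an array entry. -/
def store : XExp → (k : ℕ) → Cmd k
  | .ret e, _ => set a idx e
  | .cond b X Y, k => ite b (store X k) (store Y k)
  | .sum D X, k => seq (set a idx (.nat (.const 0))) (loop D (acc a idx X (k + 1)))

variable {a idx}

/-- Since `X` does not read the array `a`, the partial sums stored there do not influence the later
summands. -/
theorem acc_sem {X : XExp} (hX : X.avoids a = true) {k : ℕ} (hi : Stable k idx) (τ : Tape)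
    (s : State) : (acc a idx X k).sem τ s = s.setArr a (idx.map (NExp.eval s))
      (s.arr a (idx.map (NExp.eval s)) + X.val k s) := by
  induction X generalizing k s with
  | ret e => rfl
  | cond b X Y h1 h2 =>
    rw [XExp.avoids, Bool.and_eq_true, Bool.and_eq_true] at hX
    simp only [acc, ite, XExp.val]
    split_ifs
    · exact h1 hX.1.2 hi s
    · exact h2 hX.2 hi s
  | sum D X ih =>
    rw [acc, loop_sem, XExp.val]
    generalize D.val s = t
    induction t with
    | zero =>
      refine State.ext rfl ?_ rfl
      simp [iter, State.setArr]
    | succ t iht =>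
      rw [iter, ih hX hi.succ, iht, Finset.sum_range_succ]
      set I := idx.map (NExp.eval s) with hI
      set v := s.arr a I + ∑ i ∈ Finset.range t, X.val (k + 1) (s.setNat (k + 3) i) with hv
      have h1 : idx.map (NExp.eval ((s.setArr a I v).setNat (k + 3) t)) = I := by
        rw [hi _ _ _ le_rfl]
        exact map_eval_congr (s := s.setArr a I v) (s' := s) rfl idx
      have h2 : X.val (k + 1) ((s.setArr a I v).setNat (k + 3) t)
          = X.val (k + 1) (s.setNat (k + 3) t) :=
        XExp.val_congr ((AgreeOff.setArr a s I v).setNat _ _) X hX _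
      have h3 : ((s.setArr a I v).setNat (k + 3) t).arr a I = v := by
        simp [State.setArr, State.setNat]
      rw [h1, h2, h3, ← add_assoc]
      refine State.ext ?_ ?_ rfl
      · simp [State.setArr, State.setNat]
      · simp [State.setArr, State.setNat, hv]

theorem store_sem {X : XExp} (hX : X.avoids a = true) {k : ℕ} (hi : Stable k idx) (τ : Tape)
    (s : State) : (store a idx X k).sem τ s = s.setArr a (idx.map (NExp.eval s)) (X.val k s) := by
  induction X with
  | ret e => rfl
  | cond b X Y h1 h2 =>
    rw [XExp.avoids, Bool.and_eq_true, Bool.and_eq_true] at hX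
    simp only [store, ite, XExp.val]
    split_ifs
    · exact h1 hX.1.2
    · exact h2 hX.2
  | sum D X _ =>
    have h := acc_sem (X := .sum D X) hX hi τ
      ((set (k := k) a idx (.nat (.const 0))).sem τ s)
    rw [acc] at h
    rw [store, seq, h]
    simp only [set]
    rw [map_eval_congr (s := s.setArr a (idx.map (NExp.eval s)) _) (s' := s) rfl,
      XExp.val_congr (AgreeOff.setArr a s _ _) (.sum D X) hX, State.setArr_setArr]
    simp [State.setArr, CExp.eval, NExp.eval]

theorem acc_writes {X : XExp} {k b : ℕ} (h : b ∈ (acc a idx X k).writes) : b = a := by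
  induction X generalizing k with
  | ret e => simpa [acc, set] using h
  | cond t X Y h1 h2 =>
    simp only [acc, ite, List.mem_append] at h
    exact h.elim h1 h2
  | sum D X ih => exact ih (k := k + 1) h

theorem store_writes {X : XExp} {k b : ℕ} (h : b ∈ (store a idx X k).writes) : b = a := by
  induction X with
  | ret e => simpa [store, set] using h
  | cond t X Y h1 h2 =>
    simp only [store, ite, List.mem_append] at h
    exact h.elim h1 h2
  | sum D X _ =>
    simp only [store, seq, set, List.mem_append, List.mem_singleton] at h
    exact h.elim id fun h => acc_writes (k := k + 1) h

variable (a)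

/-- Tabulates an expression over a product of ranges. -/
def tabAux (X : XExp) : List Dim → List NExp → (k : ℕ) → Cmd k
  | [], pre, k => store a pre X k
  | D :: Ds, pre, k => loop D (tabAux X Ds (pre ++ [.reg (k + 3)]) (k + 1))

theorem tabAux_writes {X : XExp} {Ds : List Dim} {pre : List NExp} {k b : ℕ}
    (h : b ∈ (tabAux a X Ds pre k).writes) : b = a := by
  induction Ds generalizing pre k with
  | nil => exact store_writes h
  | cons D Ds ih => exact ih (k := k + 1) h

/-- Tabulates an expression over a product of ranges: the entry with index `pre ++ [i, j, …]` of
the array `a` becomes the value of the expression `X` in the loops with counters `i`, `j`, …. -/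
def tab {k : ℕ} (a : ℕ) (pre : List NExp) (Ds : List Dim) (X : XExp) : Cmd k :=
  { tabAux a X Ds pre k with
    writes := [a]
    frame := fun τ s b hb => (tabAux a X Ds pre k).frame τ s b fun h =>
      hb (List.mem_singleton.2 (tabAux_writes a h)) }

end Cmd

/-- The state in which the counters of the loops of depth `k`, `k + 1`, … have given values. -/
def State.setFrom : ℕ → List ℕ → State → State
  | _, [], s => s
  | k, i :: l, s => setFrom (k + 1) l (s.setNat (k + 3) i)

theorem AgreeOff.setFrom {a : ℕ} {s s' : State} (h : AgreeOff a s s') (k : ℕ) (l : List ℕ) :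
    AgreeOff a (s.setFrom k l) (s'.setFrom k l) := by
  induction l generalizing k s s' with
  | nil => exact h
  | cons i l ih => exact ih (h.setNat _ _) _

namespace Cmd

/-- The second clause drives the induction: a later round writes only below its own counter value
and so preserves the entries of the earlier rounds. -/
theorem tabAux_spec {a : ℕ} {X : XExp} (hX : X.avoids a = true) (τ : Tape) (Ds : List Dim)
    {k : ℕ} {pre : List NExp} (hp : Stable k pre) (s : State) :
    (∀ l, List.Forall₂ (fun i D => i < Dim.val s D) l Ds →
      ((tabAux a X Ds pre k).sem τ s).arr a (pre.map (NExp.eval s) ++ l)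
        = X.val (k + Ds.length) (s.setFrom k l)) ∧
    ∀ i, (∀ l, i ≠ pre.map (NExp.eval s) ++ l) →
      ((tabAux a X Ds pre k).sem τ s).arr a i = s.arr a i := by
  induction Ds generalizing k pre s with
  | nil =>
    rw [tabAux, store_sem hX hp]
    constructor
    · intro l hl
      cases hl
      simp [State.setArr, State.setFrom]
    · intro i hi
      have := hi []
      rw [List.append_nil] at this
      simp [State.setArr, this]
  | cons D Ds ih =>
    set p := tabAux a X Ds (pre ++ [.reg (k + 3)]) (k + 1) with hpdef
    have hst : Stable (k + 1) (pre ++ [.reg (k + 3)]) := hp.succ.append (stable_reg (by omega))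
    set u := iter (p.sem τ) (k + 3) s with hu
    have hnat : ∀ t, (u t).nat = s.nat := iter_nat (p.nat_eq τ) _ _
    have hag : ∀ t, AgreeOff a (u t) s := fun t => ⟨hnat t, fun b hb => by
      induction t with
      | zero => rfl
      | succ t iht =>
        rw [← iht]
        exact p.frame τ _ b fun h => hb (tabAux_writes a h)⟩
    have key : ∀ t, (∀ i < t, ∀ l, List.Forall₂ (fun i D => i < Dim.val s D) l Ds →
        (u t).arr a (pre.map (NExp.eval s) ++ i :: l)
          = X.val (k + 1 + Ds.length) ((s.setNat (k + 3) i).setFrom (k + 1) l)) ∧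
        ∀ i, (∀ l, i ≠ pre.map (NExp.eval s) ++ l) → (u t).arr a i = s.arr a i := by
      intro t
      induction t with
      | zero => exact ⟨fun i hi => absurd hi (Nat.not_lt_zero i), fun _ _ => rfl⟩
      | succ t iht =>
        obtain ⟨hv, hf⟩ := ih hst ((u t).setNat (k + 3) t)
        have hI : (pre ++ [NExp.reg (k + 3)]).map (NExp.eval ((u t).setNat (k + 3) t))
            = pre.map (NExp.eval s) ++ [t] := by
          rw [List.map_append, hp _ _ _ le_rfl, map_eval_congr (hnat t)]
          simp [NExp.eval, State.setNat]
        rw [hI] at hv hf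
        have hdim : ∀ D, Dim.val ((u t).setNat (k + 3) t) D = Dim.val s D := fun D => by
          rw [Dim.val_setNat, Dim.val_congr (hnat t)]
        simp only [hdim] at hv
        have hstep : (u (t + 1)).arr a = (p.sem τ ((u t).setNat (k + 3) t)).arr a := rfl
        rw [hstep]
        constructor
        · intro i hi l hl
          by_cases hit : i = t
          · subst hit
            have := hv l hl
            rw [List.append_assoc, List.singleton_append] at this
            rw [this]
            exact XExp.val_congr (((hag i).setNat _ _).setFrom _ _) X hX _
          · rw [hf]
            · exact iht.1 i (by omega) l hl
            · intro l' h
              rw [List.append_assoc, List.singleton_append, List.append_cancel_left_eq] at h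
              exact hit (List.cons.inj h).1
        · intro i hi
          rw [hf i fun l' h => hi (t :: l') (by
            rw [h, List.append_assoc, List.singleton_append])]
          exact iht.2 i hi
    rw [tabAux, loop_sem]
    obtain ⟨h1, h2⟩ := key (D.val s)
    refine ⟨fun l hl => ?_, h2⟩
    cases hl with
    | cons hi hl =>
      rw [h1 _ hi _ hl, List.length_cons, State.setFrom]
      congr 1
      omega

variable {a : ℕ} {X : XExp} {pre : List NExp} {k : ℕ}

theorem tab_apply (hX : X.avoids a = true) (hp : Stable k pre) (τ : Tape) (s : State)
    {Ds : List Dim} {l : List ℕ} (hl : List.Forall₂ (fun i D => i < Dim.val s D) l Ds) :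
    ((tab (k := k) a pre Ds X).sem τ s).arr a (pre.map (NExp.eval s) ++ l)
      = X.val (k + Ds.length) (s.setFrom k l) :=
  (tabAux_spec hX τ Ds hp s).1 l hl

theorem tab_frame (hX : X.avoids a = true) (hp : Stable k pre) (τ : Tape) (s : State)
    {Ds : List Dim} {i : List ℕ} (hi : ∀ l, i ≠ pre.map (NExp.eval s) ++ l) :
    ((tab (k := k) a pre Ds X).sem τ s).arr a i = s.arr a i :=
  (tabAux_spec hX τ Ds hp s).2 i hi

theorem tab_scalar (hX : X.avoids a = true) (τ : Tape) (s : State) :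
    ((tab (k := k) a [] [] X).sem τ s).arr a [] = X.val k s :=
  tab_apply hX (stable_nil k) τ s List.Forall₂.nil

theorem tab_vec (hX : X.avoids a = true) (τ : Tape) (s : State) {D : Dim} {i : ℕ}
    (hi : i < D.val s) : ((tab (k := k) a [] [D] X).sem τ s).arr a [i]
      = X.val (k + 1) (s.setNat (k + 3) i) :=
  tab_apply hX (stable_nil k) τ s (.cons hi .nil)

theorem tab_mat (hX : X.avoids a = true) (τ : Tape) (s : State) {D D' : Dim} {i j : ℕ}
    (hi : i < D.val s) (hj : j < D'.val s) : ((tab (k := k) a [] [D, D'] X).sem τ s).arr a [i, j]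
      = X.val (k + 2) ((s.setNat (k + 3) i).setNat (k + 4) j) :=
  tab_apply hX (stable_nil k) τ s (.cons hi (.cons hj .nil))

end Cmd

end NCG

end

noncomputable section

namespace NCG

open scoped ComplexOrder Matrix

/-! ### A polar decomposition from two spectral decompositions -/

section

variable {n : ℕ} (T : Matrix (Fin n) (Fin n) ℂ)

theorem gram_isHermitian : (Tᴴ * T).IsHermitian := Matrix.isHermitian_conjTranspose_mul_self T

theorem coGram_isHermitian : (T * Tᴴ).IsHermitian := Matrix.isHermitian_mul_conjTranspose_self T

/-- The eigenvalues of `T^* T`. -/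
def gramVal (j : Fin n) : ℝ := (gram_isHermitian T).eigenvalues j

/-- Eigenvectors of `T^* T`. -/
def gramVec : Matrix (Fin n) (Fin n) ℂ := (gram_isHermitian T).eigenvectorUnitary

/-- Eigenvectors of `T T^*`. -/
def coGramVec : Matrix (Fin n) (Fin n) ℂ := (coGram_isHermitian T).eigenvectorUnitary

theorem gramVec_mem : gramVec T ∈ Matrix.unitaryGroup (Fin n) ℂ :=
  (gram_isHermitian T).eigenvectorUnitary.2

theorem coGramVec_mem : coGramVec T ∈ Matrix.unitaryGroup (Fin n) ℂ :=
  (coGram_isHermitian T).eigenvectorUnitary.2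

theorem gramVal_nonneg (j : Fin n) : 0 ≤ gramVal T j :=
  (Matrix.posSemidef_conjTranspose_mul_self T).eigenvalues_nonneg j

/-- T^*T and TT^* have the same characteristic polynomial, which determines the list of eigenvalues
including its order. Hence the kernel vectors of both matrices sit at the same indices. -/
theorem coGram_eigenvalues : (coGram_isHermitian T).eigenvalues = gramVal T :=
  (Matrix.IsHermitian.eigenvalues_eq_eigenvalues_iff _ _).2 (Matrix.charpoly_mul_comm _ _)

theorem gram_eq : Tᴴ * T = conjDiag (gramVec T) fun j => (gramVal T j : ℂ) :=
  spectral_conjDiag (gram_isHermitian T)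

theorem coGram_eq : T * Tᴴ = conjDiag (coGramVec T) fun j => (gramVal T j : ℂ) := by
  rw [← coGram_eigenvalues]
  exact spectral_conjDiag (coGram_isHermitian T)

theorem conjTranspose_mul_conjDiag_mul {V : Matrix (Fin n) (Fin n) ℂ}
    (hV : V ∈ Matrix.unitaryGroup (Fin n) ℂ) (a : Fin n → ℂ) :
    Vᴴ * conjDiag V a * V = Matrix.diagonal a := by
  have h : Vᴴ * V = 1 := Matrix.mem_unitaryGroup_iff'.1 hV
  calc Vᴴ * conjDiag V a * V = (Vᴴ * V) * Matrix.diagonal a * (Vᴴ * V) := by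
        rw [conjDiag]; noncomm_ring
    _ = _ := by rw [h, one_mul, mul_one]

/-- The left singular vectors of `T`. -/
def leftVec : Matrix (Fin n) (Fin n) ℂ := Matrix.of fun i j =>
  if 0 < gramVal T j then (T * gramVec T) i j / (√(gramVal T j) : ℝ) else coGramVec T i j

theorem leftVec_eq : leftVec T =
    T * gramVec T * Matrix.diagonal (fun j => if 0 < gramVal T j then
        (((√(gramVal T j))⁻¹ : ℝ) : ℂ) else 0)
      + coGramVec T * Matrix.diagonal (fun j => if 0 < gramVal T j then 0 else 1) := by
  ext i j
  rw [Matrix.add_apply, Matrix.mul_diagonal, Matrix.mul_diagonal, leftVec, Matrix.of_apply]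
  split_ifs
  · push_cast; ring
  · ring

/-- If T^*Tw = 0 then Tw = 0, because |Tw|² = w^*T^*Tw. -/
theorem mul_gramVec_mul_diagonal :
    T * gramVec T * Matrix.diagonal (fun j => if 0 < gramVal T j then (0 : ℂ) else 1) = 0 := by
  rw [← Matrix.conjTranspose_mul_self_eq_zero, Matrix.conjTranspose_mul, Matrix.conjTranspose_mul]
  have h := conjTranspose_mul_conjDiag_mul (gramVec_mem T) fun j => (gramVal T j : ℂ)
  rw [← gram_eq] at h
  set D := Matrix.diagonal (fun j => if 0 < gramVal T j then (0 : ℂ) else 1) with hD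
  calc Dᴴ * ((gramVec T)ᴴ * Tᴴ) * (T * gramVec T * D)
      = Dᴴ * ((gramVec T)ᴴ * (Tᴴ * T) * gramVec T) * D := by noncomm_ring
    _ = 0 := by
      rw [h, hD, Matrix.diagonal_conjTranspose, Matrix.diagonal_mul_diagonal,
        Matrix.diagonal_mul_diagonal, Matrix.diagonal_eq_zero]
      funext j
      have := gramVal_nonneg T j
      by_cases hj : 0 < gramVal T j
      · simp [hj]
      · simp [le_antisymm (not_lt.1 hj) this]

theorem conjTranspose_mul_coGramVec_mul_diagonal :
    Tᴴ * coGramVec T * Matrix.diagonal (fun j => if 0 < gramVal T j then (0 : ℂ) else 1) = 0 := by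
  rw [← Matrix.conjTranspose_mul_self_eq_zero, Matrix.conjTranspose_mul, Matrix.conjTranspose_mul,
    Matrix.conjTranspose_conjTranspose]
  have h := conjTranspose_mul_conjDiag_mul (coGramVec_mem T) fun j => (gramVal T j : ℂ)
  rw [← coGram_eq] at h
  set D := Matrix.diagonal (fun j => if 0 < gramVal T j then (0 : ℂ) else 1) with hD
  calc Dᴴ * ((coGramVec T)ᴴ * T) * (Tᴴ * coGramVec T * D)
      = Dᴴ * ((coGramVec T)ᴴ * (T * Tᴴ) * coGramVec T) * D := by noncomm_ring
    _ = 0 := by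
      rw [h, hD, Matrix.diagonal_conjTranspose, Matrix.diagonal_mul_diagonal,
        Matrix.diagonal_mul_diagonal, Matrix.diagonal_eq_zero]
      funext j
      have := gramVal_nonneg T j
      by_cases hj : 0 < gramVal T j
      · simp [hj]
      · simp [le_antisymm (not_lt.1 hj) this]

/-- The columns Tw_j/σ_j are orthonormal. They are orthogonal to the remaining columns, which are
orthonormal vectors in the kernel of T^*. -/
theorem leftVec_mem : leftVec T ∈ Matrix.unitaryGroup (Fin n) ℂ := by
  rw [Matrix.mem_unitaryGroup_iff', Matrix.star_eq_conjTranspose, leftVec_eq]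
  have h1 := conjTranspose_mul_conjDiag_mul (gramVec_mem T) fun j => (gramVal T j : ℂ)
  rw [← gram_eq] at h1
  have h2 := conjTranspose_mul_coGramVec_mul_diagonal T
  have h3 : (coGramVec T)ᴴ * coGramVec T = 1 := Matrix.mem_unitaryGroup_iff'.1 (coGramVec_mem T)
  set W := gramVec T
  set C := coGramVec T
  set D := Matrix.diagonal (fun j => if 0 < gramVal T j then (((√(gramVal T j))⁻¹ : ℝ) : ℂ)
      else 0) with hD
  set D₀ := Matrix.diagonal (fun j => if 0 < gramVal T j then (0 : ℂ) else 1) with hD₀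
  have h4 : D₀ᴴ * (Cᴴ * T) = 0 := by
    have := congrArg Matrix.conjTranspose h2
    rwa [Matrix.conjTranspose_mul, Matrix.conjTranspose_mul, Matrix.conjTranspose_conjTranspose,
      Matrix.conjTranspose_zero] at this
  calc (T * W * D + C * D₀)ᴴ * (T * W * D + C * D₀)
      = Dᴴ * (Wᴴ * (Tᴴ * T) * W) * D + Dᴴ * Wᴴ * (Tᴴ * C * D₀) + (D₀ᴴ * (Cᴴ * T)) * W * D
        + D₀ᴴ * (Cᴴ * C) * D₀ := by
        rw [Matrix.conjTranspose_add, Matrix.conjTranspose_mul, Matrix.conjTranspose_mul,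
          Matrix.conjTranspose_mul]
        noncomm_ring
    _ = 1 := by
      rw [h1, h2, h4, h3, hD, hD₀, mul_zero, zero_mul, zero_mul, add_zero, add_zero, mul_one,
        Matrix.diagonal_conjTranspose, Matrix.diagonal_conjTranspose, Matrix.diagonal_mul_diagonal,
        Matrix.diagonal_mul_diagonal, Matrix.diagonal_mul_diagonal, Matrix.diagonal_add,
        ← Matrix.diagonal_one]
      congr 1
      funext j
      by_cases hj : 0 < gramVal T j
      · simp only [hj, if_true, Pi.star_apply, Complex.star_def, Complex.conj_ofReal, mul_zero,
          add_zero, ← Complex.ofReal_mul]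
        have h0 := (Real.sqrt_pos.2 hj).ne'
        have : (√(gramVal T j))⁻¹ * gramVal T j * (√(gramVal T j))⁻¹ = 1 := by
          nth_rw 2 [← Real.mul_self_sqrt hj.le]
          field_simp
        rw [this, Complex.ofReal_one]
      · simp [hj]

/-- A singular value decomposition T = QΣW^*, regrouped as QW^* times WΣW^*; the columns of Q taken
from the kernel are multiplied by 0. -/
theorem leftVec_mul_diagonal_mul :
    T = leftVec T * (gramVec T)ᴴ * conjDiag (gramVec T) fun j => ((√(gramVal T j) : ℝ) : ℂ) := by
  have h0 : (gramVec T)ᴴ * gramVec T = 1 := Matrix.mem_unitaryGroup_iff'.1 (gramVec_mem T)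
  have h1 : gramVec T * (gramVec T)ᴴ = 1 := Matrix.mem_unitaryGroup_iff.1 (gramVec_mem T)
  have h2 := mul_gramVec_mul_diagonal T
  have h3 : leftVec T * Matrix.diagonal (fun j => ((√(gramVal T j) : ℝ) : ℂ)) = T * gramVec T := by
    rw [leftVec_eq, add_mul, mul_assoc, mul_assoc (coGramVec T), Matrix.diagonal_mul_diagonal,
      Matrix.diagonal_mul_diagonal]
    have e1 : (fun j => (if 0 < gramVal T j then (0 : ℂ) else 1) * ((√(gramVal T j) : ℝ) : ℂ))
        = fun _ => 0 := by
      funext j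
      by_cases hj : 0 < gramVal T j
      · simp [hj]
      · simp [le_antisymm (not_lt.1 hj) (gramVal_nonneg T j)]
    have e2 : (fun j => (if 0 < gramVal T j then (((√(gramVal T j))⁻¹ : ℝ) : ℂ) else 0)
        * ((√(gramVal T j) : ℝ) : ℂ)) = fun j => 1 - if 0 < gramVal T j then (0 : ℂ) else 1 := by
      funext j
      by_cases hj : 0 < gramVal T j
      · have h0 := (Real.sqrt_pos.2 hj).ne'
        simp only [hj, if_true, ← Complex.ofReal_mul]
        rw [inv_mul_cancel₀ h0]; simp
      · simp [hj]
    rw [e1, e2, Matrix.diagonal_zero, mul_zero, add_zero]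
    have : Matrix.diagonal (fun j => 1 - if 0 < gramVal T j then (0 : ℂ) else 1)
        = 1 - Matrix.diagonal fun j => if 0 < gramVal T j then (0 : ℂ) else 1 := by
      rw [← Matrix.diagonal_one, Matrix.diagonal_sub]
    rw [this, mul_sub, mul_one, h2, sub_zero]
  calc T = T * gramVec T * (gramVec T)ᴴ := by rw [mul_assoc, h1, mul_one]
    _ = leftVec T * ((gramVec T)ᴴ * gramVec T) * Matrix.diagonal (fun j =>
        ((√(gramVal T j) : ℝ) : ℂ))
        * (gramVec T)ᴴ := by rw [h0, mul_one, h3]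
    _ = _ := by rw [conjDiag]; noncomm_ring

end

open Classical in
/-- The selection of decompositions that the program makes. -/
def stdSelection (n : ℕ) : Selection n where
  pol T := leftVec T * (gramVec T)ᴴ
  mod T := conjDiag (gramVec T) fun j => ((√(gramVal T j) : ℝ) : ℂ)
  -- The spectral decomposition of unitary matrices may be arbitrary: the output does not depend on
  -- it and the program does not compute it.
  vec A := if h : A ∈ Matrix.unitaryGroup (Fin n) ℂ then (exists_unitary_diagonalization h).choose
    else 1
  ang A := if h : A ∈ Matrix.unitaryGroup (Fin n) ℂ then
    (exists_unitary_diagonalization h).choose_spec.2.choose else 0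
  pol_unitary T := mul_mem (leftVec_mem T) (Unitary.star_mem (gramVec_mem T))
  mod_posSemidef T := conjDiag_posSemidef _ fun j => Real.sqrt_nonneg _
  polar T := leftVec_mul_diagonal_mul T
  vec_unitary A h := by
    rw [dif_pos h]
    exact (exists_unitary_diagonalization h).choose_spec.1
  spectral A h := by
    rw [dif_pos h, dif_pos h]
    exact (exists_unitary_diagonalization h).choose_spec.2.choose_spec

/-- The inner factors W^*W cancel, so the program needs only the two sets of singular vectors. -/
theorem complexRound_stdSelection {n d : ℕ} (X : VMat n d) (z : Fin d → Fin 4) (s : Bool) (t : ℝ) :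
    complexRound (stdSelection n) X z s t = leftVec (proj X z) *
      Matrix.diagonal (fun j => imPow s t (√(gramVal (proj X z) j))) * (gramVec (proj X z))ᴴ := by
  have h0 : (gramVec (proj X z))ᴴ * gramVec (proj X z) = 1 :=
    Matrix.mem_unitaryGroup_iff'.1 (gramVec_mem _)
  rw [complexRound, stdSelection]
  dsimp only
  rw [hermFun_conjDiag _ (gramVec_mem _), conjDiag]
  calc _ = leftVec (proj X z) * ((gramVec (proj X z))ᴴ * gramVec (proj X z)) *
      Matrix.diagonal (fun j => imPow s t (√(gramVal (proj X z) j))) * (gramVec (proj X z))ᴴ := by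
        noncomm_ring
    _ = _ := by rw [h0, mul_one]

end NCG

end

noncomputable section

namespace NCG

open scoped ComplexOrder Matrix

/-! ### Matrices and vectors in memory -/

@[simp] theorem State.nat_setNat (s : State) (r v : ℕ) :
    (s.setNat r v).nat = Function.update s.nat r v := rfl

@[simp] theorem State.arr_setNat (s : State) (r v : ℕ) : (s.setNat r v).arr = s.arr := rfl

/-- The array `a` holds the matrix `A`. -/
abbrev State.IsMat {n : ℕ} (s : State) (a : ℕ) (A : Matrix (Fin n) (Fin n) ℂ) : Prop :=
  ∀ i j : Fin n, s.arr a [(i : ℕ), (j : ℕ)] = A i j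

/-- The array `a` holds the vector `v`. -/
abbrev State.IsVec {n : ℕ} (s : State) (a : ℕ) (v : Fin n → ℂ) : Prop :=
  ∀ i : Fin n, s.arr a [(i : ℕ)] = v i

/-- The array `a` holds the number `x`. -/
abbrev State.IsNum (s : State) (a : ℕ) (x : ℂ) : Prop := s.arr a [] = x

theorem State.IsMat.congr {n : ℕ} {s s' : State} {a : ℕ} {A : Matrix (Fin n) (Fin n) ℂ}
    (h : s.IsMat a A) (h' : s'.arr a = s.arr a) : s'.IsMat a A := fun i j => by rw [h', h i j]

theorem State.IsVec.congr {n : ℕ} {s s' : State} {a : ℕ} {v : Fin n → ℂ}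
    (h : s.IsVec a v) (h' : s'.arr a = s.arr a) : s'.IsVec a v := fun i => by rw [h', h i]

theorem State.IsNum.congr {s s' : State} {a : ℕ} {x : ℂ}
    (h : s.IsNum a x) (h' : s'.arr a = s.arr a) : s'.IsNum a x := by rw [State.IsNum, h', h]

theorem State.IsMat.block {n : ℕ} {s : State} {a : ℕ} {A : Matrix (Fin n) (Fin n) ℂ}
    (h : s.IsMat a A) : s.block a n = A := Matrix.ext h

namespace Cmd

variable {n k a : ℕ} {X : XExp} {s : State}

theorem isNum_tab (τ : Tape) (hX : X.avoids a = true) {x : ℂ} (h : X.val k s = x) :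
    ((tab (k := k) a [] [] X).sem τ s).IsNum a x :=
  (tab_scalar hX τ s).trans h

theorem isVec_tab (τ : Tape) (hX : X.avoids a = true) {D : Dim} (hn : D.val s = n) {v : Fin n → ℂ}
    (h : ∀ i : Fin n, X.val (k + 1) (s.setNat (k + 3) i) = v i) :
    ((tab (k := k) a [] [D] X).sem τ s).IsVec a v := fun i =>
  (tab_vec hX τ s (by rw [hn]; exact i.2)).trans (h i)

theorem isMat_tab (τ : Tape) (hX : X.avoids a = true) (hn : s.nat 0 = n)
    {A : Matrix (Fin n) (Fin n) ℂ}
    (h : ∀ i j : Fin n, X.val (k + 2) ((s.setNat (k + 3) i).setNat (k + 4) j) = A i j) :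
    ((tab (k := k) a [] [.n, .n] X).sem τ s).IsMat a A := fun i j =>
  (tab_mat hX τ s (by rw [Dim.val, hn]; exact i.2) (by rw [Dim.val, hn]; exact j.2)).trans (h i j)

theorem isVec_eigh (τ : Tape) {src vals vecs : ℕ} (hn : s.nat 0 = n)
    {H : Matrix (Fin n) (Fin n) ℂ} (hH : H.IsHermitian) (hs : s.IsMat src H) :
    ((eigh (k := k) src vals vecs).sem τ s).IsVec vals fun j => (hH.eigenvalues j : ℂ) := by
  intro i
  obtain rfl := hs.block
  have h : (eigh (k := k) src vals vecs).sem τ s = s.eigh src vals vecs n := by rw [← hn]; rfl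
  rw [h, State.eigh, dif_pos hH]
  exact dif_pos ⟨rfl, i.2⟩

theorem isMat_eigh (τ : Tape) {src vals vecs : ℕ} (hn : s.nat 0 = n)
    {H : Matrix (Fin n) (Fin n) ℂ} (hH : H.IsHermitian) (hs : s.IsMat src H) :
    ((eigh (k := k) src vals vecs).sem τ s).IsMat vecs
      (hH.eigenvectorUnitary : Matrix (Fin n) (Fin n) ℂ) := by
  intro i j
  obtain rfl := hs.block
  have h : (eigh (k := k) src vals vecs).sem τ s = s.eigh src vals vecs n := by rw [← hn]; rfl
  rw [h, State.eigh, dif_pos hH]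
  exact dif_pos ⟨rfl, i.2, j.2⟩

theorem seq_sem (p q : Cmd k) (τ : Tape) (s : State) :
    (p.seq q).sem τ s = q.sem τ (p.sem τ s) := rfl

theorem out (p : Cmd k) (τ : Tape) (hn : s.nat 0 = n) :
    ∃ s', p.sem τ s = s' ∧ s'.nat 0 = n ∧ ∀ b, b ∉ p.writes → s'.arr b = s.arr b :=
  ⟨_, rfl, (congrFun (p.nat_eq τ s) 0).trans hn, p.frame τ s⟩

end Cmd

/-! ### Expressions -/

/-- A natural number. -/
def CExp.num (k : ℕ) : CExp := .nat (.const k)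

/-- The square root of a positive number. -/
def CExp.sqrt (e : CExp) : CExp := .exp (.div (.log e) (.num 2))

theorem CExp.eval_num (s : State) (k : ℕ) : (CExp.num k).eval s = (k : ℂ) := rfl

theorem CExp.eval_sqrt {s : State} {e : CExp} {x : ℝ} (hx : 0 < x) (h : e.eval s = (x : ℂ)) :
    (CExp.sqrt e).eval s = ((√x : ℝ) : ℂ) := by
  rw [CExp.sqrt, CExp.eval, CExp.eval, CExp.eval, h, CExp.eval_num, ← Complex.ofReal_log hx.le]
  rw [← Real.exp_log hx, ← Real.exp_half, Real.log_exp]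
  push_cast
  rfl

/-! ### The unitary matrix `U |T|^{it}` -/

attribute [simp] XExp.val CExp.eval NExp.eval Test.holds Dim.val CExp.eval_num

/-- `T^* T` for the matrix `T` in the array `30`. -/
def gramCmd : Cmd 0 := Cmd.tab 33 [] [.n, .n] (.sum .n (.ret
  (.mul (.conj (.get 30 [.reg 5, .reg 3])) (.get 30 [.reg 5, .reg 4]))))

theorem gramCmd_spec (τ : Tape) {n : ℕ} {s : State} (hn : s.nat 0 = n)
    {T : Matrix (Fin n) (Fin n) ℂ} (hT : s.IsMat 30 T) : (gramCmd.sem τ s).IsMat 33 (Tᴴ * T) := by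
  refine Cmd.isMat_tab τ rfl hn fun i j => ?_
  simp [hn, Finset.sum_range, hT, Matrix.mul_apply]

/-- `T T^*` for the matrix `T` in the array `30`. -/
def coGramCmd : Cmd 0 := Cmd.tab 34 [] [.n, .n] (.sum .n (.ret
  (.mul (.get 30 [.reg 3, .reg 5]) (.conj (.get 30 [.reg 4, .reg 5])))))

theorem coGramCmd_spec (τ : Tape) {n : ℕ} {s : State} (hn : s.nat 0 = n)
    {T : Matrix (Fin n) (Fin n) ℂ} (hT : s.IsMat 30 T) : (coGramCmd.sem τ s).IsMat 34 (T * Tᴴ) := by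
  refine Cmd.isMat_tab τ rfl hn fun i j => ?_
  simp [hn, Finset.sum_range, hT, Matrix.mul_apply]

/-- The left singular vectors. -/
def leftVecCmd : Cmd 0 := Cmd.tab 39 [] [.n, .n] (.cond (.reLt (.num 0) (.get 35 [.reg 4]))
  (.sum .n (.ret (.div (.mul (.get 30 [.reg 3, .reg 5]) (.get 36 [.reg 5, .reg 4]))
    (.sqrt (.get 35 [.reg 4])))))
  (.ret (.get 38 [.reg 3, .reg 4])))

theorem leftVecCmd_spec (τ : Tape) {n : ℕ} {s : State} (hn : s.nat 0 = n)
    {T : Matrix (Fin n) (Fin n) ℂ} (hT : s.IsMat 30 T)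
    (hv : s.IsVec 35 fun j => (gramVal T j : ℂ)) (hw : s.IsMat 36 (gramVec T))
    (hc : s.IsMat 38 (coGramVec T)) : (leftVecCmd.sem τ s).IsMat 39 (leftVec T) := by
  refine Cmd.isMat_tab τ rfl hn fun i j => ?_
  rw [leftVec, Matrix.of_apply, XExp.val]
  by_cases h : 0 < gramVal T j
  · rw [if_pos (by simpa [hv] using h), if_pos h, Matrix.mul_apply, Finset.sum_div]
    have hs : ∀ v, (CExp.sqrt (.get 35 [.reg 4])).eval
        (((s.setNat 3 i).setNat 4 j).setNat 5 v) = ((√(gramVal T j) : ℝ) : ℂ) := fun v =>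
      CExp.eval_sqrt h (by simp [hv])
    simp [hn, Finset.sum_range, hT, hw, hs]
  · rw [if_neg (by simpa [hv] using h), if_neg h]
    simp [hc]

/-- The numbers `σ^{it}` for the singular values `σ`. -/
def imPowCmd : Cmd 0 := Cmd.tab 40 [] [.n] (.cond (.reLt (.num 0) (.get 35 [.reg 3]))
  (.ret (.exp (.mul .I (.mul (.get 31 []) (.log (.sqrt (.get 35 [.reg 3])))))))
  (.ret (.get 32 [])))

theorem imPowCmd_spec (τ : Tape) {n : ℕ} {s : State} (hn : s.nat 0 = n)
    {T : Matrix (Fin n) (Fin n) ℂ} {t : ℝ} {b : Bool} (ht : s.IsNum 31 t)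
    (hb : s.IsNum 32 (if b then -1 else 1)) (hv : s.IsVec 35 fun j => (gramVal T j : ℂ)) :
    (imPowCmd.sem τ s).IsVec 40 fun j => imPow b t (√(gramVal T j)) := by
  refine Cmd.isVec_tab τ rfl (D := .n) hn fun j => ?_
  rw [imPow, XExp.val]
  by_cases h : 0 < gramVal T j
  · rw [if_pos (by simpa [hv] using h), if_neg (Real.sqrt_pos.2 h).ne']
    have hs : (CExp.sqrt (.get 35 [.reg 3])).eval (s.setNat 3 j) = ((√(gramVal T j) : ℝ) : ℂ) :=
      CExp.eval_sqrt h (by simp [hv])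
    simp [hs, ht, Complex.ofReal_log (Real.sqrt_nonneg _)]
  · rw [if_neg (by simpa [hv] using h), if_pos (Real.sqrt_eq_zero_of_nonpos (not_lt.1 h))]
    simp [hb]

/-- The product of the factors. -/
def polarMulCmd : Cmd 0 := Cmd.tab 41 [] [.n, .n] (.sum .n (.ret
  (.mul (.mul (.get 39 [.reg 3, .reg 5]) (.get 40 [.reg 5])) (.conj (.get 36 [.reg 4, .reg 5])))))

theorem polarMulCmd_spec (τ : Tape) {n : ℕ} {s : State} (hn : s.nat 0 = n)
    {Q W : Matrix (Fin n) (Fin n) ℂ} {c : Fin n → ℂ} (hQ : s.IsMat 39 Q) (hc : s.IsVec 40 c)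
    (hW : s.IsMat 36 W) : (polarMulCmd.sem τ s).IsMat 41 (Q * Matrix.diagonal c * Wᴴ) := by
  refine Cmd.isMat_tab τ rfl hn fun i j => ?_
  rw [Matrix.mul_apply]
  simp [hn, Finset.sum_range, hQ, hc, hW, Matrix.mul_diagonal]

/-- From the matrix `T` in array `30`, the number `t` in array `31` and the sign in array `32`,
the matrix `U |T|^{it}` is computed in the array `41`. -/
def polarCmd : Cmd 0 :=
  gramCmd.seq <| coGramCmd.seq <| (Cmd.eigh 33 35 36).seq <| (Cmd.eigh 34 37 38).seq <|
    leftVecCmd.seq <| imPowCmd.seq polarMulCmd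

theorem polarCmd_spec (τ : Tape) {n : ℕ} {s : State} (hn : s.nat 0 = n)
    {T : Matrix (Fin n) (Fin n) ℂ} {t : ℝ} {b : Bool} (hT : s.IsMat 30 T) (ht : s.IsNum 31 t)
    (hb : s.IsNum 32 (if b then -1 else 1)) :
    (polarCmd.sem τ s).IsMat 41 (leftVec T *
      Matrix.diagonal (fun j => imPow b t (√(gramVal T j))) * (gramVec T)ᴴ) := by
  simp only [polarCmd, Cmd.seq_sem]
  have g1 := gramCmd_spec τ hn hT
  obtain ⟨s1, h1, n1, f1⟩ := gramCmd.out τ hn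
  rw [h1] at g1 ⊢
  have T1 := hT.congr (f1 30 (by decide))
  have g2 := coGramCmd_spec τ n1 T1
  obtain ⟨s2, h2, n2, f2⟩ := coGramCmd.out τ n1
  rw [h2] at g2 ⊢
  have v3 := Cmd.isVec_eigh (k := 0) (vals := 35) (vecs := 36) τ n2 (gram_isHermitian T)
    (g1.congr (f2 33 (by decide)))
  have w3 := Cmd.isMat_eigh (k := 0) (vals := 35) (vecs := 36) τ n2 (gram_isHermitian T)
    (g1.congr (f2 33 (by decide)))
  obtain ⟨s3, h3, n3, f3⟩ := (Cmd.eigh (k := 0) 33 35 36).out τ n2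
  rw [h3] at v3 w3 ⊢
  have c4 := Cmd.isMat_eigh (k := 0) (vals := 37) (vecs := 38) τ n3 (coGram_isHermitian T)
    (g2.congr (f3 34 (by decide)))
  obtain ⟨s4, h4, n4, f4⟩ := (Cmd.eigh (k := 0) 34 37 38).out τ n3
  rw [h4] at c4 ⊢
  have T4 := ((T1.congr (f2 30 (by decide))).congr (f3 30 (by decide))).congr (f4 30 (by decide))
  have v4 := v3.congr (f4 35 (by decide))
  have w4 := w3.congr (f4 36 (by decide))
  have q5 := leftVecCmd_spec τ n4 T4 v4 w4 c4
  obtain ⟨s5, h5, n5, f5⟩ := leftVecCmd.out τ n4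
  rw [h5] at q5 ⊢
  have t5 := ((((ht.congr (f1 31 (by decide))).congr (f2 31 (by decide))).congr
    (f3 31 (by decide))).congr (f4 31 (by decide))).congr (f5 31 (by decide))
  have b5 := ((((hb.congr (f1 32 (by decide))).congr (f2 32 (by decide))).congr
    (f3 32 (by decide))).congr (f4 32 (by decide))).congr (f5 32 (by decide))
  have c6 := imPowCmd_spec τ n5 t5 b5 (v4.congr (f5 35 (by decide)))
  obtain ⟨s6, h6, n6, f6⟩ := imPowCmd.out τ n5
  rw [h6] at c6 ⊢
  exact polarMulCmd_spec τ n6 (q5.congr (f6 39 (by decide))) c6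
    ((w4.congr (f5 36 (by decide))).congr (f6 36 (by decide)))

end NCG

end

noncomputable section

namespace NCG

/-! ### Drawing the random numbers -/

/-- The random numbers are stored in the arrays `10` and `11`. -/
def drawCmd : Cmd 0 :=
  (Cmd.rand 10 [.const 0]).seq <| (Cmd.rand 10 [.const 1]).seq <| (Cmd.rand 10 [.const 2]).seq <|
    (Cmd.rand 10 [.const 3]).seq <| (Cmd.rand 10 [.const 4]).seq <|
      Cmd.loop .d (Cmd.rand 11 [.reg 3])

theorem rand_sem (τ : Tape) (k a : ℕ) (idx : List NExp) (s : State) :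
    (Cmd.rand (k := k) a idx).sem τ s =
      { s.setArr a (idx.map (NExp.eval s)) (draw s.pos τ) with pos := s.pos + 1 } := rfl

theorem drawCmd_spec (τ : Tape) {s : State} (hp : s.pos = 0) :
    (∀ i < 5, (drawCmd.sem τ s).arr 10 [i] = draw i τ) ∧
      ∀ r < s.nat 1, (drawCmd.sem τ s).arr 11 [r] = draw (5 + r) τ := by
  have key : ∀ (s : State) (t : ℕ), let u := iter ((Cmd.rand (k := 1) 11 [.reg 3]).sem τ) 3 s t
      u.pos = s.pos + t ∧ u.arr 10 = s.arr 10 ∧ ∀ r < t, u.arr 11 [r] = draw (s.pos + r) τ := by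
    intro s t
    induction t with
    | zero => exact ⟨rfl, rfl, fun r hr => absurd hr (Nat.not_lt_zero r)⟩
    | succ t ih =>
      obtain ⟨h1, h2, h3⟩ := ih
      simp only [iter, rand_sem, State.setArr, State.setNat, h1]
      refine ⟨by omega, by simpa using h2, fun r hr => ?_⟩
      by_cases hrt : r = t
      · subst hrt; simp
      · simpa [hrt] using h3 r (by omega)
  simp only [drawCmd, Cmd.seq_sem, Cmd.loop_sem]
  obtain ⟨_, h2, h3⟩ := key _ (s.nat 1)
  refine ⟨fun i hi => ?_, fun r hr => ?_⟩
  · refine (congrFun h2 _).trans ?_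
    interval_cases i <;> simp [rand_sem, State.setArr, hp]
  · refine (h3 r hr).trans ?_
    simp [rand_sem, hp]

/-! ### Elementary functions -/

/-- The number `π`. -/
def CExp.pi : CExp := .mul (.sub (.num 0) .I) (.log (.sub (.num 0) (.num 1)))

/-- The cosine. -/
def CExp.cos (e : CExp) : CExp :=
  .div (.add (.exp (.mul e .I)) (.exp (.mul (.sub (.num 0) e) .I))) (.num 2)

/-- The sine. -/
def CExp.sin (e : CExp) : CExp :=
  .div (.mul (.sub (.exp (.mul (.sub (.num 0) e) .I)) (.exp (.mul e .I))) .I) (.num 2)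

@[simp] theorem CExp.eval_pi (s : State) : CExp.pi.eval s = (Real.pi : ℂ) := by
  simp only [CExp.pi, CExp.eval, CExp.eval_num, Nat.cast_zero, Nat.cast_one, zero_sub,
    Complex.log_neg_one]
  rw [mul_comm, mul_assoc, mul_neg, Complex.I_mul_I, neg_neg, mul_one]

@[simp] theorem CExp.eval_cos (s : State) (e : CExp) : e.cos.eval s = Complex.cos (e.eval s) := by
  simp [CExp.cos, Complex.cos]

@[simp] theorem CExp.eval_sin (s : State) (e : CExp) : e.sin.eval s = Complex.sin (e.eval s) := by
  simp [CExp.sin, Complex.sin]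

/-! ### Krivine's coefficients -/

/-- The number `2 l + 1`, where `l` is the content of the register `r`. -/
def NExp.odd (r : ℕ) : NExp := .add (.mul (.const 2) (.reg r)) (.const 1)

@[simp] theorem NExp.eval_odd (s : State) (r : ℕ) : (NExp.odd r).eval s = 2 * s.nat r + 1 := rfl

/-- The table of the numbers `a_{2l+1}`. -/
def krivineACmd : Cmd 0 := Cmd.tab 14 [] [.L] (.ret (.mul (.mul
  (.mul (.exp (.mul (.nat (.reg 3)) (.mul .pi .I)))
    (.cos (.div (.mul (.nat (.odd 3)) .pi) (.num 4))))
  (.div (.num 16) (.mul (.mul .pi .pi) (.nat (.mul (.mul (.odd 3) (.odd 3)) (.mul (.odd 3)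
      (.odd 3)))))))
  (.sub (.div (.num 1) (.nat (.odd 3)))
    (.mul (.exp (.mul (.nat (.reg 3)) (.mul .pi .I))) (.div .pi (.num 4))))))

theorem krivineA_two_mul_add_one (l : ℕ) : krivineA (2 * l + 1) = (-1) ^ l *
    Real.cos ((2 * l + 1 : ℕ) * Real.pi / 4) * (16 / (Real.pi ^ 2 * ((2 * l + 1 : ℕ) : ℝ) ^ 4))
    * (1 / ((2 * l + 1 : ℕ) : ℝ) - (-1) ^ l * (Real.pi / 4)) := by
  rw [krivineA, if_neg (by simp), show (2 * l + 1) / 2 = l by omega]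

theorem krivineACmd_spec (τ : Tape) (s : State) {l : ℕ} (hl : l < s.nat 2 + 1) :
    (krivineACmd.sem τ s).arr 14 [l] = krivineA (2 * l + 1) := by
  refine (Cmd.tab_vec rfl τ s (D := .L) hl).trans ?_
  have h1 : Complex.exp (l * (Real.pi * Complex.I)) = (-1) ^ l := by
    rw [Complex.exp_nat_mul, Complex.exp_pi_mul_I]
  rw [krivineA_two_mul_add_one]
  simp [h1, -mul_eq_mul_left_iff, -mul_eq_mul_right_iff]
  ring

/-- The convolution in the recursion for the numbers `b_{2l+1}`. -/
def convCmd : Cmd 1 := Cmd.tab 15 [] [] (.sum .L (.sum .L (.cond (.natLt (.const 0) (.reg 4))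
  -- Equality of the product with the index is tested by excluding both strict inequalities.
  (.cond (.natLt (.mul (.odd 4) (.odd 5)) (.odd 3)) (.ret (.num 0))
    (.cond (.natLt (.odd 3) (.mul (.odd 4) (.odd 5))) (.ret (.num 0))
      (.ret (.mul (.get 14 [.reg 4]) (.get 16 [.reg 5])))))
  (.ret (.num 0)))))

/-- A step of the recursion for the numbers `b_{2l+1}`. -/
def stepCmd : Cmd 1 := Cmd.tab 16 [.reg 3] [] (.cond (.natLt (.reg 3) (.const 1))
  (.ret (.div (.mul (.sqrt (.num 2)) (.mul (.div .pi (.num 4)) (.mul (.div .pi (.num 4))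
    (.div .pi (.num 4))))) (.mul (.num 3) (.get 14 [.const 0]))))
  (.ret (.sub (.num 0) (.div (.get 15 []) (.get 14 [.const 0])))))

/-- The table of the numbers `b_{2l+1}`. -/
def krivineBCmd : Cmd 0 := Cmd.loop .L (convCmd.seq stepCmd)

/-- Divisors and cofactors of an odd number are odd, so they are 2i + 1 and 2j + 1 with i, j ≤ t;
the condition 0 < i removes the divisor 1. -/
theorem sum_divisors_odd {N t : ℕ} (ht : t < N) (a b : ℕ → ℂ) :
    ∑ d ∈ (2 * t + 1).divisors.erase 1, a d * b ((2 * t + 1) / d) =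
      ∑ i ∈ Finset.range N, ∑ j ∈ Finset.range N,
        if 0 < i ∧ (2 * i + 1) * (2 * j + 1) = 2 * t + 1 then a (2 * i + 1) * b (2 * j + 1)
            else 0 := by
  rw [← Finset.sum_product', ← Finset.sum_filter]
  have hodd : ∀ d e, d * e = 2 * t + 1 → d = 2 * (d / 2) + 1 := fun d e h => by
    have : Odd (d * e) := by rw [h]; exact odd_two_mul_add_one t
    obtain ⟨k, hk⟩ := (Nat.odd_mul.1 this).1
    omega
  refine Finset.sum_bij' (fun d _ => (d / 2, (2 * t + 1) / d / 2)) (fun p _ => 2 * p.1 + 1)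
    ?_ ?_ ?_ ?_ ?_
  · intro d hd
    rw [Finset.mem_erase, Nat.mem_divisors] at hd
    obtain ⟨h1, ⟨e, he⟩, -⟩ := hd
    have hd1 := hodd d e he.symm
    have he1 := hodd e d (by rw [mul_comm e, ← he])
    have hq : (2 * t + 1) / d = e := by rw [he]; exact Nat.mul_div_cancel_left _ (by omega)
    have hdl : d ≤ 2 * t + 1 := Nat.le_of_dvd (by omega) ⟨e, he⟩
    have hel : e ≤ 2 * t + 1 := Nat.le_of_dvd (by omega) ⟨d, by rw [mul_comm e, ← he]⟩
    simp only [hq, Finset.mem_filter, Finset.mem_product, Finset.mem_range]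
    refine ⟨⟨by omega, by omega⟩, by omega, ?_⟩
    rw [← hd1, ← he1, he]
  · rintro ⟨i, j⟩ hp
    simp only [Finset.mem_filter, Finset.mem_product, Finset.mem_range] at hp
    rw [Finset.mem_erase, Nat.mem_divisors]
    exact ⟨by omega, ⟨_, hp.2.2.symm⟩, by omega⟩
  · intro d hd
    rw [Finset.mem_erase, Nat.mem_divisors] at hd
    obtain ⟨h1, ⟨e, he⟩, -⟩ := hd
    exact (hodd d e he.symm).symm
  · rintro ⟨i, j⟩ hp
    simp only [Finset.mem_filter, Finset.mem_product, Finset.mem_range] at hp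
    have : (2 * t + 1) / (2 * i + 1) = 2 * j + 1 := by
      rw [← hp.2.2]; exact Nat.mul_div_cancel_left _ (by omega)
    simp only [this, Prod.mk.injEq]
    omega
  · intro d hd
    rw [Finset.mem_erase, Nat.mem_divisors] at hd
    obtain ⟨h1, ⟨e, he⟩, -⟩ := hd
    have hd1 := hodd d e he.symm
    have he1 := hodd e d (by rw [mul_comm e, ← he])
    have hq : (2 * t + 1) / d = e := by rw [he]; exact Nat.mul_div_cancel_left _ (by omega)
    rw [hq]
    simp only
    rw [← hd1, ← he1]

theorem convCmd_spec (τ : Tape) {s : State} {N t : ℕ} (hN : s.nat 2 + 1 = N) (ht : t < N)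
    (h3 : s.nat 3 = t) (hA : ∀ l < N, s.arr 14 [l] = krivineA (2 * l + 1))
    (hB : ∀ l < t, s.arr 16 [l] = krivineB (2 * l + 1)) :
    (convCmd.sem τ s).IsNum 15
      (∑ d ∈ (2 * t + 1).divisors.erase 1, (krivineA d : ℂ) * krivineB ((2 * t + 1) / d)) := by
  refine Cmd.isNum_tab τ rfl ?_
  rw [sum_divisors_odd ht (fun m => (krivineA m : ℂ)) fun m => (krivineB m : ℂ)]
  simp only [XExp.val, Dim.val, State.nat_setNat]
  simp only [Function.update_apply, Nat.reduceEqDiff, if_false, hN]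
  refine Finset.sum_congr rfl fun i hi => Finset.sum_congr rfl fun j hj => ?_
  rw [Finset.mem_range] at hi hj
  by_cases h : 0 < i ∧ (2 * i + 1) * (2 * j + 1) = 2 * t + 1
  · have hjt : j < t := by nlinarith [h.1, h.2]
    simp [h3, h.1, h.2, hA i hi, hB j hjt]
  · rw [if_neg h]
    by_cases h0 : 0 < i
    · rcases lt_trichotomy ((2 * i + 1) * (2 * j + 1)) (2 * t + 1) with h4 | h4 | h4
      · simp [h3, h4]
      · exact absurd ⟨h0, h4⟩ h
      · simp [h3, h4]
    · simp [h0]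

theorem stepCmd_spec (τ : Tape) {s : State} {t : ℕ} (h3 : s.nat 3 = t)
    (hA : s.arr 14 [0] = krivineA 1) (hT : s.IsNum 15
      (∑ d ∈ (2 * t + 1).divisors.erase 1, (krivineA d : ℂ) * krivineB ((2 * t + 1) / d))) :
    (stepCmd.sem τ s).arr 16 [t] = krivineB (2 * t + 1) := by
  have h := Cmd.tab_apply (k := 1) (a := 16) (pre := [.reg 3]) (X := (.cond (.natLt (.reg 3)
      (.const 1))
    (.ret (.div (.mul (.sqrt (.num 2)) (.mul (.div .pi (.num 4)) (.mul (.div .pi (.num 4))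
      (.div .pi (.num 4))))) (.mul (.num 3) (.get 14 [.const 0]))))
    (.ret (.sub (.num 0) (.div (.get 15 []) (.get 14 [.const 0])))))) rfl
    (stable_reg (by norm_num)) τ s List.Forall₂.nil
  simp only [List.map, NExp.eval, h3, List.append_nil] at h
  refine h.trans ?_
  have h2 : (CExp.sqrt (.num 2)).eval s = ((√2 : ℝ) : ℂ) :=
    CExp.eval_sqrt (by norm_num) (by simp)
  by_cases ht : t = 0
  · subst ht
    simp [State.setFrom, h3, hA, h2, krivineB_one]
    ring
  · rw [krivineB_of_ne (by omega)]
    simp [State.setFrom, h3, ht, hA, hT]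
    ring

theorem krivineBCmd_spec (τ : Tape) {s : State} {N : ℕ} (hN : s.nat 2 + 1 = N)
    (hA : ∀ l < N, s.arr 14 [l] = krivineA (2 * l + 1)) {l : ℕ} (hl : l < N) :
    (krivineBCmd.sem τ s).arr 16 [l] = krivineB (2 * l + 1) := by
  have key : ∀ t ≤ N, ∀ l < t, (iter ((convCmd.seq stepCmd).sem τ) 3 s t).arr 16 [l]
      = krivineB (2 * l + 1) := by
    intro t
    induction t with
    | zero => exact fun _ l hl => absurd hl (Nat.not_lt_zero l)
    | succ t ih =>
      intro ht l hl
      set u := iter ((convCmd.seq stepCmd).sem τ) 3 s t with hu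
      have hnat : u.nat = s.nat := iter_nat ((convCmd.seq stepCmd).nat_eq τ) _ _ _
      have hA' : ∀ l < N, u.arr 14 [l] = krivineA (2 * l + 1) := fun l hl => by
        rw [← hA l hl]
        exact congrFun (Cmd.iter_frame (convCmd.seq stepCmd) τ 3 s t 14 (by decide)) _
      have h1 := convCmd_spec τ (s := u.setNat 3 t) (N := N) (t := t) (by simpa [hnat] using hN)
        ht (by simp) hA' (ih (by omega))
      have f1 := convCmd.frame τ (u.setNat 3 t)
      have n1 := convCmd.nat_eq τ (u.setNat 3 t)
      change (stepCmd.sem τ (convCmd.sem τ (u.setNat 3 t))).arr 16 [l] = _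
      generalize convCmd.sem τ (u.setNat 3 t) = v at h1 f1 n1
      have h3 : v.nat 3 = t := by simp [n1]
      by_cases hlt : l = t
      · subst hlt
        refine stepCmd_spec τ h3 ?_ h1
        rw [f1 14 (by decide)]
        exact hA' 0 (by omega)
      · refine (Cmd.tab_frame (Ds := []) rfl (stable_reg (by norm_num)) τ v ?_).trans ?_
        · intro l' h
          simp only [List.map, NExp.eval, h3, List.cons_append, List.nil_append] at h
          exact hlt (List.cons.inj h).1
        · rw [f1 16 (by decide)]
          exact ih (by omega) l (by omega)
  rw [krivineBCmd, Cmd.loop_sem, Dim.val, hN]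
  exact key N le_rfl l hl

/-! ### The choice of the index -/

/-- The absolute value of the number in the entry `[r]` of the array `16`. -/
def absX (r : ℕ) (b : XExp → XExp) : XExp :=
  .cond (.reLt (.get 16 [.reg r]) (.num 0)) (b (.ret (.sub (.num 0) (.get 16 [.reg r]))))
    (b (.ret (.get 16 [.reg r])))

/-- The partial sums of the probabilities, without the last term. -/
def lowerCmd : Cmd 0 := Cmd.tab 17 [] [.L] (.sum .L
  (.cond (.natLt (.reg 4) (.reg 3)) (absX 4 id) (.ret (.num 0))))

/-- The partial sums of the probabilities, with the last term. -/
def upperCmd : Cmd 0 := Cmd.tab 18 [] [.L] (.sum .L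
  (.cond (.natLt (.reg 4) (.add (.reg 3) (.const 1))) (absX 4 id) (.ret (.num 0))))

theorem val_absX {s : State} {r k : ℕ} {x : ℝ} (h : s.arr 16 [s.nat r] = x) :
    (absX r id).val k s = ((|x| : ℝ) : ℂ) := by
  simp only [absX, id, XExp.val, Test.holds, CExp.eval, List.map, NExp.eval, h, CExp.eval_num,
    Nat.cast_zero, zero_sub, Complex.ofReal_re, Complex.zero_re]
  split_ifs with h0
  · rw [abs_of_neg h0, Complex.ofReal_neg]
  · rw [abs_of_nonneg (not_lt.1 h0)]

theorem sum_range_ite_lt {N l : ℕ} (hl : l ≤ N) (f : ℕ → ℂ) :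
    ∑ i ∈ Finset.range N, (if i < l then f i else 0) = ∑ i ∈ Finset.range l, f i := by
  rw [← Finset.sum_filter]
  congr 1
  ext i
  simp only [Finset.mem_filter, Finset.mem_range]
  omega

theorem lowerCmd_spec (τ : Tape) {s : State} {N : ℕ} (hN : s.nat 2 + 1 = N)
    (hB : ∀ l < N, s.arr 16 [l] = krivineB (2 * l + 1)) {l : ℕ} (hl : l < N) :
    (lowerCmd.sem τ s).arr 17 [l] = indexSum l := by
  refine (Cmd.tab_vec rfl τ s (D := .L) (by rw [Dim.val, hN]; exact hl)).trans ?_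
  rw [indexSum, Complex.ofReal_sum, ← sum_range_ite_lt hl.le, XExp.val, Dim.val_setNat, Dim.val, hN]
  refine Finset.sum_congr rfl fun i hi => ?_
  rw [Finset.mem_range] at hi
  rw [XExp.val, val_absX (x := krivineB (2 * i + 1)) (by simp [hB i hi])]
  simp

theorem upperCmd_spec (τ : Tape) {s : State} {N : ℕ} (hN : s.nat 2 + 1 = N)
    (hB : ∀ l < N, s.arr 16 [l] = krivineB (2 * l + 1)) {l : ℕ} (hl : l < N) :
    (upperCmd.sem τ s).arr 18 [l] = indexSum (l + 1) := by
  refine (Cmd.tab_vec rfl τ s (D := .L) (by rw [Dim.val, hN]; exact hl)).trans ?_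
  rw [indexSum, Complex.ofReal_sum, ← sum_range_ite_lt (N := N) (by omega), XExp.val,
    Dim.val_setNat, Dim.val, hN]
  refine Finset.sum_congr rfl fun i hi => ?_
  rw [Finset.mem_range] at hi
  rw [XExp.val, val_absX (x := krivineB (2 * i + 1)) (by simp [hB i hi])]
  simp

/-- The indicator of the chosen index. -/
def indicatorCmd : Cmd 0 := Cmd.tab 19 [] [.L] (.cond (.reLt (.get 10 [.const 2])
    (.get 17 [.reg 3]))
  (.ret (.num 0)) (.cond (.reLt (.get 10 [.const 2]) (.get 18 [.reg 3]))
    (.ret (.num 1)) (.ret (.num 0))))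

theorem indexOf_cases {L : ℕ} {u : ℝ} (hu : 0 ≤ u) :
    (∃ l ≤ L, u ∈ Set.Ico (indexSum l) (indexSum (l + 1)) ∧ indexOf L u = l) ∨
      indexSum (L + 1) ≤ u ∧ indexOf L u = -1 := by
  rcases le_or_gt (indexSum (L + 1)) u with h | h
  · exact Or.inr ⟨h, indexOf_of_ge h⟩
  · left
    classical
    have hex : ∃ l, u < indexSum (l + 1) := ⟨L, h⟩
    have hl : Nat.find hex ≤ L := Nat.find_min' hex h
    have hmem : u ∈ Set.Ico (indexSum (Nat.find hex)) (indexSum (Nat.find hex + 1)) := by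
      refine ⟨?_, Nat.find_spec hex⟩
      rcases Nat.eq_zero_or_pos (Nat.find hex) with h0 | h0
      · rw [h0, indexSum_zero]; exact hu
      · have := Nat.find_min hex (Nat.sub_one_lt h0.ne')
        rw [Nat.sub_add_cancel h0] at this
        exact not_lt.1 this
    exact ⟨_, hl, hmem, indexOf_of_mem hl hmem⟩

theorem indexOf_eq_iff {L l : ℕ} (hl : l ≤ L) {u : ℝ} (hu : 0 ≤ u) :
    (l : ℤ) = indexOf L u ↔ u ∈ Set.Ico (indexSum l) (indexSum (l + 1)) := by
  refine ⟨fun h => ?_, fun h => (indexOf_of_mem hl h).symm⟩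
  rcases indexOf_cases (L := L) hu with ⟨l', _, hm, h'⟩ | ⟨_, h'⟩
  · rw [h'] at h
    obtain rfl : l = l' := by exact_mod_cast h
    exact hm
  · omega

theorem indicatorCmd_spec (τ : Tape) {s : State} {L : ℕ} (hN : s.nat 2 = L) {u : ℝ} (hu : 0 ≤ u)
    (h10 : s.arr 10 [2] = u) (h17 : ∀ l < L + 1, s.arr 17 [l] = indexSum l)
    (h18 : ∀ l < L + 1, s.arr 18 [l] = indexSum (l + 1)) {l : ℕ} (hl : l < L + 1) :
    (indicatorCmd.sem τ s).arr 19 [l] = if (l : ℤ) = indexOf L u then 1 else 0 := by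
  refine (Cmd.tab_vec rfl τ s (D := .L) (by rw [Dim.val, hN]; exact hl)).trans ?_
  simp only [indexOf_eq_iff (Nat.lt_succ_iff.1 hl) hu, Set.mem_Ico]
  by_cases h1 : u < indexSum l
  · have h2 : ¬ indexSum l ≤ u := not_le.2 h1
    simp [h10, h17 l hl, h1, h2]
  · have h2 : indexSum l ≤ u := not_lt.1 h1
    by_cases h3 : u < indexSum (l + 1)
    · simp [h10, h17 l hl, h18 l hl, h1, h2, h3]
    · simp [h10, h17 l hl, h18 l hl, h1, h3]

/-- The sign of the coefficient with the chosen index. -/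
def signCmd : Cmd 0 := Cmd.tab 20 [] [] (.sum .L
  (.cond (.reLt (.get 16 [.reg 3]) (.num 0)) (.ret (.sub (.num 0) (.get 19 [.reg 3])))
    (.cond (.reLt (.num 0) (.get 16 [.reg 3])) (.ret (.get 19 [.reg 3])) (.ret (.num 0)))))

/-- The sign of the coefficient with index `l`; zero for negative `l`. -/
def indexSign (l : ℤ) : ℝ := if 0 ≤ l then Real.sign (krivineB (2 * l.toNat + 1)) else 0

/-- The program keeps the index as an indicator vector and reads off quantities that depend on it as
sums; for the index -1 the vector is zero and so is the sum. -/
theorem sum_ite_indexOf {L : ℕ} {u : ℝ} (hu : 0 ≤ u) (f : ℕ → ℂ) :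
    ∑ l ∈ Finset.range (L + 1), (if (l : ℤ) = indexOf L u then f l else 0) =
      if 0 ≤ indexOf L u then f (indexOf L u).toNat else 0 := by
  rcases indexOf_cases (L := L) hu with ⟨l', hl, _, h⟩ | ⟨_, h⟩
  · have hm : l' ∈ Finset.range (L + 1) := Finset.mem_range.2 (by omega)
    simp only [h, Nat.cast_inj, Nat.cast_nonneg, if_true, Int.toNat_natCast]
    rw [Finset.sum_eq_single_of_mem l' hm fun b _ hb => if_neg hb, if_pos rfl]
  · have : ¬ (0 : ℤ) ≤ -1 := by omega
    rw [h, if_neg this]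
    exact Finset.sum_eq_zero fun l _ => if_neg (by omega)

theorem signCmd_spec (τ : Tape) {s : State} {L : ℕ} (hN : s.nat 2 = L) {u : ℝ} (hu : 0 ≤ u)
    (hB : ∀ l < L + 1, s.arr 16 [l] = krivineB (2 * l + 1))
    (h19 : ∀ l < L + 1, s.arr 19 [l] = if (l : ℤ) = indexOf L u then 1 else 0) :
    (signCmd.sem τ s).IsNum 20 (indexSign (indexOf L u)) := by
  refine Cmd.isNum_tab τ rfl ?_
  have h := sum_ite_indexOf (L := L) hu fun l => (Real.sign (krivineB (2 * l + 1)) : ℂ)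
  have h' : ((indexSign (indexOf L u) : ℝ) : ℂ) = if 0 ≤ indexOf L u then
      (Real.sign (krivineB (2 * (indexOf L u).toNat + 1)) : ℂ) else 0 := by
    rw [indexSign]; split_ifs <;> simp
  rw [h', ← h, XExp.val, Dim.val, hN]
  refine Finset.sum_congr rfl fun l hl => ?_
  rw [Finset.mem_range] at hl
  rcases lt_trichotomy (krivineB (2 * l + 1)) 0 with h1 | h1 | h1
  · rw [Real.sign_of_neg h1]
    simp [hB l hl, h1, h19 l hl]
    split_ifs <;> simp
  · rw [h1, Real.sign_zero]
    simp [hB l hl, h1]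
  · rw [Real.sign_of_pos h1]
    simp [hB l hl, h1, h1.le, h19 l hl]

end NCG

end

noncomputable section

namespace NCG

open scoped ComplexOrder Matrix

/-! ### The projections -/

/-- The conjugates of the random fourth roots of unity. -/
def rootCmd : Cmd 0 := Cmd.tab 23 [] [.d]
  (.cond (.reLt (.get 11 [.reg 3]) (.div (.num 1) (.num 4))) (.ret (.num 1))
    (.cond (.reLt (.get 11 [.reg 3]) (.div (.num 1) (.num 2))) (.ret (.sub (.num 0) .I))
      (.cond (.reLt (.get 11 [.reg 3]) (.div (.num 3) (.num 4))) (.ret (.sub (.num 0) (.num 1)))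
        (.ret .I))))

theorem rootCmd_spec (τ : Tape) {s : State} {d : ℕ} (hd : s.nat 1 = d) {u : ℕ → ℝ}
    (hu : ∀ r < d, s.arr 11 [r] = u r) :
    (rootCmd.sem τ s).IsVec 23 fun r : Fin d => star (Complex.I ^ (quarter (u r) : ℕ)) := by
  refine Cmd.isVec_tab τ rfl (D := .d) hd fun r => ?_
  have e1 : (1 / 4 : ℂ).re = 1 / 4 := by norm_num
  have e2 : (1 / 2 : ℂ).re = 1 / 2 := by norm_num
  have e3 : (3 / 4 : ℂ).re = 3 / 4 := by norm_num
  have h := hu r r.2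
  simp only [XExp.val, Test.holds, CExp.eval, List.map, NExp.eval, State.arr_setNat,
    State.nat_setNat, zero_add, Function.update_self, h, Complex.ofReal_re, CExp.eval_num,
    Nat.cast_one, Nat.cast_ofNat, Nat.cast_zero, e1, e2, e3, quarter]
  split_ifs <;> simp [pow_succ]

/-- The projection of the vector-valued matrix in the array `a`. -/
def projCmd (a : ℕ) : Cmd 0 := Cmd.tab 30 [] [.n, .n] (.sum .d (.ret
  (.mul (.div (.num 1) (.sqrt (.num 2))) (.mul (.get a [.reg 3, .reg 4, .reg 5])
      (.get 23 [.reg 5])))))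

theorem projCmd_spec (τ : Tape) {s : State} {n d a : ℕ} (ha : a ≠ 30) (hn : s.nat 0 = n)
    (hd : s.nat 1 = d) {X : VMat n d} (hX : ∀ (i j : Fin n) (r : Fin d),
      s.arr a [(i : ℕ), (j : ℕ), (r : ℕ)] = X i j r) {z : Fin d → Fin 4}
    (hz : s.IsVec 23 fun r => star (Complex.I ^ (z r : ℕ))) :
    ((projCmd a).sem τ s).IsMat 30 (proj X z) := by
  refine Cmd.isMat_tab τ ?_ hn fun i j => ?_
  · simp [XExp.avoids, CExp.avoids, CExp.sqrt, CExp.num, ha.symm]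
  · have h2 : ∀ s, (CExp.sqrt (.num 2)).eval s = ((√2 : ℝ) : ℂ) := fun s =>
      CExp.eval_sqrt (by norm_num) (by simp)
    simp [hd, Finset.sum_range, h2, hX, hz, proj, cdot, Finset.mul_sum]

/-! ### The numbers of the complex rounding -/

/-- The random number of the complex rounding. -/
def sechExp : CExp := .mul (.div (.num 2) .pi) (.log (.div
  (.sin (.div (.mul .pi (.get 10 [.const 0])) (.num 2)))
  (.cos (.div (.mul .pi (.get 10 [.const 0])) (.num 2)))))

/-- The tangent is nonnegative on this range, so the complex and the real logarithm agree; at both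
endpoints the conventions for division by 0 and log 0 give the value 0. -/
theorem eval_sechExp {s : State} {u : ℝ} (h0 : 0 ≤ u) (h1 : u ≤ 1) (h : s.arr 10 [0] = u) :
    sechExp.eval s = (sechQuantile u : ℂ) := by
  have hp := Real.pi_pos
  have ht : 0 ≤ Real.tan (Real.pi * u / 2) :=
    Real.tan_nonneg_of_nonneg_of_le_pi_div_two (by positivity) (by nlinarith)
  rw [sechQuantile, Complex.ofReal_mul, Complex.ofReal_log ht, Real.tan_eq_sin_div_cos]
  simp [sechExp, h]

/-- The sign that is used on the kernel, chosen by the `i`-th random number. -/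
def coinX (i : ℕ) : XExp := .cond (.reLt (.get 10 [.const i]) (.div (.num 1) (.num 2)))
  (.ret (.sub (.num 0) (.num 1))) (.ret (.num 1))

theorem val_coinX {s : State} {i k : ℕ} {u : ℝ} (h : s.arr 10 [i] = u) :
    (coinX i).val k s = if coin u then -1 else 1 := by
  have e2 : (1 / 2 : ℂ).re = 1 / 2 := by norm_num
  simp only [coinX, XExp.val, Test.holds, CExp.eval, List.map, NExp.eval, h, Complex.ofReal_re,
    CExp.eval_num, Nat.cast_one, Nat.cast_ofNat, Nat.cast_zero, e2, coin, decide_eq_true_eq,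
    zero_sub]

/-- The memory after the choice of the random numbers. -/
structure Ready {n d : ℕ} (L : ℕ) (τ : Tape) (M : Tensor n) (X Y : VMat n d)
    (s : State) : Prop where
  nat_zero : s.nat 0 = n
  nat_one : s.nat 1 = d
  nat_two : s.nat 2 = L
  tensor : ∀ i j k l : Fin n, s.arr 1 [(i : ℕ), (j : ℕ), (k : ℕ), (l : ℕ)] = M i j k l
  left : ∀ (i j : Fin n) (r : Fin d), s.arr 2 [(i : ℕ), (j : ℕ), (r : ℕ)] = X i j r
  right : ∀ (i j : Fin n) (r : Fin d), s.arr 3 [(i : ℕ), (j : ℕ), (r : ℕ)] = Y i j r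
  draws : ∀ i < 5, s.arr 10 [i] = draw i τ
  indicator : ∀ l < L + 1, s.arr 19 [l] = if (l : ℤ) = indexOf L (draw 2 τ) then 1 else 0
  sign : s.IsNum 20 (indexSign (indexOf L (draw 2 τ)))
  roots : s.IsVec 23 fun r : Fin d => star (Complex.I ^ (quarter (draw (5 + r) τ) : ℕ))

theorem draw_nonneg (i : ℕ) (τ : Tape) : 0 ≤ draw i τ := (τ i).2.1

theorem draw_le_one (i : ℕ) (τ : Tape) : draw i τ ≤ 1 := (τ i).2.2

section

variable {n d L : ℕ} {τ : Tape} {M : Tensor n} {X Y : VMat n d} {s : State}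

theorem Ready.step (h : Ready L τ M X Y s) (p : Cmd 0)
    (hp : ∀ a ∈ [1, 2, 3, 10, 19, 20, 23], a ∉ p.writes) : Ready L τ M X Y (p.sem τ s) := by
  have f : ∀ a ∈ [1, 2, 3, 10, 19, 20, 23], (p.sem τ s).arr a = s.arr a := fun a ha =>
    p.frame τ s a (hp a ha)
  have hn := p.nat_eq τ s
  refine ⟨by rw [hn, h.nat_zero], by rw [hn, h.nat_one], by rw [hn, h.nat_two], ?_, ?_, ?_, ?_, ?_,
    h.sign.congr (f 20 (by decide)), h.roots.congr (f 23 (by decide))⟩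
  · rw [f 1 (by decide)]; exact h.tensor
  · rw [f 2 (by decide)]; exact h.left
  · rw [f 3 (by decide)]; exact h.right
  · rw [f 10 (by decide)]; exact h.draws
  · rw [f 19 (by decide)]; exact h.indicator

end

/-- The preparation: random numbers, coefficients, index. -/
def prepareCmd : Cmd 0 :=
  drawCmd.seq <| krivineACmd.seq <| krivineBCmd.seq <| lowerCmd.seq <| upperCmd.seq <|
    indicatorCmd.seq <| signCmd.seq rootCmd

theorem Cmd.out_nat {k : ℕ} (p : Cmd k) (τ : Tape) {s : State} {f : ℕ → ℕ} (hn : s.nat = f) :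
    ∃ s', p.sem τ s = s' ∧ s'.nat = f ∧ ∀ b, b ∉ p.writes → s'.arr b = s.arr b :=
  ⟨_, rfl, (p.nat_eq τ s).trans hn, p.frame τ s⟩

theorem prepareCmd_spec (τ : Tape) {n d L : ℕ} {M : Tensor n} {X Y : VMat n d} {s : State}
    (h0 : s.nat 0 = n) (h1 : s.nat 1 = d) (h2 : s.nat 2 = L) (hp : s.pos = 0)
    (hM : ∀ i j k l : Fin n, s.arr 1 [(i : ℕ), (j : ℕ), (k : ℕ), (l : ℕ)] = M i j k l)
    (hX : ∀ (i j : Fin n) (r : Fin d), s.arr 2 [(i : ℕ), (j : ℕ), (r : ℕ)] = X i j r)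
    (hY : ∀ (i j : Fin n) (r : Fin d), s.arr 3 [(i : ℕ), (j : ℕ), (r : ℕ)] = Y i j r) :
    Ready L τ M X Y (prepareCmd.sem τ s) := by
  have fin := prepareCmd.frame τ s
  have nfin := prepareCmd.nat_eq τ s
  have hN : s.nat 2 + 1 = L + 1 := by rw [h2]
  simp only [prepareCmd, Cmd.seq_sem] at fin nfin ⊢
  obtain ⟨g10, g11⟩ := drawCmd_spec τ hp
  obtain ⟨s1, e1, n1, f1⟩ := drawCmd.out_nat τ rfl
  rw [e1] at fin nfin g10 g11 ⊢
  have gA := fun l (hl : l < L + 1) => krivineACmd_spec τ s1 (l := l) (by rw [n1, hN]; exact hl)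
  obtain ⟨s2, e2, n2, f2⟩ := krivineACmd.out_nat τ n1
  rw [e2] at fin nfin gA ⊢
  have gB := fun l (hl : l < L + 1) => krivineBCmd_spec τ (s := s2) (l := l) (by rw [n2, hN]) gA hl
  obtain ⟨s3, e3, n3, f3⟩ := krivineBCmd.out_nat τ n2
  rw [e3] at fin nfin gB ⊢
  have gl := fun l (hl : l < L + 1) => lowerCmd_spec τ (s := s3) (l := l) (by rw [n3, hN]) gB hl
  obtain ⟨s4, e4, n4, f4⟩ := lowerCmd.out_nat τ n3
  rw [e4] at fin nfin gl ⊢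
  have gB4 : ∀ l < L + 1, s4.arr 16 [l] = krivineB (2 * l + 1) := fun l hl => by
    rw [f4 16 (by decide), gB l hl]
  have gu := fun l (hl : l < L + 1) => upperCmd_spec τ (s := s4) (l := l) (by rw [n4, hN]) gB4 hl
  obtain ⟨s5, e5, n5, f5⟩ := upperCmd.out_nat τ n4
  rw [e5] at fin nfin gu ⊢
  have g10' : ∀ i < 5, s5.arr 10 [i] = draw i τ := fun i hi => by
    rw [f5 10 (by decide), f4 10 (by decide), f3 10 (by decide), f2 10 (by decide), g10 i hi]
  have gi := fun l (hl : l < L + 1) => indicatorCmd_spec τ (s := s5) (l := l) (by rw [n5, h2])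
    (draw_nonneg 2 τ) (g10' 2 (by norm_num))
    (fun l hl => by rw [f5 17 (by decide), gl l hl]) gu hl
  obtain ⟨s6, e6, n6, f6⟩ := indicatorCmd.out_nat τ n5
  rw [e6] at fin nfin gi ⊢
  have gs := signCmd_spec τ (s := s6) (by rw [n6, h2]) (draw_nonneg 2 τ)
    (fun l hl => by rw [f6 16 (by decide), f5 16 (by decide), gB4 l hl]) gi
  obtain ⟨s7, e7, n7, f7⟩ := signCmd.out_nat τ n6
  rw [e7] at fin nfin gs ⊢
  have gr := rootCmd_spec τ (s := s7) (d := d) (u := fun r => draw (5 + r) τ) (by rw [n7, h1])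
    fun r hr => by
      rw [f7 11 (by decide), f6 11 (by decide), f5 11 (by decide), f4 11 (by decide),
        f3 11 (by decide), f2 11 (by decide), g11 r (by rw [h1]; exact hr)]
  have f8 := rootCmd.frame τ s7
  refine ⟨by rw [nfin, h0], by rw [nfin, h1], by rw [nfin, h2], ?_, ?_, ?_, ?_, ?_,
    gs.congr (f8 20 (by decide)), gr⟩
  · rw [fin 1 (by decide)]; exact hM
  · rw [fin 2 (by decide)]; exact hX
  · rw [fin 3 (by decide)]; exact hY
  · intro i hi
    rw [f8 10 (by decide), f7 10 (by decide), f6 10 (by decide), g10' i hi]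
  · intro l hl
    rw [f8 19 (by decide), f7 19 (by decide), gi l hl]

end NCG

end

noncomputable section

namespace NCG

open scoped ComplexOrder Matrix

/-! ### The unitary matrices -/

/-- Copies a matrix. -/
def copyCmd {k : ℕ} (src dst : ℕ) : Cmd k :=
  Cmd.tab dst [] [.n, .n] (.ret (.get src [.reg (k + 3), .reg (k + 4)]))

theorem copyCmd_spec {k : ℕ} (τ : Tape) {n src dst : ℕ} {s : State} (h : src ≠ dst)
    (hn : s.nat 0 = n) {A : Matrix (Fin n) (Fin n) ℂ} (hA : s.IsMat src A) :
    ((copyCmd (k := k) src dst).sem τ s).IsMat dst A := by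
  refine Cmd.isMat_tab τ ?_ hn fun i j => ?_
  · simp [XExp.avoids, CExp.avoids, h.symm]
  · simp [hA]

/-- The complex rounding of the vector-valued matrix in the array `a`, with the number given by
the expression `e` and the sign chosen by the `i`-th random number. -/
def roundCmd (a : ℕ) (e : CExp) (i dst : ℕ) : Cmd 0 :=
  (projCmd a).seq <| (Cmd.tab 31 [] [] (.ret e)).seq <| (Cmd.tab 32 [] [] (coinX i)).seq <|
    polarCmd.seq (copyCmd 41 dst)

theorem roundCmd_spec (τ : Tape) {n d a i dst : ℕ} {e : CExp} {s : State} (ha : a ≠ 30)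
    (hdst : 41 ≠ dst) (he : e.avoids 31 = true) (hn : s.nat 0 = n) (hd : s.nat 1 = d)
    {X : VMat n d} (hX : ∀ (i j : Fin n) (r : Fin d), s.arr a [(i : ℕ), (j : ℕ), (r : ℕ)] = X i j r)
    {z : Fin d → Fin 4} (hz : s.IsVec 23 fun r => star (Complex.I ^ (z r : ℕ))) {t u : ℝ}
    (het : ∀ s', s'.arr 10 = s.arr 10 → e.eval s' = t) (hu : s.arr 10 [i] = u) :
    ((roundCmd a e i dst).sem τ s).IsMat dst
      (complexRound (stdSelection n) X z (coin u) t) := by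
  simp only [roundCmd, Cmd.seq_sem]
  have g1 := projCmd_spec τ ha hn hd hX hz
  obtain ⟨s1, e1, n1, f1⟩ := (projCmd a).out τ hn
  rw [e1] at g1 ⊢
  have f1' : s1.arr 10 = s.arr 10 := f1 10 (by decide : 10 ∉ [30])
  have g2 := Cmd.isNum_tab (k := 0) (a := 31) (s := s1) (X := .ret e) τ he (het s1 f1')
  obtain ⟨s2, e2, n2, f2⟩ := (Cmd.tab (k := 0) 31 [] [] (.ret e)).out τ n1
  rw [e2] at g2 ⊢
  have f2' : ∀ b, b ∉ [31] → s2.arr b = s1.arr b := f2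
  have g3 := Cmd.isNum_tab (k := 0) (a := 32) (s := s2) (X := coinX i) τ rfl
    (val_coinX (u := u) (by rw [f2' 10 (by decide), f1', hu]))
  obtain ⟨s3, e3, n3, f3⟩ := (Cmd.tab (k := 0) 32 [] [] (coinX i)).out τ n2
  rw [e3] at g3 ⊢
  have f3' : ∀ b, b ∉ [32] → s3.arr b = s2.arr b := f3
  have g4 := polarCmd_spec τ n3 ((g1.congr (f2' 30 (by decide))).congr (f3' 30 (by decide)))
    (g2.congr (f3' 31 (by decide))) g3
  rw [← complexRound_stdSelection] at g4
  obtain ⟨s4, e4, n4, f4⟩ := polarCmd.out τ n3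
  rw [e4] at g4 ⊢
  exact copyCmd_spec τ hdst n4 g4

/-! ### The phase -/

/-- The number `M(A, B)`. -/
def formCmd : Cmd 0 := Cmd.tab 48 [] [] (.sum .n (.sum .n (.sum .n (.sum .n (.ret
  (.mul (.get 1 [.reg 3, .reg 4, .reg 5, .reg 6])
    (.mul (.get 46 [.reg 3, .reg 4]) (.conj (.get 47 [.reg 5, .reg 6])))))))))

theorem formCmd_spec (τ : Tape) {n : ℕ} {s : State} (hn : s.nat 0 = n) {M : Tensor n}
    (hM : ∀ i j k l : Fin n, s.arr 1 [(i : ℕ), (j : ℕ), (k : ℕ), (l : ℕ)] = M i j k l)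
    {A B : Matrix (Fin n) (Fin n) ℂ} (hA : s.IsMat 46 A) (hB : s.IsMat 47 B) :
    (formCmd.sem τ s).IsNum 48 (form M A B) := by
  refine Cmd.isNum_tab τ rfl ?_
  simp [hn, Finset.sum_range, hM, hA, hB, form]

/-- The phase that makes the number real. -/
def phaseCmd : Cmd 0 :=
  let P : XExp := .ret (.div (.conj (.get 48 [])) (.sqrt (.mul (.conj (.get 48 [])) (.get 48 []))))
  -- Tests see real parts only, so the imaginary part of w is tested as the real part of -iw.
  Cmd.tab 49 [] [] (.cond (.reLt (.mul (.sub (.num 0) .I) (.get 48 [])) (.num 0)) P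
    (.cond (.reLt (.num 0) (.mul (.sub (.num 0) .I) (.get 48 []))) P (.ret (.num 1))))

theorem phaseCmd_spec (τ : Tape) {s : State} {w : ℂ} (hw : s.IsNum 48 w) :
    (phaseCmd.sem τ s).IsNum 49 (phase w) := by
  refine Cmd.isNum_tab τ rfl ?_
  rw [phase]
  have key : w ≠ 0 →
      (CExp.sqrt (.mul (.conj (.get 48 [])) (.get 48 []))).eval s = ((‖w‖ : ℝ) : ℂ) := by
    intro h0
    have h := CExp.eval_sqrt (s := s) (e := .mul (.conj (.get 48 [])) (.get 48 []))
      (Complex.normSq_pos.2 h0) (by simp [hw, Complex.normSq_eq_conj_mul_self])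
    rw [h, Complex.normSq_eq_norm_sq, Real.sqrt_sq (norm_nonneg w)]
  rcases lt_trichotomy w.im 0 with h | h | h
  · have h0 : w ≠ 0 := fun h0 => by simp [h0] at h
    simp [hw, h, h.ne, key h0]
  · simp [hw, h]
  · have h0 : w ≠ 0 := fun h0 => by simp [h0] at h
    simp [hw, h, h.ne', h.le.not_gt, key h0]

/-- The first matrix multiplied by the phase. -/
def scaleCmd : Cmd 0 := Cmd.tab 50 [] [.n, .n]
  (.ret (.mul (.get 49 []) (.get 46 [.reg 3, .reg 4])))

theorem scaleCmd_spec (τ : Tape) {n : ℕ} {s : State} (hn : s.nat 0 = n) {c : ℂ}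
    {A : Matrix (Fin n) (Fin n) ℂ} (hc : s.IsNum 49 c) (hA : s.IsMat 46 A) :
    (scaleCmd.sem τ s).IsMat 50 (c • A) := by
  refine Cmd.isMat_tab τ rfl hn fun i j => ?_
  simp [hc, hA]

/-! ### Odd powers -/

/-- The square of the matrix in the array `50`. -/
def squareCmd : Cmd 0 := Cmd.tab 51 [] [.n, .n] (.sum .n (.ret
  (.mul (.get 50 [.reg 3, .reg 5]) (.get 50 [.reg 5, .reg 4]))))

theorem squareCmd_spec (τ : Tape) {n : ℕ} {s : State} (hn : s.nat 0 = n)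
    {A : Matrix (Fin n) (Fin n) ℂ} (hA : s.IsMat 50 A) : (squareCmd.sem τ s).IsMat 51 (A * A) := by
  refine Cmd.isMat_tab τ rfl hn fun i j => ?_
  simp [hn, Finset.sum_range, hA, Matrix.mul_apply]

/-- The power in the array `52` is stored in the table `54`. -/
def keepCmd : Cmd 1 := Cmd.tab 54 [.reg 3] [.n, .n] (.ret (.get 52 [.reg 4, .reg 5]))

theorem keepCmd_spec (τ : Tape) {n t : ℕ} {s : State} (hn : s.nat 0 = n) (h3 : s.nat 3 = t)
    {A : Matrix (Fin n) (Fin n) ℂ} (hA : s.IsMat 52 A) (i j : Fin n) :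
    (keepCmd.sem τ s).arr 54 [t, (i : ℕ), (j : ℕ)] = A i j := by
  have h := Cmd.tab_apply (k := 1) (a := 54) (pre := [.reg 3]) (Ds := [.n, .n]) (l := [(i : ℕ),
      (j : ℕ)])
    (X := .ret (.get 52 [.reg 4, .reg 5])) rfl (stable_reg (by norm_num)) τ s
    (.cons (by rw [Dim.val, hn]; exact i.2) (.cons (by rw [Dim.val, hn]; exact j.2) .nil))
  simp only [List.map, NExp.eval, h3, List.cons_append, List.nil_append] at h
  refine h.trans ?_
  simp [State.setFrom, hA]

theorem keepCmd_frame (τ : Tape) {t l : ℕ} {s : State} (h3 : s.nat 3 = t) (h : l ≠ t) (i : List ℕ) :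
    (keepCmd.sem τ s).arr 54 (l :: i) = s.arr 54 (l :: i) := by
  refine Cmd.tab_frame rfl (stable_reg (by norm_num)) τ s fun l' h' => ?_
  simp only [List.map, NExp.eval, h3, List.cons_append, List.nil_append] at h'
  exact h (List.cons.inj h').1

/-- The next odd power. -/
def nextCmd : Cmd 1 := Cmd.tab 53 [] [.n, .n] (.sum .n (.ret
  (.mul (.get 52 [.reg 4, .reg 6]) (.get 51 [.reg 6, .reg 5]))))

theorem nextCmd_spec (τ : Tape) {n : ℕ} {s : State} (hn : s.nat 0 = n)
    {A B : Matrix (Fin n) (Fin n) ℂ} (hA : s.IsMat 52 A) (hB : s.IsMat 51 B) :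
    (nextCmd.sem τ s).IsMat 53 (A * B) := by
  refine Cmd.isMat_tab τ rfl hn fun i j => ?_
  simp [hn, Finset.sum_range, hA, hB, Matrix.mul_apply]

/-- A step in the computation of the table of the odd powers. -/
def powerStepCmd : Cmd 1 := keepCmd.seq <| nextCmd.seq (copyCmd 53 52)

/-- The table of the odd powers of the matrix in the array `50`. -/
def powerCmd : Cmd 0 := squareCmd.seq <| (copyCmd 50 52).seq <| Cmd.loop .L powerStepCmd

theorem powerStepCmd_spec (τ : Tape) {n t : ℕ} {s : State} (hn : s.nat 0 = n) (h3 : s.nat 3 = t)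
    {A : Matrix (Fin n) (Fin n) ℂ} (hA : s.IsMat 51 (A * A)) (hP : s.IsMat 52 (A ^ (2 * t + 1)))
    (hT : ∀ l < t, ∀ i j : Fin n, s.arr 54 [l, (i : ℕ), (j : ℕ)] = (A ^ (2 * l + 1)) i j) :
    (powerStepCmd.sem τ s).IsMat 52 (A ^ (2 * (t + 1) + 1)) ∧
      ∀ l < t + 1, ∀ i j : Fin n,
        (powerStepCmd.sem τ s).arr 54 [l, (i : ℕ), (j : ℕ)] = (A ^ (2 * l + 1)) i j := by
  simp only [powerStepCmd, Cmd.seq_sem]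
  have g1 := keepCmd_spec τ hn h3 hP
  have g1' := fun l (h : l ≠ t) i => keepCmd_frame τ h3 h i
  obtain ⟨s1, e1, n1, f1⟩ := keepCmd.out τ hn
  rw [e1] at g1 g1' ⊢
  have g2 := nextCmd_spec τ n1 (hP.congr (f1 52 (by decide))) (hA.congr (f1 51 (by decide)))
  obtain ⟨s2, e2, n2, f2⟩ := nextCmd.out τ n1
  rw [e2] at g2 ⊢
  have g3 := copyCmd_spec (k := 1) τ (by norm_num : 53 ≠ 52) n2 g2
  have f3 : ∀ b, b ∉ [52] → ((copyCmd (k := 1) 53 52).sem τ s2).arr b = s2.arr b :=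
    (copyCmd (k := 1) 53 52).frame τ s2
  refine ⟨?_, fun l hl i j => ?_⟩
  · rwa [show A ^ (2 * (t + 1) + 1) = A ^ (2 * t + 1) * (A * A) by
      rw [← pow_two, ← pow_add]; congr 1]
  · rw [f3 54 (by decide), f2 54 (by decide)]
    by_cases hlt : l = t
    · subst hlt; exact g1 i j
    · rw [g1' l hlt]; exact hT l (by omega) i j

/-- All odd powers up to the bound are tabulated; the indicator of the index later picks one of
them. -/
theorem powerCmd_spec (τ : Tape) {n N : ℕ} {s : State} (hn : s.nat 0 = n) (hN : s.nat 2 + 1 = N)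
    {A : Matrix (Fin n) (Fin n) ℂ} (hA : s.IsMat 50 A) {l : ℕ} (hl : l < N) (i j : Fin n) :
    (powerCmd.sem τ s).arr 54 [l, (i : ℕ), (j : ℕ)] = (A ^ (2 * l + 1)) i j := by
  simp only [powerCmd, Cmd.seq_sem, Cmd.loop_sem]
  have g1 := squareCmd_spec τ hn hA
  obtain ⟨s1, e1, n1, f1⟩ := squareCmd.out_nat τ (s := s) rfl
  rw [e1] at g1 ⊢
  have g2 := copyCmd_spec (k := 0) τ (by norm_num : 50 ≠ 52) (by rw [n1, hn])
    (hA.congr (f1 50 (by decide)))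
  obtain ⟨s2, e2, n2, f2⟩ := (copyCmd (k := 0) 50 52).out_nat τ n1
  rw [e2] at g2 ⊢
  have g1' := g1.congr (f2 51 (by decide : 51 ∉ [52]))
  have key : ∀ t, (iter (powerStepCmd.sem τ) 3 s2 t).IsMat 52 (A ^ (2 * t + 1)) ∧
      ∀ l < t, ∀ i j : Fin n,
        (iter (powerStepCmd.sem τ) 3 s2 t).arr 54 [l, (i : ℕ), (j : ℕ)] = (A ^ (2 *
            l + 1)) i j := by
    intro t
    induction t with
    | zero => exact ⟨by simpa [iter] using g2, fun l hl => absurd hl (Nat.not_lt_zero l)⟩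
    | succ t ih =>
      have hnat := iter_nat (powerStepCmd.nat_eq τ) 3 s2 t
      have hA2 := Cmd.iter_frame powerStepCmd τ 3 s2 t 51 (by decide)
      exact powerStepCmd_spec τ (s := (iter (powerStepCmd.sem τ) 3 s2 t).setNat 3 t)
        (by simp [hnat, n2, hn]) (by simp) (g1'.congr hA2) ih.1 ih.2
  rw [Dim.val, n2, hN]
  exact (key N).2 l hl i j

end NCG

end

noncomputable section

namespace NCG

open scoped ComplexOrder Matrix

/-! ### The Hermitian matrices -/

/-- The Hermitian matrix whose functions are the output of the two-dimensional rounding. -/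
def indexTurn {n : ℕ} (l : ℤ) (t : ℝ) (A : Matrix (Fin n) (Fin n) ℂ) : Matrix (Fin n) (Fin n) ℂ :=
  if 0 ≤ l then turnMat (2 * l.toNat + 1) t A else 0

theorem turnMat_isHermitian {n : ℕ} (m : ℕ) (t : ℝ) (A : Matrix (Fin n) (Fin n) ℂ) :
    (turnMat m t A).IsHermitian := by
  simp [turnMat, Matrix.IsHermitian, Matrix.conjTranspose_smul, Matrix.conjTranspose_add, add_comm]

theorem indexTurn_isHermitian {n : ℕ} (l : ℤ) (t : ℝ) (A : Matrix (Fin n) (Fin n) ℂ) :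
    (indexTurn l t A).IsHermitian := by
  rw [indexTurn]
  split_ifs
  · exact turnMat_isHermitian _ _ _
  · exact Matrix.isHermitian_zero

/-- Used for the index -1, where `indexTurn` is 0 and both rounding functions vanish at 0. -/
theorem hermFun_zero {n : ℕ} {c : ℝ → ℂ} (h : c 0 = 0) :
    hermFun c (0 : Matrix (Fin n) (Fin n) ℂ) = 0 := by
  have h1 := hermFun_conjDiag c (one_mem (Matrix.unitaryGroup (Fin n) ℂ)) fun _ => 0
  simpa [conjDiag, h] using h1

theorem roundEig_krivineLam_eq {n : ℕ} (R : Selection n) (l : ℤ) (t : ℝ)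
    {A : Matrix (Fin n) (Fin n) ℂ} (hA : A ∈ Matrix.unitaryGroup (Fin n) ℂ) :
    roundEig R (krivineLam t l) A =
      hermFun (fun σ => ((indexSign l * krivinePhi σ : ℝ) : ℂ)) (indexTurn l t A) := by
  by_cases h : 0 ≤ l
  · lift l to ℕ using h
    simp [roundEig_krivineLam R t l hA, indexSign, indexTurn]
  · rw [roundEig_krivineLam_neg R t (not_le.1 h), indexTurn, if_neg h,
      hermFun_zero (by simp [indexSign, h])]

theorem roundEig_krivineMu_eq {n : ℕ} (R : Selection n) (l : ℤ) (t : ℝ)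
    {A : Matrix (Fin n) (Fin n) ℂ} (hA : A ∈ Matrix.unitaryGroup (Fin n) ℂ) :
    roundEig R (krivineMu t l) A =
      hermFun (fun σ => (Real.sign σ : ℂ)) (indexTurn l t A) := by
  by_cases h : 0 ≤ l
  · lift l to ℕ using h
    simp [roundEig_krivineMu R t l hA, indexTurn]
  · rw [roundEig_krivineMu_neg R t (not_le.1 h), indexTurn, if_neg h,
      hermFun_zero (by simp)]

/-- The factor `exp (-i t')`. -/
def turnExp : CExp := .exp (.sub (.num 0) (.mul .I
  (.mul .pi (.sub (.mul (.num 2) (.get 10 [.const 1])) (.num 1)))))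

/-- The Hermitian matrix, computed from the table of the odd powers. -/
def turnCmd : Cmd 0 := Cmd.tab 55 [] [.n, .n] (.sum .L (.ret (.mul (.div (.num 1) (.num 2)) (.add
  (.mul turnExp (.mul (.get 19 [.reg 5]) (.get 54 [.reg 5, .reg 3, .reg 4])))
  (.conj (.mul turnExp (.mul (.get 19 [.reg 5]) (.get 54 [.reg 5, .reg 4, .reg 3]))))))))

theorem turnCmd_spec {n d L : ℕ} {τ : Tape} {M : Tensor n} {X Y : VMat n d} {s : State}
    (h : Ready L τ M X Y s) {A : Matrix (Fin n) (Fin n) ℂ}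
    (hT : ∀ l < L + 1, ∀ i j : Fin n, s.arr 54 [l, (i : ℕ), (j : ℕ)] = (A ^ (2 * l + 1)) i j) :
    (turnCmd.sem τ s).IsMat 55
      (indexTurn (indexOf L (draw 2 τ)) (Real.pi * (2 * draw 1 τ - 1)) A) := by
  refine Cmd.isMat_tab τ rfl h.nat_zero fun i j => ?_
  have hE : ∀ v : State, v.arr 10 = s.arr 10 → turnExp.eval v =
      Complex.exp (-(Complex.I * (Real.pi * (2 * draw 1 τ - 1) : ℝ))) := by
    intro v hv
    simp [turnExp, hv, h.draws 1 (by norm_num)]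
  have key : ∀ l ∈ Finset.range (L + 1),
      (XExp.ret (.mul (.div (.num 1) (.num 2)) (.add
        (.mul turnExp (.mul (.get 19 [.reg 5]) (.get 54 [.reg 5, .reg 3, .reg 4])))
        (.conj (.mul turnExp (.mul (.get 19 [.reg 5]) (.get 54 [.reg 5, .reg 4, .reg 3]))))))).val 3
        (((s.setNat 3 i).setNat 4 j).setNat 5 l) =
      if (l : ℤ) = indexOf L (draw 2 τ) then
        turnMat (2 * l + 1) (Real.pi * (2 * draw 1 τ - 1)) A i j else 0 := by
    intro l hl
    have hl' := Finset.mem_range.1 hl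
    simp only [XExp.val, CExp.eval, hE (((s.setNat 3 i).setNat 4 j).setNat 5 l) rfl, List.map,
      NExp.eval, State.arr_setNat, State.nat_setNat, Function.update_self, CExp.eval_num,
      Nat.cast_one, Nat.cast_ofNat, ne_eq, Nat.reduceEqDiff, not_false_eq_true,
      Function.update_of_ne, h.indicator l hl', hT l hl', turnMat]
    split_ifs
    · simp only [one_mul, Matrix.smul_apply, Matrix.add_apply,
        Matrix.conjTranspose_apply, smul_eq_mul]
    · simp
  rw [XExp.val, show Dim.val _ Dim.L = L + 1 by simp [h.nat_two]]
  refine (Finset.sum_congr rfl key).trans ?_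
  rw [sum_ite_indexOf (draw_nonneg 2 τ), indexTurn]
  split_ifs <;> rfl

/-! ### Functions of the eigenvalues -/

/-- The arcsine. -/
def CExp.arcsin (e : CExp) : CExp :=
  .mul (.sub (.num 0) .I) (.log (.add (.sqrt (.sub (.num 1) (.mul e e))) (.mul .I e)))

/-- This is arcsin x = -i log(√(1 - x²) + ix). The inequalities are strict because `CExp.sqrt` takes
the logarithm of a positive number. -/
theorem CExp.eval_arcsin {s : State} {e : CExp} {x : ℝ} (h1 : -1 < x) (h2 : x < 1)
    (h : e.eval s = (x : ℂ)) : e.arcsin.eval s = (Real.arcsin x : ℂ) := by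
  have hs : (CExp.sqrt (.sub (.num 1) (.mul e e))).eval s = ((Real.cos
      (Real.arcsin x) : ℝ) : ℂ) := by
    rw [Real.cos_arcsin]
    refine CExp.eval_sqrt (by nlinarith) ?_
    simp [h, pow_two]
  have hx : (x : ℂ) = ((Real.sin (Real.arcsin x) : ℝ) : ℂ) := by rw [Real.sin_arcsin h1.le h2.le]
  have hp := Real.pi_pos
  have h3 := Real.neg_pi_div_two_le_arcsin x
  have h4 := Real.arcsin_le_pi_div_two x
  have hlog : Complex.log (Complex.exp (Real.arcsin x * Complex.I)) = Real.arcsin x * Complex.I :=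
    Complex.log_exp (by simp; linarith) (by simp; linarith)
  have hexp : (CExp.add (.sqrt (.sub (.num 1) (.mul e e))) (.mul .I e)).eval s =
      Complex.exp (Real.arcsin x * Complex.I) := by
    rw [Complex.exp_mul_I, ← Complex.ofReal_cos, ← Complex.ofReal_sin, ← hx, CExp.eval, hs,
      CExp.eval, h, CExp.eval, mul_comm Complex.I]
  rw [CExp.arcsin, CExp.eval, CExp.eval, CExp.eval, CExp.eval, hexp, hlog, CExp.eval_num,
    Nat.cast_zero, zero_sub, neg_mul, mul_left_comm, Complex.I_mul_I, mul_neg, neg_neg, mul_one]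

/-- The cubic polynomial in Krivine's function. -/
def cubicExp (e : CExp) : CExp :=
  .sub (.mul (.div (.num 6) .pi) e) (.mul (.mul (.div (.num 1) (.num 2))
    (.mul (.div (.num 4) .pi) (.mul (.div (.num 4) .pi) (.div (.num 4) .pi)))) (.mul e (.mul e e)))

theorem eval_cubicExp {s : State} {e : CExp} {x : ℝ} (h : e.eval s = (x : ℂ)) :
    (cubicExp e).eval s = (krivineCubic x : ℂ) := by
  simp [cubicExp, krivineCubic, h]
  ring

/-- Krivine's function of the eigenvalues. -/
def phiCmd : Cmd 0 := Cmd.tab 58 [] [.n]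
  (.cond (.reLt (.div (.num 1) (.sqrt (.num 2))) (.get 56 [.reg 3])) (.ret (.get 20 []))
    (.cond (.reLt (.get 56 [.reg 3]) (.sub (.num 0) (.div (.num 1) (.sqrt (.num 2)))))
      (.ret (.sub (.num 0) (.get 20 [])))
      (.ret (.mul (.get 20 []) (cubicExp (.arcsin (.get 56 [.reg 3])))))))

theorem arcsin_one_div_sqrt_two : Real.arcsin (1 / √2) = Real.pi / 4 := by
  have hp := Real.pi_pos
  refine Real.arcsin_eq_of_sin_eq ?_ ⟨by linarith, by linarith⟩
  rw [Real.sin_pi_div_four, div_eq_div_iff two_ne_zero (by positivity),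
    Real.mul_self_sqrt zero_le_two, one_mul]

/-- The values beyond ±1/√2 = sin(±π/4) are treated separately, so the arcsine is evaluated only
inside (-1, 1). -/
theorem phiCmd_spec (τ : Tape) {n : ℕ} {s : State} (hn : s.nat 0 = n) {c : ℝ}
    (hc : s.IsNum 20 c) {v : Fin n → ℝ} (hv : s.IsVec 56 fun j => (v j : ℂ)) :
    (phiCmd.sem τ s).IsVec 58 fun j => ((c * krivinePhi (v j) : ℝ) : ℂ) := by
  refine Cmd.isVec_tab τ rfl (D := .n) hn fun j => ?_
  have h2 : ∀ s, (CExp.sqrt (.num 2)).eval s = ((√2 : ℝ) : ℂ) := fun s =>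
    CExp.eval_sqrt (by norm_num) (by simp)
  have h2' : (1 / ((√2 : ℝ) : ℂ)).re = 1 / √2 := by
    rw [← Complex.ofReal_one, ← Complex.ofReal_div, Complex.ofReal_re]
  have hlt : 1 / √2 < 1 := by
    rw [div_lt_one (by positivity), Real.lt_sqrt zero_le_one]; norm_num
  have e : (CExp.get 56 [.reg 3]).eval (s.setNat (0 + 3) j) = (v j : ℂ) := by
    simp [hv]
  have e' : (CExp.get 20 []).eval (s.setNat (0 + 3) j) = (c : ℂ) := hc
  simp only [XExp.val, Test.holds, CExp.eval, h2, CExp.eval_num] at e e' ⊢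
  simp only [e, e', Nat.cast_one, Nat.cast_zero, Complex.ofReal_re, h2', zero_sub,
    Complex.neg_re]
  split_ifs with h3 h4
  · rw [krivinePhi_of_le (by rw [← arcsin_one_div_sqrt_two]; exact Real.arcsin_le_arcsin h3.le),
      mul_one]
  · rw [krivinePhi_of_ge (by
      rw [← arcsin_one_div_sqrt_two, ← Real.arcsin_neg]; exact Real.arcsin_le_arcsin h4.le)]
    simp
  · rw [eval_cubicExp (CExp.eval_arcsin (e := .get 56 [.reg 3]) (by linarith) (by linarith) e),
      krivinePhi_of_mem
      (by rw [← arcsin_one_div_sqrt_two, ← Real.arcsin_neg]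
          exact Real.arcsin_le_arcsin (not_lt.1 h4))
      (by rw [← arcsin_one_div_sqrt_two]; exact Real.arcsin_le_arcsin (not_lt.1 h3))]
    push_cast
    rfl

/-- The signs of the eigenvalues. -/
def signValCmd : Cmd 0 := Cmd.tab 58 [] [.n]
  (.cond (.reLt (.num 0) (.get 56 [.reg 3])) (.ret (.num 1))
    (.cond (.reLt (.get 56 [.reg 3]) (.num 0)) (.ret (.sub (.num 0) (.num 1))) (.ret (.num 0))))

theorem signValCmd_spec (τ : Tape) {n : ℕ} {s : State} (hn : s.nat 0 = n) {v : Fin n → ℝ}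
    (hv : s.IsVec 56 fun j => (v j : ℂ)) :
    (signValCmd.sem τ s).IsVec 58 fun j => (Real.sign (v j) : ℂ) := by
  refine Cmd.isVec_tab τ rfl (D := .n) hn fun j => ?_
  rcases lt_trichotomy (v j) 0 with h | h | h
  · simp [hv, h, h.le.not_gt, Real.sign_of_neg]
  · simp [hv, h]
  · simp [hv, h, Real.sign_of_pos]

/-- The Hermitian matrix with the eigenvalues and eigenvectors in the arrays `58` and `57`. -/
def outCmd (dst : ℕ) : Cmd 0 := Cmd.tab dst [] [.n, .n] (.sum .n (.ret
  (.mul (.mul (.get 57 [.reg 3, .reg 5]) (.get 58 [.reg 5])) (.conj (.get 57 [.reg 4, .reg 5])))))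

theorem outCmd_spec (τ : Tape) {n dst : ℕ} (h57 : 57 ≠ dst) (h58 : 58 ≠ dst) {s : State}
    (hn : s.nat 0 = n) {V : Matrix (Fin n) (Fin n) ℂ} {v : Fin n → ℂ} (hV : s.IsMat 57 V)
    (hv : s.IsVec 58 v) : ((outCmd dst).sem τ s).IsMat dst (conjDiag V v) := by
  refine Cmd.isMat_tab τ ?_ hn fun i j => ?_
  · simp [XExp.avoids, CExp.avoids, h57.symm, h58.symm]
  · simp [hn, Finset.sum_range, hV, hv, conjDiag_apply]

/-- The two-dimensional rounding of the matrix in the array `50`. -/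
def halfCmd (p : Cmd 0) (dst : ℕ) : Cmd 0 :=
  powerCmd.seq <| turnCmd.seq <| (Cmd.eigh 55 56 57).seq <| p.seq (outCmd dst)

theorem halfCmd_spec {n d L dst : ℕ} {τ : Tape} {M : Tensor n} {X Y : VMat n d} {s : State}
    (h57 : 57 ≠ dst) (h58 : 58 ≠ dst) (h : Ready L τ M X Y s) {A : Matrix (Fin n) (Fin n) ℂ}
    (hA : s.IsMat 50 A) {p : Cmd 0} (hw : 57 ∉ p.writes) {c : ℝ → ℂ}
    (hp : ∀ (s : State) (v : Fin n → ℝ), Ready L τ M X Y s → s.IsVec 56 (fun j => (v j : ℂ)) →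
      (p.sem τ s).IsVec 58 fun j => c (v j)) :
    ((halfCmd p dst).sem τ s).IsMat dst
      (hermFun c (indexTurn (indexOf L (draw 2 τ)) (Real.pi * (2 * draw 1 τ - 1)) A)) := by
  have hH := indexTurn_isHermitian (indexOf L (draw 2 τ)) (Real.pi * (2 * draw 1 τ - 1)) A
  simp only [halfCmd, Cmd.seq_sem]
  have r1 := h.step powerCmd (by decide)
  have g1 := turnCmd_spec r1 fun l hl =>
    powerCmd_spec τ h.nat_zero (by rw [h.nat_two]) hA hl
  have r2 := r1.step turnCmd (by decide)
  have g2 := Cmd.isVec_eigh (k := 0) τ (vals := 56) (vecs := 57) r2.nat_zero hH g1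
  have g3 := Cmd.isMat_eigh (k := 0) τ (vals := 56) (vecs := 57) r2.nat_zero hH g1
  have r3 := r2.step (Cmd.eigh 55 56 57) (by decide)
  have g4 := hp _ _ r3 g2
  rw [hermFun_eq hH]
  exact outCmd_spec τ h57 h58 ((congrFun (p.nat_eq τ _) 0).trans r3.nat_zero)
    (g3.congr (p.frame τ _ 57 hw)) g4

/-! ### The program of the procedure -/

/-- The matrices `A` and `B`. -/
def pairCmd : Cmd 0 :=
  (roundCmd 2 sechExp 3 46).seq <| (roundCmd 3 (.sub (.num 0) sechExp) 4 47).seq <|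
    formCmd.seq <| phaseCmd.seq scaleCmd

theorem pairCmd_spec {n d L : ℕ} {τ : Tape} {M : Tensor n} {X Y : VMat n d} {s : State}
    (h : Ready L τ M X Y s) :
    (pairCmd.sem τ s).IsMat 50 (unitaryPair (stdSelection n) M X Y (tapeSeed d L τ)).1 ∧
      (pairCmd.sem τ s).IsMat 47 (unitaryPair (stdSelection n) M X Y (tapeSeed d L τ)).2 := by
  simp only [pairCmd, Cmd.seq_sem]
  have g1 := roundCmd_spec τ (a := 2) (i := 3) (dst := 46) (e := sechExp) (by norm_num)
    (by norm_num) rfl h.nat_zero h.nat_one h.left h.roots (t := sechQuantile (draw 0 τ))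
    (fun s' hs' => eval_sechExp (draw_nonneg 0 τ) (draw_le_one 0 τ)
      (by rw [hs']; exact h.draws 0 (by norm_num)))
    (h.draws 3 (by norm_num))
  have r1 := h.step (roundCmd 2 sechExp 3 46) (by decide)
  have g2 := roundCmd_spec τ (a := 3) (i := 4) (dst := 47) (e := .sub (.num 0) sechExp)
    (by norm_num) (by norm_num) rfl r1.nat_zero r1.nat_one r1.right r1.roots
    (t := -sechQuantile (draw 0 τ))
    (fun s' hs' => by
      rw [CExp.eval, eval_sechExp (draw_nonneg 0 τ) (draw_le_one 0 τ)
        (by rw [hs']; exact r1.draws 0 (by norm_num))]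
      simp)
    (r1.draws 4 (by norm_num))
  have r2 := r1.step (roundCmd 3 (.sub (.num 0) sechExp) 4 47) (by decide)
  have g1' := g1.congr ((roundCmd 3 (.sub (.num 0) sechExp) 4 47).frame τ _ 46 (by decide))
  have g3 := formCmd_spec τ r2.nat_zero r2.tensor g1' g2
  have r3 := r2.step formCmd (by decide)
  have g4 := phaseCmd_spec τ g3
  have r4 := r3.step phaseCmd (by decide)
  have f3 := formCmd.frame τ ((roundCmd 3 (.sub (.num 0) sechExp) 4 47).sem τ
    ((roundCmd 2 sechExp 3 46).sem τ s))
  have f4 := phaseCmd.frame τ (formCmd.sem τ ((roundCmd 3 (.sub (.num 0) sechExp) 4 47).sem τ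
    ((roundCmd 2 sechExp 3 46).sem τ s)))
  refine ⟨scaleCmd_spec τ r4.nat_zero g4 ((g1'.congr (f3 46 (by decide))).congr
    (f4 46 (by decide))), ?_⟩
  exact ((g2.congr (f3 47 (by decide))).congr (f4 47 (by decide))).congr
    (scaleCmd.frame τ _ 47 (by decide))

/-- The Hermitian rounding procedure, after the computation of the bound on the index. -/
def roundingCmd : Cmd 0 :=
  prepareCmd.seq <| pairCmd.seq <| (halfCmd phiCmd 4).seq <| (copyCmd 47 50).seq
    (halfCmd signValCmd 5)

theorem roundingCmd_output (τ : Tape) {n d L : ℕ} {M : Tensor n} {X Y : VMat n d} {s : State}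
    (h0 : s.nat 0 = n) (h1 : s.nat 1 = d) (h2 : s.nat 2 = L) (hp : s.pos = 0)
    (hM : ∀ i j k l : Fin n, s.arr 1 [(i : ℕ), (j : ℕ), (k : ℕ), (l : ℕ)] = M i j k l)
    (hX : ∀ (i j : Fin n) (r : Fin d), s.arr 2 [(i : ℕ), (j : ℕ), (r : ℕ)] = X i j r)
    (hY : ∀ (i j : Fin n) (r : Fin d), s.arr 3 [(i : ℕ), (j : ℕ), (r : ℕ)] = Y i j r) :
    (roundingCmd.sem τ s).output n = hermRound (stdSelection n) M X Y (tapeSeed d L τ) := by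
  have r1 := prepareCmd_spec τ h0 h1 h2 hp hM hX hY
  simp only [roundingCmd, Cmd.seq_sem]
  obtain ⟨g1, g2⟩ := pairCmd_spec r1
  have r2 := r1.step pairCmd (by decide)
  have g3 := halfCmd_spec (dst := 4) (by norm_num) (by norm_num) r2 g1 (p := phiCmd) (by decide)
    (c := fun σ => ((indexSign (indexOf L (draw 2 τ)) * krivinePhi σ : ℝ) : ℂ))
    fun s v hs hv => phiCmd_spec τ hs.nat_zero hs.sign hv
  have r3 := r2.step (halfCmd phiCmd 4) (by decide)
  have g4 := copyCmd_spec (k := 0) τ (by norm_num : 47 ≠ 50) r3.nat_zero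
    (g2.congr ((halfCmd phiCmd 4).frame τ _ 47 (by decide)))
  have r4 := r3.step (copyCmd 47 50) (by decide)
  have g5 := halfCmd_spec (dst := 5) (by norm_num) (by norm_num) r4 g4 (p := signValCmd) (by decide)
    (c := fun σ => (Real.sign σ : ℂ))
    fun s v hs hv => signValCmd_spec τ hs.nat_zero hv
  have g3' := (g3.congr ((copyCmd (k := 0) 47 50).frame τ _ 4 (by decide : 4 ∉ [50]))).congr
    ((halfCmd signValCmd 5).frame τ _ 4 (by decide))
  rw [State.output, g3'.block, g5.block, hermRound, roundEig_krivineLam_eq _ _ _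
    (unitaryPair_fst_mem _ _ _ _ _), roundEig_krivineMu_eq _ _ _
    (unitaryPair_snd_mem _ _ _ _ _)]
  rfl

end NCG

end

/-! ### The full program and its running time -/

noncomputable section

namespace NCG

/-- Computes the bound on the index in the register `2`. -/
def limitProg (C : ℕ) : Prog :=
  .while (.reLt (.nat (.reg 2)) (.div (.nat (.const C)) (.get 0 [])))
    (.setNat 2 (.add (.reg 2) (.const 1)))

/-- The ceiling is found by counting, since a natural number is below ⌈y⌉ exactly when it is below
y. A round costs 7 for the test and 4 for the increment. -/
theorem limitProg_exec (τ : Tape) (C : ℕ) {ε : ℝ} : ∀ (j : ℕ) (s : State), s.arr 0 [] = (ε : ℂ) →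
    s.nat 2 + j = ⌈(C : ℝ) / ε⌉₊ →
      ∃ c, Exec τ (limitProg C) s (s.setNat 2 ⌈(C : ℝ) / ε⌉₊) c ∧ c ≤ 11 * (j + 1) := by
  have test : ∀ s : State, s.arr 0 [] = (ε : ℂ) →
      ((Test.reLt (.nat (.reg 2)) (.div (.nat (.const C)) (.get 0 []))).holds s ↔
        s.nat 2 < ⌈(C : ℝ) / ε⌉₊) := by
    intro s h
    have : ((C : ℂ) / (ε : ℂ)).re = (C : ℝ) / ε := by
      rw [← Complex.ofReal_natCast, ← Complex.ofReal_div, Complex.ofReal_re]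
    rw [Nat.lt_ceil]
    simp [h, this]
  intro j
  induction j with
  | zero =>
    intro s h hj
    refine ⟨7, ?_, by norm_num⟩
    rw [← hj, add_zero, State.setNat_self]
    exact Exec.whileFalse (by rw [test s h, ← hj, add_zero]; exact lt_irrefl _)
  | succ j ih =>
    intro s h hj
    obtain ⟨c, hc, hle⟩ := ih (s.setNat 2 (s.nat 2 + 1)) h (by simp; omega)
    rw [State.setNat_setNat] at hc
    exact ⟨_, Exec.whileTrue (by rw [test s h]; omega) (Exec.setNat s 2 _) hc, by
      simp only [Test.size, CExp.size, NExp.size, idxSize, List.map, List.sum_nil]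
      omega⟩

/-- The program of the Hermitian rounding procedure. -/
def roundingProg (C : ℕ) : Prog := .seq (limitProg C) roundingCmd.prog

theorem roundingProg_exec (C : ℕ) : ∃ k : ℕ, ∀ (n d : ℕ) (M : Tensor n) (ε : ℝ) (X Y : VMat n d),
    0 < ε → ε < 1 → ∀ τ : Tape, ∃ (s : State) (c : ℕ),
      Exec τ (roundingProg C) (inputState ε M X Y) s c ∧
      (c : ℝ) ≤ k * ((n : ℝ) + d + 1 / ε) ^ k ∧
      s.output n = hermRound (stdSelection n) M X Y (tapeSeed d ⌈(C : ℝ) / ε⌉₊ τ) := by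
  obtain ⟨K, hK⟩ := roundingCmd.exec
  -- Put x = n + d + 1/ε ≥ 1. Since L ≤ C/ε + 1 and 1/ε > 1, the size is at most (C + 2)x, and k
  -- dominates both the resulting coefficients and the degree K.
  refine ⟨11 * (C + 2) + K * (C + 2) ^ K + K + 1, fun n d M ε X Y h0 h1 τ => ?_⟩
  set L := ⌈(C : ℝ) / ε⌉₊ with hL
  obtain ⟨c₁, e₁, le₁⟩ := limitProg_exec τ C (ε := ε) L (inputState ε M X Y) rfl (Nat.zero_add _)
  obtain ⟨c₂, e₂, le₂⟩ := hK τ ((inputState ε M X Y).setNat 2 L) fun r hr => by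
    simp [inputState, show r ≠ 0 by omega, show r ≠ 1 by omega, show r ≠ 2 by omega]
  refine ⟨_, _, .seq e₁ e₂, ?_, roundingCmd_output τ (by simp [inputState]) (by simp [inputState])
    (by simp) rfl (fun i j k l => ?_) (fun i j r => ?_) fun i j r => ?_⟩
  · have hsize : ((inputState ε M X Y).setNat 2 L).size = n + d + L + 1 := by
      simp [State.size, inputState]
    rw [hsize] at le₂
    set x : ℝ := (n : ℝ) + d + 1 / ε with hx
    have hε : 1 < 1 / ε := by rwa [lt_div_iff₀ h0, one_mul]
    have hx1 : 1 ≤ x := by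
      have := Nat.cast_nonneg (α := ℝ) n
      have := Nat.cast_nonneg (α := ℝ) d
      linarith
    have hLle : (L : ℝ) ≤ C * (1 / ε) + 1 := by
      have := (Nat.ceil_lt_add_one (show 0 ≤ (C : ℝ) / ε by positivity)).le
      rwa [mul_one_div]
    have hN : ((n + d + L + 1 : ℕ) : ℝ) ≤ (C + 2) * x := by
      have hn : (0 : ℝ) ≤ (C + 1) * (n + d) := by positivity
      push_cast
      rw [hx]
      nlinarith
    have hc₁ : (c₁ : ℝ) ≤ 11 * ((C + 2) * x) := by
      have : (c₁ : ℝ) ≤ ((11 * (n + d + L + 1) : ℕ) : ℝ) := by exact_mod_cast (by omega)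
      push_cast at this hN
      linarith
    have hc₂ : (c₂ : ℝ) ≤ K * ((C + 2) * x) ^ K := by
      calc (c₂ : ℝ) ≤ ((K * (n + d + L + 1) ^ K : ℕ) : ℝ) := by exact_mod_cast le₂
        _ ≤ K * ((C + 2) * x) ^ K := by
          push_cast at hN ⊢
          gcongr
    set k := 11 * (C + 2) + K * (C + 2) ^ K + K + 1 with hk
    have hxk : x ≤ x ^ k := le_self_pow₀ hx1 (by omega)
    have hxK : x ^ K ≤ x ^ k := pow_le_pow_right₀ hx1 (by omega)
    have hk' : (11 * (C + 2) + K * (C + 2) ^ K : ℝ) ≤ k := by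
      exact_mod_cast (by omega : 11 * (C + 2) + K * (C + 2) ^ K ≤ k)
    calc ((c₁ + c₂ : ℕ) : ℝ) ≤ 11 * ((C + 2) * x) + K * ((C + 2) * x) ^ K := by
          push_cast; exact add_le_add hc₁ hc₂
      _ = 11 * (C + 2) * x + K * (C + 2) ^ K * x ^ K := by rw [mul_pow]; ring
      _ ≤ 11 * (C + 2) * x ^ k + K * (C + 2) ^ K * x ^ k := by gcongr
      _ = (11 * (C + 2) + K * (C + 2) ^ K) * x ^ k := by ring
      _ ≤ k * x ^ k := by gcongr
  · simp [inputState]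
  · simp [inputState]
  · simp [inputState]

end NCG

end

theorem theorem3p4 :
    (∃ C : ℕ, NCG.IsTailConst C) ∧
    ∀ C : ℕ, NCG.IsTailConst C →
      ∃ (prog : NCG.Prog) (k : ℕ),
        ∀ (n d : ℕ) (M : NCG.Tensor n) (ε : ℝ) (X Y : NCG.VMat n d),
          M.IsHerm → 0 < ε → ε < 1 →
          X ∈ NCG.vUnitary n d → Y ∈ NCG.vUnitary n d →
          (1 - ε) * NCG.sdp M ≤ ‖NCG.vform M X Y‖ →
          -- the random choices have a probability law
          MeasureTheory.IsProbabilityMeasure (NCG.seedLaw d ⌈(C : ℝ) / ε⌉₊) ∧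
          -- the guarantee on the output, for all selections of the decompositions
          (∀ R : NCG.Selection n,
            (∀ ω : NCG.Seed d,
              (NCG.hermRound R M X Y ω).1.IsHermitian ∧
              (NCG.hermRound R M X Y ω).2.IsHermitian ∧
              NCG.opNorm (NCG.hermRound R M X Y ω).1 ≤ 1 ∧
              NCG.opNorm (NCG.hermRound R M X Y ω).2 ≤ 1) ∧
            MeasureTheory.Integrable
              (fun ω => ‖NCG.form M (NCG.hermRound R M X Y ω).1 (NCG.hermRound R M X Y ω).2‖)
              (NCG.seedLaw d ⌈(C : ℝ) / ε⌉₊) ∧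
            (1 / (2 * √2) - (1 + 1 / √2) * ε) * NCG.sdp M ≤
              ∫ ω, ‖NCG.form M (NCG.hermRound R M X Y ω).1 (NCG.hermRound R M X Y ω).2‖
                ∂(NCG.seedLaw d ⌈(C : ℝ) / ε⌉₊)) ∧
          -- the procedure is carried out, exactly and with the right law of the random choices,
          -- by a fixed program in a number of steps that is polynomial in `n`, `d` and `1 / ε`
          (∃ (R : NCG.Selection n) (seed : NCG.Tape → NCG.Seed d),
            MeasureTheory.MeasurePreserving seed NCG.tapeLaw (NCG.seedLaw d ⌈(C : ℝ) / ε⌉₊) ∧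
            ∀ τ : NCG.Tape, ∃ (s : NCG.State) (c : ℕ),
              NCG.Exec τ prog (NCG.inputState ε M X Y) s c ∧
              (c : ℝ) ≤ k * ((n : ℝ) + d + 1 / ε) ^ k ∧
              s.output n = NCG.hermRound R M X Y (seed τ)) := by
  refine ⟨NCG.exists_isTailConst, fun C hC => ?_⟩
  obtain ⟨k, hk⟩ := NCG.roundingProg_exec C
  refine ⟨NCG.roundingProg C, k, fun n d M ε X Y hM h0 h1 hX hY h => ⟨inferInstance, fun R =>
    ⟨NCG.hermRound_properties R M X Y, NCG.integrable_form_hermRound R M X Y _,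
      NCG.hermRound_guarantee R hC hM h0 hX hY h⟩, NCG.stdSelection n, NCG.tapeSeed d _,
    NCG.measurePreserving_tapeSeed d _, hk n d M ε X Y h0 h1⟩⟩
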